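/- **Setting.** A *linkoid diagram* with $n$ components on $S^2$ is a generic immersion of $n$ disjoint intervals in $S^2$ whose only singularities are transversal double points with over/under data (classical crossings), its $2n$ endpoints being distinct from each other and from the double points; the endpoints are labelled bijectively by $E=\{1,\dots,2n\}$. A *linkoid* is a class of such diagrams up to isotopy of $S^2$ and the three Reidemeister moves, where no strand may be moved over or under an endpoint. Let $\mathcal A_n$ be the set of (labelled) linkoids with $n$ components, and let $H_n=\{\sigma\in S_{2n}:\sigma^2(i)=i,\ \sigma(i)\ne i \text{ for all } i\in E\}$. The *strand permutation* of $L\in\mathcal A_n$ is the $\tau\in H_n$ such that $i$ and $\tau(i)$ label the two endpoints of one component, for every $i\in E$. Let $\mathcal V$ be the set of (unoriented) virtual knots and links, that is, of link diagrams on $S^2$ with classical and virtual crossings up to isotopy and the generalized Reidemeister moves (classical, virtual and semi-virtual). For $\sigma\in H_n$, a *virtual closure* of a linkoid diagram $D$ with respect to $\sigma$ is a virtual link diagram obtained by adding, for each pair $\{i,\sigma(i)\}$, an arc that joins the endpoints $i$ and $\sigma(i)$ and on which all crossings are virtual. The case $n=0$ (the empty linkoid, with closure the empty link) is included. **Theorem.**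 Every linkoid diagram has a virtual closure with respect to every $\sigma\in H_n$, and there is exactly one map $$\varphi:\ \{(L,\tau,\sigma) : n\in\mathbb N,\ L\in\mathcal A_n \text{ with strand permutation } \tau\in H_n,\ \sigma\in H_n\}\longrightarrow\mathcal V$$ such that $\varphi(L,\tau,\sigma)$ is the class of every virtual closure with respect to $\sigma$ of every diagram of $L$ (the *virtual closure map*). The map $\varphi$ is surjective, and it is not injective. More precisely, for every $n\ge 1$ there are $\tau\in H_n$ and linkoids $L,M\in\mathcal A_n$, both with strand permutation $\tau$, that are not equivalent even when the labels of the endpoints are forgotten, such that $\varphi(L,\tau,\tau)=\varphi(M,\tau,\tau)$ is the split union of the virtual trefoil (the closure of the two-strand braid with two equal classical crossings and one virtual crossing) and $n-1$ trivial circles. -/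

import Mathlib

/-! # Linkoid diagrams, virtual link diagrams and virtual closures

Diagrams on the sphere are presented in the usual way for tangle diagrams: by general position
with respect to a height function.  A diagram drawn in the plane (the sphere minus a point) is cut
by horizontal lines into layers, each of which contains exactly one elementary piece (a local
minimum, a local maximum, a crossing, an endpoint) and vertical strands to the left and to the
right of it.  Isotopy on the sphere is generated by the planar moves of `IsotopyMove` (the codimension one
events of a generic planar isotopy: two pieces exchange heights, a minimum and a maximum cancel,
a strand of a crossing turns over, an endpoint turns over) and by the move that carries an arc
across the point at infinity, `SphereMove`. -/

namespace VirtualClosure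

/-- The elementary pieces of diagrams, read from bottom to top.  `ι` is the set of labels of
endpoints.  In `overX` the strand from bottom left to top right is the overpass, in `underX` it is the
underpass, `virt` is a virtual crossing.  `birth e` (`death e`) is an endpoint with label `e` from
which the strand goes up (down).  `mark e` is a marked point with label `e` in the interior of
a strand; it is used only to describe the position of an endpoint inside a closed-up diagram. -/
inductive Gen (ι : Type) : Type
  | cup
  | cap
  | overX
  | underX
  | virt
  | birth (e : ι)
  | death (e : ι)
  | mark (e : ι)

namespace Gen

variable {ι : Type}

/-- The number of strands at the bottom of a piece. -/
def dom : Gen ι → ℕ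
  | cup => 0
  | cap => 2
  | overX => 2
  | underX => 2
  | virt => 2
  | birth _ => 0
  | death _ => 1
  | mark _ => 1

/-- The number of strands at the top of a piece. -/
def cod : Gen ι → ℕ
  | cup => 2
  | cap => 0
  | overX => 2
  | underX => 2
  | virt => 2
  | birth _ => 1
  | death _ => 0
  | mark _ => 1

/-- The label carried by a piece, if any. -/
def label : Gen ι → Option ι
  | birth e => some e
  | death e => some e
  | mark e => some e
  | _ => none

/-- Classical crossings. -/
def IsClassicalCrossing (g : Gen ι) : Prop := g = overX ∨ g = underX

/-- All crossings. -/
def IsCrossing (g : Gen ι) : Prop := g.IsClassicalCrossing ∨ g = virt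

/-- Forget the marked points. -/
def forgetMark : Gen ι → Option (Gen Empty)
  | cup => some cup
  | cap => some cap
  | overX => some overX
  | underX => some underX
  | virt => some virt
  | _ => none

/-- Change the labels. -/
def relabel (f : ι → ι) : Gen ι → Gen ι
  | cup => cup
  | cap => cap
  | overX => overX
  | underX => underX
  | virt => virt
  | birth e => birth (f e)
  | death e => death (f e)
  | mark e => mark (f e)

end Gen

/-- One elementary piece with `left` vertical strands on its left and `right` vertical strands on
its right. -/
structure Layer (ι : Type) where
  left : ℕ
  gen : Gen ι
  right : ℕ

namespace Layer

variable {ι : Type}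

/-- Number of strands at the bottom of a layer. -/
def source (x : Layer ι) : ℕ := x.left + x.gen.dom + x.right

/-- Number of strands at the top of a layer. -/
def target (x : Layer ι) : ℕ := x.left + x.gen.cod + x.right

/-- Add `p` vertical strands on the left and `q` vertical strands on the right. -/
def pad (p q : ℕ) (x : Layer ι) : Layer ι := ⟨p + x.left, x.gen, x.right + q⟩

/-- Change the labels. -/
def relabel (f : ι → ι) (x : Layer ι) : Layer ι := ⟨x.left, x.gen.relabel f, x.right⟩

end Layer

/-- A stack of layers, listed from bottom to top. -/
abbrev Word (ι : Type) : Type := List (Layer ι)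

/-- `IsWord a w b`: the layers of `w` fit together, with `a` strands at the bottom and `b` strands
at the top. -/
def IsWord {ι : Type} : ℕ → Word ι → ℕ → Prop
  | a, [], b => a = b
  | a, x :: w, b => a = x.source ∧ IsWord x.target w b

/-- The list of the labels that occur in a word. -/
def labels {ι : Type} (w : Word ι) : List ι := w.filterMap (fun x => x.gen.label)

/-! ### Strands

The point `(t, p)` is the point of the diagram on the horizontal line just below the layer with
index `t`, in position `p` (counted from the left, starting with `0`). -/

/-- `(t, p)` is a point of the diagram. -/
def IsPoint {ι : Type} (w : Word ι) (z : ℕ × ℕ) : Prop :=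
  ∃ x, w[z.1]? = some x ∧ z.2 < x.source

/-- Two points are joined by a piece of strand that lies inside one layer.  Strands are followed
straight through crossings; they end at endpoints and at marked points. -/
inductive Link {ι : Type} (w : Word ι) : ℕ × ℕ → ℕ × ℕ → Prop
  | left {t : ℕ} {x : Layer ι} {p : ℕ} (h : w[t]? = some x) (hp : p < x.left) :
      Link w (t, p) (t + 1, p)
  | right {t : ℕ} {x : Layer ι} {p : ℕ} (h : w[t]? = some x) (hp : p < x.right) :
      Link w (t, x.left + x.gen.dom + p) (t + 1, x.left + x.gen.cod + p)
  | cup {t : ℕ} {x : Layer ι} (h : w[t]? = some x) (hx : x.gen = Gen.cup) :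
      Link w (t + 1, x.left) (t + 1, x.left + 1)
  | cap {t : ℕ} {x : Layer ι} (h : w[t]? = some x) (hx : x.gen = Gen.cap) :
      Link w (t, x.left) (t, x.left + 1)
  | rising {t : ℕ} {x : Layer ι} (h : w[t]? = some x) (hx : x.gen.IsCrossing) :
      Link w (t, x.left) (t + 1, x.left + 1)
  | falling {t : ℕ} {x : Layer ι} (h : w[t]? = some x) (hx : x.gen.IsCrossing) :
      Link w (t, x.left + 1) (t + 1, x.left)

/-- Two points lie on the same strand. -/
def Joined {ι : Type} (w : Word ι) : ℕ × ℕ → ℕ × ℕ → Prop := Relation.EqvGen (Link w)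

/-- `EndAt w e z`: at the point `z` begins or ends a strand whose end there has the label `e`.
A marked point is the end of two strands, one below it and one above it. -/
inductive EndAt {ι : Type} (w : Word ι) : ι → ℕ × ℕ → Prop
  | birth {t : ℕ} {x : Layer ι} {e : ι} (h : w[t]? = some x) (hx : x.gen = Gen.birth e) :
      EndAt w e (t + 1, x.left)
  | death {t : ℕ} {x : Layer ι} {e : ι} (h : w[t]? = some x) (hx : x.gen = Gen.death e) :
      EndAt w e (t, x.left)
  | below {t : ℕ} {x : Layer ι} {e : ι} (h : w[t]? = some x) (hx : x.gen = Gen.mark e) :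
      EndAt w e (t, x.left)
  | above {t : ℕ} {x : Layer ι} {e : ι} (h : w[t]? = some x) (hx : x.gen = Gen.mark e) :
      EndAt w e (t + 1, x.left)

/-! ### Moves -/

/-- Planar isotopy, as local pictures. -/
inductive IsotopyMove {ι : Type} : Word ι → Word ι → Prop
  /-- Two pieces next to each other exchange their heights. -/
  | exchange (g h : Gen ι) (m : ℕ) :
      IsotopyMove [⟨0, g, m + h.dom⟩, ⟨g.cod + m, h, 0⟩] [⟨g.dom + m, h, 0⟩, ⟨0, g, m + h.cod⟩]
  /-- A minimum and a maximum cancel. -/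
  | snakeLeft : IsotopyMove [⟨0, .cup, 1⟩, ⟨1, .cap, 0⟩] []
  | snakeRight : IsotopyMove [⟨1, .cup, 0⟩, ⟨0, .cap, 1⟩] []
  /-- A strand of a crossing turns over, at a maximum. -/
  | overCap : IsotopyMove [⟨1, .overX, 0⟩, ⟨0, .cap, 1⟩] [⟨0, .underX, 1⟩, ⟨1, .cap, 0⟩]
  | underCap : IsotopyMove [⟨1, .underX, 0⟩, ⟨0, .cap, 1⟩] [⟨0, .overX, 1⟩, ⟨1, .cap, 0⟩]
  | virtCap : IsotopyMove [⟨1, .virt, 0⟩, ⟨0, .cap, 1⟩] [⟨0, .virt, 1⟩, ⟨1, .cap, 0⟩]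
  /-- A strand of a crossing turns over, at a minimum. -/
  | overCup : IsotopyMove [⟨0, .cup, 1⟩, ⟨1, .overX, 0⟩] [⟨1, .cup, 0⟩, ⟨0, .underX, 1⟩]
  | underCup : IsotopyMove [⟨0, .cup, 1⟩, ⟨1, .underX, 0⟩] [⟨1, .cup, 0⟩, ⟨0, .overX, 1⟩]
  | virtCup : IsotopyMove [⟨0, .cup, 1⟩, ⟨1, .virt, 0⟩] [⟨1, .cup, 0⟩, ⟨0, .virt, 1⟩]
  /-- The strand at an endpoint turns over. -/
  | birthLeft (e : ι) : IsotopyMove [⟨0, .birth e, 1⟩, ⟨0, .cap, 0⟩] [⟨0, .death e, 0⟩]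
  | birthRight (e : ι) : IsotopyMove [⟨1, .birth e, 0⟩, ⟨0, .cap, 0⟩] [⟨0, .death e, 0⟩]
  | deathLeft (e : ι) : IsotopyMove [⟨0, .cup, 0⟩, ⟨0, .death e, 1⟩] [⟨0, .birth e, 0⟩]
  | deathRight (e : ι) : IsotopyMove [⟨0, .cup, 0⟩, ⟨1, .death e, 0⟩] [⟨0, .birth e, 0⟩]

/-- The classical Reidemeister moves, as local pictures.  Together with `IsotopyMove` they give
all the other pictures of these moves. -/
inductive ClassicalMove {ι : Type} : Word ι → Word ι → Prop
  | r1OverCap : ClassicalMove [⟨0, .overX, 0⟩, ⟨0, .cap, 0⟩] [⟨0, .cap, 0⟩]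
  | r1UnderCap : ClassicalMove [⟨0, .underX, 0⟩, ⟨0, .cap, 0⟩] [⟨0, .cap, 0⟩]
  | r1OverCup : ClassicalMove [⟨0, .cup, 0⟩, ⟨0, .overX, 0⟩] [⟨0, .cup, 0⟩]
  | r1UnderCup : ClassicalMove [⟨0, .cup, 0⟩, ⟨0, .underX, 0⟩] [⟨0, .cup, 0⟩]
  | r2OverUnder : ClassicalMove [⟨0, .overX, 0⟩, ⟨0, .underX, 0⟩] []
  | r2UnderOver : ClassicalMove [⟨0, .underX, 0⟩, ⟨0, .overX, 0⟩] []
  | r3Over : ClassicalMove [⟨0, .overX, 1⟩, ⟨1, .overX, 0⟩, ⟨0, .overX, 1⟩]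
      [⟨1, .overX, 0⟩, ⟨0, .overX, 1⟩, ⟨1, .overX, 0⟩]
  | r3Under : ClassicalMove [⟨0, .underX, 1⟩, ⟨1, .underX, 0⟩, ⟨0, .underX, 1⟩]
      [⟨1, .underX, 0⟩, ⟨0, .underX, 1⟩, ⟨1, .underX, 0⟩]

/-- The virtual Reidemeister moves and the semi-virtual move, as local pictures. -/
inductive VirtualMove {ι : Type} : Word ι → Word ι → Prop
  | v1Cap : VirtualMove [⟨0, .virt, 0⟩, ⟨0, .cap, 0⟩] [⟨0, .cap, 0⟩]
  | v1Cup : VirtualMove [⟨0, .cup, 0⟩, ⟨0, .virt, 0⟩] [⟨0, .cup, 0⟩]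
  | v2 : VirtualMove [⟨0, .virt, 0⟩, ⟨0, .virt, 0⟩] []
  | v3 : VirtualMove [⟨0, .virt, 1⟩, ⟨1, .virt, 0⟩, ⟨0, .virt, 1⟩]
      [⟨1, .virt, 0⟩, ⟨0, .virt, 1⟩, ⟨1, .virt, 0⟩]
  | svOver : VirtualMove [⟨0, .overX, 1⟩, ⟨1, .virt, 0⟩, ⟨0, .virt, 1⟩]
      [⟨1, .virt, 0⟩, ⟨0, .virt, 1⟩, ⟨1, .overX, 0⟩]
  | svUnder : VirtualMove [⟨0, .underX, 1⟩, ⟨1, .virt, 0⟩, ⟨0, .virt, 1⟩]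
      [⟨1, .virt, 0⟩, ⟨0, .virt, 1⟩, ⟨1, .underX, 0⟩]

/-- A local picture of a diagram is replaced by another one. -/
def InContext {ι : Type} (R : Word ι → Word ι → Prop) (u v : Word ι) : Prop :=
  ∃ (a b s t : Word ι) (p q : ℕ), R s t ∧
    u = a ++ s.map (Layer.pad p q) ++ b ∧ v = a ++ t.map (Layer.pad p q) ++ b

/-- An arc on the right of the diagram is carried across the point at infinity of the sphere to the
left of the diagram. -/
def SphereMove {ι : Type} (u v : Word ι) : Prop :=
  ∃ T : Word ι,
    u = [⟨0, .cup, 0⟩] ++ T.map (Layer.pad 0 1) ++ [⟨0, .cap, 0⟩] ∧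
    v = [⟨0, .cup, 0⟩] ++ T.map (Layer.pad 1 0) ++ [⟨0, .cap, 0⟩]

/-! ### Linkoids -/

/-- Diagrams on the sphere of linkoids with `n` components, whose `2n` endpoints are labelled
bijectively by `Fin (2 * n)`. -/
structure LinkoidDiagram (n : ℕ) where
  word : Word (Fin (2 * n))
  closed : IsWord 0 word 0
  /-- All crossings are classical. -/
  classical : ∀ x ∈ word, x.gen ≠ Gen.virt ∧ ∀ e, x.gen ≠ Gen.mark e
  /-- Every label is the label of exactly one endpoint. -/
  labelled : ∀ e, (labels word).count e = 1
  /-- There are no closed components. -/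
  arcs : ∀ z, IsPoint word z → ∃ e y, EndAt word e y ∧ Joined word z y

/-- Linkoids with `n` components and labelled endpoints: diagrams up to isotopy on the sphere and
the three Reidemeister moves.  No move carries a strand across an endpoint. -/
def LinkoidDiagram.setoid (n : ℕ) : Setoid (LinkoidDiagram n) :=
  Relation.EqvGen.setoid fun D E =>
    InContext IsotopyMove D.word E.word ∨ InContext ClassicalMove D.word E.word ∨
      SphereMove D.word E.word

/-- The set of linkoids with `n` components (with labelled endpoints). -/
def Linkoid (n : ℕ) : Type := Quotient (LinkoidDiagram.setoid n)

/-- The linkoid of a diagram. -/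
def LinkoidDiagram.linkoid {n : ℕ} (D : LinkoidDiagram n) : Linkoid n :=
  Quotient.mk (LinkoidDiagram.setoid n) D

/-- The involutions without fixed points of the set of the `2n` labels. -/
def Pairing (n : ℕ) : Type :=
  {σ : Equiv.Perm (Fin (2 * n)) // ∀ i, σ (σ i) = i ∧ σ i ≠ i}

/-- `τ` is the strand permutation of the diagram `D`: the endpoints with labels `e` and `τ e` are
the two endpoints of one component. -/
def LinkoidDiagram.HasStrandPerm {n : ℕ} (D : LinkoidDiagram n) (τ : Pairing n) : Prop :=
  ∀ e y z, EndAt D.word e y → EndAt D.word (τ.1 e) z → Joined D.word y z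

/-- `τ` is the strand permutation of the linkoid `L`. -/
def Linkoid.HasStrandPerm {n : ℕ} (L : Linkoid n) (τ : Pairing n) : Prop :=
  ∃ D : LinkoidDiagram n, D.linkoid = L ∧ D.HasStrandPerm τ

/-- `L` and `M` are equivalent as linkoids without labels: some diagrams of them differ only in the
labels of the endpoints. -/
def Linkoid.EquivUnlabelled {n : ℕ} (L M : Linkoid n) : Prop :=
  ∃ (D E : LinkoidDiagram n) (π : Equiv.Perm (Fin (2 * n))),
    D.linkoid = L ∧ E.linkoid = M ∧ E.word = D.word.map (Layer.relabel π)

/-! ### Virtual links -/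

/-- Virtual link diagrams on the sphere: closed curves with classical and virtual crossings. -/
structure VirtualDiagram where
  word : Word Empty
  closed : IsWord 0 word 0

/-- Isotopy on the sphere and the generalized Reidemeister moves. -/
def VirtualDiagram.setoid : Setoid VirtualDiagram :=
  Relation.EqvGen.setoid fun K K' =>
    InContext IsotopyMove K.word K'.word ∨ InContext ClassicalMove K.word K'.word ∨
      InContext VirtualMove K.word K'.word ∨ SphereMove K.word K'.word

/-- The set of virtual knots and links. -/
def VirtualLink : Type := Quotient VirtualDiagram.setoid

/-- The virtual link of a diagram. -/
def VirtualDiagram.link (K : VirtualDiagram) : VirtualLink := Quotient.mk VirtualDiagram.setoid K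

/-! ### Virtual closure -/

/-- What remains of a layer `x` with index `t` when the strands marked by `arc` are erased; a marked
point between an erased and a remaining strand becomes an endpoint. -/
def eraseLayer {ι : Type} (arc : ℕ × ℕ → Bool) (x : Layer ι) (t : ℕ) : Option (Layer ι) :=
  let g : Option (Gen ι) :=
    match x.gen with
    | .cup => if arc (t + 1, x.left) then none else some .cup
    | .cap => if arc (t, x.left) then none else some .cap
    | .virt => if arc (t, x.left) || arc (t, x.left + 1) then none else some .virt
    | .mark e => if arc (t, x.left) then some (.birth e) else some (.death e)
    | g => some g
  g.map fun g =>
    ⟨Nat.count (fun p => arc (t, p) = false) x.left, g,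
      Nat.count (fun p => arc (t, x.left + x.gen.dom + p) = false) x.right⟩

/-- Erase the strands marked by `arc`. -/
def eraseArcs {ι : Type} (arc : ℕ × ℕ → Bool) (w : Word ι) : Word ι :=
  w.zipIdx.filterMap fun xt => eraseLayer arc xt.1 xt.2

/-- Forget the marked points. -/
def forgetMarks {ι : Type} (w : Word ι) : Word Empty :=
  w.filterMap fun x => x.gen.forgetMark.map fun g => ⟨x.left, g, x.right⟩

/-- The closed diagram `P`, with one marked point for each label, and its strands marked by `arc`
show how closure arcs are added to an open diagram according to `σ`. -/
structure IsClosurePicture {n : ℕ} (σ : Pairing n) (P : Word (Fin (2 * n)))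
    (arc : ℕ × ℕ → Bool) : Prop where
  closed : IsWord 0 P 0
  noEndpoints : ∀ x ∈ P, ∀ e, x.gen ≠ Gen.birth e ∧ x.gen ≠ Gen.death e
  labelled : ∀ e, (labels P).count e = 1
  /-- Being on a closure arc can change only at the marked points ... -/
  constant : ∀ y z, Link P y z → arc y = arc z
  /-- ... and it does change there. -/
  changes : ∀ (t : ℕ) (x : Layer (Fin (2 * n))) (e : Fin (2 * n)), P[t]? = some x →
    x.gen = Gen.mark e → arc (t, x.left) ≠ arc (t + 1, x.left)
  /-- All the crossings on the closure arcs are virtual. -/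
  virtual : ∀ (t : ℕ) (x : Layer (Fin (2 * n))), P[t]? = some x → x.gen.IsClassicalCrossing →
    arc (t, x.left) = false ∧ arc (t, x.left + 1) = false
  /-- The closure arc that starts at `e` ends at `σ e`. -/
  pairs : ∀ e y z, EndAt P e y → arc y = true → EndAt P (σ.1 e) z → arc z = true → Joined P y z
  /-- There is nothing else among the added strands: no added closed curve. -/
  onlyArcs : ∀ z, IsPoint P z → arc z = true → ∃ e y, EndAt P e y ∧ Joined P z y

/-- `K` is a virtual closure of `D` with respect to `σ`: it is obtained from `D` by the addition of
a closure arc between the endpoints `e` and `σ e`, for all `e`, where all the crossings on the closure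
arcs are virtual. -/
def IsVirtualClosure {n : ℕ} (D : LinkoidDiagram n) (σ : Pairing n) (K : VirtualDiagram) : Prop :=
  ∃ (P : Word (Fin (2 * n))) (arc : ℕ × ℕ → Bool),
    IsClosurePicture σ P arc ∧ eraseArcs arc P = D.word ∧ forgetMarks P = K.word

/-- The triples of a linkoid, its strand permutation and a closure permutation. -/
structure ClosureDatum where
  n : ℕ
  linkoid : Linkoid n
  strandPerm : Pairing n
  closurePerm : Pairing n
  strand : linkoid.HasStrandPerm strandPerm

/-- `φ` is the virtual closure map: it maps a triple `(L, τ, σ)` to the class of the virtual closures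
with respect to `σ` of the diagrams of `L`. -/
def IsVirtualClosureMap (φ : ClosureDatum → VirtualLink) : Prop :=
  ∀ (x : ClosureDatum) (D : LinkoidDiagram x.n) (K : VirtualDiagram),
    D.linkoid = x.linkoid → IsVirtualClosure D x.closurePerm K → φ x = K.link

/-! ### The virtual trefoil -/

/-- The closure of the 2-strand braid with two equal classical crossings and one virtual crossing,
followed by `k` circles without crossings. -/
def trefoilWord (k : ℕ) : Word Empty :=
  [⟨0, .cup, 0⟩, ⟨1, .cup, 1⟩, ⟨0, .overX, 2⟩, ⟨0, .overX, 2⟩, ⟨0, .virt, 2⟩,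
    ⟨1, .cap, 1⟩, ⟨0, .cap, 0⟩] ++ (List.replicate k [⟨0, .cup, 0⟩, ⟨0, .cap, 0⟩]).flatten

theorem isWord_append {ι : Type} {v : Word ι} {b c : ℕ} (hv : IsWord b v c) :
    ∀ {u : Word ι} {a : ℕ}, IsWord a u b → IsWord a (u ++ v) c
  | [], _, h => by simpa [show _ = b from h] using hv
  | _ :: _, _, h => ⟨h.1, isWord_append hv h.2⟩

theorem isWord_circles (k : ℕ) :
    IsWord 0 (List.replicate k [(⟨0, .cup, 0⟩ : Layer Empty), ⟨0, .cap, 0⟩]).flatten 0 := by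
  induction k with
  | zero => rfl
  | succ k ih =>
    rw [List.replicate_succ, List.flatten_cons]
    exact isWord_append ih ⟨rfl, rfl, rfl⟩

/-- The split union of the virtual trefoil and `k` trivial circles. -/
def virtualTrefoil (k : ℕ) : VirtualDiagram where
  word := trefoilWord k
  closed := isWord_append (isWord_circles k) (b := 0)
    ⟨rfl, rfl, rfl, rfl, rfl, rfl, rfl, rfl⟩

end VirtualClosure

/-! Up to the generalized Reidemeister moves a virtual link diagram is determined by its classical
crossings and by the pairing of their ends: the course of the strands in between, with all its
virtual crossings, does not matter (the detour move). The proof turns this into a normal form. A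
network is a list of `Tensor`s, pieces whose ends carry names, where each name that occurs does so
exactly twice. The word `net β T` places all pieces side by side with their ends bent upwards, and
then `contract` joins equal names, using only virtual crossings and maxima. The heart of the matter
is `VE.contract_swap`: up to the moves, this joining does not depend on the order of the strands.
Since strands also pass pieces (`VE.bendShift`, where the semi-virtual move enters), networks obey a
simple calculus: pieces may be permuted (`VE.netPerm`) and absorbed from below (`VE.netPiece`), and
arcs may be cut, reversed and left out (`VE.netCut`, `VE.netFlip`, `VE.netElim`).

Uniqueness. A closure picture of `D` is swept from its top (`exists_swept`) and becomes the network
of the pieces of `D` together with short pieces of the closure arcs. These are contracted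
(`VE.netEdges`), and there remains the network of `D` in which the ends `e` and `σ e` carry a common
name (`IsVirtualClosure.ve_net`). It depends on `D` and `σ` only, not on the picture. A move of `D`
away from endpoints is a move of a suitable closure (`sameClosures_of_labels`). An exchange of
heights, a turn at an endpoint and the move across infinity only permute the network, or reverse and
join arcs in it. A closure exists, since arcs can be led from all endpoints to the right, past
everything by virtual crossings, and connected there.

Surjectivity. The network of a virtual link is equivalent to one that consists of arcs and classical
crossings (`exists_simple`). Each arc becomes a linkoid with one strand, each crossing a linkoid
with two strands, and the closure permutation restores the connections. In other words, the diagram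
is cut around every crossing.

Failure of injectivity. After two equal crossings the closed two-strand braid is cut at one of its
strands, and the new end is placed beyond the neighbouring strand, so that the closure arc supplies
the virtual crossing of the virtual trefoil. Either strand may be cut (`innerCore`, `outerCore`).
The resulting linkoids are told apart by the number of Fox three-colourings of a diagram, where the
colours at endpoints are free. This number is invariant as it is for knots, because no strand passes
an endpoint, and it does not see labels. It is 3 for one core and 9 for the other, and each
additional trivial strand multiplies it by 3. -/

namespace VirtualClosure

open Gen

/-! ### Words without the numbers of strands on the right -/

/-- A piece together with the number of strands on its left. -/
abbrev Op (ι : Type) := ℕ × Gen ι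

section Arity

variable {ι : Type}

theorem dom_cup : (cup : Gen ι).dom = 0 := rfl
theorem dom_cap : (cap : Gen ι).dom = 2 := rfl
theorem dom_overX : (overX : Gen ι).dom = 2 := rfl
theorem dom_underX : (underX : Gen ι).dom = 2 := rfl
theorem dom_virt : (virt : Gen ι).dom = 2 := rfl
theorem cod_cup : (cup : Gen ι).cod = 2 := rfl
theorem cod_cap : (cap : Gen ι).cod = 0 := rfl
theorem cod_overX : (overX : Gen ι).cod = 2 := rfl
theorem cod_underX : (underX : Gen ι).cod = 2 := rfl
theorem cod_virt : (virt : Gen ι).cod = 2 := rfl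

end Arity

section Ops

variable {ι : Type}

/-- The pieces of `u` can be stacked over `n` strands, and no strand is left at the top. -/
def Ok : ℕ → List (Op ι) → Prop
  | n, [] => n = 0
  | n, x :: u => x.1 + x.2.dom ≤ n ∧ Ok (n - x.2.dom + x.2.cod) u

/-- Stack pieces over `n` strands. -/
def build : ℕ → List (Op ι) → Word ι
  | _, [] => []
  | n, x :: u => ⟨x.1, x.2, n - x.1 - x.2.dom⟩ :: build (n - x.2.dom + x.2.cod) u

theorem isWord_build : ∀ {n : ℕ} {u : List (Op ι)}, Ok n u → IsWord n (build n u) 0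
  | _, [], h => h
  | n, x :: u, h => by
    refine ⟨?_, ?_⟩
    · have := h.1
      simp only [Layer.source]; omega
    · have := isWord_build h.2
      have e : (⟨x.1, x.2, n - x.1 - x.2.dom⟩ : Layer ι).target = n - x.2.dom + x.2.cod := by
        have := h.1
        simp only [Layer.target]; omega
      rw [e]; exact this

/-- Forget the numbers of strands on the right. -/
def strip (w : Word ι) : List (Op ι) := w.map fun x => (x.left, x.gen)

/-- The number of strands at the bottom determines the numbers on the right, so that `strip` loses
nothing. -/
theorem build_strip : ∀ {n : ℕ} {w : Word ι}, IsWord n w 0 → build n (strip w) = w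
  | _, [], _ => rfl
  | n, x :: w, h => by
    obtain ⟨h1, h2⟩ := h
    simp only [Layer.source] at h1
    have e : n - x.gen.dom + x.gen.cod = x.target := by simp only [Layer.target]; omega
    have e' : n - x.left - x.gen.dom = x.right := by omega
    show _ :: build _ (strip w) = _
    simp only [e, e', build_strip h2]

end Ops

/-! ### Equivalence of the upper parts of virtual link diagrams -/

/-- `u` and `v` can be exchanged as upper parts of virtual link diagrams. -/
def VE (n : ℕ) (u v : List (Op Empty)) : Prop :=
  Ok n u ∧ Ok n v ∧ ∀ pre : Word Empty, IsWord 0 pre n → ∀ h h',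
    VirtualDiagram.link ⟨pre ++ build n u, h⟩ = VirtualDiagram.link ⟨pre ++ build n v, h'⟩

namespace VE

variable {n m : ℕ} {u v w z : List (Op Empty)}

theorem refl (h : Ok n u) : VE n u u := ⟨h, h, fun _ _ _ _ => rfl⟩

theorem symm (h : VE n u v) : VE n v u :=
  ⟨h.2.1, h.1, fun pre hp h1 h2 => (h.2.2 pre hp h2 h1).symm⟩

theorem trans (h : VE n u v) (h' : VE n v w) : VE n u w :=
  ⟨h.1, h'.2.1, fun pre hp h1 h2 =>
    (h.2.2 pre hp h1 (isWord_append (isWord_build h.2.1) hp)).trans (h'.2.2 pre hp _ h2)⟩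

instance : Trans (VE n) (VE n) (VE n) := ⟨trans⟩

theorem okl (h : VE n u v) : Ok n u := h.1
theorem link_eq (h : VE 0 u v) (h1 : IsWord 0 (build 0 u) 0) (h2 : IsWord 0 (build 0 v) 0) :
    VirtualDiagram.link ⟨build 0 u, h1⟩ = VirtualDiagram.link ⟨build 0 v, h2⟩ :=
  h.2.2 [] rfl h1 h2

theorem of_len (h : VE m u v) (e : m = n) : VE n u v := e ▸ h

theorem of_eq (h : Ok n u) (e : u = v) : VE n u v := e ▸ refl h

/-- The piece `x` is handed over to the lower part `pre`. Since `VE` quantifies over all lower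
parts, an equivalence can thus be applied at any height. -/
theorem cons' (x : Op Empty) (hx : x.1 + x.2.dom ≤ n) (hm : m + x.2.dom = n + x.2.cod)
    (h : VE m u v) : VE n (x :: u) (x :: v) := by
  have e : n - x.2.dom + x.2.cod = m := by omega
  have hL : (⟨x.1, x.2, n - x.1 - x.2.dom⟩ : Layer Empty).source = n := by
    simp only [Layer.source]; omega
  have hL' : (⟨x.1, x.2, n - x.1 - x.2.dom⟩ : Layer Empty).target = m := by
    simp only [Layer.target]; omega
  refine ⟨⟨hx, by rw [e]; exact h.1⟩, ⟨hx, by rw [e]; exact h.2.1⟩, ?_⟩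
  intro pre hp h1 h2
  have hp' : IsWord 0 (pre ++ [⟨x.1, x.2, n - x.1 - x.2.dom⟩]) m :=
    isWord_append (b := n) (show IsWord n [_] m from ⟨hL.symm, hL'⟩) hp
  have := h.2.2 _ hp' (isWord_append (isWord_build h.1) hp') (isWord_append (isWord_build h.2.1) hp')
  simp only [List.append_assoc, List.singleton_append] at this
  simp only [build, e]
  exact this

theorem cons (l : ℕ) (g : Gen Empty) (h : VE m u v)
    (hx : l + g.dom ≤ n := by
      (try simp only [dom_cup, dom_cap, dom_overX, dom_underX, dom_virt, cod_cup, cod_cap, cod_overX,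
        cod_underX, cod_virt]) <;> omega)
    (hm : m + g.dom = n + g.cod := by
      (try simp only [dom_cup, dom_cap, dom_overX, dom_underX, dom_virt, cod_cup, cod_cap, cod_overX,
        cod_underX, cod_virt]) <;> omega) :
    VE n ((l, g) :: u) ((l, g) :: v) := cons' (l, g) hx hm h

theorem virtOn (l : ℕ) (h : VE n u v) (hx : l + 2 ≤ n := by omega) :
    VE n ((l, virt) :: u) ((l, virt) :: v) := cons l virt h

/-- It suffices to have the moves at the foot of the upper part: `cons'` carries them to other
heights. `SphereMove` is not among them; equivalences in the sense of `VE` are obtained without it.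
-/
theorem of_move {s t : Word Empty} {p q : ℕ}
    (h : IsotopyMove s t ∨ ClassicalMove s t ∨ VirtualMove s t)
    (hu : Ok n u) (hv : Ok n v) (eu : build n u = s.map (Layer.pad p q) ++ build m z)
    (ev : build n v = t.map (Layer.pad p q) ++ build m z) : VE n u v := by
  refine ⟨hu, hv, fun pre hp h1 h2 => Quotient.sound (Relation.EqvGen.rel _ _ ?_)⟩
  have key : ∀ R : Word Empty → Word Empty → Prop, R s t →
      InContext R (pre ++ build n u) (pre ++ build n v) := fun R hR =>
    ⟨pre, build m z, s, t, p, q, hR, by rw [eu, List.append_assoc], by rw [ev, List.append_assoc]⟩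
  rcases h with h | h | h
  · exact Or.inl (key _ h)
  · exact Or.inr (Or.inl (key _ h))
  · exact Or.inr (Or.inr (Or.inl (key _ h)))

end VE

theorem Ok.cast {ι : Type} {n m : ℕ} {u : List (Op ι)} (h : Ok m u) (e : n = m := by omega) : Ok n u := e ▸ h

theorem Ok.cons {ι : Type} {n m : ℕ} (l : ℕ) (g : Gen ι) {u : List (Op ι)} (h : Ok m u)
    (hx : l + g.dom ≤ n := by
      (try simp only [dom_cup, dom_cap, dom_overX, dom_underX, dom_virt, cod_cup, cod_cap, cod_overX,
        cod_underX, cod_virt]) <;> omega)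
    (hm : m + g.dom = n + g.cod := by
      (try simp only [dom_cup, dom_cap, dom_overX, dom_underX, dom_virt, cod_cup, cod_cap, cod_overX,
        cod_underX, cod_virt]) <;> omega) :
    Ok n ((l, g) :: u) :=
  ⟨hx, by
    have e : n - g.dom + g.cod = m := by have : l + g.dom ≤ n := hx; omega
    simp only [e]; exact h⟩

theorem Ok.virtOn {ι : Type} {n : ℕ} (l : ℕ) {u : List (Op ι)} (h : Ok n u)
    (hx : l + 2 ≤ n := by omega) : Ok n ((l, virt) :: u) := .cons l virt h

/-! ### The moves as equivalences of upper parts -/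

namespace VE

variable {n m l : ℕ} {z : List (Op Empty)}

/-- Here `k` counts the strands on the left of `h` that do not end at `g`. The position of `h` is `k
+ g.cod` above `g` and `k + g.dom` below it. -/
theorem exch (g h : Gen Empty) (l k k1 k2 : ℕ) (hz : Ok m z)
    (hlk : l ≤ k := by omega)
    (h1 : k1 = k + g.cod := by
      (try simp only [dom_cup, dom_cap, dom_overX, dom_underX, dom_virt, cod_cup, cod_cap, cod_overX,
        cod_underX, cod_virt]) <;> omega)
    (h2 : k2 = k + g.dom := by
      (try simp only [dom_cup, dom_cap, dom_overX, dom_underX, dom_virt, cod_cup, cod_cap, cod_overX,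
        cod_underX, cod_virt]) <;> omega)
    (hn : k + g.dom + h.dom ≤ n := by
      (try simp only [dom_cup, dom_cap, dom_overX, dom_underX, dom_virt, cod_cup, cod_cap, cod_overX,
        cod_underX, cod_virt]) <;> omega)
    (hm : m + g.dom + h.dom = n + g.cod + h.cod := by
      (try simp only [dom_cup, dom_cap, dom_overX, dom_underX, dom_virt, cod_cup, cod_cap, cod_overX,
        cod_underX, cod_virt]) <;> omega) :
    VE n ((l, g) :: (k1, h) :: z) ((k2, h) :: (l, g) :: z) := by
  subst h1 h2
  refine of_move (p := l) (q := n - k - g.dom - h.dom) (m := m) (z := z)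
    (Or.inl (.exchange g h (k - l)))
    (.cons (m := n - g.dom + g.cod) _ _ (.cons _ _ hz ?_ ?_) ?_ ?_)
    (.cons (m := n - h.dom + h.cod) _ _ (.cons _ _ hz ?_ ?_) ?_ ?_) ?_ ?_
  any_goals omega
  · simp only [build, Layer.pad, List.map, List.cons_append, List.nil_append, List.cons.injEq, Layer.mk.injEq, true_and]
    refine ⟨⟨by omega, by omega⟩, ⟨by omega, by omega⟩, by congr 1; omega⟩
  · simp only [build, Layer.pad, List.map, List.cons_append, List.nil_append, List.cons.injEq, Layer.mk.injEq, true_and]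
    refine ⟨⟨by omega, by omega⟩, ⟨by omega, by omega⟩, by congr 1; omega⟩

/-- Two consecutive pieces are replaced by two pieces. -/
theorem of_two {g1 g2 g3 g4 : Gen Empty} {l1 l2 l3 l4 r1 r2 r3 r4 : ℕ} (l : ℕ)
    (h : IsotopyMove [⟨l1, g1, r1⟩, ⟨l2, g2, r2⟩] [⟨l3, g3, r3⟩, ⟨l4, g4, r4⟩] ∨
      ClassicalMove [⟨l1, g1, r1⟩, ⟨l2, g2, r2⟩] [⟨l3, g3, r3⟩, ⟨l4, g4, r4⟩] ∨
      VirtualMove [⟨l1, g1, r1⟩, ⟨l2, g2, r2⟩] [⟨l3, g3, r3⟩, ⟨l4, g4, r4⟩])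
    (hz : Ok m z) (hn : l + (l1 + g1.dom + r1) ≤ n)
    (hm : m + g1.dom + g2.dom = n + g1.cod + g2.cod)
    (hm' : m + g3.dom + g4.dom = n + g3.cod + g4.cod)
    (e2 : l2 + g2.dom + r2 = l1 + g1.cod + r1) (e3 : l3 + g3.dom + r3 = l1 + g1.dom + r1)
    (e4 : l4 + g4.dom + r4 = l3 + g3.cod + r3) :
    VE n ((l + l1, g1) :: (l + l2, g2) :: z) ((l + l3, g3) :: (l + l4, g4) :: z) := by
  refine of_move (p := l) (q := n - l - (l1 + g1.dom + r1)) (m := m) (z := z) h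
    (.cons (m := n - g1.dom + g1.cod) _ _ (.cons _ _ hz ?_ ?_) ?_ ?_)
    (.cons (m := n - g3.dom + g3.cod) _ _ (.cons _ _ hz ?_ ?_) ?_ ?_) ?_ ?_
  any_goals omega
  · simp only [build, Layer.pad, List.map, List.cons_append, List.nil_append, List.cons.injEq, Layer.mk.injEq, true_and]
    refine ⟨by omega, by omega, by congr 1; omega⟩
  · simp only [build, Layer.pad, List.map, List.cons_append, List.nil_append, List.cons.injEq, Layer.mk.injEq, true_and]
    refine ⟨by omega, by omega, by congr 1; omega⟩

theorem of_zero {g1 g2 : Gen Empty} {l1 l2 r1 r2 : ℕ} (l : ℕ)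
    (h : IsotopyMove [⟨l1, g1, r1⟩, ⟨l2, g2, r2⟩] [] ∨
      ClassicalMove [⟨l1, g1, r1⟩, ⟨l2, g2, r2⟩] [] ∨
      VirtualMove [⟨l1, g1, r1⟩, ⟨l2, g2, r2⟩] [])
    (hz : Ok n z) (hn : l + (l1 + g1.dom + r1) ≤ n)
    (hm : g1.dom + g2.dom = g1.cod + g2.cod)
    (e2 : l2 + g2.dom + r2 = l1 + g1.cod + r1) :
    VE n ((l + l1, g1) :: (l + l2, g2) :: z) z := by
  refine of_move (p := l) (q := n - l - (l1 + g1.dom + r1)) (m := n) (z := z) h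
    (.cons (m := n - g1.dom + g1.cod) _ _ (.cons _ _ hz ?_ ?_) ?_ ?_) hz ?_ rfl
  any_goals omega
  · simp only [build, Layer.pad, List.map, List.cons_append, List.nil_append, List.cons.injEq, Layer.mk.injEq, true_and]
    refine ⟨by omega, by omega, by congr 1; omega⟩

theorem snakeL (l : ℕ) (hz : Ok n z) (h : l + 1 ≤ n := by omega) :
    VE n ((l, cup) :: (l + 1, cap) :: z) z :=
  of_zero l (Or.inl .snakeLeft) hz (by simpa [Gen.dom] using h) rfl rfl

theorem snakeR (l : ℕ) (hz : Ok n z) (h : l + 1 ≤ n := by omega) :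
    VE n ((l + 1, cup) :: (l, cap) :: z) z :=
  of_zero l (Or.inl .snakeRight) hz (by simpa [Gen.dom] using h) rfl rfl

theorem virtVirt (l : ℕ) (hz : Ok n z) (h : l + 2 ≤ n := by omega) :
    VE n ((l, virt) :: (l, virt) :: z) z :=
  of_zero l (Or.inr (Or.inr .v2)) hz (by simpa [Gen.dom] using h) rfl rfl

theorem virtCap (l : ℕ) (hz : Ok m z) (h : l + 3 ≤ n := by omega) (hm : m + 2 = n := by omega) :
    VE n ((l + 1, virt) :: (l, cap) :: z) ((l, virt) :: (l + 1, cap) :: z) :=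
  of_two l (Or.inl .virtCap) hz (by simp [Gen.dom]; omega) (by simp [Gen.dom, Gen.cod]; omega) (by simp [Gen.dom, Gen.cod]; omega)
    rfl rfl rfl

theorem virtCup (l : ℕ) (hz : Ok m z) (h : l + 1 ≤ n := by omega) (hm : m = n + 2 := by omega) :
    VE n ((l, cup) :: (l + 1, virt) :: z) ((l + 1, cup) :: (l, virt) :: z) :=
  of_two l (Or.inl .virtCup) hz (by simp [Gen.dom]; omega) (by simp [Gen.dom, Gen.cod]; omega) (by simp [Gen.dom, Gen.cod]; omega)
    rfl rfl rfl

theorem capSymm (l : ℕ) (hz : Ok m z) (h : l + 2 ≤ n := by omega) (hm : m + 2 = n := by omega) :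
    VE n ((l, virt) :: (l, cap) :: z) ((l, cap) :: z) := by
  refine of_move (p := l) (q := n - l - 2) (m := m) (z := z) (Or.inr (Or.inr .v1Cap))
    (.cons (m := n) _ _ (.cons _ _ hz)) (.cons _ _ hz) ?_ ?_
  all_goals
    simp only [build, Layer.pad, List.map, List.cons_append, List.nil_append, List.cons.injEq, Layer.mk.injEq, true_and, Gen.dom, Gen.cod]
    refine ⟨by omega, ?_⟩
  · exact ⟨by omega, by congr 1; omega⟩
  · congr 1; omega

theorem cupSymm (l : ℕ) (hz : Ok m z) (h : l ≤ n := by omega) (hm : m = n + 2 := by omega) :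
    VE n ((l, cup) :: (l, virt) :: z) ((l, cup) :: z) := by
  refine of_move (p := l) (q := n - l) (m := m) (z := z) (Or.inr (Or.inr .v1Cup))
    (.cons (m := m) _ _ (.cons (m := m) _ _ hz)) (.cons _ _ hz) ?_ ?_
  all_goals
    simp only [build, Layer.pad, List.map, List.cons_append, List.nil_append, List.cons.injEq, Layer.mk.injEq, true_and, Gen.dom, Gen.cod]
    refine ⟨by omega, ?_⟩
  · exact ⟨by omega, by congr 1; omega⟩
  · congr 1; omega

theorem of_three {g1 g2 g3 g4 g5 g6 : Gen Empty} {l1 l2 l3 l4 l5 l6 r1 r2 r3 r4 r5 r6 : ℕ} (l : ℕ)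
    (h : VirtualMove [⟨l1, g1, r1⟩, ⟨l2, g2, r2⟩, ⟨l3, g3, r3⟩]
      [⟨l4, g4, r4⟩, ⟨l5, g5, r5⟩, ⟨l6, g6, r6⟩])
    (hz : Ok n z) (hn : l + 3 ≤ n)
    (hd : ∀ g ∈ [g1, g2, g3, g4, g5, g6], g.dom = 2 ∧ g.cod = 2)
    (e1 : l1 + r1 = 1 := by rfl) (e2 : l2 + r2 = 1 := by rfl) (e3 : l3 + r3 = 1 := by rfl)
    (e4 : l4 + r4 = 1 := by rfl) (e5 : l5 + r5 = 1 := by rfl) (e6 : l6 + r6 = 1 := by rfl) :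
    VE n ((l + l1, g1) :: (l + l2, g2) :: (l + l3, g3) :: z)
      ((l + l4, g4) :: (l + l5, g5) :: (l + l6, g6) :: z) := by
  simp only [List.mem_cons, List.not_mem_nil, or_false, forall_eq_or_imp, forall_eq] at hd
  obtain ⟨h1, h2, h3, h4, h5, h6⟩ := hd
  have e : n - 2 + 2 = n := by omega
  refine of_move (p := l) (q := n - l - 3) (m := n) (z := z) (Or.inr (Or.inr h))
    (.cons (m := n) _ _ (.cons (m := n) _ _ (.cons _ _ hz ?_ ?_) ?_ ?_) ?_ ?_)
    (.cons (m := n) _ _ (.cons (m := n) _ _ (.cons _ _ hz ?_ ?_) ?_ ?_) ?_ ?_) ?_ ?_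
  any_goals omega
  all_goals
    simp only [build, Layer.pad, List.map, List.cons_append, List.nil_append, List.cons.injEq,
      Layer.mk.injEq, true_and, h1, h2, h3, h4, h5, h6, e]
    refine ⟨by omega, by omega, by omega, trivial⟩

theorem braid (l : ℕ) (hz : Ok n z) (h : l + 3 ≤ n := by omega) :
    VE n ((l, virt) :: (l + 1, virt) :: (l, virt) :: z)
      ((l + 1, virt) :: (l, virt) :: (l + 1, virt) :: z) :=
  of_three l .v3 hz h (by simp [Gen.dom, Gen.cod])

/-- A strand passes over a piece from right to left. -/
theorem crossNat (l : ℕ) {g : Gen Empty} (hg : g.IsClassicalCrossing) (hz : Ok n z)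
    (h : l + 3 ≤ n := by omega) :
    VE n ((l, g) :: (l + 1, virt) :: (l, virt) :: z)
      ((l + 1, virt) :: (l, virt) :: (l + 1, g) :: z) := by
  rcases hg with rfl | rfl
  · exact of_three l .svOver hz h (by simp [Gen.dom, Gen.cod])
  · exact of_three l .svUnder hz h (by simp [Gen.dom, Gen.cod])

theorem virtComm (l k : ℕ) (hz : Ok n z) (hlk : l + 2 ≤ k := by omega) (hn : k + 2 ≤ n := by omega) :
    VE n ((l, virt) :: (k, virt) :: z) ((k, virt) :: (l, virt) :: z) :=
  exch virt virt l (k - 2) k k hz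

end VE

/-! ### Joining strands with equal names -/

section Lin

variable {α : Type} [DecidableEq α]

/-- Every name that occurs in the list occurs exactly twice. -/
def Lin (β : List α) : Prop := ∀ x, β.count x = 0 ∨ β.count x = 2

theorem Lin.perm {β γ : List α} (h : Lin β) (e : β.Perm γ) : Lin γ := fun x => by
  rw [← e.count_eq]; exact h x

/-- A name that is listed twice is used up, so no copy of `x` is left in `γ`; the other counts do
not change. -/
theorem Lin.of_double {x : α} {β γ : List α} (h : Lin β) (e : β.Perm (x :: x :: γ)) : Lin γ :=
  fun y => by
    have := h.perm e y
    by_cases hxy : x = y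
    · subst hxy; simp only [List.count_cons_self] at this; omega
    · simpa only [List.count_cons_of_ne hxy] using this

theorem lin_nil : Lin ([] : List α) := fun _ => Or.inl rfl

theorem Lin.split {x : α} {β : List α} (h : Lin (x :: β)) :
    ∃ γ₁ γ₂, β = γ₁ ++ x :: γ₂ ∧ x ∉ γ₁ ∧ x ∉ γ₂ ∧ Lin (γ₁ ++ γ₂) := by
  have hx : x ∈ β := by
    have := h x
    simp only [List.count_cons_self] at this
    exact List.count_pos_iff.1 (by omega)
  obtain ⟨γ₁, γ₂, h1, h2⟩ := List.eq_append_cons_of_mem hx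
  subst h1
  refine ⟨γ₁, γ₂, rfl, h2, ?_, ?_⟩
  · have := h x
    simp only [List.count_cons_self, List.count_append, List.count_eq_zero_of_not_mem h2] at this
    exact List.count_eq_zero.1 (by omega)
  · exact h.of_double (List.perm_middle.cons _)

end Lin

section Contract

variable {α : Type} [DecidableEq α] {ι : Type}

/-- The strand in position `i + 1` is pulled to the left into position `1`. -/
def pull : ℕ → List (Op ι) → List (Op ι)
  | 0, z => z
  | i + 1, z => (i + 1, virt) :: pull i z

/-- Join the strands with equal names, using virtual crossings only. -/
def contract : List α → List (Op ι)
  | [] => []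
  | a :: β => pull (β.idxOf a) ((0, cap) :: contract (β.erase a))
termination_by β => β.length
decreasing_by
  have := List.length_erase_le (a := a) (l := β)
  simp; omega

theorem contract_nil : contract ([] : List α) = ([] : List (Op ι)) := by rw [contract]

/-- The recursion in the form that is used below: `γ₁` are the strands between the first strand and
its partner, and the partner is pulled across them. -/
theorem contract_cons {x : α} {γ₁ γ₂ : List α} (h : x ∉ γ₁) :
    contract (x :: (γ₁ ++ x :: γ₂)) = pull (ι := ι) γ₁.length ((0, cap) :: contract (γ₁ ++ γ₂)) := by
  rw [contract, List.idxOf_append_of_notMem h, List.erase_append_right _ h]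
  simp

theorem ok_pull {n : ℕ} {z : List (Op ι)} (hz : Ok n z) :
    ∀ {i : ℕ}, i + 2 ≤ n → Ok n (pull i z)
  | 0, _ => hz
  | i + 1, h => .cons (m := n) _ _ (ok_pull hz (by omega))

theorem ok_contract : ∀ {n : ℕ} {β : List α}, β.length = n → Lin β → Ok n (contract (ι := ι) β) := by
  intro n
  induction n using Nat.strong_induction_on with
  | _ n ih =>
    rintro (_ | ⟨x, β⟩) hn h
    · rw [contract_nil]; exact hn.symm
    · obtain ⟨γ₁, γ₂, rfl, h1, h2, h3⟩ := h.split
      rw [contract_cons h1]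
      simp only [List.length_cons, List.length_append] at hn
      refine ok_pull (.cons (m := (γ₁ ++ γ₂).length) _ _ (ih _ ?_ rfl h3) ?_ ?_) ?_
      all_goals try simp only [List.length_append, Gen.dom, Gen.cod]
      all_goals omega

/-- Names are only compared with each other. An injective renaming therefore gives the same word,
not just an equivalent one. -/
theorem contract_map {β' : Type} [DecidableEq β'] {f : α → β'} (hf : Function.Injective f) :
    ∀ {n : ℕ} {β : List α}, β.length = n → contract (ι := ι) (β.map f) = contract β := by
  intro n
  induction n using Nat.strong_induction_on with
  | _ n ih =>
    rintro (_ | ⟨x, β⟩) hn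
    · rw [List.map_nil, contract_nil, contract_nil]
    · rw [List.map_cons, contract, contract]
      have h1 : (β.map f).idxOf (f x) = β.idxOf x := by
        clear hn
        induction β with
        | nil => rfl
        | cons y β ihy =>
          by_cases hy : y = x
          · simp [hy]
          · rw [List.map_cons, List.idxOf_cons_ne _ (hf.ne hy), List.idxOf_cons_ne _ hy, ihy]
      have h2 : (β.map f).erase (f x) = (β.erase x).map f := by
        rw [List.map_erase hf]
      rw [h1, h2, ih (β.erase x).length ?_ rfl]
      have := List.length_erase_le (a := x) (l := β)
      simp at hn; omega

end Contract

/-! ### The joining word does not depend on the order of the strands -/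

namespace VE

variable {n m : ℕ} {z : List (Op Empty)}

theorem pull {u v : List (Op Empty)} (h : VE n u v) :
    ∀ {i : ℕ}, i + 2 ≤ n → VE n (pull i u) (pull i v)
  | 0, _ => h
  | i + 1, hi => .virtOn _ (VE.pull h (by omega))

/-- All crossings of the pull lie to the left of the crossing at `l` and are disjoint from it. -/
theorem virtPull {l : ℕ} (hz : Ok n z) (hl : l + 2 ≤ n) :
    ∀ {i : ℕ}, i + 2 ≤ l →
      VE n ((l, virt) :: VirtualClosure.pull i z) (VirtualClosure.pull i ((l, virt) :: z))
  | 0, _ => refl (.cons _ _ hz)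
  | i + 1, hi =>
    trans (virtComm (i + 1) l (ok_pull hz (by omega))).symm (.virtOn _ (virtPull hz hl (by omega)))

/-- The pulled strand starts to the right of the crossing at `l` and passes both of its strands.
This is one third virtual move and otherwise commutation; both strands end one position further
right. -/
theorem virtPullBraid {l : ℕ} (hz : Ok n z) (hl : 1 ≤ l) :
    ∀ {i : ℕ}, l < i → i + 2 ≤ n →
      VE n ((l, virt) :: VirtualClosure.pull i z) (VirtualClosure.pull i ((l + 1, virt) :: z))
  | i + 1, hi, hn => by
    by_cases h : l < i
    · exact trans (virtComm l (i + 1) (ok_pull hz (by omega)))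
        (.virtOn _ (virtPullBraid hz hl h (by omega)))
    · obtain rfl : l = i := by omega
      obtain ⟨j, rfl⟩ : ∃ j, l = j + 1 := ⟨l - 1, by omega⟩
      refine trans (braid (j + 1) (ok_pull hz (by omega))) ?_
      exact .virtOn _ (.virtOn _ (virtPull hz (by omega) (by omega)))

theorem capVirt (l : ℕ) (hz : Ok m z) (h : l + 4 ≤ n := by omega) (hm : m + 2 = n := by omega) :
    VE n ((l + 2, virt) :: (0, cap) :: z) ((0, cap) :: (l, virt) :: z) :=
  (exch cap virt 0 l l (l + 2) hz).symm

variable {α : Type} [DecidableEq α]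

/-- The word that joins strands with equal names does not depend on the order of the strands. -/
theorem contract_swap : ∀ {n : ℕ} (β₁ β₂ : List α) (a b : α), (β₁ ++ a :: b :: β₂).length = n →
    Lin (β₁ ++ a :: b :: β₂) →
    VE n ((β₁.length, virt) :: contract (β₁ ++ b :: a :: β₂)) (contract (β₁ ++ a :: b :: β₂)) := by
  intro n
  induction n using Nat.strong_induction_on with
  | _ n ih =>
  -- The case where the first strand `x` takes no part in the exchange. Its partner is on the left
  -- of the exchanged pair, belongs to it, or is on the right of it.
  have key : ∀ (x : α) (β₁ β₂ : List α) (a b : α), (x :: (β₁ ++ a :: b :: β₂)).length = n →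
      Lin (x :: (β₁ ++ a :: b :: β₂)) →
      VE n ((β₁.length + 1, virt) :: contract (x :: (β₁ ++ b :: a :: β₂)))
        (contract (x :: (β₁ ++ a :: b :: β₂))) := by
    intro x β₁ β₂ a b hn hlin
    have hlin' : Lin (x :: (β₁ ++ b :: a :: β₂)) :=
      hlin.perm (by
        refine List.Perm.cons _ (List.Perm.append_left _ (List.Perm.swap _ _ _)))
    simp only [List.length_cons, List.length_append] at hn
    by_cases h1 : x ∈ β₁
    -- Partner on the left: the pull does not meet the crossing, which goes up past the maximum and
    -- is then handled by the induction hypothesis.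
    · obtain ⟨γ₁, γ₂, rfl, h2⟩ := List.eq_append_cons_of_mem h1
      have hl := hlin
      have h3 : Lin (γ₁ ++ γ₂ ++ a :: b :: β₂) := by
        refine hl.of_double (x := x) (List.perm_iff_count.2 fun y => ?_)
        simp only [List.count_cons, List.count_append]; ring
      have e : ∀ c d : α, x :: (γ₁ ++ x :: γ₂ ++ c :: d :: β₂) =
          x :: (γ₁ ++ x :: (γ₂ ++ c :: d :: β₂)) := by simp
      rw [e, e, contract_cons h2, contract_cons h2]
      simp only [List.length_cons, List.length_append] at hn ⊢
      have ok : Ok (n - 2) (contract (ι := Empty) (γ₁ ++ (γ₂ ++ b :: a :: β₂))) := by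
        refine ok_contract (by simp; omega) (h3.perm ?_)
        simp only [List.append_assoc]
        exact List.Perm.append_left _ (List.Perm.append_left _ (List.Perm.swap _ _ _))
      have step := ih (n - 2) (by omega) (γ₁ ++ γ₂) β₂ a b (by simp; omega) h3
      simp only [List.length_append, List.append_assoc] at step
      refine trans (virtPull (.cons (m := n - 2) _ _ ok) (by omega) (by omega)) (VE.pull ?_ (by omega))
      refine trans (capVirt (γ₁.length + γ₂.length) ok |> fun h => by convert h using 3; omega) ?_
      exact .cons _ _ step
    · by_cases h2 : x = a
      -- Partner `a`: after the exchange the pull is longer by one crossing, which cancels against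
      -- the given one.
      · subst h2
        have e : β₁.length + 1 = (β₁ ++ [b]).length := by simp
        have h3 : x ∉ β₁ ++ [b] ∨ x = b := by
          by_cases hb : x = b
          · exact Or.inr hb
          · left; simp [h1, hb]
        rcases h3 with h3 | rfl
        · have e1 : x :: (β₁ ++ b :: x :: β₂) = x :: ((β₁ ++ [b]) ++ x :: β₂) := by simp
          have e2 : (β₁ ++ [b]) ++ β₂ = β₁ ++ b :: β₂ := by simp
          rw [e1, contract_cons h3, contract_cons h1, ← e, e2]
          have ok : Ok (n - 2) (contract (ι := Empty) (β₁ ++ b :: β₂)) := by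
            refine ok_contract (by simp; omega) ?_
            refine hlin.of_double (x := x) (List.perm_iff_count.2 fun y => ?_)
            simp only [List.count_cons, List.count_append]; ring
          exact virtVirt _ (ok_pull (.cons (m := n - 2) _ _ ok) (by omega)) (by omega)
        -- Now `x`, `a` and `b` are equal, so this name would occur three times.
        · exfalso
          have := hlin x
          simp only [List.count_cons, List.count_append, beq_self_eq_true, if_true] at this
          omega
      · by_cases h3 : x = b
        -- Partner `b`: the given crossing is the first crossing of the longer pull, so that both
        -- words are the same.
        · subst h3
          have e : β₁.length + 1 = (β₁ ++ [a]).length := by simp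
          have h4 : x ∉ β₁ ++ [a] := by simp [h1, h2]
          have e1 : x :: (β₁ ++ a :: x :: β₂) = x :: ((β₁ ++ [a]) ++ x :: β₂) := by simp
          have e2 : (β₁ ++ [a]) ++ β₂ = β₁ ++ a :: β₂ := by simp
          rw [e1, contract_cons h4, contract_cons h1, ← e, e2]
          have ok : Ok (n - 2) (contract (ι := Empty) (β₁ ++ a :: β₂)) := by
            refine ok_contract (by simp; omega) ?_
            refine hlin.of_double (x := x) (List.perm_iff_count.2 fun y => ?_)
            simp only [List.count_cons, List.count_append]; ring
          exact refl (ok_pull (i := β₁.length + 1) (.cons (m := n - 2) _ _ ok) (by omega))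
        -- Partner on the right: the pulled strand crosses both strands of the pair.
        · have h4 : x ∈ β₂ := by
            have := hlin x
            simp only [List.count_cons, List.count_append, beq_self_eq_true, if_true, beq_iff_eq, Ne.symm h2, Ne.symm h3,
              if_false, List.count_eq_zero_of_not_mem h1] at this
            exact List.count_pos_iff.1 (by omega)
          obtain ⟨γ₁, γ₂, rfl, h5⟩ := List.eq_append_cons_of_mem h4
          have e : ∀ c d : α, x :: (β₁ ++ c :: d :: (γ₁ ++ x :: γ₂)) =
            x :: ((β₁ ++ c :: d :: γ₁) ++ x :: γ₂) := by simp
          have h6 : Lin (β₁ ++ a :: b :: (γ₁ ++ γ₂)) := by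
            refine hlin.of_double (x := x) (List.perm_iff_count.2 fun y => ?_)
            simp only [List.count_cons, List.count_append]; ring
          rw [e, e, contract_cons (by simp [h1, h2, h3, h5]), contract_cons (by simp [h1, h2, h3, h5])]
          simp only [List.length_cons, List.length_append] at hn ⊢
          have ok : Ok (n - 2) (contract (ι := Empty) (β₁ ++ b :: a :: γ₁ ++ γ₂)) := by
            refine ok_contract (by simp; omega) (h6.perm ?_)
            simp only [List.append_assoc]
            exact List.Perm.append_left _ (List.Perm.swap _ _ _)
          have step := ih (n - 2) (by omega) β₁ (γ₁ ++ γ₂) a b (by simp; omega) h6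
          refine trans (virtPullBraid (.cons (m := n - 2) _ _ ok) (by omega) (by omega) (by omega))
            (VE.pull ?_ (by omega))
          refine trans (capVirt β₁.length ok) ?_
          refine .cons (m := n - 2) _ _ ?_
          simpa only [List.append_assoc, List.cons_append] using step
  intro β₁ β₂ a b hn hlin
  cases β₁ with
  | cons x β₁ => exact key x β₁ β₂ a b hn hlin
  | nil =>
    simp only [List.nil_append, List.length_nil] at hn hlin ⊢
    by_cases hab : a = b
    · subst hab
      have h0 := @contract_cons α _ Empty a [] β₂ (by simp)
      simp only [List.nil_append, VirtualClosure.pull, List.length_nil] at h0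
      rw [h0]
      simp only [List.length_cons] at hn
      refine capSymm (m := n - 2) 0 (ok_contract (by omega) ?_)
      refine hlin.of_double (x := a) (List.perm_iff_count.2 fun y => ?_)
      simp only [List.count_cons]
    · have lin_swap : ∀ {c d : α} {γ : List α}, Lin (c :: d :: γ) → Lin (d :: c :: γ) :=
        fun h => h.perm (List.Perm.swap _ _ _)
      -- At the left end the order of the remaining strands can be changed freely: exchanges among
      -- them are covered by `key` on both sides and commute with the crossing at `0`. The prefix
      -- `γ` is what the induction on the permutation has already passed.
      have move : ∀ {δ ε : List α}, δ.Perm ε → ∀ γ : List α, (a :: b :: (γ ++ ε)).length = n →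
          Lin (a :: b :: (γ ++ ε)) →
          VE n ((0, virt) :: contract (b :: a :: (γ ++ δ))) (contract (a :: b :: (γ ++ δ))) →
          VE n ((0, virt) :: contract (b :: a :: (γ ++ ε))) (contract (a :: b :: (γ ++ ε))) := by
        intro δ ε hp
        induction hp with
        | nil => exact fun _ _ _ h => h
        | cons x _ ihp =>
          intro γ hn hl h
          have := ihp (γ ++ [x]) (by simpa using hn) (by simpa using hl) (by simpa using h)
          simpa using this
        | swap x y ε =>
          intro γ hn hl h
          have hl' : Lin (b :: a :: (γ ++ x :: y :: ε)) := lin_swap hl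
          have k1 := key a (b :: γ) ε x y (by simpa using hn) hl
          have k2 := key b (a :: γ) ε x y (by simpa using hn) hl'
          simp only [List.length_cons, List.length_append, List.cons_append] at k1 k2 hn
          have ok2 := (k2.okl).2
          refine trans (.cons _ _ k2.symm) (trans ?_ (trans (.cons _ _ h) k1))
          refine virtComm 0 _ (Ok.cast ok2 ?_)
          simp only [Gen.dom, Gen.cod]; omega
        | trans h1 h2 ih1 ih2 =>
          intro γ hn hl h
          refine ih2 γ hn hl (ih1 γ ?_ ?_ h)
          · simpa [h2.length_eq] using hn
          · exact hl.perm ((List.Perm.append_left _ h2.symm).cons _ |>.cons _)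
      have ha : a ∈ β₂ := by
        have := hlin a
        simp only [List.count_cons, beq_self_eq_true, if_true, beq_iff_eq, Ne.symm hab, if_false] at this
        exact List.count_pos_iff.1 (by omega)
      obtain ⟨β₃, hp⟩ : ∃ β₃, β₂.Perm (a :: b :: β₃) := by
        have hb : b ∈ β₂.erase a := by
          have := hlin b
          simp only [List.count_cons, beq_self_eq_true, if_true, beq_iff_eq, hab, if_false] at this
          rw [List.mem_erase_of_ne (Ne.symm hab)]
          exact List.count_pos_iff.1 (by omega)
        exact ⟨_, (List.perm_cons_erase ha).trans ((List.perm_cons_erase hb).cons _)⟩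
      -- It remains to treat the case that the partners of `a` and `b` come next, where both words
      -- are explicit.
      refine move hp.symm [] hn hlin ?_
      have hl : Lin β₃ := by
        have := hlin.perm ((hp.cons _).cons _)
        refine (this.of_double (x := a) (γ := b :: b :: β₃) (List.perm_iff_count.2 fun y => by
          simp only [List.count_cons]; ring)).of_double (x := b) (List.Perm.refl _)
      have c1 : contract (a :: b :: a :: b :: β₃) =
          (1, virt) :: (0, cap) :: (0, cap) :: contract (ι := Empty) β₃ := by
        have h1 := @contract_cons α _ Empty a [b] (b :: β₃) (by simp [hab])
        have h2 := @contract_cons α _ Empty b [] β₃ (by simp)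
        simp only [List.cons_append, List.nil_append, List.length_cons, List.length_nil] at h1 h2
        rw [h1, h2]; rfl
      have c2 : contract (b :: a :: a :: b :: β₃) =
          (2, virt) :: (1, virt) :: (0, cap) :: (0, cap) :: contract (ι := Empty) β₃ := by
        have h1 := @contract_cons α _ Empty b [a, a] β₃ (by simp [Ne.symm hab])
        have h2 := @contract_cons α _ Empty a [] β₃ (by simp)
        simp only [List.cons_append, List.nil_append, List.length_cons, List.length_nil] at h1 h2
        rw [h1, h2]; rfl
      have hlen : β₃.length + 4 = n := by
        have := hp.length_eq
        simp only [List.length_cons] at this hn; omega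
      have ok : Ok (n - 4) (contract (ι := Empty) β₃) := ok_contract (by omega) hl
      have ok' : Ok (n - 2) ((0, cap) :: contract (ι := Empty) β₃) := .cons (m := n - 4) _ _ ok
      simp only [List.nil_append]
      rw [c1, c2]
      calc VE n _ ((0, virt) :: (2, virt) :: (0, virt) :: (1, cap) :: (0, cap) :: contract β₃) :=
            .virtOn _ (.virtOn _ (virtCap 0 ok'))
        VE n _ ((2, virt) :: (0, virt) :: (0, virt) :: (1, cap) :: (0, cap) :: contract β₃) :=
            virtComm 0 2 (.virtOn _ (.cons (m := n - 2) _ _ ok'))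
        VE n _ ((2, virt) :: (1, cap) :: (0, cap) :: contract β₃) :=
            .virtOn _ (virtVirt 0 (.cons (m := n - 2) _ _ ok'))
        VE n _ ((1, virt) :: (2, cap) :: (0, cap) :: contract β₃) := virtCap 1 ok'
        VE n _ ((1, virt) :: (0, cap) :: (0, cap) :: contract β₃) :=
            .virtOn _ (exch cap cap 0 0 0 2 ok).symm

end VE

/-! ### Diagrams as networks of named pieces -/

/-- Only endpoints and marked points have a single strand at the bottom, and they need a label.
Hence `bend` has just two cases. -/
theorem dom_eq (g : Gen Empty) : g.dom = 0 ∨ g.dom = 2 := by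
  cases g <;> first | exact Or.inl rfl | exact Or.inr rfl | (rename_i e; exact e.elim)

/-- A piece with names for the strands at its bottom and at its top. -/
structure Tensor (ι α : Type) where
  gen : Gen ι
  bot : List α
  top : List α

namespace Tensor

variable {ι α : Type}

/-- The names at the piece, from the top left in clockwise order. -/
def legs (t : Tensor ι α) : List α := t.top ++ t.bot.reverse

/-- The numbers of names are right. -/
def WF (t : Tensor ι α) : Prop := t.bot.length = t.gen.dom ∧ t.top.length = t.gen.cod

/-- Rename the strands. -/
def map {β : Type} (f : α → β) (t : Tensor ι α) : Tensor ι β := ⟨t.gen, t.bot.map f, t.top.map f⟩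

/-- A piece of strand. -/
def arc (a b : α) : Tensor Empty α := ⟨cup, [], [a, b]⟩

theorem wf_arc (a b : α) : (arc a b).WF := ⟨rfl, rfl⟩

theorem legs_map {β : Type} (f : α → β) (t : Tensor ι α) : (t.map f).legs = t.legs.map f := by
  simp [legs, map]

theorem WF.map {β : Type} (f : α → β) {t : Tensor ι α} (h : t.WF) : (t.map f).WF := by
  simpa [WF, Tensor.map] using h

theorem WF.length_legs {t : Tensor ι α} (h : t.WF) : t.legs.length = t.gen.cod + t.gen.dom := by
  simp [legs, h.1, h.2]

end Tensor

/-- All names in a network. -/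
def names {ι α : Type} (T : List (Tensor ι α)) : List α := T.flatMap Tensor.legs

theorem names_cons {ι α : Type} (t : Tensor ι α) (T : List (Tensor ι α)) :
    names (t :: T) = t.legs ++ names T := rfl

theorem names_append {ι α : Type} (S T : List (Tensor ι α)) :
    names (S ++ T) = names S ++ names T := List.flatMap_append

theorem names_map {ι α β : Type} (f : α → β) (T : List (Tensor ι α)) :
    names (T.map (Tensor.map f)) = (names T).map f := by
  induction T with
  | nil => rfl
  | cons t T ih => rw [List.map_cons, names_cons, names_cons, ih, Tensor.legs_map, List.map_append]

/-- A piece in position `l` whose bottom is bent to the right and up. -/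
def bend (l : ℕ) (g : Gen Empty) (z : List (Op Empty)) : List (Op Empty) :=
  if g.dom = 0 then (l, g) :: z else (l, cup) :: (l + 1, cup) :: (l, g) :: z

/-- A word for a network and for strands with names `β` that come from below: all pieces are placed
on the left, and then strands with equal names are joined. -/
def net {α : Type} [DecidableEq α] : List α → List (Tensor Empty α) → List (Op Empty)
  | β, [] => contract β
  | β, t :: T => bend 0 t.gen (net (t.legs ++ β) T)

/-- The network `T`, with strands `β` from below, has good names. -/
def Good {α : Type} [DecidableEq α] (β : List α) (T : List (Tensor Empty α)) : Prop :=
  (∀ t ∈ T, t.WF) ∧ Lin (β ++ names T)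

theorem Good.cons {α : Type} [DecidableEq α] {β : List α} {t : Tensor Empty α}
    {T : List (Tensor Empty α)} (h : Good β (t :: T)) : Good (t.legs ++ β) T := by
  refine ⟨fun s hs => h.1 s (List.mem_cons_of_mem _ hs), h.2.perm ?_⟩
  rw [names_cons, ← List.append_assoc]
  exact List.perm_append_comm.append_right _

theorem Good.of_perm {α : Type} [DecidableEq α] {β γ : List α} {S T : List (Tensor Empty α)}
    (h : Good β S) (hw : ∀ t ∈ T, t.WF) (e : (β ++ names S).Perm (γ ++ names T)) : Good γ T :=
  ⟨hw, h.2.perm e⟩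

theorem ok_bend {n m : ℕ} {l : ℕ} {g : Gen Empty} {z : List (Op Empty)} (hz : Ok m z) (hl : l ≤ n)
    (hm : m = n + g.cod + g.dom) : Ok n (bend l g z) := by
  unfold bend
  split_ifs with h
  · exact .cons (m := m) _ _ hz
  · have := (dom_eq g).resolve_left h
    exact .cons (m := n + 2) _ _ (.cons (m := n + 4) _ _ (.cons (m := m) _ _ hz))

theorem ok_net {α : Type} [DecidableEq α] : ∀ {T : List (Tensor Empty α)} {β : List α},
    Good β T → Ok β.length (net β T)
  | [], β, h => ok_contract rfl (by simpa [names] using h.2)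
  | t :: T, β, h => by
    refine ok_bend (ok_net h.cons) (Nat.zero_le _) ?_
    rw [List.length_append, (h.1 t (by simp)).length_legs]; omega

/-- Again an equality of words, because names enter only through `contract`. -/
theorem net_map {α β' : Type} [DecidableEq α] [DecidableEq β'] {f : α → β'}
    (hf : Function.Injective f) : ∀ (T : List (Tensor Empty α)) (β : List α),
    net (β.map f) (T.map (Tensor.map f)) = net β T
  | [], β => contract_map hf rfl
  | t :: T, β => by
    rw [List.map_cons, net, net, ← net_map hf T, List.map_append, Tensor.legs_map]
    rfl

/-- A strand moves to the right across `k` strands. -/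
def shift : ℕ → ℕ → List (Op Empty) → List (Op Empty)
  | _, 0, z => z
  | l, k + 1, z => (l, virt) :: shift (l + 1) k z

theorem ok_shift {n : ℕ} {z : List (Op Empty)} (hz : Ok n z) :
    ∀ {k l : ℕ}, l + k < n → Ok n (shift l k z)
  | 0, _, _ => hz
  | k + 1, l, h => .virtOn _ (ok_shift hz (by omega))

/-! ### Passing bent pieces -/

namespace VE

variable {n m : ℕ} {z u v : List (Op Empty)}

theorem bend {l : ℕ} {g : Gen Empty} (h : VE m u v) (hl : l ≤ n) (hm : m = n + g.cod + g.dom) :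
    VE n (bend l g u) (bend l g v) := by
  unfold VirtualClosure.bend
  split_ifs with h0
  · exact .cons (m := m) _ _ h
  · have := (dom_eq g).resolve_left h0
    exact .cons (m := n + 2) _ _ (.cons (m := n + 4) _ _ (.cons (m := m) _ _ h))

theorem shift (h : VE n u v) : ∀ {k l : ℕ}, l + k < n → VE n (shift l k u) (shift l k v)
  | 0, _, _ => h
  | k + 1, l, hk => .virtOn _ (VE.shift h (by omega))

/-- A piece passes a piece on its left. -/
theorem bendComm {l k : ℕ} {g h : Gen Empty} (hz : Ok m z) (hlk : l ≤ k) (hn : k + h.dom ≤ n)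
    (hm : m + h.dom = n + g.cod + g.dom + h.cod) :
    VE n (VirtualClosure.bend l g ((k + g.cod + g.dom, h) :: z)) ((k, h) :: VirtualClosure.bend l g z) := by
  unfold VirtualClosure.bend
  split_ifs with h0
  · exact exch g h l k _ _ hz
  · have := (dom_eq g).resolve_left h0
    calc VE n _ ((l, cup) :: (l + 1, cup) :: (k + 4, h) :: (l, g) :: z) :=
          .cons (m := n + 2) _ _ (.cons (m := n + 4) _ _ (exch g h l (k + 2) _ _ hz))
      VE n _ ((l, cup) :: (k + 2, h) :: (l + 1, cup) :: (l, g) :: z) :=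
          .cons (m := n + 2) _ _ (exch cup h (l + 1) (k + 2) _ _ (m := n + 4 + h.cod - h.dom)
            (.cons (m := m) _ _ hz))
      VE n _ ((k, h) :: (l, cup) :: (l + 1, cup) :: (l, g) :: z) :=
          exch cup h l k _ _ (m := n + 2 + h.cod - h.dom)
            (.cons (m := n + 4 + h.cod - h.dom) _ _ (.cons (m := m) _ _ hz))

/-- Two bent pieces exchange their heights. -/
theorem bendBend {l k : ℕ} {g h : Gen Empty} (hz : Ok m z) (hlk : l ≤ k) (hn : k ≤ n)
    (hm : m = n + g.cod + g.dom + h.cod + h.dom) :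
    VE n (VirtualClosure.bend l g (VirtualClosure.bend (k + g.cod + g.dom) h z))
      (VirtualClosure.bend k h (VirtualClosure.bend l g z)) := by
  rcases dom_eq h with h0 | h0
  · have e : ∀ k z, VirtualClosure.bend k h z = (k, h) :: z := fun k z => by
      simp [VirtualClosure.bend, h0]
    rw [e, e]
    exact bendComm hz hlk (by omega) (by omega)
  · have e : ∀ k z, VirtualClosure.bend k h z = (k, cup) :: (k + 1, cup) :: (k, h) :: z := fun k z => by
      simp [VirtualClosure.bend, h0]
    rw [e, e]
    have o : Ok (n + 4 + g.cod + g.dom) ((k + g.cod + g.dom, h) :: z) := .cons (m := m) _ _ hz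
    have e1 : k + g.cod + g.dom + 1 = (k + 1) + g.cod + g.dom := by omega
    refine trans (bendComm (m := n + 2 + g.cod + g.dom) ?_ hlk ?_ ?_) (cons (m := n + 2) _ _ ?_)
    · exact .cons (m := n + 4 + g.cod + g.dom) _ _ o
    · simp only [Gen.dom]; omega
    · simp only [Gen.dom, Gen.cod]; omega
    · rw [e1]
      refine trans (bendComm o (by omega) ?_ ?_) (cons (m := n + 4) _ _ ?_)
      · simp only [Gen.dom]; omega
      · simp only [Gen.dom, Gen.cod]; omega
      · exact bendComm hz hlk (by omega) (by omega)

/-- A strand passes a cup from the left to the right. -/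
theorem cupShift (l : ℕ) (hz : Ok m z) (hl : l < n) (hm : m = n + 2) :
    VE n ((l + 1, cup) :: (l, virt) :: (l + 1, virt) :: z) ((l, cup) :: z) :=
  trans (virtCup l (.virtOn _ hz)).symm (.cons (m := m) _ _ (virtVirt _ hz))

/-- A strand passes a piece from the left to the right. -/
theorem genShift (l : ℕ) {g : Gen Empty} (hz : Ok m z) (hl : l + g.dom < n)
    (hm : m + g.dom = n + g.cod) :
    VE n ((l + 1, g) :: VirtualClosure.shift l g.cod z) (VirtualClosure.shift l g.dom ((l, g) :: z)) := by
  -- `crossNat` carries a strand past a crossing in one direction. The other direction follows by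
  -- insertion of two cancelling pairs of virtual crossings below and by cancellation above.
  have cross : g.IsClassicalCrossing → g.dom = 2 → g.cod = 2 →
      VE n ((l + 1, g) :: VirtualClosure.shift l g.cod z) (VirtualClosure.shift l g.dom ((l, g) :: z)) := by
    intro hg h1 h2
    rw [h1, h2]
    obtain rfl : m = n := by omega
    have o : Ok m ((l, g) :: z) := .cons (m := m) _ _ hz
    have o1 : Ok m ((l + 1, g) :: (l, virt) :: (l + 1, virt) :: z) :=
      .cons (m := m) _ _ (.virtOn _ (.virtOn _ hz))
    calc VE m ((l + 1, g) :: (l, virt) :: (l + 1, virt) :: z)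
            ((l, virt) :: (l, virt) :: (l + 1, g) :: (l, virt) :: (l + 1, virt) :: z) :=
          (virtVirt l o1).symm
      VE m _ ((l, virt) :: (l + 1, virt) :: (l + 1, virt) :: (l, virt) :: (l + 1, g) :: (l, virt) :: (l + 1, virt) :: z) :=
          .virtOn _ (virtVirt (l + 1) (.virtOn _ o1)).symm
      VE m _ ((l, virt) :: (l + 1, virt) :: (l, g) :: (l + 1, virt) :: (l, virt) :: (l, virt) :: (l + 1, virt) :: z) :=
          .virtOn _ (.virtOn _ (crossNat l hg (.virtOn _ (.virtOn _ hz))).symm)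
      VE m _ ((l, virt) :: (l + 1, virt) :: (l, g) :: (l + 1, virt) :: (l + 1, virt) :: z) :=
          .virtOn _ (.virtOn _ (.cons (m := m) _ _ (.virtOn _ (virtVirt _ (.virtOn _ hz)))))
      VE m _ ((l, virt) :: (l + 1, virt) :: (l, g) :: z) :=
          .virtOn _ (.virtOn _ (.cons (m := m) _ _ (virtVirt _ hz)))
  match g with
  | cup => exact cupShift l hz hl hm
  | cap =>
    simp only [Gen.dom, Gen.cod] at hl hm
    calc VE n ((l + 1, cap) :: z) ((l, virt) :: (l, virt) :: (l + 1, cap) :: z) :=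
          (virtVirt l (.cons (m := m) _ _ hz)).symm
      VE n _ ((l, virt) :: (l + 1, virt) :: (l, cap) :: z) := .virtOn _ (virtCap l hz).symm
  | overX => exact cross (Or.inl rfl) rfl rfl
  | underX => exact cross (Or.inr rfl) rfl rfl
  | virt =>
    obtain rfl : m = n := by simp only [Gen.dom, Gen.cod] at hm; omega
    exact (braid l hz hl).symm

/-- A strand passes a bent piece from the left to the right. -/
theorem bendShift (l : ℕ) {g : Gen Empty} (hz : Ok m z) (hl : l < n)
    (hm : m = n + g.cod + g.dom) :
    VE n (VirtualClosure.bend (l + 1) g (VirtualClosure.shift l (g.cod + g.dom) z))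
      (VirtualClosure.bend l g z) := by
  rcases dom_eq g with h0 | h0
  · have e : ∀ k z, VirtualClosure.bend k g z = (k, g) :: z := fun k z => by
      simp [VirtualClosure.bend, h0]
    rw [e, e]
    have := genShift (n := n) (g := g) l hz (by omega) (by omega)
    simpa only [h0, add_zero, VirtualClosure.shift] using this
  · have e : ∀ k z, VirtualClosure.bend k g z = (k, cup) :: (k + 1, cup) :: (k, g) :: z := fun k z => by
      simp [VirtualClosure.bend, h0]
    have e2 : ∀ (c l d : ℕ) (z : List (Op Empty)), VirtualClosure.shift l (c + d) z =
        VirtualClosure.shift l c (VirtualClosure.shift (l + c) d z) := by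
      intro c
      induction c with
      | zero => intro l d z; simp [VirtualClosure.shift]
      | succ c ih =>
        intro l d z
        rw [Nat.succ_add, VirtualClosure.shift, ih, VirtualClosure.shift,
          Nat.add_right_comm l 1 c, Nat.add_assoc l c 1]
    rw [e, e, e2, h0]
    have o1 : Ok m (VirtualClosure.shift (l + g.cod) 2 z) := ok_shift hz (by omega)
    have o2 : Ok (n + 4) ((l, g) :: z) := .cons (m := m) _ _ hz
    calc VE n _ ((l + 1, cup) :: (l + 2, cup) :: VirtualClosure.shift l 2 ((l, g) :: VirtualClosure.shift (l + g.cod) 2 z)) := by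
          refine .cons (m := n + 2) _ _ (.cons (m := n + 4) _ _ ?_)
          have := genShift (n := n + 4) (g := g) l o1 (by omega) (by omega)
          rwa [h0] at this
      VE n _ ((l + 1, cup) :: (l + 2, cup) :: (l, virt) :: (l + 1, virt) :: (l + 2, virt) :: (l + 3, virt) :: (l, g) :: z) := by
          refine .cons (m := n + 2) _ _ (.cons (m := n + 4) _ _ (.virtOn _ (.virtOn _ ?_)))
          refine trans (exch g virt l l _ _ (m := m) (.virtOn _ hz)) (.virtOn _ ?_)
          exact exch g virt l (l + 1) _ _ hz
      VE n _ ((l + 1, cup) :: (l, virt) :: (l + 2, cup) :: (l + 1, virt) :: (l + 2, virt) :: (l + 3, virt) :: (l, g) :: z) := by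
          refine .cons (m := n + 2) _ _ ?_
          exact (exch virt cup l (l + 2 - 2 + 0) _ _ (m := n + 4) (.virtOn _ (.virtOn _ (.virtOn _ o2)))).symm
      VE n _ ((l + 1, cup) :: (l, virt) :: (l + 1, cup) :: (l + 3, virt) :: (l, g) :: z) :=
          .cons (m := n + 2) _ _ (.virtOn _ (cupShift (l + 1) (m := n + 4) (.virtOn _ o2) (by omega) (by omega)))
      VE n _ ((l + 1, cup) :: (l, virt) :: (l + 1, virt) :: (l + 1, cup) :: (l, g) :: z) :=
          .cons (m := n + 2) _ _ (.virtOn _ (exch cup virt (l + 1) (l + 1) _ _ (m := n + 4) o2))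
      VE n _ ((l, cup) :: (l + 1, cup) :: (l, g) :: z) :=
          cupShift l (m := n + 2) (.cons (m := n + 4) _ _ o2) hl rfl

end VE

/-! ### Calculus of networks -/

theorem perm_swap_mid {α : Type} (β₁ β₂ : List α) (a b : α) :
    (β₁ ++ a :: b :: β₂).Perm (β₁ ++ b :: a :: β₂) := (List.Perm.swap _ _ _).append_left _

section Net

variable {α : Type} [DecidableEq α]

theorem Good.nil {β : List α} (h : Good β []) : Lin β := by simpa [names] using h.2

theorem Good.reorder {β γ : List α} {T : List (Tensor Empty α)} (h : Good β T) (e : β.Perm γ) :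
    Good γ T := ⟨h.1, h.2.perm (e.append_right _)⟩

theorem Good.uncap {β₁ β₂ : List α} {a : α} {T : List (Tensor Empty α)}
    (h : Good (β₁ ++ a :: a :: β₂) T) : Good (β₁ ++ β₂) T :=
  ⟨h.1, h.2.of_double (x := a) (List.perm_iff_count.2 fun y => by
    simp only [List.count_cons, List.count_append]; ring)⟩

/-- The names in `t.bot` are listed twice, as strands from below and as ends of `t`; both copies
disappear. The names in `t.top` only change their place. -/
theorem Good.unpiece {β₁ β₂ : List α} {t : Tensor Empty α} {T : List (Tensor Empty α)}
    (h : Good (β₁ ++ t.bot ++ β₂) (t :: T)) : Good (β₁ ++ t.top ++ β₂) T := by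
  refine ⟨fun s hs => h.1 s (List.mem_cons_of_mem _ hs), fun y => ?_⟩
  have := h.2 y
  simp only [names_cons, Tensor.legs, List.count_append, List.count_reverse] at this ⊢
  omega

theorem Good.uncut {β₁ β₂ : List α} {a b : α} {T : List (Tensor Empty α)}
    (h : Good (β₁ ++ a :: β₂) (Tensor.arc a b :: T)) : Good (β₁ ++ b :: β₂) T :=
  ⟨fun s hs => h.1 s (List.mem_cons_of_mem _ hs),
    h.2.of_double (x := a) (List.perm_iff_count.2 fun y => by
      simp only [names_cons, Tensor.legs, Tensor.arc, List.count_cons, List.count_append,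
        List.reverse_nil, List.count_nil]; ring)⟩

/-! ### Absorbing crossings, caps, pieces and arcs -/

namespace VE

/-- The crossing is to the right of all bent pieces. It rises past them and is absorbed at the top
by `contract_swap`. -/
theorem netSwap : ∀ {T : List (Tensor Empty α)} {β₁ β₂ : List α} {a b : α},
    Good (β₁ ++ a :: b :: β₂) T → ∀ {n l : ℕ}, n = (β₁ ++ a :: b :: β₂).length → l = β₁.length →
    VE n ((l, virt) :: net (β₁ ++ b :: a :: β₂) T) (net (β₁ ++ a :: b :: β₂) T)
  | [], β₁, β₂, a, b, h, _, _, hn, hl => by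
    subst hn hl; exact contract_swap β₁ β₂ a b rfl h.nil
  | t :: T, β₁, β₂, a, b, h, n, l, hn, hl => by
    have hlen := (h.1 t (by simp)).length_legs
    have h' : Good ((t.legs ++ β₁) ++ a :: b :: β₂) T := by
      rw [List.append_assoc]; exact h.cons
    have step := netSwap h' rfl rfl
    simp only [List.length_append, List.length_cons, List.append_assoc] at hn step
    refine trans (bendComm (m := n + t.gen.cod + t.gen.dom) (l := 0) (k := l) (g := t.gen) (h := virt) ?_ (by omega) ?_ ?_).symm
      (VE.bend ?_ (by omega) rfl)
    · refine Ok.cast (ok_net (h.reorder (perm_swap_mid _ _ _ _)).cons) ?_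
      simp only [List.length_append, List.length_cons]; omega
    · simp only [Gen.dom]; omega
    · simp only [Gen.dom, Gen.cod]
    · have e : l + t.gen.cod + t.gen.dom = t.legs.length + β₁.length := by omega
      have e' : n + t.gen.cod + t.gen.dom = t.legs.length + (β₁.length + (β₂.length + 1 + 1)) := by omega
      rw [e, e']; exact step

theorem netShift {T : List (Tensor Empty α)} : ∀ {δ β₁ β₂ : List α} {x : α},
    Good (β₁ ++ x :: (δ ++ β₂)) T → ∀ {n l : ℕ}, n = (β₁ ++ x :: (δ ++ β₂)).length → l = β₁.length →
    VE n (VirtualClosure.shift l δ.length (net (β₁ ++ (δ ++ x :: β₂)) T)) (net (β₁ ++ x :: (δ ++ β₂)) T)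
  | [], _, _, _, h, _, _, hn, _ => by
    subst hn; exact refl (ok_net h)
  | d :: δ, β₁, β₂, x, h, n, l, hn, hl => by
    have h' : Good ((β₁ ++ [d]) ++ x :: (δ ++ β₂)) T :=
      h.reorder (List.perm_iff_count.2 fun y => by
        simp only [List.count_cons, List.count_append, List.cons_append, List.count_nil]; ring)
    have step := netShift h' (n := n) (l := l + 1) (by rw [hn]; simp) (by simp [hl])
    simp only [List.append_assoc, List.cons_append, List.nil_append] at step
    refine trans (virtOn _ step ?_) (netSwap h hn hl)
    simp only [List.length_append, List.length_cons] at hn; omega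

/-- Like `netSwap`, the maximum rises past all bent pieces. At the far left it is the first step of
`contract` itself. -/
theorem netCap : ∀ {T : List (Tensor Empty α)} {β₁ β₂ : List α} {a : α},
    Good (β₁ ++ a :: a :: β₂) T → ∀ {n l : ℕ}, n = (β₁ ++ a :: a :: β₂).length → l = β₁.length →
    VE n ((l, cap) :: net (β₁ ++ β₂) T) (net (β₁ ++ a :: a :: β₂) T)
  | [], β₁, β₂, a, h, n, l, hn, hl => by
    induction β₁ using List.reverseRecOn generalizing β₂ n l with
    | nil =>
      subst hn hl
      have h0 := contract_cons (ι := Empty) (x := a) (γ₁ := []) (γ₂ := β₂) (by simp)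
      simp only [List.nil_append, VirtualClosure.pull, List.length_nil] at h0
      simp only [List.nil_append, net, List.length_nil]
      rw [← h0]
      exact refl (ok_contract rfl h.nil)
    -- Otherwise the last strand `x` on the left is taken across to the right of the two equal
    -- names; this also takes it across the maximum.
    | append_singleton β₁ x ih =>
      have h1 : Good (β₁ ++ x :: ([a, a] ++ β₂)) ([] : List (Tensor Empty α)) :=
        h.reorder (by simp)
      have h2 : Good (β₁ ++ a :: a :: x :: β₂) ([] : List (Tensor Empty α)) :=
        h.reorder (List.perm_iff_count.2 fun y => by
          simp only [List.count_cons, List.count_append, List.count_nil]; ring)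
      simp only [List.length_append, List.length_cons, List.length_nil] at hn hl
      have o := ok_net h2.uncap
      have s1 := netShift h1 (n := n) (l := β₁.length) (by simp; omega) rfl
      have s2 := ih (x :: β₂) h2 n β₁.length (by simp; omega) rfl
      have e1 : β₁ ++ [x] ++ a :: a :: β₂ = β₁ ++ x :: ([a, a] ++ β₂) := by simp
      have e2 : β₁ ++ [x] ++ β₂ = β₁ ++ x :: β₂ := by simp
      rw [e1, e2]
      refine trans ?_ s1
      simp only [List.length_append, List.length_cons] at o
      calc VE n _ ((β₁.length, virt) :: (β₁.length, virt) :: (β₁.length + 1, cap) :: net (β₁ ++ x :: β₂) []) := by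
            rw [hl]
            exact (virtVirt _ (.cons (m := n - 2) _ _ (o.cast (by omega)))).symm
        VE n _ ((β₁.length, virt) :: (β₁.length + 1, virt) :: (β₁.length, cap) :: net (β₁ ++ x :: β₂) []) :=
            virtOn _ (virtCap _ (o.cast (n := n - 2) (by omega))).symm
        VE n _ ((β₁.length, virt) :: (β₁.length + 1, virt) :: net (β₁ ++ a :: a :: x :: β₂) []) :=
            virtOn _ (virtOn _ s2)
  | t :: T, β₁, β₂, a, h, n, l, hn, hl => by
    have hlen := (h.1 t (by simp)).length_legs
    have h' : Good ((t.legs ++ β₁) ++ a :: a :: β₂) T := by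
      rw [List.append_assoc]; exact h.cons
    have step := netCap h' rfl rfl
    have o := ok_net h.uncap.cons
    simp only [List.length_append, List.length_cons, List.append_assoc] at hn step o
    refine trans (bendComm (m := n - 2 + t.gen.cod + t.gen.dom) (l := 0) (k := l) (g := t.gen) (h := cap)
      (o.cast (by omega)) (by omega) ?_ ?_).symm (VE.bend ?_ (by omega) rfl)
    · simp only [Gen.dom]; omega
    · simp only [Gen.dom, Gen.cod]; omega
    · have e : l + t.gen.cod + t.gen.dom = t.legs.length + β₁.length := by omega
      have e' : n + t.gen.cod + t.gen.dom = t.legs.length + (β₁.length + (β₂.length + 1 + 1)) := by omega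
      rw [e, e']; exact step

/-- The bent piece that belongs to the first tensor can be put anywhere. -/
theorem netBend {t : Tensor Empty α} {T : List (Tensor Empty α)} {β₁ β₂ : List α}
    (h : Good (β₁ ++ β₂) (t :: T)) {n l : ℕ} (hn : n = (β₁ ++ β₂).length) (hl : l = β₁.length) :
    VE n (VirtualClosure.bend l t.gen (net (β₁ ++ (t.legs ++ β₂)) T)) (net (β₁ ++ β₂) (t :: T)) := by
  have hlen := (h.1 t (by simp)).length_legs
  induction β₁ using List.reverseRecOn generalizing β₂ n l with
  | nil => subst hn hl; exact refl (ok_net h)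
  -- The last strand `x` on the left is moved to the other side of the bent piece by `bendShift`.
  | append_singleton β₁ x ih =>
    have e1 : β₁ ++ [x] ++ (t.legs ++ β₂) = β₁ ++ x :: (t.legs ++ β₂) := by simp
    have e2 : β₁ ++ [x] ++ β₂ = β₁ ++ x :: β₂ := by simp
    rw [e2] at h hn ⊢
    rw [e1]
    have h1 : Good (β₁ ++ x :: (t.legs ++ β₂)) T := h.cons.reorder (List.perm_iff_count.2 fun y => by
        simp only [List.count_cons, List.count_append]; ring)
    simp only [List.length_append, List.length_cons, List.length_nil] at hn hl
    have s1 := netShift h1 (n := n + t.gen.cod + t.gen.dom) (l := β₁.length)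
      (by simp only [List.length_append, List.length_cons]; omega) rfl
    have o := ok_net (h1.reorder (γ := β₁ ++ (t.legs ++ x :: β₂)) (List.perm_iff_count.2 fun y => by
        simp only [List.count_cons, List.count_append]; ring))
    simp only [List.length_append, List.length_cons] at o
    refine trans (VE.bend s1.symm (by omega) rfl) ?_
    rw [hl, hlen]
    refine trans (bendShift (m := n + t.gen.cod + t.gen.dom) _ (o.cast (by omega)) (by omega) rfl) ?_
    exact ih h (by simp only [List.length_append, List.length_cons]; omega) rfl

/-- A piece below a network can be included into the network. -/
theorem netPiece {t : Tensor Empty α} {T : List (Tensor Empty α)} {β₁ β₂ : List α}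
    (h : Good (β₁ ++ t.bot ++ β₂) (t :: T)) {n l : ℕ} (hn : n = (β₁ ++ t.bot ++ β₂).length)
    (hl : l = β₁.length) :
    VE n ((l, t.gen) :: net (β₁ ++ t.top ++ β₂) T) (net (β₁ ++ t.bot ++ β₂) (t :: T)) := by
  obtain ⟨g, bot, top⟩ := t
  have hw := h.1 _ (List.mem_cons_self ..)
  obtain ⟨w1, w2⟩ := hw
  simp only at w1 w2 h hn ⊢
  have h0 : Good (β₁ ++ (bot ++ β₂)) (⟨g, bot, top⟩ :: T) := by rwa [← List.append_assoc]
  have s0 := netBend h0 (n := n) (l := l) (by rw [hn, List.append_assoc]) hl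
  rw [List.append_assoc β₁ bot]
  refine trans ?_ s0
  have o := ok_net h.unpiece
  simp only [List.length_append] at hn o
  simp only [VirtualClosure.bend]
  split_ifs with hd
  · obtain rfl : bot = [] := List.length_eq_zero_iff.1 (by omega)
    simp only [Tensor.legs, List.reverse_nil, List.append_nil, List.nil_append, List.append_assoc] at o ⊢
    simp only [List.append_assoc, List.length_nil] at *
    exact refl (.cons (m := n + g.cod) _ _ (o.cast (by omega)))
  · have hd2 := (dom_eq g).resolve_left hd
    obtain ⟨p, q, rfl⟩ : ∃ p q, bot = [p, q] := List.length_eq_two.1 (by omega)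
    have hc := h0.cons
    -- Behind the bent piece the bottom names stand as `q, p, p, q`. Joining first `p` and then `q`
    -- with itself produces two snakes, which are pulled straight; what is left is the piece without
    -- its bend.
    have e1 : β₁ ++ ((⟨g, [p, q], top⟩ : Tensor Empty α).legs ++ ([p, q] ++ β₂)) =
        (β₁ ++ top ++ [q]) ++ p :: p :: (q :: β₂) := by simp [Tensor.legs]
    have e2 : (β₁ ++ top ++ [q]) ++ (q :: β₂) = (β₁ ++ top) ++ q :: q :: β₂ := by simp
    have g1 : Good ((β₁ ++ top ++ [q]) ++ p :: p :: (q :: β₂)) T :=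
      hc.reorder (List.perm_iff_count.2 fun y => by
        simp only [Tensor.legs, List.count_cons, List.count_append, List.count_reverse, List.count_nil]; ring)
    have g2 : Good ((β₁ ++ top) ++ q :: q :: β₂) T := e2 ▸ g1.uncap
    rw [e1]
    have s1 := netCap g1 (n := n + 4 + g.cod - 2) (l := l + g.cod + 1)
      (by simp at hn ⊢; omega) (by simp; omega)
    have s2 := netCap g2 (n := n + 4 + g.cod - 4) (l := l + g.cod)
      (by simp at hn ⊢; omega) (by simp; omega)
    rw [e2] at s1
    simp only [List.length_cons, List.length_nil] at hn
    have o' : Ok (n + 4 + g.cod - 6) (net (β₁ ++ top ++ β₂) T) := o.cast (by omega)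
    have og : Ok n ((l, g) :: net (β₁ ++ top ++ β₂) T) :=
      .cons (m := n + 4 + g.cod - 6) _ _ o'
    refine VE.symm ?_
    calc VE n _ ((l, cup) :: (l + 1, cup) :: (l, g) :: (l + g.cod + 1, cap) :: (l + g.cod, cap) :: net (β₁ ++ top ++ β₂) T) :=
          .cons (m := n + 2) _ _ (.cons (m := n + 4) _ _ (.cons (m := n + 4 + g.cod - 2) _ _
            (trans s1.symm (.cons (m := n + 4 + g.cod - 4) _ _ s2.symm))))
      VE n _ ((l, cup) :: (l + 1, cup) :: (l + 3, cap) :: (l, g) :: (l + g.cod, cap) :: net (β₁ ++ top ++ β₂) T) :=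
          .cons (m := n + 2) _ _ (.cons (m := n + 4) _ _ (exch g cap l (l + 1) _ _ (m := n + 4 + g.cod - 4)
            (.cons (m := n + 4 + g.cod - 6) _ _ o')))
      VE n _ ((l, cup) :: (l + 1, cup) :: (l + 3, cap) :: (l + 2, cap) :: (l, g) :: net (β₁ ++ top ++ β₂) T) :=
          .cons (m := n + 2) _ _ (.cons (m := n + 4) _ _ (.cons (m := n + 2) _ _
            (exch g cap l l _ _ (m := n + 4 + g.cod - 6) o')))
      VE n _ ((l, cup) :: (l + 1, cap) :: (l + 1, cup) :: (l + 2, cap) :: (l, g) :: net (β₁ ++ top ++ β₂) T) :=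
          .cons (m := n + 2) _ _ (exch cup cap (l + 1) (l + 1) _ _ (m := n + 2) (.cons (m := n) _ _ og))
      VE n _ ((l + 1, cup) :: (l + 2, cap) :: (l, g) :: net (β₁ ++ top ++ β₂) T) :=
          snakeL l (.cons (m := n + 2) _ _ (.cons (m := n) _ _ og))
      VE n _ ((l, g) :: net (β₁ ++ top ++ β₂) T) := snakeL (l + 1) og

/-- A strand is cut into two pieces. -/
theorem netCut {T : List (Tensor Empty α)} {β₁ β₂ : List α} {a b : α}
    (h : Good (β₁ ++ a :: β₂) (Tensor.arc a b :: T)) {n : ℕ} (hn : n = (β₁ ++ a :: β₂).length) :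
    VE n (net (β₁ ++ b :: β₂) T) (net (β₁ ++ a :: β₂) (Tensor.arc a b :: T)) := by
  have e1 : β₁ ++ a :: β₂ = (β₁ ++ [a]) ++ β₂ := by simp
  have e2 : (β₁ ++ [a]) ++ ((Tensor.arc a b).legs ++ β₂) = β₁ ++ a :: a :: (b :: β₂) := by
    simp [Tensor.legs, Tensor.arc]
  have o := ok_net h.uncut
  have g1 : Good (β₁ ++ a :: a :: (b :: β₂)) T := h.cons.reorder (List.perm_iff_count.2 fun y => by
        simp only [Tensor.legs, Tensor.arc, List.count_cons, List.count_append, List.count_reverse, List.count_nil]; ring)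
  rw [e1] at h hn ⊢
  have s0 := netBend h hn (l := β₁.length + 1) (by simp)
  rw [e2] at s0
  simp only [List.length_append, List.length_cons, List.length_nil] at hn o
  refine trans ?_ s0
  refine trans (snakeR β₁.length (o.cast (by omega))).symm
    (.cons (m := n + 2) _ _ (netCap g1 ?_ rfl))
  simp; omega

theorem netCons {t : Tensor Empty α} {S T : List (Tensor Empty α)} {β : List α}
    (ht : t.WF) (h : VE (t.legs ++ β).length (net (t.legs ++ β) S) (net (t.legs ++ β) T))
    {n : ℕ} (hn : n = β.length) :
    VE n (net β (t :: S)) (net β (t :: T)) :=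
  VE.bend h (by omega) (by rw [List.length_append, ht.length_legs]; omega)

/-- For two neighbours, `netBend` puts the second piece to the right of the legs of the first, so
that `bendBend` can exchange their heights. -/
theorem netPerm {S T : List (Tensor Empty α)} (hp : S.Perm T) :
    ∀ {β : List α}, Good β S → ∀ {n : ℕ}, n = β.length → VE n (net β S) (net β T) := by
  induction hp with
  | nil => intro β h n hn; subst hn; exact refl (ok_net h)
  | cons t _ ih =>
    intro β h n hn
    exact netCons (h.1 t (by simp)) (ih h.cons rfl) hn
  | swap t s T =>
    intro β h n hn
    have hs := (h.1 s (by simp))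
    have ht := (h.1 t (by simp))
    have s0 := netBend h.cons rfl rfl
    refine trans (VE.bend s0.symm (by omega) (by rw [List.length_append, hs.length_legs]; omega)) ?_
    have g : Good (s.legs ++ (t.legs ++ β)) T := h.cons.cons.reorder (List.perm_iff_count.2 fun y => by
        simp only [List.count_append]; ring)
    have o := ok_net g
    simp only [List.length_append, hs.length_legs, ht.length_legs] at o ⊢
    have := bendBend (n := n) (l := 0) (k := 0) (g := s.gen) (h := t.gen) o (by omega) (by omega) (by omega)
    rw [zero_add] at this
    exact this
  | trans h1 h2 ih1 ih2 =>
    intro β h n hn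
    refine trans (ih1 h hn) (ih2 ⟨fun t ht => h.1 t (h1.mem_iff.2 ht), h.2.perm ?_⟩ hn)
    exact (h1.flatMap_right _).append_left _

/-- An arc is a minimum at the far left; a first virtual move exchanges its two ends. -/
theorem netFlip {T : List (Tensor Empty α)} {β : List α} {a b : α}
    (h : Good β (Tensor.arc a b :: T)) {n : ℕ} (hn : n = β.length) :
    VE n (net β (Tensor.arc a b :: T)) (net β (Tensor.arc b a :: T)) := by
  have h1 : Good ([] ++ a :: b :: β) T := h.cons
  have h2 : Good ([] ++ b :: a :: β) T := h1.reorder (List.Perm.swap _ _ _)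
  have s := netSwap h2 rfl rfl
  have o := ok_net h2
  simp only [List.nil_append, List.length_cons, List.length_nil] at s o
  have key : VE n ((0, cup) :: net (a :: b :: β) T) ((0, cup) :: net (b :: a :: β) T) := by
    have o1 := (ok_net h1).cast (n := n + 2) (by simp; omega)
    refine trans (cupSymm 0 o1).symm ?_
    exact .cons (m := n + 2) _ _ (by rw [hn]; exact s)
  exact key

/-- A maximum whose two ends are bent upwards contains a snake and straightens to a minimum. In a
network there is no difference between them. -/
theorem netCapArc {T : List (Tensor Empty α)} {β : List α} {a b : α}
    (h : Good β (⟨cap, [a, b], []⟩ :: T)) {n : ℕ} (hn : n = β.length) :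
    VE n (net β (⟨cap, [a, b], []⟩ :: T)) (net β (Tensor.arc a b :: T)) := by
  have h1 : Good (b :: a :: β) T := h.cons
  have o := (ok_net h1).cast (n := n + 2) (by simp; omega)
  have h2 : Good β (Tensor.arc b a :: T) :=
    h.of_perm (by
      intro t ht
      rcases List.mem_cons.1 ht with rfl | ht
      · exact Tensor.wf_arc _ _
      · exact h.1 t (List.mem_cons_of_mem _ ht)) (by simp [names_cons, Tensor.legs, Tensor.arc])
  refine trans ?_ (netFlip h2 hn)
  show VE n ((0, cup) :: (0 + 1, cup) :: (0, cap) :: net (b :: a :: β) T) ((0, cup) :: net (b :: a :: β) T)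
  exact .cons (m := n + 2) _ _ (snakeR 0 o)

end VE

/-- Substitute the name `y` for `x`. -/
def sub (x y z : α) : α := if z = x then y else z

theorem map_sub_eq {x y : α} {l : List α} (h : x ∉ l) : l.map (sub x y) = l := by
  conv_rhs => rw [← List.map_id l]
  refine List.map_congr_left fun z hz => ?_
  have : z ≠ x := fun e => h (e ▸ hz)
  simp [sub, this]

theorem mem_names_of_mem {ι α : Type} {t : Tensor ι α} {T : List (Tensor ι α)} (ht : t ∈ T) {x : α}
    (hx : x ∈ t.legs) : x ∈ names T := List.mem_flatMap.2 ⟨t, ht, hx⟩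

theorem Tensor.map_sub_eq {x y : α} {t : Tensor Empty α} (h : x ∉ t.legs) : t.map (sub x y) = t := by
  obtain ⟨g, b, c⟩ := t
  simp only [Tensor.legs, List.mem_append, List.mem_reverse, not_or] at h
  simp only [Tensor.map, VirtualClosure.map_sub_eq h.1, VirtualClosure.map_sub_eq h.2]

theorem map_map_sub_eq {x y : α} {T : List (Tensor Empty α)} (h : x ∉ names T) :
    T.map (Tensor.map (sub x y)) = T := by
  conv_rhs => rw [← List.map_id T]
  exact List.map_congr_left fun t ht => Tensor.map_sub_eq fun hx => h (mem_names_of_mem ht hx)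

/-- The second copy of `x` takes the place of the copy of `y` that was at the removed arc. -/
theorem Good.sub {T : List (Tensor Empty α)} {x y : α} (hxy : x ≠ y)
    (h : Good [] (Tensor.arc x y :: T)) : Good [] (T.map (Tensor.map (sub x y))) := by
  refine ⟨?_, ?_⟩
  · intro t ht
    obtain ⟨s, hs, rfl⟩ := List.mem_map.1 ht
    exact (h.1 s (List.mem_cons_of_mem _ hs)).map _
  · have hl : Lin (x :: (y :: names T)) := h.2
    obtain ⟨γ₁, γ₂, e, h1, h2, h3⟩ := hl.split
    rw [List.nil_append, names_map]
    cases γ₁ with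
    | nil => exact absurd (List.cons.inj e).1 hxy.symm
    | cons z γ₁ =>
      rw [List.cons_append, List.cons.injEq] at e
      obtain ⟨rfl, e⟩ := e
      rw [e, List.map_append, List.map_cons, map_sub_eq (fun h => h1 (List.mem_cons_of_mem _ h)),
        map_sub_eq h2]
      have : VirtualClosure.sub x y x = y := if_pos rfl
      rw [this]
      exact h3.perm List.perm_middle.symm

/-- A piece of strand between different strands is left out. -/
theorem VE.netElim {T : List (Tensor Empty α)} {x y : α} (hxy : x ≠ y)
    (h : Good [] (Tensor.arc x y :: T)) :
    VE 0 (net [] (Tensor.arc x y :: T)) (net [] (T.map (Tensor.map (VirtualClosure.sub x y)))) := by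
  have hl : Lin (x :: (y :: names T)) := h.2
  have hx : x ∈ names T := by
    have := hl x
    simp only [List.count_cons_self, List.count_cons_of_ne hxy.symm] at this
    exact List.count_pos_iff.1 (by omega)
  -- As `x ≠ y`, the arc is not a circle and the other copy of `x` is at a piece `t`. With `t` in
  -- front, `x` is a strand from below for the rest of the network, where `netCut` applies.
  obtain ⟨t, ht, hxt⟩ := List.mem_flatMap.1 hx
  obtain ⟨S₁, S₂, rfl⟩ := List.append_of_mem ht
  have hp : (Tensor.arc x y :: (S₁ ++ t :: S₂)).Perm (t :: Tensor.arc x y :: (S₁ ++ S₂)) :=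
    (List.perm_middle.cons _).trans (List.Perm.swap _ _ _)
  have hg : Good [] (t :: Tensor.arc x y :: (S₁ ++ S₂)) :=
    ⟨fun s hs => h.1 s (hp.mem_iff.2 hs), h.2.perm (hp.flatMap_right _)⟩
  obtain ⟨γ₁, γ₂, e⟩ := List.append_of_mem hxt
  have hc := hl x
  simp only [List.count_cons_self, List.count_cons_of_ne hxy.symm, names_append, names_cons,
    List.count_append, e] at hc
  have n1 : x ∉ γ₁ := List.count_eq_zero.1 (by omega)
  have n2 : x ∉ γ₂ := List.count_eq_zero.1 (by omega)
  have n3 : x ∉ names S₁ := List.count_eq_zero.1 (by omega)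
  have n4 : x ∉ names S₂ := List.count_eq_zero.1 (by omega)
  have g1 : Good (γ₁ ++ x :: γ₂) (Tensor.arc x y :: (S₁ ++ S₂)) := by
    have := hg.cons
    rwa [e, List.append_nil] at this
  have el : (t.map (VirtualClosure.sub x y)).legs = γ₁ ++ y :: γ₂ := by
    rw [Tensor.legs_map, e, List.map_append, List.map_cons, map_sub_eq n1, map_sub_eq n2]
    simp [VirtualClosure.sub]
  have s := VE.netCut g1 rfl
  have key : VE 0 (net [] (t :: Tensor.arc x y :: (S₁ ++ S₂)))
      (net [] (t.map (VirtualClosure.sub x y) :: (S₁ ++ S₂))) := by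
    show VE 0 (VirtualClosure.bend 0 t.gen (net (t.legs ++ []) _))
      (VirtualClosure.bend 0 t.gen (net ((t.map (VirtualClosure.sub x y)).legs ++ []) _))
    rw [el, e, List.append_nil, List.append_nil]
    refine VE.bend s.symm (by omega) ?_
    have := (hg.1 t (by simp)).length_legs
    rw [e] at this; omega
  refine trans (VE.netPerm hp h rfl) (trans key ?_)
  rw [List.map_append, List.map_cons, map_map_sub_eq n3, map_map_sub_eq n4]
  refine VE.netPerm List.perm_middle.symm ?_ rfl
  have := h.sub hxy
  rw [List.map_append, List.map_cons, map_map_sub_eq n3, map_map_sub_eq n4] at this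
  exact ⟨fun s hs => this.1 s (List.perm_middle.mem_iff.2 hs), this.2.perm (List.perm_middle.flatMap_right _)⟩

end Net

/-! ### Names for the strands of a diagram -/

/-- `Named β w T γ`: names are given to the strands of `w` between its pieces, `β` at the bottom and
`γ` at the top; `T` is the network of its pieces. -/
inductive Named {ι α : Type} : List α → Word ι → List (Tensor ι α) → List α → Prop
  | nil (β : List α) : Named β [] [] β
  | cons {β₁ bot top β₂ δ : List α} {g : Gen ι} {w : Word ι} {T : List (Tensor ι α)} {l r : ℕ}
      (hl : β₁.length = l) (hr : β₂.length = r)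
      (hb : bot.length = g.dom) (ht : top.length = g.cod) (h : Named (β₁ ++ top ++ β₂) w T δ) :
      Named (β₁ ++ bot ++ β₂) (⟨l, g, r⟩ :: w) (⟨g, bot, top⟩ :: T) δ

theorem exists_append_of_length {α : Type} {l : List α} {a b : ℕ} (h : l.length = a + b) :
    ∃ l₁ l₂, l = l₁ ++ l₂ ∧ l₁.length = a ∧ l₂.length = b :=
  ⟨l.take a, l.drop a, (List.take_append_drop a l).symm, by simp [h], by simp [h]⟩

theorem Lin.double {α : Type} [DecidableEq α] {x : α} {β γ : List α} (h : Lin β) (hx : x ∉ β)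
    (e : γ.Perm (x :: x :: β)) : Lin γ := fun y => by
  rw [e.count_eq]
  by_cases hxy : x = y
  · subst hxy; simp [List.count_eq_zero.2 hx]
  · simpa [List.count_cons_of_ne hxy] using h y

/-- Each piece gives the unused names `k, k + 1, ...` to the strands at its top. A name then occurs
once where its strand begins and once where it ends. The last clause keeps a name whose strand has
ended from being used again. -/
theorem exists_named {ι : Type} : ∀ {w : Word ι} {a k : ℕ} {β : List ℕ}, IsWord a w 0 →
    β.length = a → β.Nodup → (∀ x ∈ β, x < k) →
    ∃ T, Named β w T [] ∧ Lin (β ++ names T) ∧ ∀ x ∈ names T, x ∈ β ∨ k ≤ x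
  | [], a, k, β, hw, hl, _, _ => by
    obtain rfl : a = 0 := hw
    obtain rfl := List.length_eq_zero_iff.1 hl
    exact ⟨[], .nil _, lin_nil, by simp [names]⟩
  | ⟨l, g, r⟩ :: w, a, k, β, hw, hl, hd, hk => by
    obtain ⟨h1, h2⟩ := hw
    simp only [Layer.source] at h1
    obtain ⟨β₀, β₂, rfl, h3, h4⟩ := exists_append_of_length (hl.trans h1)
    obtain ⟨β₁, bot, rfl, h5, h6⟩ := exists_append_of_length h3
    have hd' : (β₁ ++ List.range' k g.cod ++ β₂).Nodup := by
      rw [List.nodup_append, List.nodup_append] at hd ⊢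
      refine ⟨⟨hd.1.1, List.nodup_range', ?_⟩, hd.2.1, ?_⟩
      · intro x hx y hy
        have := hk x (by simp [hx])
        have := (List.mem_range'_1.1 hy).1
        omega
      · intro x hx y hy
        rcases List.mem_append.1 hx with hx | hx
        · exact hd.2.2 x (List.mem_append_left _ hx) y hy
        · have := hk y (by simp [hy])
          have := (List.mem_range'_1.1 hx).1
          omega
    obtain ⟨T, hT, hlin, hm⟩ := exists_named (k := k + g.cod) (β := β₁ ++ List.range' k g.cod ++ β₂) h2
      (by simp [Layer.target, h4, h5]; omega) hd' (by
        intro x hx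
        simp only [List.mem_append, List.mem_range'_1] at hx
        rcases hx with (hx | hx) | hx
        · have := hk x (by simp [hx]); omega
        · omega
        · have := hk x (by simp [hx]); omega)
    refine ⟨⟨g, bot, List.range' k g.cod⟩ :: T, .cons h5 h4 h6 (by simp) hT, ?_, ?_⟩
    · intro y
      have hy := hlin y
      simp only [names_cons, Tensor.legs, List.count_append, List.count_reverse] at hy ⊢
      -- A name at the bottom of the piece is neither new nor present in the rows above, so its two
      -- copies are the one in the row and the one at the piece.
      by_cases hb : y ∈ bot
      · have c0 : bot.count y = 1 := List.count_eq_one_of_mem (List.nodup_append.1 (List.nodup_append.1 hd).1).2.1 hb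
        have c1 : y ∉ β₁ := fun h => (List.nodup_append.1 (List.nodup_append.1 hd).1).2.2 y h y hb rfl
        have c2 : y ∉ β₂ := fun h => (List.nodup_append.1 hd).2.2 y (List.mem_append_right _ hb) y h rfl
        have c3 : y < k := hk y (by simp [hb])
        have c4 : y ∉ List.range' k g.cod := fun h => by have := (List.mem_range'_1.1 h).1; omega
        have c5 : y ∉ names T := fun h => by
          rcases hm y h with h | h
          · simp only [List.mem_append] at h; tauto
          · omega
        simp [c0, List.count_eq_zero.2 c1, List.count_eq_zero.2 c2, List.count_eq_zero.2 c4, List.count_eq_zero.2 c5]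
      · rw [List.count_eq_zero.2 hb]; omega
    · intro x hx
      simp only [names_cons, Tensor.legs, List.mem_append, List.mem_reverse, List.mem_range'_1] at hx
      rcases hx with (hx | hx) | hx
      · right; omega
      · left; simp [hx]
      · rcases hm x hx with h | h
        · simp only [List.mem_append, List.mem_range'_1] at h ⊢
          rcases h with (h | h) | h
          · left; simp [h]
          · right; omega
          · left; simp [h]
        · right; omega

/-- A closed word has a network with good names. -/
theorem exists_named_closed {ι : Type} {w : Word ι} (h : IsWord 0 w 0) :
    ∃ T : List (Tensor ι ℕ), Named [] w T [] ∧ Lin (names T) := by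
  obtain ⟨T, h1, h2, _⟩ := exists_named (k := 0) (β := []) h rfl List.nodup_nil (by simp)
  exact ⟨T, h1, by simpa using h2⟩

/-- Endpoints become pieces of strands, that connect the strand that ends there and the closure
arc, which has the name `b e` at the endpoint `e`. -/
def Tensor.close {ι α γ : Type} (b : ι → γ) (t : Tensor ι α) : Tensor Empty (α ⊕ γ) :=
  match t.gen.forgetMark with
  | some g => ⟨g, t.bot.map Sum.inl, t.top.map Sum.inl⟩
  | none => ⟨cup, [], (t.bot ++ t.top).map Sum.inl ++ t.gen.label.toList.map fun e => Sum.inr (b e)⟩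

/-- The names of closure arcs are equal at `e` and `σ e` only. -/
def ArcNames {n : ℕ} {γ : Type} (σ : Pairing n) (b : Fin (2 * n) → γ) : Prop :=
  ∀ e e', b e = b e' ↔ e' = e ∨ e' = σ.1 e

/-! ### Names for a closure picture -/

section Rows

variable (arc : ℕ × ℕ → Bool)

/-- The `m` points from `(t, p)` to the right; only points on the closure arcs have names. -/
def row (t p m : ℕ) : List (Option (ℕ × ℕ)) :=
  (List.range m).map fun i => if arc (t, p + i) then some (t, p + i) else none

theorem row_zero (t p : ℕ) : row arc t p 0 = [] := rfl

theorem row_succ (t p m : ℕ) :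
    row arc t p (m + 1) = row arc t p m ++ [if arc (t, p + m) then some (t, p + m) else none] := by
  simp [row, List.range_succ]

theorem row_add (t p a b : ℕ) : row arc t p (a + b) = row arc t p a ++ row arc t (p + a) b := by
  simp [row, List.range_add, Nat.add_assoc, Function.comp_def]

/-- The number of points without names. -/
def free {γ : Type} (M : List (Option γ)) : ℕ := M.countP Option.isNone

theorem free_append {γ : Type} (M N : List (Option γ)) : free (M ++ N) = free M + free N :=
  List.countP_append

/-- The points without names are counted in the way in which `eraseLayer` computes the numbers of
remaining strands. -/
theorem free_row (t p m : ℕ) :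
    free (row arc t p m) = Nat.count (fun i => arc (t, p + i) = false) m := by
  induction m with
  | zero => rfl
  | succ m ih =>
    rw [row_succ, free_append, ih, Nat.count_succ]
    cases arc (t, p + m) <;> simp [free]

theorem free_row_congr {t t' p p' m : ℕ} (h : ∀ i < m, arc (t, p + i) = arc (t', p' + i)) :
    free (row arc t p m) = free (row arc t' p' m) := by
  induction m with
  | zero => rfl
  | succ m ih =>
    rw [row_succ, row_succ, free_append, free_append, ih fun i hi => h i (by omega), ← h m (by omega)]
    cases arc (t, p + m) <;> rfl

theorem length_row (t p m : ℕ) : (row arc t p m).length = m := by simp [row]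

/-- The names of the points of a row: `δ` are the names of the points that are not on closure
arcs. -/
def fill {α γ : Type} : List (Option γ) → List α → List (α ⊕ γ)
  | [], _ => []
  | some c :: M, δ => Sum.inr c :: fill M δ
  | none :: M, d :: δ => Sum.inl d :: fill M δ
  | none :: _, [] => []

theorem fill_append {α γ : Type} {N : List (Option γ)} {ε : List α} : ∀ {M : List (Option γ)} {δ : List α},
    free M = δ.length → fill (M ++ N) (δ ++ ε) = fill M δ ++ fill N ε
  | [], [], _ => rfl
  | [], _ :: _, h => by simp [free] at h
  | some c :: M, δ, h => by
    have := fill_append (N := N) (ε := ε) (M := M) (δ := δ) (by simpa [free] using h)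
    simp [fill, this]
  | none :: M, [], h => by simp [free] at h
  | none :: M, d :: δ, h => by
    have := fill_append (N := N) (ε := ε) (M := M) (δ := δ) (by simpa [free] using h)
    simp [fill, this]

theorem length_fill {α γ : Type} : ∀ {M : List (Option γ)} {δ : List α}, free M = δ.length →
    (fill M δ).length = M.length
  | [], _, _ => rfl
  | some c :: M, δ, h => by
    simp [fill, length_fill (M := M) (δ := δ) (by simpa [free] using h)]
  | none :: M, [], h => by simp [free] at h
  | none :: M, d :: δ, h => by
    simp [fill, length_fill (M := M) (δ := δ) (by simpa [free] using h)]

theorem mem_fill_inr {α γ : Type} {c : γ} : ∀ {M : List (Option γ)} {δ : List α},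
    Sum.inr c ∈ fill M δ → some c ∈ M
  | some d :: M, δ, h => by
    rcases List.mem_cons.1 h with h | h
    · cases h; simp
    · exact List.mem_cons_of_mem _ (mem_fill_inr h)
  | none :: M, d :: δ, h => by
    rcases List.mem_cons.1 h with h | h
    · cases h
    · exact List.mem_cons_of_mem _ (mem_fill_inr h)

theorem mem_row {t p m : ℕ} {c : ℕ × ℕ} (h : some c ∈ row arc t p m) :
    c.1 = t ∧ p ≤ c.2 ∧ c.2 < p + m ∧ arc c = true := by
  obtain ⟨i, hi, e⟩ := List.mem_map.1 h
  split_ifs at e with ha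
  cases e
  have := List.mem_range.1 hi
  exact ⟨rfl, by simp, by simpa using this, ha⟩

/-- The pieces of closure arcs that go up straight from the points `(t, p)`, ... to `(t + 1, p')`, ... -/
def straight (t p p' m : ℕ) : List ((ℕ × ℕ) × (ℕ × ℕ)) :=
  ((List.range m).filter fun i => arc (t, p + i)).map fun i => ((t, p + i), (t + 1, p' + i))

theorem mem_straight {t p p' m : ℕ} {z : (ℕ × ℕ) × (ℕ × ℕ)} : z ∈ straight arc t p p' m ↔
    ∃ i < m, arc (t, p + i) = true ∧ z = ((t, p + i), (t + 1, p' + i)) := by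
  simp only [straight, List.mem_map, List.mem_filter, List.mem_range]
  constructor
  · rintro ⟨i, ⟨h1, h2⟩, rfl⟩; exact ⟨i, h1, h2, rfl⟩
  · rintro ⟨i, h1, h2, rfl⟩; exact ⟨i, ⟨h1, h2⟩, rfl⟩

/-- The network of pieces of closure arcs. -/
def edges (α : Type) {γ : Type} (E : List (γ × γ)) : List (Tensor Empty (α ⊕ γ)) :=
  E.map fun z => Tensor.arc (Sum.inr z.1) (Sum.inr z.2)

theorem edges_append (α : Type) {γ : Type} (E F : List (γ × γ)) :
    edges α (E ++ F) = edges α E ++ edges α F := List.map_append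

/-- The converse of `Good.uncut`, for a fresh name `a`. -/
theorem Good.cut {α : Type} [DecidableEq α] {β₁ β₂ : List α} {a b : α} {T : List (Tensor Empty α)}
    (h : Good (β₁ ++ b :: β₂) T) (ha : a ∉ β₁ ++ b :: β₂ ++ names T) :
    Good (β₁ ++ a :: β₂) (Tensor.arc a b :: T) := by
  refine ⟨?_, h.2.double ha (List.perm_iff_count.2 fun y => by
      simp only [names_cons, Tensor.legs, Tensor.arc, List.count_cons, List.count_append,
        List.reverse_nil, List.count_nil]; ring)⟩
  intro t ht
  rcases List.mem_cons.1 ht with rfl | ht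
  · exact Tensor.wf_arc _ _
  · exact h.1 t ht

/-- The closure arcs are cut at all points of a row. -/
theorem VE.netStraight {α : Type} [DecidableEq α] {t p p' : ℕ} : ∀ {m : ℕ}
    {β₁ β₂ : List (α ⊕ ℕ × ℕ)} {δ : List α} {T : List (Tensor Empty (α ⊕ ℕ × ℕ))},
    (∀ i < m, arc (t, p + i) = arc (t + 1, p' + i)) → free (row arc t p m) = δ.length →
    Good (β₁ ++ fill (row arc (t + 1) p' m) δ ++ β₂) T →
    (∀ i < m, Sum.inr (t, p + i) ∉ β₁ ++ fill (row arc (t + 1) p' m) δ ++ β₂ ++ names T) →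
    ∀ {n : ℕ}, n = (β₁ ++ fill (row arc t p m) δ ++ β₂).length →
    Good (β₁ ++ fill (row arc t p m) δ ++ β₂) (edges α (straight arc t p p' m) ++ T) ∧
    VE n (net (β₁ ++ fill (row arc (t + 1) p' m) δ ++ β₂) T)
      (net (β₁ ++ fill (row arc t p m) δ ++ β₂) (edges α (straight arc t p p' m) ++ T))
  | 0, β₁, β₂, δ, T, _, _, hG, _, n, hn => by
    subst hn
    exact ⟨hG, refl (ok_net hG)⟩
  | m + 1, β₁, β₂, δ, T, ha, hf, hG, hfresh, n, hn => by
    have hfm : free (row arc t p m) = free (row arc (t + 1) p' m) :=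
      free_row_congr arc fun i hi => ha i (by omega)
    have ham := ha m (by omega)
    rw [row_succ, row_succ] at *
    rw [free_append] at hf
    obtain ⟨δ₁, δ₂, rfl, h1, h2⟩ := exists_append_of_length hf.symm
    rw [fill_append h1.symm] at hn ⊢
    rw [fill_append (hfm.symm.trans h1.symm)] at hG hfresh ⊢
    -- The last point of the row is either on a strand of the diagram, whose name is the same in
    -- both rows, or on a closure arc, which is cut there.
    cases hc : arc (t, p + m) with
    | false =>
      have hc' : arc (t + 1, p' + m) = false := by rw [← ham, hc]
      simp only [hc, hc', free, List.countP_cons, List.countP_nil] at h2 hn hG hfresh ⊢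
      simp only [Bool.false_eq_true, if_false, Option.isNone, if_true] at h2 hn hG hfresh ⊢
      obtain ⟨d, rfl⟩ := List.length_eq_one_iff.1 h2
      have es : straight arc t p p' (m + 1) = straight arc t p p' m := by
        simp [straight, List.range_succ, List.filter_append, hc]
      rw [es]
      have eq : ∀ M : List (Option (ℕ × ℕ)), β₁ ++ (fill M δ₁ ++ fill [none] [d]) ++ β₂ =
          β₁ ++ fill M δ₁ ++ (Sum.inl d :: β₂) := fun M => by simp [fill]
      rw [eq] at hn hG ⊢
      rw [eq]
      exact VE.netStraight (fun i hi => ha i (by omega)) h1.symm hG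
        (fun i hi => by have := hfresh i (by omega); rwa [eq] at this) hn
    | true =>
      have hc' : arc (t + 1, p' + m) = true := by rw [← ham, hc]
      simp only [hc, hc', free, List.countP_cons, List.countP_nil] at h2 hn hG hfresh ⊢
      simp only [if_true, Option.isNone, Bool.false_eq_true, if_false] at h2 hn hG hfresh ⊢
      obtain rfl := List.length_eq_zero_iff.1 h2
      have es : straight arc t p p' (m + 1) =
          straight arc t p p' m ++ [((t, p + m), (t + 1, p' + m))] := by
        simp [straight, List.range_succ, List.filter_append, hc]
      rw [es, edges_append]
      have eq : ∀ (M : List (Option (ℕ × ℕ))) (c : ℕ × ℕ), β₁ ++ (fill M δ₁ ++ fill [some c] []) ++ β₂ =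
          β₁ ++ fill M δ₁ ++ (Sum.inr c :: β₂) := fun M c => by simp [fill]
      have eq' : ∀ (M : List (Tensor Empty (α ⊕ ℕ × ℕ))) (c d : ℕ × ℕ), M ++ edges α [(c, d)] ++ T =
          M ++ (Tensor.arc (Sum.inr c) (Sum.inr d) :: T) := fun M c d => by simp [edges]
      rw [eq] at hn hG ⊢
      rw [eq, eq']
      simp only [eq] at hfresh
      have hG' := hG.cut (hfresh m (by omega))
      have s1 := VE.netCut hG' rfl
      have hfr : ∀ i < m, Sum.inr (t, p + i) ∉ β₁ ++ fill (row arc (t + 1) p' m) δ₁ ++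
          (Sum.inr (t, p + m) :: β₂) ++ names (Tensor.arc (Sum.inr (t, p + m)) (Sum.inr (t + 1, p' + m)) :: T) := by
        intro i hi
        have := hfresh i (by omega)
        simp only [List.mem_append, List.mem_cons, names_cons, Tensor.legs, Tensor.arc, not_or,
          List.reverse_nil, List.not_mem_nil, Sum.inr.injEq, Prod.mk.injEq] at this ⊢
        refine ⟨⟨this.1.1, by omega, this.1.2.2⟩, ⟨⟨by omega, by omega, not_false⟩, not_false⟩, this.2⟩
      have s2 := VE.netStraight (fun i hi => ha i (by omega)) h1.symm hG' hfr hn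
      refine ⟨s2.1, trans ?_ s2.2⟩
      have e : n = (β₁ ++ fill (row arc (t + 1) p' m) δ₁ ++ Sum.inr (t, p + m) :: β₂).length := by
        rw [hn]
        simp only [List.length_append, List.length_cons, length_fill h1.symm,
          length_fill (hfm.symm.trans h1.symm), length_row]
      rw [e]
      exact s1

end Rows

/-! ### The network of a closure picture -/

/-- Two points are joined by a piece of strand inside the layer `x` with index `t`. -/
inductive LayerLink {ι : Type} (x : Layer ι) (t : ℕ) : ℕ × ℕ → ℕ × ℕ → Prop
  | left {p : ℕ} (hp : p < x.left) : LayerLink x t (t, p) (t + 1, p)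
  | right {p : ℕ} (hp : p < x.right) :
      LayerLink x t (t, x.left + x.gen.dom + p) (t + 1, x.left + x.gen.cod + p)
  | cup (hx : x.gen = Gen.cup) : LayerLink x t (t + 1, x.left) (t + 1, x.left + 1)
  | cap (hx : x.gen = Gen.cap) : LayerLink x t (t, x.left) (t, x.left + 1)
  | rising (hx : x.gen.IsCrossing) : LayerLink x t (t, x.left) (t + 1, x.left + 1)
  | falling (hx : x.gen.IsCrossing) : LayerLink x t (t, x.left + 1) (t + 1, x.left)

theorem Link.layerLink {ι : Type} {w : Word ι} {y z : ℕ × ℕ} (h : Link w y z) :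
    ∃ t x, w[t]? = some x ∧ LayerLink x t y z := by
  cases h with
  | left h hp => exact ⟨_, _, h, .left hp⟩
  | right h hp => exact ⟨_, _, h, .right hp⟩
  | cup h hx => exact ⟨_, _, h, .cup hx⟩
  | cap h hx => exact ⟨_, _, h, .cap hx⟩
  | rising h hx => exact ⟨_, _, h, .rising hx⟩
  | falling h hx => exact ⟨_, _, h, .falling hx⟩

/-- Erase marked strands in a word whose first layer has index `t`. -/
def eraseFrom {ι : Type} (arc : ℕ × ℕ → Bool) (t : ℕ) (w : Word ι) : Word ι :=
  (w.zipIdx t).filterMap fun xt => eraseLayer arc xt.1 xt.2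

theorem eraseFrom_cons {ι : Type} (arc : ℕ × ℕ → Bool) (t : ℕ) (x : Layer ι) (w : Word ι) :
    eraseFrom arc t (x :: w) = (eraseLayer arc x t).toList ++ eraseFrom arc (t + 1) w := by
  simp only [eraseFrom, List.zipIdx_cons, List.filterMap_cons]
  cases eraseLayer arc x t <;> rfl

/-- The ops of a word whose marked points are forgotten. -/
def forgetOps {ι : Type} (w : Word ι) : List (Op Empty) := strip (forgetMarks w)

theorem forgetOps_cons {ι : Type} (x : Layer ι) (w : Word ι) :
    forgetOps (x :: w) = (x.gen.forgetMark.map fun g => (x.left, g)).toList ++ forgetOps w := by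
  simp only [forgetOps, forgetMarks, List.filterMap_cons, strip]
  cases x.gen.forgetMark <;> rfl

section Sweep

variable {ι : Type} (P : Word ι) (arc : ℕ × ℕ → Bool) (b : ι → ℕ × ℕ)

/-- The part `u` of the picture `P` above the layer with index `t` is equivalent to the network `T`
of its remaining strands together with pieces `E` of closure arcs. -/
structure Swept (t : ℕ) (β : List (ℕ ⊕ ℕ × ℕ)) (T : List (Tensor ι ℕ)) (u : List (Op Empty))
    (E : List ((ℕ × ℕ) × (ℕ × ℕ))) : Prop where
  good : Good β (T.map (Tensor.close b) ++ edges ℕ E)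
  ve : VE β.length u (net β (T.map (Tensor.close b) ++ edges ℕ E))
  above : ∀ z, Sum.inr z ∈ β ++ names (T.map (Tensor.close b) ++ edges ℕ E) → t ≤ z.1
  points : ∀ y ∈ E, arc y.1 = true ∧ IsPoint P y.1 ∧ IsPoint P y.2
  links : ∀ s x y z, t ≤ s → P[s]? = some x → LayerLink x s y z → arc y = true → (y, z) ∈ E

theorem isPoint_of_drop {t m : ℕ} {w : Word ι} (hw : P.drop t = w) (h : IsWord m w 0) {p : ℕ}
    (hp : p < m) : IsPoint P (t, p) := by
  cases w with
  | nil => exact absurd hp (by rw [show m = 0 from h]; omega)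
  | cons x w =>
    refine ⟨x, ?_, by rw [← h.1]; exact hp⟩
    have : (P.drop t)[0]? = some x := by rw [hw]; rfl
    simpa using this

/-- What all kinds of layers have in common. The names `X` are those directly below the piece, and
`T₁`, `E₁` are its contributions to the diagram and to the closure arcs. Beside the piece, only the
closure arcs have to be cut, first on the right and then on the left. -/
theorem Swept.step {t : ℕ} {x : Layer ι} {w : Word ι} {β' : List (ℕ ⊕ ℕ × ℕ)}
    {T' : List (Tensor ι ℕ)} {u u' : List (Op Empty)} {E' : List ((ℕ × ℕ) × (ℕ × ℕ))}
    (hP : P.drop t = x :: w) (hw : IsWord x.target w 0)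
    (hc : ∀ y z, Link P y z → arc y = arc z) (h' : Swept P arc b (t + 1) β' T' u' E')
    {δ₁ δ₃ : List ℕ} (h1 : free (row arc t 0 x.left) = δ₁.length)
    (h3 : free (row arc t (x.left + x.gen.dom) x.right) = δ₃.length)
    (X : List (ℕ ⊕ ℕ × ℕ)) (T₁ : List (Tensor ι ℕ)) (E₁ : List ((ℕ × ℕ) × (ℕ × ℕ)))
    (hX : X.length = x.gen.dom)
    (hG : Good (fill (row arc (t + 1) 0 x.left) δ₁ ++ X ++
        fill (row arc (t + 1) (x.left + x.gen.cod) x.right) δ₃)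
      ((T₁.map (Tensor.close b) ++ edges ℕ E₁) ++ (T'.map (Tensor.close b) ++ edges ℕ E')))
    (hV : VE x.source u (net (fill (row arc (t + 1) 0 x.left) δ₁ ++ X ++
        fill (row arc (t + 1) (x.left + x.gen.cod) x.right) δ₃)
      ((T₁.map (Tensor.close b) ++ edges ℕ E₁) ++ (T'.map (Tensor.close b) ++ edges ℕ E'))))
    (habove : ∀ z, Sum.inr z ∈ X ++ names (T₁.map (Tensor.close b) ++ edges ℕ E₁) →
      t + 1 ≤ z.1 ∨ (z.1 = t ∧ x.left ≤ z.2 ∧ z.2 < x.left + x.gen.dom))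
    (hpts : ∀ y ∈ E₁, arc y.1 = true ∧ IsPoint P y.1 ∧ IsPoint P y.2)
    (hlinks : ∀ y z, LayerLink x t y z → arc y = true →
      (∃ p < x.left, y = (t, p) ∧ z = (t + 1, p)) ∨
      (∃ p < x.right, y = (t, x.left + x.gen.dom + p) ∧ z = (t + 1, x.left + x.gen.cod + p)) ∨
      (y, z) ∈ E₁) :
    ∃ E, Swept P arc b t (fill (row arc t 0 x.left) δ₁ ++ X ++
      fill (row arc t (x.left + x.gen.dom) x.right) δ₃) (T₁ ++ T') u E := by
  have hx : P[t]? = some x := by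
    have : (P.drop t)[0]? = some x := by rw [hP]; rfl
    simpa using this
  have hP' : P.drop (t + 1) = w := by
    have : (P.drop t).drop 1 = w := by rw [hP]; rfl
    simpa [List.drop_drop, Nat.add_comm] using this
  have ptop : ∀ {p}, p < x.target → IsPoint P (t + 1, p) := fun hp => isPoint_of_drop P hP' hw hp
  have pbot : ∀ {p}, p < x.source → IsPoint P (t, p) := fun hp => ⟨x, hx, hp⟩
  have aL : ∀ i < x.left, arc (t, 0 + i) = arc (t + 1, 0 + i) := fun i hi => by
    rw [Nat.zero_add]; exact hc _ _ (.left hx hi)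
  have aR : ∀ i < x.right, arc (t, x.left + x.gen.dom + i) = arc (t + 1, x.left + x.gen.cod + i) :=
    fun i hi => hc _ _ (.right hx hi)
  have fL := free_row_congr arc aL
  have fR := free_row_congr arc aR
  set S := (T₁.map (Tensor.close b) ++ edges ℕ E₁) ++ (T'.map (Tensor.close b) ++ edges ℕ E') with hS
  set FL' := fill (row arc (t + 1) 0 x.left) δ₁ with hFL'
  set FR' := fill (row arc (t + 1) (x.left + x.gen.cod) x.right) δ₃ with hFR'
  set FL := fill (row arc t 0 x.left) δ₁ with hFL
  set FR := fill (row arc t (x.left + x.gen.dom) x.right) δ₃ with hFR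
  have lFL : FL.length = x.left := by rw [hFL, length_fill h1, length_row]
  have lFR : FR.length = x.right := by rw [hFR, length_fill h3, length_row]
  have lFL' : FL'.length = x.left := by rw [hFL', length_fill (fL.symm.trans h1), length_row]
  have lFR' : FR'.length = x.right := by rw [hFR', length_fill (fR.symm.trans h3), length_row]
  -- Names of arc points record their height and position. Those present so far are higher than the
  -- current row or belong to the piece, so the names for the cuts beside it are new.
  have fresh : ∀ z, Sum.inr z ∈ FL' ++ X ++ FR' ++ names S →
      t + 1 ≤ z.1 ∨ (z.1 = t ∧ x.left ≤ z.2 ∧ z.2 < x.left + x.gen.dom) := by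
    intro z hz
    simp only [hS, names_append, List.mem_append] at hz
    rcases hz with ((hz | hz) | hz) | ((hz | hz) | hz)
    · left; have := mem_row arc (mem_fill_inr hz); omega
    · exact habove z (by simp [hz])
    · left; have := mem_row arc (mem_fill_inr hz); omega
    · exact habove z (by simp [hz, names_append])
    · exact habove z (by simp [hz, names_append])
    · left; exact h'.above z (by simp only [names_append, List.mem_append]; tauto)
  have hsrc : x.source = x.left + x.gen.dom + x.right := rfl
  have sR := VE.netStraight arc (t := t) (p := x.left + x.gen.dom) (p' := x.left + x.gen.cod)
    (m := x.right) (β₁ := FL' ++ X) (β₂ := []) (δ := δ₃) (T := S) aR h3 (by rw [List.append_nil]; exact hG)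
    (by
      intro i hi hm
      rw [List.append_nil] at hm
      have := fresh _ hm
      simp only at this; omega) rfl
  simp only [List.append_nil] at sR
  have sL := VE.netStraight arc (t := t) (p := 0) (p' := 0)
    (m := x.left) (β₁ := []) (β₂ := X ++ FR) (δ := δ₁)
    (T := edges ℕ (straight arc t (x.left + x.gen.dom) (x.left + x.gen.cod) x.right) ++ S) aL h1
    (by simpa only [List.nil_append, List.append_assoc] using sR.1)
    (by
      intro i hi hm
      simp only [List.nil_append, names_append, List.mem_append] at hm
      rcases hm with (hm | hm | hm) | hm | hm
      · have := mem_row arc (mem_fill_inr hm); simp at this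
      · have := fresh (t, 0 + i) (by simp only [List.mem_append]; tauto)
        simp only at this; omega
      · have := mem_row arc (mem_fill_inr hm); simp only at this; omega
      · simp only [names, edges, List.mem_flatMap, List.mem_map] at hm
        obtain ⟨_, ⟨z, hz, rfl⟩, hm⟩ := hm
        obtain ⟨j, hj, _, rfl⟩ := (mem_straight arc).1 hz
        simp [Tensor.legs, Tensor.arc] at hm
        omega
      · have := fresh (t, 0 + i) (by simp only [List.mem_append]; tauto)
        simp only at this; omega) rfl
  simp only [List.nil_append] at sL
  set E := straight arc t 0 0 x.left ++
    (straight arc t (x.left + x.gen.dom) (x.left + x.gen.cod) x.right ++ (E₁ ++ E')) with hE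
  have hp : (edges ℕ (straight arc t 0 0 x.left) ++
      (edges ℕ (straight arc t (x.left + x.gen.dom) (x.left + x.gen.cod) x.right) ++ S)).Perm
      ((T₁ ++ T').map (Tensor.close b) ++ edges ℕ E) := by
    rw [hE, hS, edges_append, edges_append, edges_append, List.map_append]
    generalize edges ℕ (straight arc t 0 0 x.left) = a1
    generalize edges ℕ (straight arc t (x.left + x.gen.dom) (x.left + x.gen.cod) x.right) = a2
    generalize T₁.map (Tensor.close b) = a3
    generalize T'.map (Tensor.close b) = a4
    generalize edges ℕ E₁ = a5
    generalize edges ℕ E' = a6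
    classical
    refine List.perm_iff_count.2 fun y => ?_
    simp only [List.count_append]; ring
  have g1 : Good (FL ++ (X ++ FR)) _ := sL.1
  have sL2 : VE (FL ++ (X ++ FR)).length (net (FL' ++ X ++ FR)
      (edges ℕ (straight arc t (x.left + x.gen.dom) (x.left + x.gen.cod) x.right) ++ S))
      (net (FL ++ (X ++ FR)) (edges ℕ (straight arc t 0 0 x.left) ++
        (edges ℕ (straight arc t (x.left + x.gen.dom) (x.left + x.gen.cod) x.right) ++ S))) := by
    rw [List.append_assoc FL']; exact sL.2
  have ea : FL ++ X ++ FR = FL ++ (X ++ FR) := List.append_assoc ..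
  have g2 : Good (FL ++ X ++ FR) ((T₁ ++ T').map (Tensor.close b) ++ edges ℕ E) :=
    ⟨fun t ht => g1.1 t (hp.mem_iff.2 ht), by
      rw [ea]; exact g1.2.perm ((hp.flatMap_right _).append_left _)⟩
  refine ⟨E, g2, ?_, ?_, ?_, ?_⟩
  · have e : (FL ++ X ++ FR).length = x.source := by
      simp only [List.length_append, lFL, lFR, hX, hsrc]
    rw [e]
    refine VE.trans hV (VE.trans (sR.2.of_len ?_) (VE.trans (sL2.of_len ?_) ?_))
    · simp only [List.length_append, lFL', hX, hsrc, length_fill h3, length_row]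
    · simp only [List.length_append, lFL, lFR, hX, hsrc]; omega
    · have := VE.netPerm hp g1 rfl
      rw [ea]
      refine this.of_len ?_
      simp only [List.length_append, lFL, lFR, hX, hsrc]; omega
  · intro z hz
    have hz' : Sum.inr z ∈ FL ++ X ++ FR ++ names (edges ℕ (straight arc t 0 0 x.left) ++
      (edges ℕ (straight arc t (x.left + x.gen.dom) (x.left + x.gen.cod) x.right) ++ S)) :=
      ((hp.flatMap_right _).append_left _).mem_iff.2 hz
    have hst : ∀ p p' m, Sum.inr z ∈ names (edges ℕ (straight arc t p p' m)) → t ≤ z.1 := by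
      intro p p' m hm
      simp only [names, edges, List.mem_flatMap, List.mem_map] at hm
      obtain ⟨_, ⟨y, hy, rfl⟩, hm⟩ := hm
      obtain ⟨j, hj, _, rfl⟩ := (mem_straight arc).1 hy
      simp only [Tensor.legs, Tensor.arc, List.reverse_nil, List.append_nil, List.mem_cons,
          Sum.inr.injEq, List.not_mem_nil, or_false] at hm
      rcases hm with rfl | rfl <;> simp
    simp only [names_append, List.mem_append] at hz'
    rcases hz' with ((hm | hm) | hm) | hm | hm | hm
    · exact (mem_row arc (mem_fill_inr hm)).1.ge
    · have := fresh z (by simp only [List.mem_append]; tauto); omega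
    · exact (mem_row arc (mem_fill_inr hm)).1.ge
    · exact hst _ _ _ hm
    · exact hst _ _ _ hm
    · have := fresh z (by simp only [List.mem_append]; tauto); omega
  · intro y hy
    simp only [hE, List.mem_append] at hy
    have htgt : x.target = x.left + x.gen.cod + x.right := rfl
    rcases hy with hy | hy | hy | hy
    · obtain ⟨j, hj, ha, rfl⟩ := (mem_straight arc).1 hy
      exact ⟨ha, pbot (by omega), ptop (by omega)⟩
    · obtain ⟨j, hj, ha, rfl⟩ := (mem_straight arc).1 hy
      exact ⟨ha, pbot (by omega), ptop (by omega)⟩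
    · exact hpts y hy
    · exact h'.points y hy
  · intro s x' y z hs hx' hl ha
    simp only [hE, List.mem_append]
    rcases Nat.eq_or_lt_of_le hs with rfl | hs
    · obtain rfl : x = x' := by rw [hx] at hx'; exact Option.some.inj hx'
      rcases hlinks y z hl ha with ⟨p, hp, rfl, rfl⟩ | ⟨p, hp, rfl, rfl⟩ | h
      · left
        exact (mem_straight arc).2 ⟨p, hp, by simpa using ha, by simp⟩
      · right; left
        exact (mem_straight arc).2 ⟨p, hp, ha, rfl⟩
      · tauto
    · right; right; right
      exact h'.links s x' y z hs hx' hl ha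

end Sweep

/-- Equality of names is decided. -/
instance sumBEq {α γ : Type} [DecidableEq α] [DecidableEq γ] : BEq (α ⊕ γ) :=
  instBEqOfDecidableEq

theorem count_inl_fill {γ : Type} [DecidableEq γ] (n : ℕ) : ∀ {M : List (Option γ)} {δ : List ℕ},
    free M = δ.length → List.count (Sum.inl n) (fill M δ) = δ.count n
  | [], [], _ => rfl
  | [], _ :: _, h => by simp [free] at h
  | some c :: M, δ, h => by
    rw [fill, List.count_cons_of_ne (by simp), count_inl_fill n (by simpa [free] using h)]
  | none :: M, [], h => by simp [free] at h
  | none :: M, d :: δ, h => by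
    rw [fill, List.count_cons, List.count_cons, count_inl_fill n (by simpa [free] using h)]
    simp

theorem count_inl_map {γ : Type} [DecidableEq γ] (n : ℕ) (l : List ℕ) :
    List.count (Sum.inl n) (l.map (Sum.inl : ℕ → ℕ ⊕ γ)) = l.count n :=
  List.count_map_of_injective _ _ Sum.inl_injective _

theorem count_inr_map {γ : Type} [DecidableEq γ] (c : γ) (l : List ℕ) :
    List.count (Sum.inr c) (l.map (Sum.inl : ℕ → ℕ ⊕ γ)) = 0 :=
  List.count_eq_zero.2 (by simp)

theorem count_inl_inr {γ : Type} [DecidableEq γ] (n : ℕ) (l : List γ) :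
    List.count (Sum.inl n) (l.map (Sum.inr : γ → ℕ ⊕ γ)) = 0 :=
  List.count_eq_zero.2 (by simp)

/-- Closing adds names of closure arcs only and keeps the names of the strands of the diagram. -/
theorem count_inl_close {ι γ : Type} [DecidableEq γ] (b : ι → γ) (n : ℕ) (T : List (Tensor ι ℕ)) :
    List.count (Sum.inl n) (names (T.map (Tensor.close b))) = (names T).count n := by
  induction T with
  | nil => rfl
  | cons t T ih =>
    have : List.count (Sum.inl n) (t.close b).legs = t.legs.count n := by
      rw [Tensor.close, Tensor.legs, Tensor.legs]
      split
      · simp only [List.count_append, List.count_reverse, count_inl_map]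
      · have e : List.map (fun e => Sum.inr (b e)) t.gen.label.toList =
            (List.map b t.gen.label.toList).map (Sum.inr : γ → ℕ ⊕ γ) := by simp
        simp only [List.count_append, List.count_reverse, count_inl_map, e, count_inl_inr,
          List.count_nil]
        omega
    rw [List.map_cons, names_cons, names_cons, List.count_append, List.count_append, this, ih]

theorem count_inl_edges {γ : Type} [DecidableEq γ] (n : ℕ) (E : List (γ × γ)) :
    List.count (Sum.inl n) (names (edges ℕ E)) = 0 := by
  refine List.count_eq_zero.2 fun h => ?_
  simp only [names, edges, List.mem_flatMap, List.mem_map] at h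
  obtain ⟨_, ⟨z, _, rfl⟩, h⟩ := h
  simp [Tensor.legs, Tensor.arc] at h

theorem Named.wf {ι α : Type} {β δ : List α} {w : Word ι} {T : List (Tensor ι α)}
    (h : Named β w T δ) : ∀ t ∈ T, t.WF := by
  induction h with
  | nil => simp
  | cons hl hr hb ht h ih =>
    intro t ht'
    rcases List.mem_cons.1 ht' with rfl | h'
    · exact ⟨hb, ht⟩
    · exact ih t h'

theorem row_of_false {arc : ℕ × ℕ → Bool} {t p m : ℕ} (h : ∀ i < m, arc (t, p + i) = false) :
    row arc t p m = List.replicate m none := by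
  rw [List.eq_replicate_iff]
  refine ⟨length_row .., fun y hy => ?_⟩
  obtain ⟨i, hi, rfl⟩ := List.mem_map.1 hy
  simp [h i (List.mem_range.1 hi)]

theorem fill_replicate {α γ : Type} (δ : List α) :
    fill (List.replicate δ.length (none : Option γ)) δ = δ.map Sum.inl := by
  induction δ with
  | nil => rfl
  | cons d δ ih => rw [List.length_cons, List.replicate_succ, fill, ih, List.map_cons]

theorem fill_row_of_false {α : Type} {arc : ℕ × ℕ → Bool} {t p m : ℕ} (h : ∀ i < m, arc (t, p + i) = false)
    {δ : List α} (hδ : δ.length = m) : fill (row arc t p m) δ = δ.map Sum.inl := by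
  subst hδ; rw [row_of_false h, fill_replicate]

theorem free_row_of_false {arc : ℕ × ℕ → Bool} {t p m : ℕ} (h : ∀ i < m, arc (t, p + i) = false) :
    free (row arc t p m) = m := by
  rw [row_of_false h]; simp [free, List.countP_replicate]

/-! ### Induction over the layers of a closure picture -/

section Sweep

variable {ι : Type} {P : Word ι} {arc : ℕ × ℕ → Bool} {b : ι → ℕ × ℕ}

theorem fill_row_three {t : ℕ} {l d r : ℕ} {δ₁ δ₂ δ₃ : List ℕ} (h1 : free (row arc t 0 l) = δ₁.length)
    (h2 : free (row arc t l d) = δ₂.length) :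
    fill (row arc t 0 (l + d + r)) (δ₁ ++ δ₂ ++ δ₃) =
      fill (row arc t 0 l) δ₁ ++ fill (row arc t l d) δ₂ ++ fill (row arc t (l + d) r) δ₃ := by
  rw [row_add, row_add, Nat.zero_add, Nat.zero_add, fill_append (by
    rw [free_append, h1, h2, List.length_append]), fill_append h1]

/-- The layer is not met by the closure arcs. -/
theorem Swept.piece {t : ℕ} {x : Layer ι} {w : Word ι} {δ₁ δ₃ bot top : List ℕ}
    {T' : List (Tensor ι ℕ)} {u' : List (Op Empty)} {E' : List ((ℕ × ℕ) × (ℕ × ℕ))} {g : Gen Empty}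
    (hP : P.drop t = x :: w) (hw : IsWord x.target w 0)
    (hc : ∀ y z, Link P y z → arc y = arc z) (h1 : free (row arc t 0 x.left) = δ₁.length)
    (h3 : free (row arc t (x.left + x.gen.dom) x.right) = δ₃.length)
    (hb : bot.length = x.gen.dom) (ht : top.length = x.gen.cod)
    (hbf : ∀ i < x.gen.dom, arc (t, x.left + i) = false)
    (htf : ∀ i < x.gen.cod, arc (t + 1, x.left + i) = false)
    (hg : x.gen.forgetMark = some g) (hgd : g.dom = x.gen.dom) (hgc : g.cod = x.gen.cod)
    (h' : Swept P arc b (t + 1) (fill (row arc (t + 1) 0 x.left) δ₁ ++ top.map Sum.inl ++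
      fill (row arc (t + 1) (x.left + x.gen.cod) x.right) δ₃) T' u' E')
    (h1' : free (row arc (t + 1) 0 x.left) = δ₁.length)
    (h3' : free (row arc (t + 1) (x.left + x.gen.cod) x.right) = δ₃.length)
    (hlin : Lin (δ₁ ++ bot ++ δ₃ ++ names (⟨x.gen, bot, top⟩ :: T'))) :
    ∃ E, Swept P arc b t (fill (row arc t 0 x.left) δ₁ ++ bot.map Sum.inl ++
      fill (row arc t (x.left + x.gen.dom) x.right) δ₃) (⟨x.gen, bot, top⟩ :: T') ((x.left, g) :: u') E := by
  have hcl : Tensor.close b (⟨x.gen, bot, top⟩ : Tensor ι ℕ) = ⟨g, bot.map Sum.inl, top.map Sum.inl⟩ := by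
    simp only [Tensor.close, hg]
  have hG : Good (fill (row arc (t + 1) 0 x.left) δ₁ ++ bot.map Sum.inl ++
        fill (row arc (t + 1) (x.left + x.gen.cod) x.right) δ₃)
      (([(⟨x.gen, bot, top⟩ : Tensor ι ℕ)].map (Tensor.close b) ++ edges ℕ []) ++
        (T'.map (Tensor.close b) ++ edges ℕ E')) := by
    refine ⟨?_, ?_⟩
    · intro s hs
      rcases List.mem_append.1 hs with hs | hs
      · simp only [List.map_cons, List.map_nil, hcl, edges, List.append_nil, List.mem_singleton] at hs
        subst hs
        exact ⟨by simp [hb, hgd], by simp [ht, hgc]⟩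
      · exact h'.good.1 s hs
    · rintro (n | z)
      · have := hlin n
        simp only [List.map_cons, List.map_nil, hcl, names_append, names_cons, List.count_append,
          count_inl_fill _ h1', count_inl_fill _ h3', count_inl_map, Tensor.legs, List.count_reverse,
          count_inl_close, count_inl_edges] at this ⊢
        have e' : names ([] : List (Tensor Empty (ℕ ⊕ ℕ × ℕ))) = [] := rfl
        simp only [e', List.count_nil] at this ⊢
        omega
      · have := h'.good.2 (Sum.inr z)
        have e : names (edges ℕ ([] : List ((ℕ × ℕ) × (ℕ × ℕ)))) = [] := rfl
        have e' : names ([] : List (Tensor Empty (ℕ ⊕ ℕ × ℕ))) = [] := rfl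
        simpa only [List.map_cons, List.map_nil, hcl, names_append, names_cons, List.count_append,
          count_inr_map, Tensor.legs, List.count_reverse, e, e', List.count_nil, Nat.add_zero, Nat.zero_add] using this
  refine Swept.step P arc b (x := x) (δ₁ := δ₁) (δ₃ := δ₃) hP hw hc h' h1 h3 (bot.map Sum.inl) [⟨x.gen, bot, top⟩] [] (by simp [hb])
    hG ?_ ?_ (by simp) ?_
  · have hG' := hG
    simp only [List.map_cons, List.map_nil, hcl, edges, List.append_nil, List.singleton_append] at hG' ⊢
    refine VE.trans (.cons' (m := x.target) _ ?_ ?_ (h'.ve.of_len ?_)) (VE.netPiece hG' ?_ ?_)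
    · simp only [hgd, Layer.source]; omega
    · simp only [hgd, hgc, Layer.source, Layer.target]; omega
    · simp [length_fill h1', length_fill h3', length_row, ht, Layer.target, Nat.add_assoc]
    · simp [length_fill h1', length_fill h3', length_row, hb, Layer.source, Nat.add_assoc]
    · simp [length_fill h1', length_row]
  · intro z hz
    simp [hcl, edges, names, Tensor.legs] at hz
  · intro y z hl ha
    cases hl with
    | left hp => exact .inl ⟨_, hp, rfl, rfl⟩
    | right hp => exact .inr (.inl ⟨_, hp, rfl, rfl⟩)
    | cup hx => have := htf 0 (by rw [hx]; simp [cod]); simp_all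
    | cap hx => have := hbf 0 (by rw [hx]; simp [dom]); simp_all
    | rising hx => have := hbf 0 (by rcases hx with (hx | hx) | hx <;> rw [hx] <;> simp [dom]); simp_all
    | falling hx => have := hbf 1 (by rcases hx with (hx | hx) | hx <;> rw [hx] <;> simp [dom]); simp_all

end Sweep

theorem Named.cons_inv {ι α : Type} {β δ : List α} {w : Word ι} {T : List (Tensor ι α)} {l r : ℕ}
    {g : Gen ι} (h : Named β (⟨l, g, r⟩ :: w) T δ) {β₁ bot β₂ : List α} (e : β = β₁ ++ bot ++ β₂)
    (h1 : β₁.length = l) (h2 : β₂.length = r) :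
    ∃ top T', T = ⟨g, bot, top⟩ :: T' ∧ bot.length = g.dom ∧ top.length = g.cod ∧
      Named (β₁ ++ top ++ β₂) w T' δ := by
  cases h with
  | @cons γ₁ bot' top γ₂ _ _ _ T' _ _ hl hr hb ht h =>
    obtain ⟨e1, rfl⟩ := List.append_inj' e (by omega)
    obtain ⟨rfl, rfl⟩ := List.append_inj e1 (by omega)
    exact ⟨top, T', rfl, hb, ht, h⟩

/-- The strands of a virtual crossing are exchanged, when they come from below. -/
theorem Good.exchange {α : Type} [DecidableEq α] {F G : List α} {c d : α} {S : List (Tensor Empty α)}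
    (h : Good (F ++ [c, d] ++ G) S) {n l : ℕ} (hl : F.length = l) (hn : n = l + 2 + G.length)
    {u : List (Op Empty)} (hu : VE n u (net (F ++ [c, d] ++ G) S)) :
    Good (F ++ [d, c] ++ G) S ∧ VE n ((l, virt) :: u) (net (F ++ [d, c] ++ G) S) := by
  have hG : Good (F ++ [d, c] ++ G) S := h.reorder (by
    simpa using perm_swap_mid F G c d)
  refine ⟨hG, VE.trans (.virtOn l hu) ?_⟩
  simp only [List.append_assoc, List.cons_append, List.nil_append] at hG ⊢
  exact VE.netSwap hG (by simp; omega) hl.symm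

theorem cut_of_good {α : Type} [DecidableEq α] {β₁ β₂ : List α} {x y : α} {S : List (Tensor Empty α)}
    (h : Good (β₁ ++ y :: β₂) S) (hx : x ∉ β₁ ++ y :: β₂ ++ names S) {n : ℕ}
    {u : List (Op Empty)} (hn : n = (β₁ ++ x :: β₂).length) (hu : VE n u (net (β₁ ++ y :: β₂) S)) :
    Good (β₁ ++ x :: β₂) (Tensor.arc x y :: S) ∧
      VE n u (net (β₁ ++ x :: β₂) (Tensor.arc x y :: S)) :=
  ⟨h.cut hx, VE.trans hu (VE.netCut (h.cut hx) hn)⟩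

section Sweep

variable {ι : Type} {P : Word ι} {arc : ℕ × ℕ → Bool} {b : ι → ℕ × ℕ}

/-- By recursion on the layers that remain above, so that the picture is swept from its top. A piece
away from the closure arcs is kept; a minimum or maximum of an arc leaves an edge; a virtual
crossing with an arc is removed by `netSwap` and leaves edges; a marked point becomes the closed-up
endpoint. By `hv` no classical crossing meets an arc. According to `hb`, the name of the arc at `e`
is the neighbour of the marked point that lies on the arc. -/
theorem exists_swept (hne : ∀ x ∈ P, ∀ e, x.gen ≠ Gen.birth e ∧ x.gen ≠ Gen.death e)
    (hc : ∀ y z, Link P y z → arc y = arc z)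
    (hch : ∀ (t : ℕ) (x : Layer ι) (e : ι), P[t]? = some x → x.gen = Gen.mark e →
      arc (t, x.left) ≠ arc (t + 1, x.left))
    (hv : ∀ (t : ℕ) (x : Layer ι), P[t]? = some x → x.gen.IsClassicalCrossing →
      arc (t, x.left) = false ∧ arc (t, x.left + 1) = false)
    (hb : ∀ (t : ℕ) (x : Layer ι) (e : ι), P[t]? = some x → x.gen = Gen.mark e →
      b e = if arc (t, x.left) then (t, x.left) else (t + 1, x.left)) :
    ∀ {w : Word ι} {t m : ℕ} {T : List (Tensor ι ℕ)} {δ : List ℕ}, P.drop t = w → IsWord m w 0 →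
      Named δ (eraseFrom arc t w) T [] → Lin (δ ++ names T) → free (row arc t 0 m) = δ.length →
      ∃ E, Swept P arc b t (fill (row arc t 0 m) δ) T (forgetOps w) E
  | [], t, m, T, δ, hP, hw, hN, hL, hf => by
    obtain rfl : m = 0 := hw
    cases hN
    refine ⟨[], ⟨⟨by simp [edges], by simpa [edges, names, row_zero, fill] using lin_nil⟩,
      .of_eq (show Ok 0 [] from rfl) (by
        simp [edges, row_zero, fill, net, contract_nil, forgetOps, forgetMarks, strip]), by simp [edges, names, row_zero, fill], by simp, ?_⟩⟩
    intro s x y z hs hx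
    have := List.drop_eq_nil_iff.1 hP
    rw [List.getElem?_eq_none (by omega)] at hx
    cases hx
  | ⟨l, g, r⟩ :: w, t, m, T, δ, hP, hw, hN, hL, hf => by
    obtain ⟨hm, hw⟩ := hw
    have ih := @exists_swept hne hc hch hv hb w (t + 1)
    have hx : P[t]? = some ⟨l, g, r⟩ := by
      have : (P.drop t)[0]? = some ⟨l, g, r⟩ := by rw [hP]; rfl
      simpa using this
    have hP' : P.drop (t + 1) = w := by
      have : (P.drop t).drop 1 = w := by rw [hP]; rfl
      simpa [List.drop_drop, Nat.add_comm] using this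
    simp only [Layer.source] at hm
    subst hm
    rw [row_add, row_add, free_append, free_append, Nat.zero_add, Nat.zero_add] at hf
    obtain ⟨δ₀, δ₃, rfl, h0, h3⟩ := exists_append_of_length hf.symm
    obtain ⟨δ₁, δ₂, rfl, h1, h2⟩ := exists_append_of_length h0
    rw [fill_row_three h1.symm h2.symm]
    have f1 : free (row arc (t + 1) 0 l) = δ₁.length := by
      rw [h1]; exact (free_row_congr arc fun i hi => by
        rw [Nat.zero_add]; exact hc _ _ (.left hx hi)).symm
    have f3 : free (row arc (t + 1) (l + g.cod) r) = δ₃.length := by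
      rw [h3]; exact (free_row_congr arc fun i hi => hc _ _ (.right hx hi)).symm
    have ih' : ∀ {top : List ℕ} {T' : List (Tensor ι ℕ)}, free (row arc (t + 1) l g.cod) = top.length →
        Named (δ₁ ++ top ++ δ₃) (eraseFrom arc (t + 1) w) T' [] → Lin (δ₁ ++ top ++ δ₃ ++ names T') →
        ∃ E, Swept P arc b (t + 1) (fill (row arc (t + 1) 0 l) δ₁ ++ fill (row arc (t + 1) l g.cod) top ++
          fill (row arc (t + 1) (l + g.cod) r) δ₃) T' (forgetOps w) E := by
      intro top T' hf hN hL
      rw [← fill_row_three f1 hf]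
      refine ih hP' hw hN hL ?_
      rw [row_add, row_add, free_append, free_append, Nat.zero_add, Nat.zero_add, f1, f3, hf,
        List.length_append, List.length_append]
    have c1 : Nat.count (fun p => arc (t, p) = false) l = δ₁.length := by
      rw [h1, free_row]; simp only [Nat.zero_add]
    have c3 : Nat.count (fun p => arc (t, l + g.dom + p) = false) r = δ₃.length := by
      rw [h3, free_row]
    rw [eraseFrom_cons] at hN
    rw [forgetOps_cons]
    -- Layers whose piece is disjoint from the closure arcs.
    have piece : ∀ g' : Gen Empty, g.forgetMark = some g' → g'.dom = g.dom → g'.cod = g.cod →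
        (∀ i < g.dom, arc (t, l + i) = false) → (∀ i < g.cod, arc (t + 1, l + i) = false) →
        eraseLayer arc ⟨l, g, r⟩ t = some ⟨δ₁.length, g, δ₃.length⟩ → ∃ E,
        Swept P arc b t (fill (row arc t 0 l) δ₁ ++ fill (row arc t l g.dom) δ₂ ++
          fill (row arc t (l + g.dom) r) δ₃) T ((g.forgetMark.map fun g => (l, g)).toList ++ forgetOps w) E := by
      intro g' hg hd hcd hbf htf he
      rw [he] at hN
      obtain ⟨top, T', rfl, hbl, htl, hN⟩ := Named.cons_inv hN rfl rfl rfl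
      obtain ⟨E', h'⟩ := ih' (top := top) (T' := T') (by rw [free_row_of_false htf, htl]) hN (by
        intro y
        have := hL y
        simp only [names_cons, Tensor.legs, List.count_append, List.count_reverse] at this ⊢
        omega)
      rw [fill_row_of_false htf htl] at h'
      rw [fill_row_of_false hbf hbl, hg]
      exact Swept.piece (x := ⟨l, g, r⟩) hP hw hc h1.symm h3.symm hbl htl hbf htf hg hd hcd h' f1 f3 hL
    -- Layers that are erased. Here `X` and `mid` are the names directly below and above the piece,
    -- and the last hypothesis is the local computation with arbitrary strands `F` and `G` beside
    -- it.
    have arcs : ∀ (X mid : List (ℕ ⊕ ℕ × ℕ)) (E₁ : List ((ℕ × ℕ) × (ℕ × ℕ))) (top : List ℕ),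
        eraseLayer arc ⟨l, g, r⟩ t = none → (hf : free (row arc (t + 1) l g.cod) = top.length) → top = δ₂ →
        mid = fill (row arc (t + 1) l g.cod) top → X = fill (row arc t l g.dom) δ₂ →
        (∀ y ∈ E₁, arc y.1 = true ∧ IsPoint P y.1 ∧ IsPoint P y.2) →
        (∀ z, Sum.inr z ∈ names (edges ℕ E₁) →
          t + 1 ≤ z.1 ∨ (z.1 = t ∧ l ≤ z.2 ∧ z.2 < l + g.dom)) →
        (∀ y z, LayerLink ⟨l, g, r⟩ t y z → arc y = true →
          (∃ p < l, y = (t, p) ∧ z = (t + 1, p)) ∨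
          (∃ p < r, y = (t, l + g.dom + p) ∧ z = (t + 1, l + g.cod + p)) ∨ (y, z) ∈ E₁) →
        (∀ (F G : List (ℕ ⊕ ℕ × ℕ)) (S : List (Tensor Empty (ℕ ⊕ ℕ × ℕ))), F.length = l → G.length = r →
          Good (F ++ mid ++ G) S → (∀ z, Sum.inr z ∈ F ++ mid ++ G ++ names S → t + 1 ≤ z.1) →
          VE (l + g.cod + r) (forgetOps w) (net (F ++ mid ++ G) S) →
          Good (F ++ X ++ G) (edges ℕ E₁ ++ S) ∧ VE (l + g.dom + r)
            ((g.forgetMark.map fun g => (l, g)).toList ++ forgetOps w) (net (F ++ X ++ G) (edges ℕ E₁ ++ S))) →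
        ∃ E, Swept P arc b t (fill (row arc t 0 l) δ₁ ++ fill (row arc t l g.dom) δ₂ ++
          fill (row arc t (l + g.dom) r) δ₃) T ((g.forgetMark.map fun g => (l, g)).toList ++ forgetOps w) E := by
      rintro X mid E₁ top he hf' rfl rfl rfl hpts habove hlinks hall
      rw [he] at hN
      obtain ⟨E', h'⟩ := ih' hf' hN hL
      have hG' := hall _ _ _ (by rw [length_fill f1, length_row]) (by rw [length_fill f3, length_row]) h'.good h'.above
        (h'.ve.of_len (by simp only [List.length_append, length_fill f1, length_fill f3, length_fill hf', length_row]))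
      refine Swept.step P arc b (x := ⟨l, g, r⟩) hP hw hc h' h1.symm h3.symm _ [] E₁
        (by rw [length_fill h2.symm, length_row]) hG'.1 hG'.2 ?_ hpts hlinks
      intro z hz
      rcases List.mem_append.1 hz with hz | hz
      · right
        have := mem_row arc (mem_fill_inr hz); tauto
      · exact habove z hz
    have ptop : ∀ {p}, p < l + g.cod + r → IsPoint P (t + 1, p) := fun hp => isPoint_of_drop P hP' hw hp
    have pbot : ∀ {p}, p < l + g.dom + r → IsPoint P (t, p) := fun hp => ⟨_, hx, hp⟩
    cases g with
    | cup =>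
      have h01 : arc (t + 1, l) = arc (t + 1, l + 1) := hc _ _ (.cup hx rfl)
      cases ha : arc (t + 1, l) with
      | false =>
        refine piece cup rfl rfl rfl (by simp [dom]) ?_ (by simp [eraseLayer, ha, c1, c3])
        intro i hi
        obtain rfl | rfl : i = 0 ∨ i = 1 := by simp only [cod] at hi; omega
        exacts [ha, h01 ▸ ha]
      | true =>
        have ha1 : arc (t + 1, l + 1) = true := h01 ▸ ha
        obtain rfl : δ₂ = [] := List.length_eq_zero_iff.1 h2
        refine arcs [] [Sum.inr (t + 1, l), Sum.inr (t + 1, l + 1)] [((t + 1, l), (t + 1, l + 1))] []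
          (by simp [eraseLayer, ha]) (by simp [row, cod, List.range_succ, ha, ha1, free]) rfl
          (by simp [row, cod, List.range_succ, ha, ha1, fill]) (by simp [row, dom, fill])
          (by simpa [ha] using ⟨ptop (by simp only [cod]; omega), ptop (by simp only [cod]; omega)⟩)
          (by simp [edges, names, Tensor.legs, Tensor.arc]) ?_ ?_
        · intro y z hl ha
          cases hl with
          | left hp => exact .inl ⟨_, hp, rfl, rfl⟩
          | right hp => exact .inr (.inl ⟨_, hp, rfl, rfl⟩)
          | cup hx => simp
          | cap hx => cases hx
          | rising hx => rcases hx with (hx | hx) | hx <;> cases hx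
          | falling hx => rcases hx with (hx | hx) | hx <;> cases hx
        · intro F G S hF hG hS _ hu
          have hG' : Good (F ++ [] ++ G) (Tensor.arc (Sum.inr (t + 1, l)) (Sum.inr (t + 1, l + 1)) :: S) :=
            hS.of_perm (by
              intro s hs
              rcases List.mem_cons.1 hs with rfl | hs
              · exact Tensor.wf_arc _ _
              · exact hS.1 s hs) (List.perm_iff_count.2 fun y => by
                simp only [names_cons, Tensor.legs, Tensor.arc, List.count_append, List.reverse_nil, List.count_nil]; ring)
          refine ⟨hG', VE.trans (.cons (m := l + 2 + r) l cup hu) (VE.netPiece hG' ?_ hF.symm)⟩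
          simp [Tensor.arc, hF, hG, dom]
    | cap =>
      have h01 : arc (t, l) = arc (t, l + 1) := hc _ _ (.cap hx rfl)
      cases ha : arc (t, l) with
      | false =>
        refine piece cap rfl rfl rfl ?_ (by simp [cod]) (by simpa [eraseLayer, ha, c1] using c3)
        intro i hi
        obtain rfl | rfl : i = 0 ∨ i = 1 := by simp only [dom] at hi; omega
        exacts [ha, h01 ▸ ha]
      | true =>
        have ha1 : arc (t, l + 1) = true := h01 ▸ ha
        obtain rfl : δ₂ = [] := List.length_eq_zero_iff.1 (by
          rw [h2]; simp [row, dom, List.range_succ, ha, ha1, free])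
        refine arcs [Sum.inr (t, l), Sum.inr (t, l + 1)] [] [((t, l), (t, l + 1))] []
          (by simp [eraseLayer, ha]) (by simp [row, cod, free]) rfl
          (by simp [row, cod, fill]) (by simp [row, dom, List.range_succ, ha, ha1, fill])
          (by simpa [ha] using ⟨pbot (by simp only [dom]; omega), pbot (by simp only [dom]; omega)⟩)
          (by simp [edges, names, Tensor.legs, Tensor.arc, dom]) ?_ ?_
        · intro y z hl ha
          cases hl with
          | left hp => exact .inl ⟨_, hp, rfl, rfl⟩
          | right hp => exact .inr (.inl ⟨_, hp, rfl, rfl⟩)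
          | cup hx => cases hx
          | cap hx => simp
          | rising hx => rcases hx with (hx | hx) | hx <;> cases hx
          | falling hx => rcases hx with (hx | hx) | hx <;> cases hx
        · intro F G S hF hG hS hfr hu
          have n1 : Sum.inr (t, l) ∉ F ++ [] ++ G ++ names S := fun h => by have := hfr _ h; simp only at this; omega
          have n2 : Sum.inr (t, l + 1) ∉ F ++ [] ++ G ++ names S := fun h => by have := hfr _ h; simp only at this; omega
          have hL2 : Lin ((Sum.inr (t, l + 1) : ℕ ⊕ ℕ × ℕ) :: Sum.inr (t, l + 1) :: (F ++ [] ++ G ++ names S)) :=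
            hS.2.double n2 (List.Perm.refl _)
          have hL : Lin (F ++ [Sum.inr (t, l), Sum.inr (t, l + 1)] ++ G ++
              (Sum.inr (t, l) :: Sum.inr (t, l + 1) :: names S)) :=
            hL2.double (x := Sum.inr (t, l)) (by
              simp only [List.mem_cons, Sum.inr.injEq, Prod.mk.injEq, not_or]
              exact ⟨by omega, by omega, n1⟩) (List.perm_iff_count.2 fun y => by
                simp only [List.count_cons, List.count_append, List.count_nil]; ring)
          have hG' : Good (F ++ [Sum.inr (t, l), Sum.inr (t, l + 1)] ++ G)
              (⟨cap, [Sum.inr (t, l), Sum.inr (t, l + 1)], []⟩ :: S) := by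
            refine ⟨?_, hL.perm (List.perm_iff_count.2 fun y => by
                simp only [names_cons, Tensor.legs, List.reverse_cons, List.reverse_nil, List.nil_append,
                  List.count_append, List.count_cons, List.count_nil]; ring)⟩
            intro s hs
            rcases List.mem_cons.1 hs with rfl | hs
            · exact ⟨rfl, rfl⟩
            · exact hS.1 s hs
          have hn : l + 2 + r = (F ++ [(Sum.inr (t, l) : ℕ ⊕ ℕ × ℕ), Sum.inr (t, l + 1)] ++ G).length := by
            simp [hF, hG]; omega
          refine ⟨⟨?_, hL⟩, VE.trans (.cons (m := l + 0 + r) l cap hu) (VE.trans (VE.netPiece hG' hn hF.symm)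
            (VE.netCapArc hG' hn))⟩
          intro s hs
          rcases List.mem_cons.1 hs with rfl | hs
          · exact Tensor.wf_arc _ _
          · exact hS.1 s hs
    | overX =>
      obtain ⟨ha, hb'⟩ := hv t _ hx (.inl rfl)
      refine piece overX rfl rfl rfl ?_ ?_ (by simpa [eraseLayer, c1] using c3)
      · intro i hi
        obtain rfl | rfl : i = 0 ∨ i = 1 := by simp only [dom] at hi; omega
        exacts [ha, hb']
      · intro i hi
        obtain rfl | rfl : i = 0 ∨ i = 1 := by simp only [cod] at hi; omega
        · exact (hc _ _ (.falling hx (.inl (.inl rfl)))).symm.trans hb'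
        · exact (hc _ _ (.rising hx (.inl (.inl rfl)))).symm.trans ha
    | underX =>
      obtain ⟨ha, hb'⟩ := hv t _ hx (.inr rfl)
      refine piece underX rfl rfl rfl ?_ ?_ (by simpa [eraseLayer, c1] using c3)
      · intro i hi
        obtain rfl | rfl : i = 0 ∨ i = 1 := by simp only [dom] at hi; omega
        exacts [ha, hb']
      · intro i hi
        obtain rfl | rfl : i = 0 ∨ i = 1 := by simp only [cod] at hi; omega
        · exact (hc _ _ (.falling hx (.inl (.inr rfl)))).symm.trans hb'
        · exact (hc _ _ (.rising hx (.inl (.inr rfl)))).symm.trans ha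
    | virt =>
      have hr : arc (t, l) = arc (t + 1, l + 1) := hc _ _ (.rising hx (.inr rfl))
      have hf' : arc (t, l + 1) = arc (t + 1, l) := hc _ _ (.falling hx (.inr rfl))
      have links : ∀ y z, LayerLink ⟨l, (virt : Gen ι), r⟩ t y z → arc y = true →
          (∃ p < l, y = (t, p) ∧ z = (t + 1, p)) ∨
          (∃ p < r, y = (t, l + 2 + p) ∧ z = (t + 1, l + 2 + p)) ∨
          (y = (t, l) ∧ z = (t + 1, l + 1) ∧ arc (t, l) = true) ∨
          (y = (t, l + 1) ∧ z = (t + 1, l) ∧ arc (t, l + 1) = true) := by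
        intro y z hl ha
        cases hl with
        | left hp => exact .inl ⟨_, hp, rfl, rfl⟩
        | right hp => exact .inr (.inl ⟨_, hp, rfl, rfl⟩)
        | cup hx => cases hx
        | cap hx => cases hx
        | rising hx => exact .inr (.inr (.inl ⟨rfl, rfl, ha⟩))
        | falling hx => exact .inr (.inr (.inr ⟨rfl, rfl, ha⟩))
      have q1 : IsPoint P (t, l) := pbot (by simp only [dom]; omega)
      have q2 : IsPoint P (t, l + 1) := pbot (by simp only [dom]; omega)
      have q3 : IsPoint P (t + 1, l) := ptop (by simp only [cod]; omega)
      have q4 : IsPoint P (t + 1, l + 1) := ptop (by simp only [cod]; omega)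
      -- The crossing stays if neither strand is on a closure arc. Otherwise the strands are
      -- exchanged, and each strand on an arc leaves an edge.
      cases ha : arc (t, l) <;> cases ha' : arc (t, l + 1)
      · refine piece virt rfl rfl rfl ?_ ?_ (by simpa [eraseLayer, ha, ha', c1] using c3)
        · intro i hi
          obtain rfl | rfl : i = 0 ∨ i = 1 := by simp only [dom] at hi; omega
          exacts [ha, ha']
        · intro i hi
          obtain rfl | rfl : i = 0 ∨ i = 1 := by simp only [cod] at hi; omega
          · exact hf'.symm.trans ha'
          · exact hr.symm.trans ha
      · obtain ⟨n, rfl⟩ : ∃ n, δ₂ = [n] := List.length_eq_one_iff.1 (by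
          rw [h2]; simp [row, dom, List.range_succ, ha, ha', free])
        rw [ha] at hr; rw [ha'] at hf'
        refine arcs [Sum.inl n, Sum.inr (t, l + 1)] [Sum.inr (t + 1, l), Sum.inl n] [((t, l + 1), (t + 1, l))] [n]
          (by simp [eraseLayer, ha, ha']) (by simp [row, cod, List.range_succ, ← hr, ← hf', free]) rfl
          (by simp [row, cod, List.range_succ, ← hr, ← hf', fill]) (by simp [row, dom, List.range_succ, ha, ha', fill])
          (by simpa [ha'] using ⟨q2, q3⟩) (by simp [edges, names, Tensor.legs, Tensor.arc, dom]) ?_ ?_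
        · intro y z hl hy
          rcases links y z hl hy with h | h | ⟨_, _, h⟩ | ⟨rfl, rfl, h⟩
          · exact .inl h
          · exact .inr (.inl h)
          · rw [ha] at h; cases h
          · simp
        · intro F G S hF hG hS hfr hu
          have s1 := hS.exchange hF (by rw [hG]; rfl) hu
          have e : ∀ c : ℕ ⊕ ℕ × ℕ, F ++ [Sum.inl n, c] ++ G = (F ++ [Sum.inl n]) ++ c :: G := fun c => by simp
          rw [e] at s1 ⊢
          refine cut_of_good s1.1 ?_ (by simp [hF, hG, dom]; omega) s1.2
          intro h
          have := hfr (t, l + 1) (by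
            simp only [List.mem_append, List.mem_cons] at h ⊢; tauto)
          simp only at this; omega
      · obtain ⟨n, rfl⟩ : ∃ n, δ₂ = [n] := List.length_eq_one_iff.1 (by
          rw [h2]; simp [row, dom, List.range_succ, ha, ha', free])
        rw [ha] at hr; rw [ha'] at hf'
        refine arcs [Sum.inr (t, l), Sum.inl n] [Sum.inl n, Sum.inr (t + 1, l + 1)] [((t, l), (t + 1, l + 1))] [n]
          (by simp [eraseLayer, ha, ha']) (by simp [row, cod, List.range_succ, ← hr, ← hf', free]) rfl
          (by simp [row, cod, List.range_succ, ← hr, ← hf', fill]) (by simp [row, dom, List.range_succ, ha, ha', fill])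
          (by simpa [ha] using ⟨q1, q4⟩) (by simp [edges, names, Tensor.legs, Tensor.arc, dom]) ?_ ?_
        · intro y z hl hy
          rcases links y z hl hy with h | h | ⟨rfl, rfl, h⟩ | ⟨_, _, h⟩
          · exact .inl h
          · exact .inr (.inl h)
          · simp
          · rw [ha'] at h; cases h
        · intro F G S hF hG hS hfr hu
          have s1 := hS.exchange hF (by rw [hG]; rfl) hu
          have e : ∀ c : ℕ ⊕ ℕ × ℕ, F ++ [c, Sum.inl n] ++ G = F ++ c :: (Sum.inl n :: G) := fun c => by simp
          rw [e] at s1 ⊢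
          refine cut_of_good s1.1 ?_ (by simp [hF, hG, dom]; omega) s1.2
          intro h
          have := hfr (t, l) (by
            simp only [List.mem_append, List.mem_cons] at h ⊢; tauto)
          simp only at this; omega
      · obtain rfl : δ₂ = [] := List.length_eq_zero_iff.1 (by
          rw [h2]; simp [row, dom, List.range_succ, ha, ha', free])
        rw [ha] at hr; rw [ha'] at hf'
        refine arcs [Sum.inr (t, l), Sum.inr (t, l + 1)] [Sum.inr (t + 1, l), Sum.inr (t + 1, l + 1)]
          [((t, l + 1), (t + 1, l)), ((t, l), (t + 1, l + 1))] []
          (by simp [eraseLayer, ha, ha']) (by simp [row, cod, List.range_succ, ← hr, ← hf', free]) rfl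
          (by simp [row, cod, List.range_succ, ← hr, ← hf', fill]) (by simp [row, dom, List.range_succ, ha, ha', fill])
          (by simpa [ha, ha'] using ⟨⟨q2, q3⟩, ⟨q1, q4⟩⟩) (by simp [edges, names, Tensor.legs, Tensor.arc, dom]) ?_ ?_
        · intro y z hl hy
          rcases links y z hl hy with h | h | ⟨rfl, rfl, h⟩ | ⟨rfl, rfl, h⟩
          · exact .inl h
          · exact .inr (.inl h)
          · simp
          · simp
        · intro F G S hF hG hS hfr hu
          have s1 := hS.exchange hF (by rw [hG]; rfl) hu
          have e : ∀ c : ℕ ⊕ ℕ × ℕ, F ++ [c, Sum.inr (t + 1, l)] ++ G = F ++ c :: (Sum.inr (t + 1, l) :: G) :=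
            fun c => by simp
          have e' : ∀ c : ℕ ⊕ ℕ × ℕ, F ++ [Sum.inr (t, l), c] ++ G = (F ++ [Sum.inr (t, l)]) ++ c :: G :=
            fun c => by simp
          rw [e] at s1
          have s2 := cut_of_good (x := Sum.inr (t, l)) s1.1 (by
            intro h
            have := hfr (t, l) (by
              simp only [List.mem_append, List.mem_cons] at h ⊢; tauto)
            simp only at this; omega) (n := l + 2 + r) (by simp [hF, hG]; omega) s1.2
          rw [← e, e'] at s2
          rw [e']
          refine cut_of_good s2.1 ?_ (by simp [hF, hG, dom]; omega) s2.2
          intro h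
          simp only [names_cons, Tensor.legs, Tensor.arc, List.reverse_nil, List.append_nil,
            List.mem_append, List.mem_cons, Sum.inr.injEq, Prod.mk.injEq, List.not_mem_nil, or_false] at h
          have h' : Sum.inr (t, l + 1) ∈ F ++ [Sum.inr (t + 1, l), Sum.inr (t + 1, l + 1)] ++ G ++ names S := by
            simp only [List.mem_append, List.mem_cons, Sum.inr.injEq, Prod.mk.injEq, List.not_mem_nil, or_false]
            rcases h with ((h | h) | h) | h
            · tauto
            · omega
            · rcases h with h | h
              · omega
              · tauto
            · rcases h with (h | h) | h
              · omega
              · omega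
              · tauto
          have := hfr _ h'
          simp only at this; omega
    | birth e => exact absurd rfl (hne _ (List.mem_of_getElem? hx) e).1
    | death e => exact absurd rfl (hne _ (List.mem_of_getElem? hx) e).2
    | mark e =>
      have hne := hch t _ e hx rfl
      have hbe := hb t _ e hx rfl
      simp only at hne hbe
      have links : ∀ y z, LayerLink ⟨l, mark e, r⟩ t y z → arc y = true →
          (∃ p < l, y = (t, p) ∧ z = (t + 1, p)) ∨
          (∃ p < r, y = (t, l + 1 + p) ∧ z = (t + 1, l + 1 + p)) ∨
          (y, z) ∈ ([] : List ((ℕ × ℕ) × (ℕ × ℕ))) := by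
        intro y z hl ha
        cases hl with
        | left hp => exact .inl ⟨_, hp, rfl, rfl⟩
        | right hp => exact .inr (.inl ⟨_, hp, rfl, rfl⟩)
        | cup hx => cases hx
        | cap hx => cases hx
        | rising hx => rcases hx with (hx | hx) | hx <;> cases hx
        | falling hx => rcases hx with (hx | hx) | hx <;> cases hx
      -- If the arc lies below the marked point, the endpoint is one from which the diagram goes up;
      -- if the arc lies above, the diagram goes down. In both cases the endpoint becomes an arc
      -- between a strand of the diagram and a closure arc.
      cases ha : arc (t, l) with
      | true =>
        have ha' : arc (t + 1, l) = false := by rw [ha] at hne; simpa using hne.symm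
        obtain rfl : δ₂ = [] := List.length_eq_zero_iff.1 (by
          rw [h2]; simp [row, dom, List.range_succ, ha, free])
        have he : eraseLayer arc ⟨l, mark e, r⟩ t = some ⟨δ₁.length, birth e, δ₃.length⟩ := by
          simpa [eraseLayer, ha, c1] using c3
        rw [he] at hN
        obtain ⟨top, T', rfl, -, htl, hN⟩ := Named.cons_inv hN rfl rfl rfl
        obtain ⟨d, rfl⟩ := List.length_eq_one_iff.1 htl
        obtain ⟨E', h'⟩ := ih' (top := [d]) (T' := T') (by simp [row, cod, List.range_succ, ha', free]) hN (by
          intro y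
          have := hL y
          simp only [names_cons, Tensor.legs, List.count_append, List.count_reverse, List.count_nil] at this ⊢
          omega)
        have hmid : fill (row arc (t + 1) l (mark e).cod) [d] = [Sum.inl d] := by
          simp [row, cod, List.range_succ, ha', fill]
        have hX : fill (row arc t l (mark e).dom) ([] : List ℕ) = [Sum.inr (t, l)] := by
          simp [row, dom, List.range_succ, ha, fill]
        rw [hmid] at h'
        rw [hX]
        rw [ha] at hbe
        have hcl : Tensor.close b (⟨birth e, [], [d]⟩ : Tensor ι ℕ) = Tensor.arc (Sum.inl d) (Sum.inr (t, l)) := by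
          simp [Tensor.close, forgetMark, label, hbe, Tensor.arc]
        have hg := h'.good
        have hu := h'.ve
        rw [List.append_assoc, List.singleton_append] at hg hu
        have hab : ∀ z, Sum.inr z ∈ fill (row arc (t + 1) 0 l) δ₁ ++ Sum.inl d ::
            fill (row arc (t + 1) (l + (mark e).cod) r) δ₃ ++ names (T'.map (Tensor.close b) ++ edges ℕ E') →
            t + 1 ≤ z.1 := fun z hz => h'.above z (by rwa [List.append_assoc _ [_], List.singleton_append])
        have hn : l + 1 + r = (fill (row arc (t + 1) 0 l) δ₁ ++ Sum.inr (t, l) ::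
            fill (row arc (t + 1) (l + (mark e).cod) r) δ₃).length := by
          simp [length_fill f1, length_fill f3, length_row]; omega
        have s := cut_of_good (x := Sum.inr (t, l)) hg (fun h => by
          have := hab _ h; simp only at this; omega) hn (hu.of_len (by rw [hn]; simp))
        have hG2 := Good.of_perm s.1 (T := Tensor.arc (Sum.inl d) (Sum.inr (t, l)) ::
          (T'.map (Tensor.close b) ++ edges ℕ E')) (by
            intro s' hs'
            rcases List.mem_cons.1 hs' with rfl | hs'
            · exact Tensor.wf_arc _ _
            · exact hg.1 s' hs') (List.Perm.append_left _ ((List.Perm.swap _ _ _)))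
        refine Swept.step P arc b (x := ⟨l, mark e, r⟩) hP hw hc h' h1.symm h3.symm [Sum.inr (t, l)]
          [⟨birth e, [], [d]⟩] [] rfl ?_ ?_ ?_ (by simp) links
        · rw [List.map_singleton, hcl, List.append_assoc, List.singleton_append]
          exact hG2
        · rw [List.map_singleton, hcl, List.append_assoc, List.singleton_append]
          exact VE.trans s.2 (VE.netFlip s.1 hn)
        · intro z hz
          rw [List.map_singleton, hcl] at hz
          right
          have : z = (t, l) := by simpa [names, Tensor.legs, Tensor.arc, edges] using hz
          subst this
          exact ⟨rfl, le_refl _, by simp only [dom]; omega⟩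
      | false =>
        have ha' : arc (t + 1, l) = true := by rw [ha] at hne; simpa using hne.symm
        obtain ⟨d, rfl⟩ : ∃ n, δ₂ = [n] := List.length_eq_one_iff.1 (by
          rw [h2]; simp [row, dom, List.range_succ, ha, free])
        have he : eraseLayer arc ⟨l, mark e, r⟩ t = some ⟨δ₁.length, death e, δ₃.length⟩ := by
          simpa [eraseLayer, ha, c1] using c3
        rw [he] at hN
        obtain ⟨top, T', rfl, -, htl, hN⟩ := Named.cons_inv hN rfl rfl rfl
        obtain rfl := List.length_eq_zero_iff.1 htl
        obtain ⟨E', h'⟩ := ih' (top := []) (T' := T') (by simp [row, cod, List.range_succ, ha', free]) hN (by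
          intro y
          have := hL y
          simp only [names_cons, Tensor.legs, List.count_append, List.count_reverse, List.count_nil] at this ⊢
          omega)
        have hmid : fill (row arc (t + 1) l (mark e).cod) ([] : List ℕ) = [Sum.inr (t + 1, l)] := by
          simp [row, cod, List.range_succ, ha', fill]
        have hX : fill (row arc t l (mark e).dom) [d] = [Sum.inl d] := by
          simp [row, dom, List.range_succ, ha, fill]
        rw [hmid] at h'
        rw [hX]
        rw [ha] at hbe
        have hcl : Tensor.close b (⟨death e, [d], []⟩ : Tensor ι ℕ) =
            Tensor.arc (Sum.inl d) (Sum.inr (t + 1, l)) := by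
          simp [Tensor.close, forgetMark, label, hbe, Tensor.arc]
        have hg := h'.good
        have hu := h'.ve
        rw [List.append_assoc, List.singleton_append] at hg hu
        have hn : l + 1 + r = (fill (row arc (t + 1) 0 l) δ₁ ++ (Sum.inl d : ℕ ⊕ ℕ × ℕ) ::
            fill (row arc (t + 1) (l + (mark e).cod) r) δ₃).length := by
          simp [length_fill f1, length_fill f3, length_row]; omega
        have s := cut_of_good (x := Sum.inl d) hg (fun h => by
          have h0 := hL d
          have h1 := List.count_pos_iff.2 h
          simp only [names_cons, Tensor.legs, List.count_append, List.count_reverse, List.count_nil,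
            List.count_cons_self] at h0
          simp only [names_append, List.count_append, count_inl_fill _ f1, count_inl_fill _ f3,
            count_inl_close, count_inl_edges, List.count_cons_of_ne (show (Sum.inr (t + 1, l) : ℕ ⊕ ℕ × ℕ) ≠ Sum.inl d by simp)] at h1
          omega) hn (hu.of_len (by rw [hn]; simp))
        refine Swept.step P arc b (x := ⟨l, mark e, r⟩) hP hw hc h' h1.symm h3.symm [Sum.inl d]
          [⟨death e, [d], []⟩] [] rfl ?_ ?_ ?_ (by simp) links
        · rw [List.map_singleton, hcl, List.append_assoc, List.singleton_append]
          exact s.1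
        · rw [List.map_singleton, hcl, List.append_assoc, List.singleton_append]
          exact s.2
        · intro z hz
          rw [List.map_singleton, hcl] at hz
          left
          have : z = (t + 1, l) := by simpa [names, Tensor.legs, Tensor.arc, edges] using hz
          subst this
          exact le_refl _

end Sweep

/-! ### Closure arcs are contracted -/

/-- `(x, y)` is one of the pieces `E`. -/
def Edge {γ : Type} (E : List (γ × γ)) (x y : γ) : Prop := (x, y) ∈ E

theorem Tensor.close_map {ι γ γ' : Type} (f : γ → γ') (b : ι → γ) (t : Tensor ι ℕ) :
    (t.close b).map (Sum.map id f) = t.close (f ∘ b) := by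
  unfold Tensor.close Tensor.map
  split <;> simp [Function.comp_def]

theorem map_close_map {ι γ γ' : Type} (f : γ → γ') (b : ι → γ) (T : List (Tensor ι ℕ)) :
    (T.map (Tensor.close b)).map (Tensor.map (Sum.map id f)) = T.map (Tensor.close (f ∘ b)) := by
  rw [List.map_map]
  exact List.map_congr_left fun t _ => Tensor.close_map f b t

theorem edges_map {γ γ' : Type} (f : γ → γ') (E : List (γ × γ)) :
    (edges ℕ E).map (Tensor.map (Sum.map id f)) = edges ℕ (E.map (Prod.map f f)) := by
  simp [edges, Tensor.map, Tensor.arc]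

theorem sub_inr {γ : Type} [DecidableEq γ] (x y : γ) :
    sub (Sum.inr x : ℕ ⊕ γ) (Sum.inr y) = Sum.map id (sub x y) := by
  funext z
  rcases z with n | z
  · simp [sub]
  · by_cases h : z = x <;> simp [sub, h]

theorem eqvGen_map {γ γ' : Type} {r : γ → γ → Prop} {s : γ' → γ' → Prop} {f : γ → γ'}
    (h : ∀ x y, r x y → Relation.EqvGen s (f x) (f y)) {x y : γ} (hxy : Relation.EqvGen r x y) :
    Relation.EqvGen s (f x) (f y) := by
  induction hxy with
  | rel _ _ h' => exact h _ _ h'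
  | refl => exact .refl _
  | symm _ _ _ ih => exact ih.symm
  | trans _ _ _ _ _ ih1 ih2 => exact ih1.trans _ _ _ ih2

theorem mem_names_close {ι γ : Type} {b : ι → γ} {T : List (Tensor ι ℕ)} {t : Tensor ι ℕ} {e : ι}
    (ht : t ∈ T) (he : t.gen.label = some e) : Sum.inr (b e) ∈ names (T.map (Tensor.close b)) := by
  refine mem_names_of_mem (List.mem_map_of_mem ht) ?_
  have h : t.gen.forgetMark = none := by
    cases hg : t.gen <;> simp_all [label, forgetMark]
  simp [Tensor.close, h, Tensor.legs, he]

/-- The edges are removed one by one with `netElim`, and `f` collects the substitutions. Therefore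
`f` identifies points that are connected by edges. The hypothesis that every edge is connected with
an endpoint excludes circles. -/
theorem VE.netEdges {ι γ : Type} [DecidableEq γ] {T : List (Tensor ι ℕ)}
    (hl : ∀ e, ∃ t ∈ T, t.gen.label = some e) : ∀ {n : ℕ} {E : List (γ × γ)} {b : ι → γ}, E.length = n →
    Good [] (T.map (Tensor.close b) ++ edges ℕ E) →
    (∀ y ∈ E, ∃ e, Relation.EqvGen (Edge E) y.1 (b e)) →
    ∃ f : γ → γ, Good [] (T.map (Tensor.close (f ∘ b))) ∧
      VE 0 (net [] (T.map (Tensor.close b) ++ edges ℕ E)) (net [] (T.map (Tensor.close (f ∘ b)))) ∧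
      ∀ x y, Relation.EqvGen (Edge E) x y → f x = f y
  | 0, E, b, hn, hG, _ => by
    obtain rfl := List.length_eq_zero_iff.1 hn
    simp only [edges, List.map_nil, List.append_nil] at hG ⊢
    refine ⟨id, hG, refl (ok_net hG), fun x y h => ?_⟩
    induction h with
    | rel _ _ h => simp [Edge] at h
    | refl => rfl
    | symm _ _ _ ih => exact ih.symm
    | trans _ _ _ _ _ ih1 ih2 => exact ih1.trans ih2
  | n + 1, (x, y) :: E, b, hn, hG, hE => by
    have hp : (T.map (Tensor.close b) ++ edges ℕ ((x, y) :: E)).Perm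
        (Tensor.arc (Sum.inr x) (Sum.inr y) :: (T.map (Tensor.close b) ++ edges ℕ E)) :=
      List.perm_middle
    have hG' : Good [] (Tensor.arc (Sum.inr x) (Sum.inr y) :: (T.map (Tensor.close b) ++ edges ℕ E)) :=
      hG.of_perm (fun t ht => hG.1 t (hp.mem_iff.2 ht)) ((hp.flatMap_right _).append_left _)
    have hxy : x ≠ y := by
      rintro rfl
      have h0 : Sum.inr x ∉ names (T.map (Tensor.close b) ++ edges ℕ E) := by
        have := hG'.2 (Sum.inr x)
        simp only [List.nil_append, names_cons, Tensor.legs, Tensor.arc, List.reverse_nil, List.append_nil,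
          List.cons_append, List.count_cons_self] at this
        exact List.count_eq_zero.1 (by omega)
      simp only [names_append, List.mem_append, not_or] at h0
      obtain ⟨e, he⟩ := hE (x, x) (by simp)
      -- An edge from `x` to `x` uses up both copies of this name. So `x` is connected with no other
      -- point, and in particular with no name at an endpoint.
      have key : ∀ u v, Relation.EqvGen (Edge ((x, x) :: E)) u v → (u = x ↔ v = x) := by
        intro u v h
        induction h with
        | rel u v h =>
          rcases List.mem_cons.1 h with h | h
          · cases h; rfl
          · have hu : Sum.inr u ∈ names (edges ℕ E) :=
              mem_names_of_mem (List.mem_map_of_mem h) (by simp [Tensor.legs, Tensor.arc])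
            have hv : Sum.inr v ∈ names (edges ℕ E) :=
              mem_names_of_mem (List.mem_map_of_mem h) (by simp [Tensor.legs, Tensor.arc])
            constructor
            · rintro rfl; exact absurd hu h0.2
            · rintro rfl; exact absurd hv h0.2
        | refl => rfl
        | symm _ _ _ ih => exact ih.symm
        | trans _ _ _ _ _ ih1 ih2 => exact ih1.trans ih2
      obtain ⟨t, ht, hte⟩ := hl e
      have := mem_names_close (b := b) ht hte
      rw [(key _ _ he).1 rfl] at this
      exact h0.1 this
    have hxy' : (Sum.inr x : ℕ ⊕ γ) ≠ Sum.inr y := fun h => hxy (Sum.inr_injective h)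
    have s1 := VE.netElim hxy' hG'
    have g1 := hG'.sub hxy'
    rw [List.map_append, sub_inr, map_close_map, edges_map] at s1 g1
    have hmap : ∀ u v, Relation.EqvGen (Edge ((x, y) :: E)) u v →
        Relation.EqvGen (Edge (E.map (Prod.map (VirtualClosure.sub x y) (VirtualClosure.sub x y))))
          (VirtualClosure.sub x y u) (VirtualClosure.sub x y v) := by
      intro u v h
      refine eqvGen_map ?_ h
      intro u v h
      rcases List.mem_cons.1 h with h | h
      · cases h
        simp [VirtualClosure.sub]
        exact .refl _
      · exact .rel _ _ (List.mem_map_of_mem h)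
    obtain ⟨f, h1, h2, h3⟩ := VE.netEdges hl (n := n) (by simpa using hn) g1 (by
      intro z hz
      obtain ⟨z', hz', rfl⟩ := List.mem_map.1 hz
      obtain ⟨e, he⟩ := hE z' (List.mem_cons_of_mem _ hz')
      exact ⟨e, hmap _ _ he⟩)
    refine ⟨f ∘ VirtualClosure.sub x y, h1, ?_, fun u v h => h3 _ _ (hmap _ _ h)⟩
    exact trans (VE.netPerm hp hG rfl) (trans s1 h2)

/-! ### The names of closure arcs do not matter -/

/-- Both maps identify exactly `e` with `σ e`, so both are injective renamings of one map onto the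
range of `b`, and `net_map` applies twice. -/
theorem net_close_eq {n : ℕ} {γ γ' : Type} [DecidableEq γ] [DecidableEq γ'] {σ : Pairing n}
    {b : Fin (2 * n) → γ} {b' : Fin (2 * n) → γ'} (hb : ArcNames σ b) (hb' : ArcNames σ b')
    (T : List (Tensor (Fin (2 * n)) ℕ)) :
    net [] (T.map (Tensor.close b)) = net [] (T.map (Tensor.close b')) := by
  have key : ∀ {γ γ' : Type} [DecidableEq γ] [DecidableEq γ'] {f : γ → γ'} {b : Fin (2 * n) → γ},
      Function.Injective f → net [] (T.map (Tensor.close (f ∘ b))) = net [] (T.map (Tensor.close b)) := by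
    intro γ γ' _ _ f b hf
    rw [← map_close_map]
    exact net_map (Function.Injective.sumMap Function.injective_id hf) _ []
  have h1 := key (f := (Subtype.val : Set.range b → γ)) (b := Set.rangeFactorization b) Subtype.val_injective
  have hs : ∀ x : Set.range b, ∃ e, b e = x := fun x => x.2
  choose c hc using hs
  have hf : Function.Injective (b' ∘ c) := by
    intro x y h
    have := (hb' _ _).1 h
    exact Subtype.ext (by rw [← hc x, ← hc y]; exact (hb _ _).2 this)
  have h2 := key (b := Set.rangeFactorization b) hf
  have e1 : (Subtype.val : Set.range b → γ) ∘ Set.rangeFactorization b = b := rfl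
  have e2 : (b' ∘ c) ∘ Set.rangeFactorization b = b' := by
    funext e
    exact (hb' _ _).2 ((hb _ _).1 (hc (Set.rangeFactorization b e)))
  rw [e1] at h1
  rw [e2] at h2
  exact h1.trans h2.symm

/-! ### Positions of labels -/

theorem labels_cons {ι : Type} (x : Layer ι) (w : Word ι) :
    labels (x :: w) = x.gen.label.toList ++ labels w := by
  simp only [labels, List.filterMap_cons]
  cases x.gen.label <;> rfl

theorem mem_labels {ι : Type} {w : Word ι} {e : ι} :
    e ∈ labels w ↔ ∃ (i : ℕ) (x : Layer ι), w[i]? = some x ∧ x.gen.label = some e := by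
  simp only [labels, List.mem_filterMap]
  constructor
  · rintro ⟨x, h, h'⟩
    obtain ⟨i, h⟩ := List.mem_iff_getElem?.1 h
    exact ⟨i, x, h, h'⟩
  · rintro ⟨i, x, h, h'⟩; exact ⟨x, List.mem_iff_getElem?.2 ⟨i, h⟩, h'⟩

theorem index_unique {ι : Type} [DecidableEq ι] {e : ι} : ∀ {w : Word ι}, (labels w).count e = 1 →
    ∀ {i j : ℕ} {x y : Layer ι}, w[i]? = some x → w[j]? = some y → x.gen.label = some e →
      y.gen.label = some e → i = j
  | [], h, _, _, _, _, _, _, _, _ => by simp [labels] at h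
  | a :: w, h, i, j, x, y, hi, hj, hx, hy => by
    rw [labels_cons, List.count_append] at h
    have pos : ∀ {k : ℕ} {z : Layer ι}, w[k]? = some z → z.gen.label = some e → 0 < (labels w).count e :=
      fun h1 h2 => List.count_pos_iff.2 (mem_labels.2 ⟨_, _, h1, h2⟩)
    cases i with
    | zero =>
      cases j with
      | zero => rfl
      | succ j =>
        have := pos (by simpa using hj) hy
        simp only [List.getElem?_cons_zero, Option.some.injEq] at hi
        subst hi
        rw [hx] at h
        simp at h; simp_all
    | succ i =>
      cases j with
      | zero =>
        have := pos (by simpa using hi) hx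
        simp only [List.getElem?_cons_zero, Option.some.injEq] at hj
        subst hj
        rw [hy] at h
        simp at h; simp_all
      | succ j =>
        have h1 := pos (by simpa using hi) hx
        have h2 : (labels w).count e = 1 := by omega
        rw [index_unique h2 (i := i) (j := j) (by simpa using hi) (by simpa using hj) hx hy]

theorem Named.labels {ι α : Type} {β δ : List α} {w : Word ι} {T : List (Tensor ι α)}
    (h : Named β w T δ) : T.filterMap (fun t => t.gen.label) = labels w := by
  induction h with
  | nil => rfl
  | cons hl hr hb ht h ih =>
    rw [labels_cons, ← ih, List.filterMap_cons]
    cases Gen.label _ <;> rfl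

theorem count_inr_close {ι γ : Type} [DecidableEq γ] (b : ι → γ) (c : γ) (T : List (Tensor ι ℕ)) :
    (names (T.map (Tensor.close b))).count (Sum.inr c) =
      ((T.filterMap fun t => t.gen.label).map b).count c := by
  induction T with
  | nil => rfl
  | cons t T ih =>
    have : (t.close b).legs.count (Sum.inr c) = (t.gen.label.toList.map b).count c := by
      have e : List.map (fun e => Sum.inr (b e)) t.gen.label.toList =
          (List.map b t.gen.label.toList).map (Sum.inr : γ → ℕ ⊕ γ) := by simp
      rw [Tensor.close, Tensor.legs]
      split
      · rename_i g hg
        have : t.gen.label = none := by cases h : t.gen <;> simp_all [label, forgetMark]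
        simp [this, List.count_append, count_inr_map]
      · simp only [List.count_append, List.reverse_nil, count_inr_map, e, List.count_nil]
        rw [List.count_map_of_injective _ _ Sum.inr_injective]
        omega
    rw [List.map_cons, names_cons, List.count_append, this, ih, List.filterMap_cons]
    cases t.gen.label <;> simp [List.count_cons, Nat.add_comm]

/-! ### The class of a virtual closure -/

/-- If the name at `e` and `σ e` occurred at a third label, it would be used three times. -/
theorem arcNames_of_lin {n : ℕ} {γ : Type} [DecidableEq γ] {σ : Pairing n} {b : Fin (2 * n) → γ}
    {T : List (Tensor (Fin (2 * n)) ℕ)} (hl : ∀ e, e ∈ T.filterMap fun t => t.gen.label)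
    (h : Lin (names (T.map (Tensor.close b)))) (hb : ∀ e, b e = b (σ.1 e)) : ArcNames σ b := by
  intro e e'
  constructor
  · intro he
    by_contra hne
    push Not at hne
    have hnd : [e', e, σ.1 e].Nodup := by
      simp [hne.1, hne.2, (σ.2 e).2.symm]
    obtain ⟨l, hp, hs⟩ := List.Nodup.subperm hnd fun x _ => hl x
    have h1 := (hs.map b).count_le (b e)
    rw [(hp.map b).count_eq] at h1
    have h2 := h (Sum.inr (b e))
    rw [count_inr_close] at h2
    have h3 : (List.map b [e', e, σ.1 e]).count (b e) = 3 := by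
      simp [he.symm, ← hb e]
    omega
  · rintro (rfl | rfl)
    · rfl
    · exact hb e

/-- The reason for uniqueness: the right side does not involve the closure picture, only names for
`D` and names for the arcs, which are determined by `σ`. -/
theorem IsVirtualClosure.ve_net {n : ℕ} {D : LinkoidDiagram n} {σ : Pairing n} {K : VirtualDiagram}
    (h : IsVirtualClosure D σ K) {T : List (Tensor (Fin (2 * n)) ℕ)} (hT : Named [] D.word T [])
    (hL : Lin (names T)) {γ : Type} [DecidableEq γ] {b : Fin (2 * n) → γ} (hb : ArcNames σ b) :
    VE 0 (strip K.word) (net [] (T.map (Tensor.close b))) := by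
  obtain ⟨P, arc, hP, hD, hK⟩ := h
  have hmark : ∀ e, ∃ (t : ℕ) (x : Layer (Fin (2 * n))), P[t]? = some x ∧ x.gen = mark e := by
    intro e
    obtain ⟨t, x, hx, he⟩ := mem_labels.1 (List.count_pos_iff.1 (by rw [hP.labelled e]; exact one_pos))
    refine ⟨t, x, hx, ?_⟩
    have hne := hP.noEndpoints x (List.mem_of_getElem? hx)
    cases hg : x.gen <;> rw [hg] at he <;> simp only [label, Option.some.injEq, reduceCtorEq] at he
    · exact absurd hg (hne _).1
    · exact absurd hg (hne _).2
    · rw [he]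
  choose t x hx hg using hmark
  -- Of the two points next to the marked point with label `e`, `c e` is the one on the closure arc.
  set c : Fin (2 * n) → ℕ × ℕ := fun e => if arc (t e, (x e).left) then (t e, (x e).left) else (t e + 1, (x e).left)
  have huniq : ∀ (t' : ℕ) (x' : Layer (Fin (2 * n))) (e : Fin (2 * n)), P[t']? = some x' → x'.gen = mark e →
      t' = t e ∧ x' = x e := by
    intro t' x' e h1 h2
    obtain rfl := index_unique (hP.labelled e) h1 (hx e) (by rw [h2]; rfl) (by rw [hg e]; rfl)
    have := hx e
    rw [h1] at this
    exact ⟨rfl, Option.some.inj this⟩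
  have hc : ∀ (t' : ℕ) (x' : Layer (Fin (2 * n))) (e : Fin (2 * n)), P[t']? = some x' → x'.gen = mark e →
      c e = if arc (t', x'.left) then (t', x'.left) else (t' + 1, x'.left) := by
    intro t' x' e h1 h2
    obtain ⟨rfl, rfl⟩ := huniq t' x' e h1 h2
    rfl
  have hch := hP.changes
  obtain ⟨E, hE⟩ := exists_swept (b := c) (fun x hx e => hP.noEndpoints x hx e) hP.constant hP.changes hP.virtual hc
    (w := P) (t := 0) (m := 0) (T := T) (δ := []) rfl hP.closed (by
      rw [show eraseFrom arc 0 P = D.word from hD]; exact hT) hL rfl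
  have hac : ∀ e, arc (c e) = true ∧ EndAt P e (c e) := by
    intro e
    have := hch _ _ e (hx e) (hg e)
    simp only [c]
    cases ha : arc (t e, (x e).left) with
    | true => exact ⟨ha, .below (hx e) (hg e)⟩
    | false =>
      rw [ha] at this
      exact ⟨by simpa using this.symm, .above (hx e) (hg e)⟩
  have hend : ∀ e y, EndAt P e y → arc y = true → y = c e := by
    intro e y h ha
    cases h with
    | birth h1 h2 => exact absurd h2 (hP.noEndpoints _ (List.mem_of_getElem? h1) _).1
    | death h1 h2 => exact absurd h2 (hP.noEndpoints _ (List.mem_of_getElem? h1) _).2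
    | below h1 h2 => rw [hc _ _ _ h1 h2, ha]; rfl
    | above h1 h2 =>
      have := hch _ _ e h1 h2
      rw [ha] at this
      rw [hc _ _ _ h1 h2, show arc _ = false by simpa using this]; rfl
  -- Being on an arc is constant along strands, and for points on arcs being joined means being
  -- connected by edges.
  have hjoin : ∀ y z, Joined P y z → arc y = arc z ∧ (arc y = true → Relation.EqvGen (Edge E) y z) := by
    intro y z h
    induction h with
    | rel y z h =>
      obtain ⟨s, x', hx', hl⟩ := h.layerLink
      exact ⟨hP.constant _ _ h, fun ha => .rel _ _ (hE.links s x' y z (Nat.zero_le _) hx' hl ha)⟩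
    | refl => exact ⟨rfl, fun _ => .refl _⟩
    | symm _ _ _ ih => exact ⟨ih.1.symm, fun ha => (ih.2 (ih.1.trans ha)).symm⟩
    | trans _ _ _ _ _ ih1 ih2 =>
      exact ⟨ih1.1.trans ih2.1, fun ha => (ih1.2 ha).trans _ _ _ (ih2.2 (ih1.1.symm.trans ha))⟩
  have hlab : ∀ e, e ∈ T.filterMap fun t => t.gen.label := fun e => by
    rw [hT.labels]
    exact List.count_pos_iff.1 (by rw [D.labelled e]; exact one_pos)
  have hgood := hE.good
  have hve := hE.ve
  obtain ⟨f, h1, h2, h3⟩ := VE.netEdges (fun e => by simpa using List.mem_filterMap.1 (hlab e)) rfl hgood (by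
    intro y hy
    obtain ⟨ha, hp, _⟩ := hE.points y hy
    obtain ⟨e, z, hz, hj⟩ := hP.onlyArcs _ hp ha
    have := hjoin _ _ hj
    rw [hend e z hz (this.1 ▸ ha)] at this
    exact ⟨e, this.2 ha⟩)
  -- The picture joins the arc at `e` with the arc at `σ e`, so the contraction gives them equal
  -- names; `Lin` excludes further coincidences.
  have hAN : ArcNames σ (f ∘ c) := arcNames_of_lin hlab h1.2 fun e =>
    h3 _ _ ((hjoin _ _ (hP.pairs e _ _ (hac e).2 (hac e).1 (hac _).2 (hac _).1)).2 (hac e).1)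
  rw [← hK, ← net_close_eq hAN hb]
  exact VE.trans hve h2

/-! ### Existence of virtual closures -/

section Existence

theorem labels_append {ι : Type} (v w : Word ι) : labels (v ++ w) = labels v ++ labels w :=
  List.filterMap_append

variable {ι : Type}

/-- A layer of a closure picture, in the neighbourhood of its piece: a strand is marked `some e` if it
belongs to the closure arc that ends at `e`.  The last argument is the piece that remains when the closure arcs
are erased. -/
inductive LocalStep (σ : ι → ι) : List (Option ι) → Gen ι → List (Option ι) → Option (Gen ι) → Prop
  | keep (g : Gen ι) (h : g = cup ∨ g = cap ∨ g.IsClassicalCrossing) :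
      LocalStep σ (List.replicate g.dom none) g (List.replicate g.cod none) (some g)
  | cup (e : ι) : LocalStep σ [] cup [some e, some e] none
  | cap (e : ι) : LocalStep σ [some e, some (σ e)] cap [] none
  | virt (x y : Option ι) (h : x.isSome ∨ y.isSome) : LocalStep σ [x, y] virt [y, x] none
  | birth (e : ι) : LocalStep σ [some e] (mark e) [none] (some (birth e))
  | death (e : ι) : LocalStep σ [none] (mark e) [some e] (some (death e))

/-- A stack of layers of a closure picture, with the rows between them, from a bottom row to a top row, and
the word that remains when closure arcs are erased. -/
inductive Run (σ : ι → ι) :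
    List (Option ι) → List (Layer ι × List (Option ι)) → Word ι → List (Option ι) → Prop
  | nil (ρ : List (Option ι)) : Run σ ρ [] [] ρ
  | cons {A B X Y ρ' : List (Option ι)} {g : Gen ι} {o : Option (Gen ι)}
      {S : List (Layer ι × List (Option ι))} {w : Word ι} (h : LocalStep σ X g Y o)
      (hg : g = cup → o.isSome) (hS : Run σ (A ++ Y ++ B) S w ρ') :
      Run σ (A ++ X ++ B) ((⟨A.length, g, B.length⟩, A ++ Y ++ B) :: S)
        ((o.map fun g => ⟨free A, g, free B⟩).toList ++ w) ρ'
  | stub {A B ρ' : List (Option ι)} {e : ι} {S : List (Layer ι × List (Option ι))} {w : Word ι}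
      (hS : Run σ (A ++ [none, some e] ++ B) S w ρ') :
      Run σ (A ++ B) ((⟨A.length, cup, B.length⟩, A ++ [some e, some e] ++ B) ::
        (⟨A.length, mark e, B.length + 1⟩, A ++ [none, some e] ++ B) :: S)
        (⟨free A, birth e, free B⟩ :: w) ρ'

theorem Run.append {σ : ι → ι} {ρ₁ ρ₂ ρ₃ : List (Option ι)} {S S' : List (Layer ι × List (Option ι))}
    {w w' : Word ι} (h : Run σ ρ₁ S w ρ₂) (h' : Run σ ρ₂ S' w' ρ₃) : Run σ ρ₁ (S ++ S') (w ++ w') ρ₃ := by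
  induction h with
  | nil => exact h'
  | @cons A B X Y _ g o S w h hg _ ih =>
    rw [List.append_assoc (o.map fun g => (⟨free A, g, free B⟩ : Layer ι)).toList]
    exact .cons h hg (ih h')
  | stub _ ih => exact .stub (ih h')

/-- A strand of a closure arc is moved to the right. -/
theorem Run.slide (σ : ι → ι) (e : ι) : ∀ (C A B : List (Option ι)),
    ∃ S, Run σ (A ++ [some e] ++ C ++ B) S [] (A ++ C ++ [some e] ++ B) ∧ labels (S.map Prod.fst) = []
  | [], A, B => ⟨[], by simpa using Run.nil _, rfl⟩
  | c :: C, A, B => by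
    obtain ⟨S, h, h'⟩ := Run.slide σ e C (A ++ [c]) B
    refine ⟨(⟨A.length, .virt, (C ++ B).length⟩, A ++ [c, some e] ++ (C ++ B)) :: S, ?_, ?_⟩
    · have := Run.cons (A := A) (B := C ++ B) (LocalStep.virt (σ := σ) (some e) c (.inl rfl)) (by simp)
        (S := S) (w := []) (ρ' := A ++ (c :: C) ++ [some e] ++ B) (by simpa using h)
      simpa using this
    · rw [List.map_cons, labels_cons, h']; rfl

/-- The strands of all closure arcs are connected. -/
theorem Run.pairing (σ : ι → ι) (hσ : ∀ e, σ (σ e) = e ∧ σ e ≠ e) : ∀ (n : ℕ) (L : List ι), L.length = n →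
    L.Nodup → (∀ e ∈ L, σ e ∈ L) → ∃ S, Run σ (L.map some) S [] [] ∧ labels (S.map Prod.fst) = []
  | _, [], _, _, _ => ⟨[], .nil _, rfl⟩
  | 0, e :: L, h, _, _ => by simp at h
  | n + 1, e :: L, hn, hd, hL => by
    have he : σ e ∈ L := by
      have := hL e (by simp)
      rcases List.mem_cons.1 this with h | h
      · exact absurd h (hσ e).2
      · exact h
    obtain ⟨L₁, L₂, rfl⟩ := List.append_of_mem he
    have hd1 := List.nodup_cons.1 hd
    have hd2 := List.nodup_middle.1 hd1.2
    have hd3 := List.nodup_cons.1 hd2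
    have hmem : ∀ x ∈ L₁ ++ L₂, σ x ∈ L₁ ++ L₂ := by
      intro x hx
      have h1 : x ∈ L₁ ++ σ e :: L₂ := by simp only [List.mem_append, List.mem_cons] at hx ⊢; tauto
      have h2 : σ x ≠ e := by
        intro h
        rw [← h, (hσ x).1] at hd3
        exact hd3.1 hx
      have h3 : σ x ≠ σ e := by
        intro h
        have := congrArg σ h
        rw [(hσ x).1, (hσ e).1] at this
        exact hd1.1 (this ▸ h1)
      have := hL x (List.mem_cons_of_mem _ h1)
      simp only [List.mem_append, List.mem_cons] at this ⊢
      tauto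
    obtain ⟨S, h1, h2⟩ := Run.pairing σ hσ n.pred (L₁ ++ L₂) (by
      simp only [List.length_cons, List.length_append] at hn ⊢
      simp; omega) hd3.2 hmem
    obtain ⟨S', h3, h4⟩ := Run.slide σ e (L₁.map some) [] (some (σ e) :: L₂.map some)
    have h5 := Run.cons (A := L₁.map some) (B := L₂.map some) (LocalStep.cap (σ := σ) e) (by simp)
      (S := S) (w := []) (ρ' := []) (by simpa using h1)
    have h6 := h3.append (by simpa using h5)
    refine ⟨_, by simpa using h6, ?_⟩
    rw [List.map_append, List.map_cons, labels_append, labels_cons, h4, h2]; rfl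

/-- The part of a closure picture that contains a given diagram. -/
theorem Run.exists_of_isWord (σ : ι → ι) : ∀ {w : Word ι} {a : ℕ} (L : List ι), IsWord a w 0 →
    (∀ x ∈ w, x.gen ≠ Gen.virt ∧ ∀ e, x.gen ≠ Gen.mark e) →
    ∃ S, Run σ (List.replicate a none ++ L.map some) S w (((labels w).reverse ++ L).map some) ∧
      labels (S.map Prod.fst) = labels w
  | [], a, L, hw, _ => by
    obtain rfl : a = 0 := hw
    exact ⟨[], .nil _, rfl⟩
  | ⟨l, g, r⟩ :: w, a, L, hw, hc => by
    obtain ⟨ha, hw⟩ := hw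
    have ih := fun L => Run.exists_of_isWord σ L hw fun x hx => hc x (List.mem_cons_of_mem _ hx)
    have hg := hc ⟨l, g, r⟩ (by simp)
    simp only [Layer.source, Layer.target] at ha hw ih
    subst ha
    have hfl : ∀ k, free (List.replicate k (none : Option ι)) = k := fun k => by simp [free, List.countP_replicate]
    have hfr : ∀ k, free (List.replicate k none ++ L.map some) = k := fun k => by
      rw [free_append, hfl]; simp [free]
    have rep : ∀ (x y z : ℕ) (M : List (Option ι)), List.replicate (x + y + z) none ++ M =
        List.replicate x none ++ (List.replicate y none ++ (List.replicate z none ++ M)) := fun x y z M => by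
      rw [List.replicate_add, List.replicate_add, List.append_assoc, List.append_assoc]
    have keep : (g = cup ∨ g = cap ∨ g.IsClassicalCrossing) → ∃ S,
        Run σ (List.replicate (l + g.dom + r) none ++ L.map some) S (⟨l, g, r⟩ :: w)
          (((labels (⟨l, g, r⟩ :: w)).reverse ++ L).map some) ∧
          labels (S.map Prod.fst) = labels (⟨l, g, r⟩ :: w) := by
      intro h
      obtain ⟨S, h1, h2⟩ := ih L
      have hlab : g.label = none := by
        rcases h with rfl | rfl | rfl | rfl <;> rfl
      have e : labels (⟨l, g, r⟩ :: w) = labels w := by rw [labels_cons, hlab]; rfl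
      rw [e]
      have := Run.cons (A := List.replicate l none) (B := List.replicate r none ++ L.map some)
        (LocalStep.keep (σ := σ) g h) (fun _ => rfl) (S := S) (w := w)
        (ρ' := ((labels w).reverse ++ L).map some)
        (by rw [List.append_assoc, ← rep]; exact h1)
      rw [hfl, hfr] at this
      refine ⟨_, by rw [rep, ← List.append_assoc]; exact this, ?_⟩
      rw [List.map_cons, labels_cons, h2, hlab]; rfl
    cases g with
    | cup => exact keep (.inl rfl)
    | cap => exact keep (.inr (.inl rfl))
    | overX => exact keep (.inr (.inr (.inl rfl)))
    | underX => exact keep (.inr (.inr (.inr rfl)))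
    | virt => exact absurd rfl hg.1
    | mark e => exact absurd rfl (hg.2 e)
    -- The endpoint becomes a minimum with the marked point on its left strand, which goes on as the
    -- strand of the diagram. The right strand is the closure arc; it is slid to the right of the
    -- diagram. Since the latest arc comes first there, the labels are reversed at the top.
    | birth e =>
      obtain ⟨S, h1, h2⟩ := ih (e :: L)
      obtain ⟨S', h3, h4⟩ := Run.slide σ e (List.replicate r none) (List.replicate l none ++ [none]) (L.map some)
      have h5 := h3.append (S' := S) (w' := w) (ρ₃ := ((labels w).reverse ++ e :: L).map some) (by
        have e1 := fun M => rep l 1 r M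
        have e2 := fun M => rep l 0 r M
        simp only [List.replicate_zero, List.replicate_one, List.nil_append, Nat.add_zero] at e1 e2
        simpa [cod, e1, e2] using h1)
      have h6 := Run.stub (A := List.replicate l none) (B := List.replicate r none ++ L.map some) (σ := σ) (e := e)
        (S := S' ++ S) (w := w) (ρ' := ((labels w).reverse ++ e :: L).map some) (by simpa using h5)
      rw [hfl, hfr] at h6
      refine ⟨_, by rw [rep]; simpa [dom, labels_cons, label] using h6, ?_⟩
      simp only [List.map_cons, List.map_append, labels_cons, label, Option.toList_none, Option.toList_some,
        List.nil_append]
      rw [labels_append, h4, h2]; rfl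
    -- Above the marked point the old strand goes on as a closure arc, which is slid to the right in
    -- the same way.
    | death e =>
      obtain ⟨S, h1, h2⟩ := ih (e :: L)
      obtain ⟨S', h3, h4⟩ := Run.slide σ e (List.replicate r none) (List.replicate l none) (L.map some)
      have h5 := h3.append (S' := S) (w' := w) (ρ₃ := ((labels w).reverse ++ e :: L).map some) (by
        have e1 := fun M => rep l 1 r M
        have e2 := fun M => rep l 0 r M
        simp only [List.replicate_zero, List.replicate_one, List.nil_append, Nat.add_zero] at e1 e2
        simpa [cod, e1, e2] using h1)
      have h6 := Run.cons (A := List.replicate l none) (B := List.replicate r none ++ L.map some)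
        (LocalStep.death (σ := σ) e) (by simp)
        (S := S' ++ S) (w := w) (ρ' := ((labels w).reverse ++ e :: L).map some) (by simpa using h5)
      rw [hfl, hfr] at h6
      refine ⟨_, by rw [rep]; simpa [dom, labels_cons, label] using h6, ?_⟩
      simp only [List.map_cons, List.map_append, labels_cons, label, Option.toList_some]
      rw [labels_append, h4, h2]; rfl

end Existence

/-! ### The marked rows of a run form a closure picture -/

section Existence

variable {ι : Type}

/-- The row with index `t`. -/
def rowAt (ρ : List (Option ι)) (S : List (Layer ι × List (Option ι))) (t : ℕ) : List (Option ι) :=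
  ((ρ :: S.map Prod.snd)[t]?).getD []

/-- The mark of a point. -/
def markAt (ρ : List (Option ι)) (S : List (Layer ι × List (Option ι))) (z : ℕ × ℕ) : Option ι :=
  (rowAt ρ S z.1)[z.2]?.join

theorem rowAt_succ (ρ : List (Option ι)) (y : Layer ι × List (Option ι)) (S : List (Layer ι × List (Option ι)))
    (t : ℕ) : rowAt ρ (y :: S) (t + 1) = rowAt y.2 S t := rfl

theorem LocalStep.length_left {σ : ι → ι} {X Y : List (Option ι)} {g : Gen ι} {o : Option (Gen ι)}
    (h : LocalStep σ X g Y o) : X.length = g.dom := by cases h <;> simp [dom]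

theorem LocalStep.length_right {σ : ι → ι} {X Y : List (Option ι)} {g : Gen ι} {o : Option (Gen ι)}
    (h : LocalStep σ X g Y o) : Y.length = g.cod := by cases h <;> simp [cod]

theorem Run.isWord {σ : ι → ι} {ρ ρ' : List (Option ι)} {S : List (Layer ι × List (Option ι))} {w : Word ι}
    (h : Run σ ρ S w ρ') : IsWord ρ.length (S.map Prod.fst) ρ'.length := by
  induction h with
  | nil => rfl
  | cons h _ _ ih =>
    refine ⟨?_, ?_⟩
    · simp [Layer.source, h.length_left, Nat.add_assoc]
    · convert ih using 1
      simp [Layer.target, h.length_right, Nat.add_assoc]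
  | stub _ ih =>
    refine ⟨by simp [Layer.source, dom], ?_, ?_⟩
    · simp [Layer.source, Layer.target, dom, cod]; omega
    · convert ih using 1
      simp [Layer.target, cod]; omega

theorem Run.rowAt_length {σ : ι → ι} {ρ ρ' : List (Option ι)} {S : List (Layer ι × List (Option ι))} {w : Word ι}
    (h : Run σ ρ S w ρ') : rowAt ρ S S.length = ρ' := by
  induction h with
  | nil => rfl
  | cons _ _ _ ih => exact ih
  | stub _ ih => exact ih

/-- The layer with index `t`. -/
theorem Run.layer {σ : ι → ι} {ρ ρ' : List (Option ι)} {S : List (Layer ι × List (Option ι))} {w : Word ι}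
    (h : Run σ ρ S w ρ') : ∀ {t : ℕ} {x : Layer ι}, (S.map Prod.fst)[t]? = some x →
    ∃ (A X Y B : List (Option ι)) (g : Gen ι) (o : Option (Gen ι)), LocalStep σ X g Y o ∧
      x = ⟨A.length, g, B.length⟩ ∧ rowAt ρ S t = A ++ X ++ B ∧ rowAt ρ S (t + 1) = A ++ Y ++ B ∧
      (g = .cup → o = none → ∃ e r, Y = [some e, some e] ∧
        (S.map Prod.fst)[t + 1]? = some ⟨A.length, mark e, r⟩) := by
  induction h with
  | nil => intro t x h; simp at h
  | @cons A B X Y _ g o S w h hg _ ih =>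
    intro t x hx
    cases t with
    | zero =>
      refine ⟨A, X, Y, B, g, o, h, ?_, rfl, ?_, ?_⟩
      · simpa using hx.symm
      · cases S <;> rfl
      · intro h1 h2; rw [h2] at hg; simp at hg; exact absurd h1 hg
    | succ t => exact ih hx
  | @stub A B _ e S w _ ih =>
    intro t x hx
    rcases t with _ | _ | t
    · refine ⟨A, [], [some e, some e], B, .cup, none, .cup e, by simpa using hx.symm, by simp [rowAt], by simp [rowAt],
        fun _ _ => ⟨e, B.length + 1, rfl, rfl⟩⟩
    · refine ⟨A, [some e], [none], some e :: B, mark e, _, .birth e, by simpa using hx.symm, by simp [rowAt],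
        ?_, by simp⟩
      rw [rowAt_succ, rowAt_succ]
      cases S <;> simp [rowAt]
    · exact ih hx

theorem count_free (f : ℕ → Bool) (A : List (Option ι)) (h : ∀ i < A.length, f i = (A[i]?.join).isSome) :
    Nat.count (fun i => f i = false) A.length = free A := by
  induction A using List.reverseRecOn with
  | nil => rfl
  | append_singleton A a ih =>
    rw [free_append, List.length_append, List.length_singleton, Nat.count_succ, ih]
    · have := h A.length (by simp)
      rw [this]
      cases a <;> simp [free]
    · intro i hi
      rw [h i (by simp; omega), List.getElem?_append_left hi]

theorem LocalStep.eraseLayer {σ : ι → ι} {X Y A B : List (Option ι)} {g : Gen ι} {o : Option (Gen ι)}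
    (h : LocalStep σ X g Y o) {arc : ℕ × ℕ → Bool} {t : ℕ}
    (h1 : ∀ p, arc (t, p) = ((A ++ X ++ B)[p]?.join).isSome)
    (h2 : ∀ p, arc (t + 1, p) = ((A ++ Y ++ B)[p]?.join).isSome) :
    eraseLayer arc ⟨A.length, g, B.length⟩ t = o.map fun g => ⟨free A, g, free B⟩ := by
  have hd := h.length_left
  have cA : Nat.count (fun p => arc (t, p) = false) A.length = free A := count_free _ A fun i hi => by
    rw [h1, List.append_assoc, List.getElem?_append_left hi]
  have cB : Nat.count (fun p => arc (t, A.length + g.dom + p) = false) B.length = free B :=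
    count_free (fun p => arc (t, A.length + g.dom + p)) B fun i _ => by
      rw [h1, List.getElem?_append_right (by simp [hd])]
      congr 3
      simp [hd]
  have b0 := h1 A.length
  have b1 := h1 (A.length + 1)
  have t0 := h2 A.length
  unfold VirtualClosure.eraseLayer
  simp only [cA, cB]
  cases h with
  | keep g h =>
    rcases h with rfl | rfl | rfl | rfl
    · simp only [cod, List.append_assoc, List.replicate_succ, List.cons_append] at t0
      simp at t0
      simp [t0]
    · simp only [dom, List.append_assoc, List.replicate_succ, List.cons_append] at b0
      simp at b0
      simp [b0]
    · rfl
    · rfl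
  | cup e => simp at t0; simp [t0]
  | cap e => simp at b0; simp [b0]
  | virt x y h =>
    simp only [List.append_assoc, List.cons_append, List.nil_append, List.getElem?_append_right (Nat.le_refl _),
      List.getElem?_append_right (Nat.le_add_right _ _)] at b0 b1
    simp at b0 b1
    have : (x.isSome || y.isSome) = true := by simpa using h
    simp [b0, b1, this]
  | birth e => simp at b0; simp [b0]
  | death e => simp at b0; simp [b0]

theorem Run.erase {σ : ι → ι} {ρ ρ' : List (Option ι)} {S : List (Layer ι × List (Option ι))} {w : Word ι}
    (h : Run σ ρ S w ρ') : ∀ {arc : ℕ × ℕ → Bool} {t : ℕ},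
    (∀ i p, arc (t + i, p) = (markAt ρ S (i, p)).isSome) → eraseFrom arc t (S.map Prod.fst) = w := by
  induction h with
  | nil => intros; rfl
  | @cons A B X Y _ g o S w h hg hS ih =>
    intro arc t ha
    rw [List.map_cons, eraseFrom_cons, ih (t := t + 1) (fun i p => by rw [Nat.add_right_comm, Nat.add_assoc, ha]; rfl),
      h.eraseLayer (t := t) (fun p => ha 0 p) fun p => ?_]
    rw [ha 1 p]
    cases S <;> rfl
  | @stub A B _ e S w hS ih =>
    intro arc t ha
    have e1 := LocalStep.eraseLayer (σ := σ) (A := A) (B := B) (.cup e) (arc := arc) (t := t)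
      (fun p => by simpa [markAt, rowAt] using ha 0 p) (fun p => by simpa [markAt, rowAt] using ha 1 p)
    have e2 := LocalStep.eraseLayer (σ := σ) (A := A) (B := some e :: B) (.birth e) (arc := arc) (t := t + 1)
      (fun p => by simpa [markAt, rowAt] using ha 1 p) (fun p => by
        have := ha 2 p
        rw [markAt, rowAt_succ, rowAt_succ] at this
        rw [show t + 1 + 1 = t + 2 from rfl, this]
        cases S <;> simp [rowAt])
    rw [List.map_cons, List.map_cons, eraseFrom_cons, eraseFrom_cons, ih (t := t + 1 + 1) (fun i p => by
      rw [show t + 1 + 1 + i = t + (i + 2) by omega, ha]; rfl), e1]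
    simp only [List.length_cons] at e2
    rw [e2]
    simp [free]

/-- Marks change only at maxima, or at marked points. -/
theorem Run.markAt_link {σ : ι → ι} {ρ ρ' : List (Option ι)} {S : List (Layer ι × List (Option ι))} {w : Word ι}
    (h : Run σ ρ S w ρ') {y z : ℕ × ℕ} (hl : Link (S.map Prod.fst) y z) :
    markAt ρ S y = markAt ρ S z ∨ ∃ e, markAt ρ S y = some e ∧ markAt ρ S z = some (σ e) := by
  obtain ⟨t, x, hx, hl⟩ := hl.layerLink
  obtain ⟨A, X, Y, B, g, o, hs, rfl, h1, h2, -⟩ := h.layer hx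
  have hd := hs.length_left
  have hc := hs.length_right
  cases hl with
  | left hp =>
    left
    simp only at hp
    simp only [markAt, h1, h2, List.append_assoc, List.getElem?_append_left hp]
  | @right p hp =>
    left
    have e1 : (A ++ X ++ B)[A.length + g.dom + p]? = B[p]? := by
      rw [List.getElem?_append_right (by simp [hd])]; congr 1; simp [hd]
    have e2 : (A ++ Y ++ B)[A.length + g.cod + p]? = B[p]? := by
      rw [List.getElem?_append_right (by simp [hc])]; congr 1; simp [hc]
    simp only [markAt, h1, h2, e1, e2]
  | cup hg =>
    left
    simp only at hg
    subst hg
    cases hs <;> simp [markAt, h2, cod, List.replicate_succ]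
  | cap hg =>
    simp only at hg
    subst hg
    cases hs with
    | keep => left; simp [markAt, h1, dom, List.replicate_succ]
    | cap e => right; exact ⟨e, by simp [markAt, h1], by simp [markAt, h1]⟩
  | rising hg =>
    left
    rcases hg with (hg | hg) | hg <;> simp only at hg <;> subst hg <;> cases hs <;>
      simp [markAt, h1, h2, dom, cod, List.replicate_succ]
  | falling hg =>
    left
    rcases hg with (hg | hg) | hg <;> simp only at hg <;> subst hg <;> cases hs <;>
      simp [markAt, h1, h2, dom, cod, List.replicate_succ]

/-- Every point of a closure arc is connected with an end of the arc. -/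
theorem Run.exists_endAt {σ : ι → ι} {ρ' : List (Option ι)} {S : List (Layer ι × List (Option ι))} {w : Word ι}
    (h : Run σ [] S w ρ') : ∀ {t p : ℕ} {e : ι}, markAt [] S (t, p) = some e →
    ∃ y, EndAt (S.map Prod.fst) e y ∧ (markAt [] S y).isSome ∧ Joined (S.map Prod.fst) (t, p) y
  | 0, p, e, hm => by simp [markAt, rowAt] at hm
  | t + 1, p, e, hm => by
    have ht : t < S.length := by
      by_contra ht
      have : rowAt [] S (t + 1) = [] := by
        rw [rowAt, List.getElem?_eq_none (by simp; omega)]; rfl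
      simp [markAt, this] at hm
    obtain ⟨x, hx⟩ : ∃ x, (S.map Prod.fst)[t]? = some x := ⟨_, List.getElem?_eq_getElem (by simpa using ht)⟩
    obtain ⟨A, X, Y, B, g, o, hs, rfl, h1, h2, h3⟩ := h.layer hx
    have hd := hs.length_left
    have hc := hs.length_right
    -- If the strand comes from the row below with the same mark, it is followed downwards by
    -- recursion on the height.
    have up : ∀ {q}, Link (S.map Prod.fst) (t, q) (t + 1, p) → markAt [] S (t, q) = some e →
        ∃ y, EndAt (S.map Prod.fst) e y ∧ (markAt [] S y).isSome ∧ Joined (S.map Prod.fst) (t + 1, p) y := by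
      intro q hl hq
      obtain ⟨y, hy1, hy2, hy3⟩ := h.exists_endAt hq
      exact ⟨y, hy1, hy2, (Relation.EqvGen.rel _ _ hl).symm.trans _ _ _ hy3⟩
    rcases Nat.lt_or_ge p A.length with hp | hp
    · refine up (.left hx hp) ?_
      rw [← hm]
      simp only [markAt, h1, h2, List.append_assoc, List.getElem?_append_left hp]
    rcases Nat.lt_or_ge p (A.length + g.cod) with hp' | hp'
    · obtain ⟨i, rfl⟩ := Nat.exists_eq_add_of_le hp
      have hi : i < g.cod := by omega
      have hY : Y[i]?.join = some e := by
        rw [← hm]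
        simp only [markAt, h2]
        rw [List.append_assoc, List.getElem?_append_right (by omega), Nat.add_sub_cancel_left,
          List.getElem?_append_left (by omega)]
      cases hs with
      | keep g _ => simp [hi] at hY
      | cap e => simp at hY
      | virt x y _ =>
        obtain rfl | rfl : i = 0 ∨ i = 1 := by simp only [cod] at hi; omega
        · exact up (.falling hx (.inr rfl)) (by simpa [markAt, h1] using hY)
        · exact up (.rising hx (.inr rfl)) (by simpa [markAt, h1] using hY)
      | birth e => simp only [cod] at hi; simp_all
      | death e' =>
        obtain rfl : i = 0 := by simp only [cod] at hi; omega
        obtain rfl : e' = e := by simpa using hY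
        exact ⟨_, .above hx rfl, by simp [markAt, h2], .refl _⟩
      | cup e' =>
        obtain ⟨e'', r, hYe, hx'⟩ := h3 rfl rfl
        obtain rfl : e' = e'' := by simpa using hYe
        have hj : Joined (S.map Prod.fst) (t + 1, A.length + i) (t + 1, A.length) := by
          obtain rfl | rfl : i = 0 ∨ i = 1 := by simp only [cod] at hi; omega
          · exact .refl _
          · exact (Relation.EqvGen.rel _ _ (.cup hx rfl)).symm
        obtain rfl : e' = e := by
          obtain rfl | rfl : i = 0 ∨ i = 1 := by simp only [cod] at hi; omega
          all_goals simpa using hY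
        exact ⟨_, .below hx' rfl, by simp [markAt, h2], hj⟩
    · obtain ⟨i, rfl⟩ := Nat.exists_eq_add_of_le hp'
      have hB : B[i]?.join = some e := by
        rw [← hm]
        simp only [markAt, h2]
        rw [List.getElem?_append_right (by simp [hc])]
        congr 2; simp [hc]
      have hi : i < B.length := by
        by_contra hi
        rw [List.getElem?_eq_none (by omega)] at hB
        simp at hB
      refine up (.right hx hi) ?_
      rw [← hB]
      simp only [markAt, h1]
      rw [List.getElem?_append_right (by simp [hd])]
      congr 2; simp [hd]

/-- Above the last marked point, each strand of a closure arc goes to the strand that it shall be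
connected with. -/
theorem Run.exists_joined {σ : ι → ι} (hσ : ∀ e, σ (σ e) = e) {ρ : List (Option ι)}
    {S : List (Layer ι × List (Option ι))} {w : Word ι} (h : Run σ ρ S w []) {m : ℕ}
    (hm : ∀ (t : ℕ) (x : Layer ι), m ≤ t → (S.map Prod.fst)[t]? = some x → x.gen.label = none) :
    ∀ (n t p : ℕ) (e : ι), n + t = S.length → m ≤ t → markAt ρ S (t, p) = some e →
      ∃ z, markAt ρ S z = some (σ e) ∧ Joined (S.map Prod.fst) (t, p) z
  | 0, t, p, e, ht, _, hp => by
    rw [Nat.zero_add] at ht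
    rw [markAt, ht, h.rowAt_length] at hp
    simp at hp
  | n + 1, t, p, e, ht, hmt, hp => by
    obtain ⟨x, hx⟩ : ∃ x, (S.map Prod.fst)[t]? = some x :=
      ⟨_, List.getElem?_eq_getElem (by rw [List.length_map]; omega)⟩
    obtain ⟨A, X, Y, B, g, o, hs, rfl, h1, h2, -⟩ := h.layer hx
    have hd := hs.length_left
    have hc := hs.length_right
    have up : ∀ {q}, Link (S.map Prod.fst) (t, p) (t + 1, q) → markAt ρ S (t + 1, q) = some e →
        ∃ z, markAt ρ S z = some (σ e) ∧ Joined (S.map Prod.fst) (t, p) z := by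
      intro q hl hq
      obtain ⟨z, hz1, hz2⟩ := Run.exists_joined hσ h hm n (t + 1) q e (by omega) (by omega) hq
      exact ⟨z, hz1, (Relation.EqvGen.rel _ _ hl).trans _ _ _ hz2⟩
    rcases Nat.lt_or_ge p A.length with hp1 | hp1
    · refine up (.left hx hp1) ?_
      rw [← hp]
      simp only [markAt, h1, h2, List.append_assoc, List.getElem?_append_left hp1]
    rcases Nat.lt_or_ge p (A.length + g.dom) with hp' | hp'
    · obtain ⟨i, rfl⟩ := Nat.exists_eq_add_of_le hp1
      have hi : i < g.dom := by omega
      have hX : X[i]?.join = some e := by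
        rw [← hp]
        simp only [markAt, h1]
        rw [List.append_assoc, List.getElem?_append_right (by omega), Nat.add_sub_cancel_left,
          List.getElem?_append_left (by omega)]
      cases hs with
      | keep g _ => simp [hi] at hX
      | cup e => simp at hX
      | virt x y _ =>
        obtain rfl | rfl : i = 0 ∨ i = 1 := by simp only [dom] at hi; omega
        · exact up (.rising hx (.inr rfl)) (by simpa [markAt, h2] using hX)
        · exact up (.falling hx (.inr rfl)) (by simpa [markAt, h2] using hX)
      | birth e => exact absurd (hm t _ hmt hx) (by simp [label])
      | death e => exact absurd (hm t _ hmt hx) (by simp [label])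
      | cap e' =>
        obtain rfl | rfl : i = 0 ∨ i = 1 := by simp only [dom] at hi; omega
        · obtain rfl : e' = e := by simpa using hX
          exact ⟨_, by simp [markAt, h1], .rel _ _ (.cap hx rfl)⟩
        · obtain rfl : σ e' = e := by simpa using hX
          refine ⟨(t, A.length), by simp [markAt, h1, hσ], (Relation.EqvGen.rel _ _ (.cap hx rfl)).symm⟩
    · obtain ⟨i, rfl⟩ := Nat.exists_eq_add_of_le hp'
      have hB : B[i]?.join = some e := by
        rw [← hp]
        simp only [markAt, h1]
        rw [List.getElem?_append_right (by simp [hd])]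
        congr 2; simp [hd]
      have hi : i < B.length := by
        by_contra hi
        rw [List.getElem?_eq_none (by omega)] at hB
        simp at hB
      refine up (.right hx hi) ?_
      rw [← hB]
      simp only [markAt, h2]
      rw [List.getElem?_append_right (by simp [hc])]
      congr 2; simp [hc]

/-- A marked point has one strand below and one above, so that its layer can be left out. -/
theorem isWord_forgetMarks {w : Word ι} (hw : ∀ x ∈ w, ∀ e, x.gen ≠ Gen.birth e ∧ x.gen ≠ Gen.death e) :
    ∀ {a b : ℕ}, IsWord a w b → IsWord a (forgetMarks w) b := by
  induction w with
  | nil => exact fun h => h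
  | cons x w ih =>
    intro a b h
    have ih' := ih (fun y hy => hw y (List.mem_cons_of_mem _ hy)) h.2
    have hx := hw x (by simp)
    have h1 := h.1
    simp only [Layer.source, Layer.target] at h1 ih'
    rw [forgetMarks, List.filterMap_cons]
    cases hg : x.gen <;> rw [hg] at h1 ih' <;> simp only [dom, cod] at h1 ih'
    case birth e => exact absurd hg (hx e).1
    case death e => exact absurd hg (hx e).2
    case mark e => rw [h1]; exact ih'
    all_goals exact ⟨h1, ih'⟩

/-- A label occurs at one marked point only, where two strands end; exactly one of them is on a
closure arc. -/
theorem EndAt.unique {n : ℕ} {P : Word (Fin (2 * n))} {arc : ℕ × ℕ → Bool}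
    (hne : ∀ x ∈ P, ∀ e, x.gen ≠ Gen.birth e ∧ x.gen ≠ Gen.death e) (hl : ∀ e, (labels P).count e = 1)
    (hch : ∀ (t : ℕ) (x : Layer (Fin (2 * n))) (e : Fin (2 * n)), P[t]? = some x → x.gen = Gen.mark e →
      arc (t, x.left) ≠ arc (t + 1, x.left)) {e : Fin (2 * n)} {y z : ℕ × ℕ} (hy : EndAt P e y)
    (hz : EndAt P e z) (h : arc y = arc z) : y = z := by
  have key : ∀ {y}, EndAt P e y → ∃ (t : ℕ) (x : Layer (Fin (2 * n))), P[t]? = some x ∧ x.gen = mark e ∧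
      (y = (t, x.left) ∨ y = (t + 1, x.left)) := by
    intro y hy
    cases hy with
    | birth h1 h2 => exact absurd h2 (hne _ (List.mem_of_getElem? h1) _).1
    | death h1 h2 => exact absurd h2 (hne _ (List.mem_of_getElem? h1) _).2
    | below h1 h2 => exact ⟨_, _, h1, h2, .inl rfl⟩
    | above h1 h2 => exact ⟨_, _, h1, h2, .inr rfl⟩
  obtain ⟨t, x, h1, h2, h3⟩ := key hy
  obtain ⟨t', x', h1', h2', h3'⟩ := key hz
  obtain rfl := index_unique (hl e) h1 h1' (by rw [h2]; rfl) (by rw [h2']; rfl)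
  obtain rfl : x = x' := Option.some.inj (h1.symm.trans h1')
  have := hch t x e h1 h2
  rcases h3 with rfl | rfl <;> rcases h3' with rfl | rfl
  · rfl
  · exact absurd h this
  · exact absurd h.symm this
  · rfl

/-- The picture consists of a run through the diagram, which leads all closure arcs to the top on
the right, and a run that connects them in pairs. A point is on a closure arc when it carries a
mark. -/
theorem LinkoidDiagram.exists_isVirtualClosure {n : ℕ} (D : LinkoidDiagram n) (σ : Pairing n) :
    ∃ K, IsVirtualClosure D σ K := by
  obtain ⟨S₁, h1, l1⟩ := Run.exists_of_isWord σ.1 (w := D.word) (a := 0) [] D.closed D.classical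
  have hL : ∀ e, e ∈ labels D.word := fun e => List.count_pos_iff.1 (by rw [D.labelled e]; exact one_pos)
  simp only [List.append_nil] at h1
  obtain ⟨S₂, h2, l2⟩ := Run.pairing σ.1 σ.2 _ (labels D.word).reverse rfl
    (List.nodup_reverse.2 (List.nodup_iff_count_le_one.2 fun e => (D.labelled e).le))
    (fun e _ => List.mem_reverse.2 (hL _))
  have hS := h1.append h2
  simp only [List.append_nil, List.replicate_zero, List.map_nil] at hS
  set S := S₁ ++ S₂ with hSdef
  set P := S.map Prod.fst with hP
  have hlab : labels P = labels D.word := by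
    rw [hP, hSdef, List.map_append, labels_append, l1, l2, List.append_nil]
  have hne : ∀ x ∈ P, ∀ e, x.gen ≠ Gen.birth e ∧ x.gen ≠ Gen.death e := by
    intro x hx e
    obtain ⟨t, ht⟩ := List.mem_iff_getElem?.1 hx
    obtain ⟨A, X, Y, B, g, o, hs, rfl, -⟩ := hS.layer ht
    cases hs with
    | keep g h => rcases h with rfl | rfl | rfl | rfl <;> simp
    | _ => simp
  have hch : ∀ (t : ℕ) (x : Layer (Fin (2 * n))) (e : Fin (2 * n)), P[t]? = some x → x.gen = Gen.mark e →
      (markAt [] S (t, x.left)).isSome ≠ (markAt [] S (t + 1, x.left)).isSome := by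
    intro t x e ht hg
    obtain ⟨A, X, Y, B, g, o, hs, rfl, h1, h2, -⟩ := hS.layer ht
    simp only at hg
    subst hg
    cases hs with
    | keep g h => rcases h with h | h | h | h <;> cases h
    | birth e => simp [markAt, h1, h2]
    | death e => simp [markAt, h1, h2]
  have hc : ∀ y z, Link P y z → (markAt [] S y).isSome = (markAt [] S z).isSome := by
    intro y z h
    rcases hS.markAt_link h with h | ⟨e, h, h'⟩
    · rw [h]
    · rw [h, h']; rfl
  have hlabelled : ∀ e, (labels P).count e = 1 := fun e => by rw [hlab]; exact D.labelled e
  have hj : ∀ y z, Joined P y z → (markAt [] S y).isSome = (markAt [] S z).isSome := by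
    intro y z h
    induction h with
    | rel _ _ h => exact hc _ _ h
    | refl => rfl
    | symm _ _ _ ih => exact ih.symm
    | trans _ _ _ _ _ ih1 ih2 => exact ih1.trans ih2
  refine ⟨⟨forgetMarks P, isWord_forgetMarks hne hS.isWord⟩, P, fun z => (markAt [] S z).isSome,
    ⟨hS.isWord, hne, hlabelled, hc, hch, ?_, ?_, ?_⟩, hS.erase (t := 0) (fun i p => by rw [Nat.zero_add]), rfl⟩
  · intro t x ht hg
    obtain ⟨A, X, Y, B, g, o, hs, rfl, h1, h2, -⟩ := hS.layer ht
    simp only at hg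
    rcases hg with rfl | rfl <;> cases hs <;> simp [markAt, h1, dom, List.replicate_succ]
  -- In the row between the two runs each label marks a strand. Going down, this strand reaches the
  -- end `e`. Going up, it reaches a maximum where it meets the mark `σ e`, from which one descends
  -- to the end `σ e`.
  · intro e y z hy hya hz hza
    have hrow : rowAt [] S S₁.length = (labels D.word).reverse.map some := by
      rw [← h1.rowAt_length, hSdef]
      simp only [rowAt, List.map_append]
      rw [← List.cons_append, List.getElem?_append_left (by simp)]
      rfl
    obtain ⟨p, hp⟩ : ∃ p, markAt [] S (S₁.length, p) = some e := by
      obtain ⟨p, hp⟩ := List.mem_iff_getElem?.1 (List.mem_reverse.2 (hL e))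
      exact ⟨p, by rw [markAt, hrow, List.getElem?_map, hp]; rfl⟩
    obtain ⟨y', hy1, hy2, hy3⟩ := hS.exists_endAt hp
    obtain ⟨z', hz1, hz2⟩ := Run.exists_joined (fun e => (σ.2 e).1) hS (m := S₁.length) (by
      intro t x ht hx
      rw [hSdef, List.map_append, List.getElem?_append_right (by simpa using ht)] at hx
      cases hl : x.gen.label with
      | none => rfl
      | some e' =>
        have := mem_labels.2 ⟨_, _, hx, hl⟩
        rw [l2] at this
        cases this) S₂.length S₁.length p e (by rw [hSdef, List.length_append]; omega) le_rfl hp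
    obtain ⟨z'', hz3, hz4, hz5⟩ := hS.exists_endAt (t := z'.1) (p := z'.2) hz1
    have uniq := fun {e y z} => @EndAt.unique n P (fun z => (markAt [] S z).isSome) hne hlabelled hch e y z
    rw [uniq hy hy1 (hya.trans hy2.symm), uniq hz hz3 (hza.trans hz4.symm)]
    exact (hy3.symm.trans _ _ _ hz2).trans _ _ _ hz5
  · intro z _ hz
    obtain ⟨e, he⟩ := Option.isSome_iff_exists.1 hz
    obtain ⟨y, h1, -, h3⟩ := hS.exists_endAt (t := z.1) (p := z.2) he
    exact ⟨e, y, h1, h3⟩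

end Existence

/-! ### Layerwise closures -/

section CloseOps

variable {ι : Type}

/-- The ops of the part of a closure picture that contains `w`, followed by `z`: closure arcs go to the right
from all endpoints. -/
def closeOps : Word ι → List (Op Empty) → List (Op Empty)
  | [], z => z
  | ⟨l, .birth _, r⟩ :: w, z => (l, cup) :: shift (l + 1) r (closeOps w z)
  | ⟨l, .death _, r⟩ :: w, z => shift l r (closeOps w z)
  | ⟨l, g, _⟩ :: w, z => (g.forgetMark.map fun g => (l, g)).toList ++ closeOps w z

theorem closeOps_append : ∀ (u v : Word ι) (z : List (Op Empty)),
    closeOps (u ++ v) z = closeOps u (closeOps v z)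
  | [], _, _ => rfl
  | ⟨l, g, r⟩ :: u, v, z => by
    cases g <;> simp only [List.cons_append, closeOps, closeOps_append u v z]

/-- Each endpoint of `w` adds one strand on the right, besides the `k` strands that are already
there. This explains the number of strands above `w`. -/
theorem VE.closeOps {u v : List (Op Empty)} : ∀ {w : Word ι} {n m k : ℕ}, IsWord n w m →
    (∀ x ∈ w, x.gen ≠ Gen.virt ∧ ∀ e, x.gen ≠ Gen.mark e) →
    VE (m + ((labels w).length + k)) u v → VE (n + k) (closeOps w u) (closeOps w v)
  | [], n, m, k, hw, _, h => h.of_len (by rw [show n = m from hw]; simp [labels])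
  | ⟨l, g, r⟩ :: w, n, m, k, hw, hc, h => by
    obtain ⟨h1, h2⟩ := hw
    simp only [Layer.source, Layer.target] at h1 h2
    subst h1
    have hc' := hc ⟨l, g, r⟩ (by simp)
    rw [labels_cons, List.length_append] at h
    have hcw : ∀ x ∈ w, x.gen ≠ Gen.virt ∧ ∀ e, x.gen ≠ Gen.mark e := fun x hx => hc x (List.mem_cons_of_mem _ hx)
    cases g
    case virt => exact absurd rfl hc'.1
    case mark e => exact absurd rfl (hc'.2 e)
    case birth e =>
      have := VE.closeOps (k := k + 1) h2 hcw (h.of_len (by simp [label]; omega))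
      refine .cons' (m := l + r + k + 2) _ (by simp [dom]; omega) (by simp [dom, cod]) ?_
      exact VE.shift (this.of_len (by simp [cod]; omega)) (by omega)
    case death e =>
      have := VE.closeOps (k := k + 1) h2 hcw (h.of_len (by simp [label]; omega))
      exact VE.shift (this.of_len (by simp [dom, cod]; omega)) (by simp [dom]; omega)
    all_goals
      have := VE.closeOps (k := k) h2 hcw (h.of_len (by simp [label]))
      exact .cons' _ (by simp only [dom]; omega) (by simp only [dom, cod] <;> omega) this

/-- The way back from networks to words: the closure is drawn layer by layer, with the arcs `ρ` on
the right. A new arc is placed before the older ones, hence the reversed labels. In this form the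
layers of `w` are present, and moves can be applied to them. -/
theorem VE.netClose {γ : Type} [DecidableEq γ] {b : ι → γ} {β δ : List ℕ} {w : Word ι} {T : List (Tensor ι ℕ)}
    (h : Named β w T δ) (hw : ∀ x ∈ w, x.gen ≠ Gen.virt ∧ ∀ e, x.gen ≠ Gen.mark e) :
    ∀ {ρ : List (ℕ ⊕ γ)} {R : List (Tensor Empty (ℕ ⊕ γ))} {n : ℕ},
    Good (β.map Sum.inl ++ ρ) (T.map (Tensor.close b) ++ R) → n = (β.map Sum.inl ++ ρ).length →
    VE n (VirtualClosure.closeOps w (net (δ.map Sum.inl ++ ((labels w).reverse.map (Sum.inr ∘ b) ++ ρ)) R))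
      (net (β.map Sum.inl ++ ρ) (T.map (Tensor.close b) ++ R)) := by
  induction h with
  | nil β => intro ρ R n hG hn; subst hn; exact refl (ok_net hG)
  | @cons β₁ bot top β₂ δ g w T l r hl hr hb ht h ih =>
    intro ρ R n hG hn
    have hg := hw ⟨l, g, r⟩ (by simp)
    have ih := fun {ρ R n} => ih (fun x hx => hw x (List.mem_cons_of_mem _ hx)) (ρ := ρ) (R := R) (n := n)
    have eb : (β₁ ++ bot ++ β₂).map Sum.inl ++ ρ =
        (β₁.map Sum.inl ++ bot.map Sum.inl ++ (β₂.map Sum.inl ++ ρ) : List (ℕ ⊕ γ)) := by simp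
    have et : (β₁ ++ top ++ β₂).map Sum.inl ++ ρ =
        (β₁.map Sum.inl ++ top.map Sum.inl ++ (β₂.map Sum.inl ++ ρ) : List (ℕ ⊕ γ)) := by simp
    have hn' : n = l + g.dom + r + ρ.length := by rw [hn]; simp [hl, hr, hb]; omega
    have lt : l + g.cod + r + ρ.length = ((β₁ ++ top ++ β₂).map Sum.inl ++ ρ : List (ℕ ⊕ γ)).length := by
      simp [hl, ht, hr]; omega
    rw [eb] at hG hn ⊢
    rw [List.map_cons, List.cons_append] at hG ⊢
    have piece : ∀ g' : Gen Empty, g.forgetMark = some g' → g'.dom = g.dom → g'.cod = g.cod →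
        VE n ((l, g') :: VirtualClosure.closeOps w
            (net (δ.map Sum.inl ++ ((labels w).reverse.map (Sum.inr ∘ b) ++ ρ)) R))
          (net (β₁.map Sum.inl ++ bot.map Sum.inl ++ (β₂.map Sum.inl ++ ρ))
            (Tensor.close b ⟨g, bot, top⟩ :: (T.map (Tensor.close b) ++ R))) := by
      intro g' hg' hd hc
      have e : Tensor.close b (⟨g, bot, top⟩ : Tensor ι ℕ) = ⟨g', bot.map Sum.inl, top.map Sum.inl⟩ := by
        simp only [Tensor.close, hg']
      rw [e] at hG ⊢
      have hG' := hG.unpiece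
      have s := VE.netPiece hG hn (List.length_map (as := β₁) (Sum.inl : ℕ → ℕ ⊕ γ) ▸ hl.symm)
      simp only at s hG'
      rw [← et] at s hG'
      exact trans (.cons' (m := l + g.cod + r + ρ.length) _ (by simp only [hn', hd]; omega)
        (by simp only [hn', hd, hc]; omega) (ih hG' lt)) s
    cases g
    case virt => exact absurd rfl hg.1
    case mark e => exact absurd rfl (hg.2 e)
    case birth e =>
      obtain rfl := List.length_eq_zero_iff.1 hb
      obtain ⟨d, rfl⟩ := List.length_eq_one_iff.1 ht
      have e1 : Tensor.close b (⟨.birth e, [], [d]⟩ : Tensor ι ℕ) = ⟨cup, [], [Sum.inl d, Sum.inr (b e)]⟩ := by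
        simp [Tensor.close, forgetMark, label]
      rw [e1] at hG ⊢
      have hG' := hG.unpiece
      have s1 := VE.netPiece hG hn (List.length_map (as := β₁) (Sum.inl : ℕ → ℕ ⊕ γ) ▸ hl.symm)
      have e2 : β₁.map Sum.inl ++ [Sum.inl d, Sum.inr (b e)] ++ (β₂.map Sum.inl ++ ρ) =
        (β₁.map Sum.inl ++ [Sum.inl d]) ++ Sum.inr (b e) :: (β₂.map Sum.inl ++ ρ) := by simp
      have e3 : (β₁.map Sum.inl ++ [Sum.inl d]) ++ (β₂.map Sum.inl ++ Sum.inr (b e) :: ρ) =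
        (β₁ ++ [d] ++ β₂).map Sum.inl ++ Sum.inr (b e) :: ρ := by simp
      have e4 : (labels (⟨l, .birth e, r⟩ :: w)).reverse.map (Sum.inr ∘ b) ++ ρ =
        (labels w).reverse.map (Sum.inr ∘ b) ++ Sum.inr (b e) :: ρ := by simp [labels_cons, label]
      simp only at s1 hG'
      rw [e2] at s1 hG'
      have hG2 := hG'.reorder (γ := (β₁ ++ [d] ++ β₂).map Sum.inl ++ Sum.inr (b e) :: ρ) (by
        rw [← e3]; exact List.Perm.append_left _ List.perm_middle.symm)
      have s2 := VE.netShift hG' (n := n + 2) (l := l + 1) (by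
        rw [hn']; simp [hl, hr, dom]; omega) (by simp [hl])
      rw [e3, List.length_map, hr] at s2
      rw [e4]
      simp only [dom] at hn'
      exact trans (.cons (m := n + 2) l cup (trans (VE.shift (ih hG2 (by rw [hn']; simp [hl, hr]; omega))
        (by omega)) s2)) s1
    case death e =>
      obtain rfl := List.length_eq_zero_iff.1 ht
      obtain ⟨d, rfl⟩ := List.length_eq_one_iff.1 hb
      have e1 : Tensor.close b (⟨.death e, [d], []⟩ : Tensor ι ℕ) = Tensor.arc (Sum.inl d) (Sum.inr (b e)) := by
        simp [Tensor.close, forgetMark, label, Tensor.arc]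
      have e2 : ∀ c : ℕ ⊕ γ, β₁.map Sum.inl ++ [c] ++ (β₂.map Sum.inl ++ ρ) =
        β₁.map Sum.inl ++ c :: (β₂.map Sum.inl ++ ρ) := by simp
      have e3 : β₁.map Sum.inl ++ (β₂.map Sum.inl ++ Sum.inr (b e) :: ρ) =
        (β₁ ++ [] ++ β₂).map Sum.inl ++ Sum.inr (b e) :: ρ := by simp
      have e4 : (labels (⟨l, .death e, r⟩ :: w)).reverse.map (Sum.inr ∘ b) ++ ρ =
        (labels w).reverse.map (Sum.inr ∘ b) ++ Sum.inr (b e) :: ρ := by simp [labels_cons, label]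
      rw [e1, List.map_singleton, e2] at hG ⊢
      rw [List.map_singleton, e2] at hn
      have hG' := hG.uncut
      have s1 := VE.netCut hG hn
      have hG2 := hG'.reorder (γ := (β₁ ++ [] ++ β₂).map Sum.inl ++ Sum.inr (b e) :: ρ) (by
        rw [← e3]; exact List.Perm.append_left _ List.perm_middle.symm)
      simp only [dom] at hn'
      have s2 := VE.netShift hG' (n := n) (l := l) (by
        rw [hn']; simp [hl, hr]; omega) (by simp [hl])
      rw [e3, List.length_map, hr] at s2
      rw [e4]
      exact trans (VE.shift (ih hG2 (by rw [hn']; simp [hl, hr]; omega)) (by omega)) (trans s2 s1)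
    case cup => exact piece cup rfl rfl rfl
    case cap => exact piece cap rfl rfl rfl
    case overX => exact piece overX rfl rfl rfl
    case underX => exact piece underX rfl rfl rfl

end CloseOps

/-! ### Virtual closures of equivalent diagrams -/

section Words

variable {ι : Type}

theorem isWord_append_iff {v : Word ι} {c : ℕ} : ∀ {u : Word ι} {a : ℕ},
    IsWord a (u ++ v) c ↔ ∃ b, IsWord a u b ∧ IsWord b v c
  | [], a => ⟨fun h => ⟨a, rfl, h⟩, fun ⟨b, h, h'⟩ => by
      rw [List.nil_append, show a = b from h]; exact h'⟩
  | x :: u, a => by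
    simp only [List.cons_append, IsWord, isWord_append_iff (u := u)]
    constructor
    · rintro ⟨h1, b, h2, h3⟩; exact ⟨b, ⟨h1, h2⟩, h3⟩
    · rintro ⟨b, ⟨h1, h2⟩, h3⟩; exact ⟨h1, b, h2, h3⟩

theorem IsWord.pad {w : Word ι} (p q : ℕ) : ∀ {a b : ℕ}, IsWord a w b →
    IsWord (p + a + q) (w.map (Layer.pad p q)) (p + b + q) := by
  induction w with
  | nil => intro a b h; rw [show a = b from h]; rfl
  | cons x w ih =>
    rintro a b ⟨h1, h2⟩
    refine ⟨?_, ?_⟩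
    · rw [h1]; simp only [Layer.source, Layer.pad]; omega
    · convert ih h2 using 1
      simp only [Layer.target, Layer.pad]; omega

theorem build_strip_append {z : List (Op ι)} : ∀ {n m : ℕ} {w : Word ι}, IsWord n w m → Ok m z →
    Ok n (strip w ++ z) ∧ build n (strip w ++ z) = w ++ build m z
  | _, _, [], h, hz => by rw [show _ = _ from h]; exact ⟨hz, rfl⟩
  | n, m, x :: w, h, hz => by
    obtain ⟨h1, h2⟩ := h
    simp only [Layer.source, Layer.target] at h1 h2
    have e : n - x.gen.dom + x.gen.cod = x.left + x.gen.cod + x.right := by omega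
    obtain ⟨i1, i2⟩ := build_strip_append h2 hz
    refine ⟨⟨by simp only; omega, by simp only [e]; exact i1⟩, ?_⟩
    simp only [strip, List.map_cons, List.cons_append, build, e]
    rw [← strip, i2, show n - x.left - x.gen.dom = x.right by omega]

theorem strip_pad {w : Word ι} (p q k : ℕ) :
    strip (w.map (Layer.pad p (q + k))) = strip (w.map (Layer.pad p q)) := by
  simp [strip, Layer.pad, Function.comp_def]

theorem map_pad_pad (w : Word ι) (p q p' q' : ℕ) :
    (w.map (Layer.pad p q)).map (Layer.pad p' q') = w.map (Layer.pad (p' + p) (q + q')) := by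
  simp [Layer.pad, Function.comp_def, Nat.add_assoc]

theorem forgetMarks_pad (w : Word ι) (p q : ℕ) :
    forgetMarks (w.map (Layer.pad p q)) = (forgetMarks w).map (Layer.pad p q) := by
  induction w with
  | nil => rfl
  | cons x w ih =>
    rw [forgetMarks, forgetMarks, List.map_cons, List.filterMap_cons, List.filterMap_cons, ← forgetMarks,
      ← forgetMarks, ih]
    simp only [Layer.pad]
    cases x.gen.forgetMark <;> rfl

/-- The move `s → t`, with strands on both sides. -/
theorem VE.ofContext {s t : Word Empty} {p q n m : ℕ} {z : List (Op Empty)}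
    (h : IsotopyMove s t ∨ ClassicalMove s t ∨ VirtualMove s t) (hs : IsWord n (s.map (Layer.pad p q)) m)
    (ht : IsWord n (t.map (Layer.pad p q)) m) (hz : Ok m z) :
    VE n (strip (s.map (Layer.pad p q)) ++ z) (strip (t.map (Layer.pad p q)) ++ z) :=
  VE.of_move (m := m) (z := z) h (build_strip_append hs hz).1 (build_strip_append ht hz).1
    (build_strip_append hs hz).2 (build_strip_append ht hz).2

theorem closeOps_of_labels {z : List (Op Empty)} : ∀ {w : Word ι}, labels w = [] →
    closeOps w z = strip (forgetMarks w) ++ z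
  | [], _ => rfl
  | ⟨l, g, r⟩ :: w, h => by
    rw [labels_cons, List.append_eq_nil_iff] at h
    have ih := closeOps_of_labels (z := z) h.2
    have e : ∀ g' : Gen Empty, g.forgetMark = some g' →
        strip (forgetMarks (⟨l, g, r⟩ :: w)) ++ z = (l, g') :: (strip (forgetMarks w) ++ z) := by
      intro g' hg
      simp [forgetMarks, hg, strip]
    cases g <;> first | (rw [e _ rfl, ← ih]; rfl) | (exact absurd h.1 (by simp [label]))

theorem Named.append_inv {α : Type} {δ : List α} {v : Word ι} : ∀ {u : Word ι} {T : List (Tensor ι α)} {β : List α},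
    Named β (u ++ v) T δ → ∃ T₁ T₂ γ, T = T₁ ++ T₂ ∧ Named β u T₁ γ ∧ Named γ v T₂ δ
  | [], T, β, h => ⟨[], T, β, rfl, .nil β, h⟩
  | x :: u, T, β, h => by
    cases h with
    | cons hl hr hb ht h =>
      obtain ⟨T₁, T₂, γ, rfl, h1, h2⟩ := Named.append_inv h
      exact ⟨_ :: T₁, T₂, γ, rfl, .cons hl hr hb ht h1, h2⟩

theorem Named.append {α : Type} {β γ δ : List α} {u v : Word ι} {T₁ T₂ : List (Tensor ι α)}
    (h : Named β u T₁ γ) (h' : Named γ v T₂ δ) : Named β (u ++ v) (T₁ ++ T₂) δ := by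
  induction h with
  | nil => exact h'
  | cons hl hr hb ht _ ih => exact .cons hl hr hb ht (ih h')

theorem Named.exists_mem {α : Type} {β δ : List α} {w : Word ι} {T : List (Tensor ι α)} (h : Named β w T δ) :
    ∀ t ∈ T, ∃ x ∈ w, x.gen = t.gen := by
  induction h with
  | nil => simp
  | cons hl hr hb ht _ ih =>
    intro t h'
    rcases List.mem_cons.1 h' with rfl | h'
    · exact ⟨_, List.mem_cons_self .., rfl⟩
    · obtain ⟨x, hx, hg⟩ := ih t h'
      exact ⟨x, List.mem_cons_of_mem _ hx, hg⟩

theorem IsWord.right_unique : ∀ {w : Word ι} {a b b' : ℕ}, IsWord a w b → IsWord a w b' → b = b'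
  | [], _, _, _, h, h' => h.symm.trans h'
  | _ :: _, _, _, _, h, h' => IsWord.right_unique h.2 h'.2

theorem IsWord.left_unique {w : Word ι} {a a' b : ℕ} (h : IsWord a w b) (h' : IsWord a' w b) : a = a' := by
  cases w with
  | nil => exact Eq.trans h (Eq.symm h')
  | cons x w => exact h.1.trans h'.1.symm

theorem Tensor.WF.close {ι γ : Type} {t : Tensor ι ℕ} (h : t.WF) (hm : ∀ e, t.gen ≠ mark e) (b : ι → γ) :
    (t.close b).WF := by
  obtain ⟨g, bot, top⟩ := t
  obtain ⟨h1, h2⟩ := h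
  simp only at h1 h2
  cases g <;> simp_all [Tensor.close, forgetMark, Tensor.WF, dom, cod, label]

end Words

section Invariance

variable {n : ℕ} {σ : Pairing n}

/-- Names of closure arcs. -/
theorem exists_arcNames (σ : Pairing n) : ArcNames σ fun e => min e (σ.1 e) := by
  intro e e'
  have h := σ.2 e
  have h' := σ.2 e'
  simp only
  constructor
  · intro hm
    rcases min_choice e (σ.1 e) with h1 | h1 <;> rcases min_choice e' (σ.1 e') with h2 | h2 <;>
      rw [h1, h2] at hm
    · exact .inl hm.symm
    · right; rw [hm, h'.1]
    · exact .inr hm.symm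
    · left; rw [← h.1, hm, h'.1]
  · rintro (rfl | rfl)
    · rfl
    · simp only [h.1, min_comm]

/-- The name `b e` occurs at the labels `e` and `σ e`, each of which belongs to one endpoint, and
nowhere else. -/
theorem Good.close {γ : Type} [DecidableEq γ] {b : Fin (2 * n) → γ} (hb : ArcNames σ b)
    {T : List (Tensor (Fin (2 * n)) ℕ)} (hw : ∀ t ∈ T, t.WF) (hm : ∀ t ∈ T, ∀ e, t.gen ≠ mark e) (hL : Lin (names T))
    (hl : ∀ e, (T.filterMap fun t => t.gen.label).count e = 1) : Good [] (T.map (Tensor.close b)) := by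
  refine ⟨fun s hs => ?_, ?_⟩
  · obtain ⟨t, ht, rfl⟩ := List.mem_map.1 hs
    exact (hw t ht).close (hm t ht) b
  rintro (k | c)
  · rw [List.nil_append, count_inl_close]; exact hL k
  rw [List.nil_append, count_inr_close]
  set L := T.filterMap fun t => t.gen.label
  by_cases hc : c ∈ L.map b
  · right
    obtain ⟨e, he, rfl⟩ := List.mem_map.1 hc
    have hp := List.perm_cons_erase he
    have he' : σ.1 e ∈ L.erase e := by
      rw [List.mem_erase_of_ne (σ.2 e).2]
      exact List.count_pos_iff.1 (by rw [hl]; exact one_pos)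
    have hp' := hp.trans ((List.perm_cons_erase he').cons e)
    rw [(hp'.map b).count_eq, List.map_cons, List.map_cons, ← (hb e _).2 (.inr rfl), List.count_cons_self,
      List.count_cons_self, List.count_eq_zero.2]
    intro hm
    obtain ⟨x, hx, hxe⟩ := List.mem_map.1 hm
    have h1 := hl x
    rw [hp'.count_eq] at h1
    have h2 := List.count_pos_iff.2 hx
    rcases (hb e x).1 hxe.symm with rfl | rfl
    · rw [List.count_cons_self, List.count_cons] at h1; omega
    · rw [List.count_cons, List.count_cons_self] at h1; omega
  · left; exact List.count_eq_zero.2 hc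

theorem LinkoidDiagram.good_close (D : LinkoidDiagram n) {T : List (Tensor (Fin (2 * n)) ℕ)}
    (hT : Named [] D.word T []) (hL : Lin (names T)) {γ : Type} [DecidableEq γ] {b : Fin (2 * n) → γ}
    (hb : ArcNames σ b) : Good [] (T.map (Tensor.close b)) := by
  refine Good.close hb hT.wf (fun t ht e hg => ?_) hL fun e => by rw [hT.labels]; exact D.labelled e
  obtain ⟨x, hx, hx'⟩ := hT.exists_mem t ht
  exact (D.classical x hx).2 e (hx'.trans hg)

/-- The diagrams have the same virtual closures. -/
def SameClosures (D E : LinkoidDiagram n) : Prop :=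
  ∀ (σ : Pairing n) (K K' : VirtualDiagram), IsVirtualClosure D σ K → IsVirtualClosure E σ K' → K.link = K'.link

theorem VE.link {K K' : VirtualDiagram} (h : VE 0 (strip K.word) (strip K'.word)) : K.link = K'.link := by
  have h1 := build_strip K.closed
  have h2 := build_strip K'.closed
  have := VE.link_eq h (by rw [h1]; exact K.closed) (by rw [h2]; exact K'.closed)
  simpa only [h1, h2] using this

/-- By `ve_net` it is enough to compare the two closed networks; the names of the arcs may be taken
as in `exists_arcNames`. -/
theorem sameClosures_of_net {D E : LinkoidDiagram n} {T T' : List (Tensor (Fin (2 * n)) ℕ)}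
    (hT : Named [] D.word T []) (hL : Lin (names T)) (hT' : Named [] E.word T' []) (hL' : Lin (names T'))
    (h : ∀ b : Fin (2 * n) → Fin (2 * n), Good [] (T.map (Tensor.close b)) → Good [] (T'.map (Tensor.close b)) →
      VE 0 (net [] (T.map (Tensor.close b))) (net [] (T'.map (Tensor.close b)))) : SameClosures D E := by
  intro σ K K' hK hK'
  have hb := exists_arcNames σ
  exact VE.link ((hK.ve_net hT hL hb).trans ((h _ (D.good_close hT hL hb) (E.good_close hT' hL' hb)).trans
    (hK'.ve_net hT' hL' hb).symm))

/-- This has content: any two closures of one diagram, obtained from different pictures, are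
equivalent. -/
theorem SameClosures.refl (D : LinkoidDiagram n) : SameClosures D D := by
  obtain ⟨T, hT, hL⟩ := exists_named_closed D.closed
  exact sameClosures_of_net hT hL hT hL fun b h _ => .refl (ok_net h)

theorem SameClosures.symm {D E : LinkoidDiagram n} (h : SameClosures D E) : SameClosures E D :=
  fun σ K K' hK hK' => (h σ K' K hK' hK).symm

/-- The middle diagram must have a closure for every `σ`, so existence of closures is needed here.
-/
theorem SameClosures.trans {D E F : LinkoidDiagram n} (h : SameClosures D E) (h' : SameClosures E F) :
    SameClosures D F := fun σ K K' hK hK' => by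
  obtain ⟨K'', hK''⟩ := E.exists_isVirtualClosure σ
  exact (h σ K K'' hK hK'').trans (h' σ K'' K' hK'' hK')

/-- A move that does not concern endpoints. -/
theorem sameClosures_of_labels {D E : LinkoidDiagram n} {a c s t : Word (Fin (2 * n))} {p q : ℕ}
    (hD : D.word = a ++ s.map (Layer.pad p q) ++ c) (hE : E.word = a ++ t.map (Layer.pad p q) ++ c)
    (hs : labels s = []) (ht : labels t = [])
    (h : IsotopyMove (forgetMarks s) (forgetMarks t) ∨ ClassicalMove (forgetMarks s) (forgetMarks t) ∨
      VirtualMove (forgetMarks s) (forgetMarks t)) : SameClosures D E := by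
  have labpad : ∀ u : Word (Fin (2 * n)), labels (u.map (Layer.pad p q)) = labels u := fun u => by
    simp [labels, List.filterMap_map, Function.comp_def, Layer.pad]
  have nolab : ∀ {u : Word (Fin (2 * n))}, labels u = [] → ∀ x ∈ u, ∀ e, x.gen ≠ Gen.birth e ∧ x.gen ≠ Gen.death e := by
    intro u hu x hx e
    have : x.gen.label = none := by
      cases hl : x.gen.label with
      | none => rfl
      | some e => exact absurd (hu ▸ List.mem_filterMap.2 ⟨x, hx, hl⟩ : e ∈ ([] : List (Fin (2 * n)))) (by simp)
    constructor <;> intro hg <;> rw [hg] at this <;> cases this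
  obtain ⟨T, hT, hL⟩ := exists_named_closed D.closed
  obtain ⟨T', hT', hL'⟩ := exists_named_closed E.closed
  refine sameClosures_of_net hT hL hT' hL' fun b hG hG' => ?_
  -- Both networks are written as layered closures. The move then takes place inside the virtual
  -- diagram, with the arcs from the endpoints in `a` as additional strands on its right.
  have v1 := VE.netClose (b := b) hT D.classical (ρ := []) (R := []) (n := 0) (by simpa using hG) rfl
  have v2 := VE.netClose (b := b) hT' E.classical (ρ := []) (R := []) (n := 0) (by simpa using hG') rfl
  have lab : labels D.word = labels E.word := by
    rw [hD, hE]; simp only [labels_append, labpad, hs, ht]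
  rw [← lab] at v2
  set Z := net (([] : List ℕ).map Sum.inl ++ ((labels D.word).reverse.map (Sum.inr ∘ b) ++ [])) ([] : List (Tensor Empty (ℕ ⊕ Fin (2 * n)))) with hZ
  simp only [List.map_nil, List.append_nil] at v1 v2
  have okZ : Ok (labels D.word).length Z := by
    refine (ok_net ⟨by simp, ?_⟩).cast (by simp)
    rintro (k | x)
    · left
      exact List.count_eq_zero.2 (by simp [names])
    · have := hG.2 (Sum.inr x)
      rw [List.nil_append, count_inr_close, hT.labels] at this
      convert this using 2 <;>
      · simp only [List.map_nil, List.nil_append, List.append_nil, names, List.flatMap_nil, ← List.map_map,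
          List.map_reverse, List.count_reverse]
        rw [List.count_map_of_injective _ _ Sum.inr_injective]
  refine v1.symm.trans (VE.trans ?_ v2)
  have wD := D.closed
  have wE := E.closed
  have cD := D.classical
  rw [hD] at wD cD ⊢
  rw [hE] at wE ⊢
  obtain ⟨k, w1, w3⟩ := isWord_append_iff.1 wD
  obtain ⟨m, w1, w2⟩ := isWord_append_iff.1 w1
  obtain ⟨k', w1', w3'⟩ := isWord_append_iff.1 wE
  obtain ⟨m', w1', w2'⟩ := isWord_append_iff.1 w1'
  obtain rfl := w1.right_unique w1'
  obtain rfl := w3.left_unique w3'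
  rw [closeOps_append, closeOps_append, closeOps_append, closeOps_append]
  refine VE.closeOps (k := 0) w1 (fun x hx => cD x (by simp [hx])) ?_
  have lD : (labels D.word).length = (labels a).length + (labels c).length := by
    rw [hD]; simp [labels_append, labpad, hs]
  have okc : Ok (k + (labels a).length) (closeOps c Z) :=
    (VE.closeOps (k := (labels a).length) w3 (fun x hx => cD x (by simp [hx]))
      (VE.refl (okZ.cast (by rw [lD]; omega)))).okl
  rw [closeOps_of_labels ((labpad s).trans hs), closeOps_of_labels ((labpad t).trans ht)]
  have p1 := (isWord_forgetMarks (nolab ((labpad s).trans hs)) w2).pad 0 (labels a).length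
  have p2 := (isWord_forgetMarks (nolab ((labpad t).trans ht)) w2').pad 0 (labels a).length
  rw [forgetMarks_pad, map_pad_pad, Nat.zero_add] at p1 p2
  rw [forgetMarks_pad, forgetMarks_pad, ← strip_pad p q (labels a).length, ← strip_pad p q (labels a).length]
  have := VE.ofContext h p1 p2 (okc.cast (n := 0 + k + (labels a).length) (by omega))
  simp only [Nat.zero_add] at this
  exact this.of_len (by omega)

end Invariance

/-! ### Moves at endpoints and the move across infinity -/

section Invariance

variable {n : ℕ}

theorem names_perm {ι α : Type} {S T : List (Tensor ι α)} (h : S.Perm T) : (names S).Perm (names T) :=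
  h.flatMap_right _

theorem Good.perm {α : Type} [DecidableEq α] {β : List α} {S T : List (Tensor Empty α)} (h : Good β S)
    (hp : S.Perm T) : Good β T :=
  ⟨fun t ht => h.1 t (hp.mem_iff.2 ht), h.2.perm ((names_perm hp).append_left _)⟩

/-- A local change of the network. -/
theorem sameClosures_of_local {D E : LinkoidDiagram n} {a c s t : Word (Fin (2 * n))}
    (hD : D.word = a ++ s ++ c) (hE : E.word = a ++ t ++ c)
    (h : ∀ β γ Ts, Named β s Ts γ → (∃ R, Lin (names (Ts ++ R))) → ∃ Tt : List (Tensor (Fin (2 * n)) ℕ), Named β t Tt γ ∧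
      (∀ R, Lin (names (Ts ++ R)) → Lin (names (Tt ++ R))) ∧
      ∀ (b : Fin (2 * n) → Fin (2 * n)) (R : List (Tensor Empty (ℕ ⊕ Fin (2 * n)))),
        Good [] (Ts.map (Tensor.close b) ++ R) →
        VE 0 (net [] (Ts.map (Tensor.close b) ++ R)) (net [] (Tt.map (Tensor.close b) ++ R))) :
    SameClosures D E := by
  obtain ⟨T, hT, hL⟩ := exists_named_closed D.closed
  have hT0 := hT
  rw [hD] at hT
  obtain ⟨T₁, T₃, δ, rfl, h1, h3⟩ := hT.append_inv
  obtain ⟨T₁, Ts, β, rfl, h1, h2⟩ := h1.append_inv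
  have pm : ∀ {ι α : Type} (X Y Z : List (Tensor ι α)), (X ++ Y ++ Z).Perm (Y ++ (X ++ Z)) := fun X Y Z => by
    rw [← List.append_assoc]; exact List.perm_append_comm.append_right _
  obtain ⟨Tt, h2', hLt, hV⟩ := h β δ Ts h2 ⟨_, hL.perm (names_perm (pm _ _ _))⟩
  refine sameClosures_of_net hT0 hL (T' := T₁ ++ Tt ++ T₃) (by rw [hE]; exact (h1.append h2').append h3)
    ((hLt _ (hL.perm (names_perm (pm _ _ _)))).perm (names_perm (pm _ _ _).symm)) fun b hG hG' => ?_
  simp only [List.map_append] at hG hG' ⊢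
  refine (VE.netPerm (pm _ _ _) hG rfl).trans (VE.trans (hV b _ (hG.perm (pm _ _ _))) ?_)
  exact (VE.netPerm (pm _ _ _) hG' rfl).symm

theorem Named.nil_inv {ι α : Type} {β γ : List α} {T : List (Tensor ι α)} (h : Named β [] T γ) :
    T = [] ∧ γ = β := by
  cases h; exact ⟨rfl, rfl⟩

/-- An exchange of heights only permutes the network. Endpoints among the exchanged pieces need no
separate treatment. -/
theorem sameClosures_exchange {D E : LinkoidDiagram n} {a c : Word (Fin (2 * n))} {g h : Gen (Fin (2 * n))}
    {m p q : ℕ} (hD : D.word = a ++ [⟨0, g, m + h.dom⟩, ⟨g.cod + m, h, 0⟩].map (Layer.pad p q) ++ c)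
    (hE : E.word = a ++ [⟨g.dom + m, h, 0⟩, ⟨0, g, m + h.cod⟩].map (Layer.pad p q) ++ c) :
    SameClosures D E := by
  refine sameClosures_of_local hD hE fun β γ Ts hN _ => ?_
  simp only [List.map_cons, List.map_nil, Layer.pad, Nat.add_zero, Nat.zero_add] at hN ⊢
  cases hN with
  | @cons β₁ bot top β₂ _ _ _ T _ _ hl hr hb ht hN =>
    obtain ⟨β₂, β₃, rfl, h1, h2⟩ := exists_append_of_length hr
    obtain ⟨μ, bot', rfl, h3, h4⟩ := exists_append_of_length h1
    obtain ⟨top', T', rfl, -, ht', hN⟩ := Named.cons_inv hN (β₁ := β₁ ++ top ++ μ) (bot := bot') (β₂ := β₃)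
      (by simp) (by simp; omega) h2
    obtain ⟨rfl, rfl⟩ := hN.nil_inv
    refine ⟨[⟨h, bot', top'⟩, ⟨g, bot, top⟩], ?_, fun R hL => ?_, fun b R hG => ?_⟩
    · have e1 : β₁ ++ bot ++ (μ ++ bot' ++ β₃) = (β₁ ++ bot ++ μ) ++ bot' ++ β₃ := by simp
      have e2 : β₁ ++ top ++ μ ++ top' ++ β₃ = β₁ ++ top ++ (μ ++ top' ++ β₃) := by simp
      rw [e1, e2]
      refine .cons (by simp; omega) h2 h4 ht' ?_
      rw [show β₁ ++ bot ++ μ ++ top' ++ β₃ = β₁ ++ bot ++ (μ ++ top' ++ β₃) by simp]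
      exact .cons hl (by simp; omega) hb ht (.nil _)
    · exact hL.perm (names_perm (List.Perm.swap _ _ _))
    · exact VE.netPerm (List.Perm.swap _ _ _) hG rfl

/-- The end of a strand is moved along the strand. -/
theorem VE.netEnd {γ : Type} [DecidableEq γ] {d c : ℕ} {x : γ} (hdc : d ≠ c) {R : List (Tensor Empty (ℕ ⊕ γ))}
    (hG : Good [] (Tensor.arc (Sum.inl d) (Sum.inl c) :: Tensor.arc (Sum.inl d) (Sum.inr x) :: R)) :
    VE 0 (net [] (Tensor.arc (Sum.inl d) (Sum.inl c) :: Tensor.arc (Sum.inl d) (Sum.inr x) :: R))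
      (net [] (Tensor.arc (Sum.inl c) (Sum.inr x) :: R)) := by
  have h := VE.netElim (fun h => hdc (Sum.inl_injective h)) hG
  have hd : (Sum.inl d : ℕ ⊕ γ) ∉ names R := by
    have := hG.2 (Sum.inl d)
    simp only [List.nil_append, names_cons, Tensor.legs, Tensor.arc, List.reverse_nil, List.append_nil,
      List.count_append, List.count_cons_self] at this
    exact List.count_eq_zero.1 (by omega)
  rw [List.map_cons, map_map_sub_eq hd] at h
  have e : Tensor.map (VirtualClosure.sub (Sum.inl d) (Sum.inl c)) (Tensor.arc (Sum.inl d) (Sum.inr x)) =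
      Tensor.arc (Sum.inl c) (Sum.inr x : ℕ ⊕ γ) := by
    simp [Tensor.map, Tensor.arc, VirtualClosure.sub]
  rwa [e] at h

/-- The four forms of `X` are the maximum or minimum next to an endpoint, with its ends in either
order. Each can be brought to the arc from `d` to `c`, along which the end is then moved. -/
theorem VE.netTurn {γ : Type} [DecidableEq γ] {d c : ℕ} {x : γ} (hdc : d ≠ c) {X : Tensor Empty (ℕ ⊕ γ)}
    {R S : List (Tensor Empty (ℕ ⊕ γ))}
    (hX : X = ⟨cap, [Sum.inl d, Sum.inl c], []⟩ ∨ X = ⟨cap, [Sum.inl c, Sum.inl d], []⟩ ∨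
      X = Tensor.arc (Sum.inl d) (Sum.inl c) ∨ X = Tensor.arc (Sum.inl c) (Sum.inl d))
    (hS : S.Perm (X :: Tensor.arc (Sum.inl d) (Sum.inr x) :: R)) (hG : Good [] S) :
    VE 0 (net [] S) (net [] (Tensor.arc (Sum.inl c) (Sum.inr x) :: R)) := by
  have h0 := VE.netPerm hS hG rfl
  have g0 := hG.perm hS
  have g1 : ∀ {y z : ℕ ⊕ γ}, X.legs.Perm [y, z] →
      Good [] (Tensor.arc y z :: Tensor.arc (Sum.inl d) (Sum.inr x) :: R) := by
    intro y z hp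
    refine ⟨fun t ht => ?_, g0.2.perm (hp.append_right _)⟩
    rcases List.mem_cons.1 ht with rfl | ht
    · exact Tensor.wf_arc _ _
    · exact g0.1 t (List.mem_cons_of_mem _ ht)
  have g2 := fun h => VE.netEnd hdc (g1 (y := Sum.inl d) (z := Sum.inl c) h)
  refine trans h0 ?_
  rcases hX with rfl | rfl | rfl | rfl
  · exact trans (VE.netCapArc g0 rfl) (g2 (List.Perm.swap _ _ _))
  · exact trans (VE.netCapArc g0 rfl) (trans (VE.netFlip (g1 (List.Perm.swap _ _ _)) rfl) (g2 (List.Perm.refl _)))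
  · exact g2 (List.Perm.refl _)
  · exact trans (VE.netFlip g0 rfl) (g2 (List.Perm.swap _ _ _))

/-- If the two names were equal, there would be at least three copies. -/
theorem ne_of_lin {d c : ℕ} {l R : List ℕ} (h : Lin (l ++ R)) (hl : l.Perm [d, c, d]) : d ≠ c := by
  rintro rfl
  have := h d
  rw [List.count_append, hl.count_eq] at this
  simp at this
  omega

theorem sameClosures_turn {D E : LinkoidDiagram n} {a c s t : Word (Fin (2 * n))} {e : Fin (2 * n)}
    {p q : ℕ} (hD : D.word = a ++ s.map (Layer.pad p q) ++ c) (hE : E.word = a ++ t.map (Layer.pad p q) ++ c)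
    (h : (s = [⟨0, .birth e, 1⟩, ⟨0, .cap, 0⟩] ∨ s = [⟨1, .birth e, 0⟩, ⟨0, .cap, 0⟩]) ∧ t = [⟨0, .death e, 0⟩] ∨
      (s = [⟨0, .cup, 0⟩, ⟨0, .death e, 1⟩] ∨ s = [⟨0, .cup, 0⟩, ⟨1, .death e, 0⟩]) ∧ t = [⟨0, .birth e, 0⟩]) :
    SameClosures D E := by
  -- The name `d` belongs to the short strand between the endpoint and the turning point, and `k` to
  -- the strand that goes on. After closing, `d` only connects `k` with the closure arc.
  have key : ∀ {Ts : List (Tensor (Fin (2 * n)) ℕ)} {Tt : Tensor (Fin (2 * n)) ℕ} {d k : ℕ},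
      (names Ts).Perm [d, k, d] → Tt.legs = [k] →
      (∀ b : Fin (2 * n) → Fin (2 * n), Tensor.close b Tt = Tensor.arc (Sum.inl k) (Sum.inr (b e)) ∧
        ∃ X, (X = ⟨cap, [Sum.inl d, Sum.inl k], []⟩ ∨ X = ⟨cap, [Sum.inl k, Sum.inl d], []⟩ ∨
          X = Tensor.arc (Sum.inl d) (Sum.inl k) ∨ X = Tensor.arc (Sum.inl k) (Sum.inl d)) ∧
          (Ts.map (Tensor.close b)).Perm [X, Tensor.arc (Sum.inl d) (Sum.inr (b e))]) →
      (∃ R, Lin (names (Ts ++ R))) →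
      (∀ R, Lin (names (Ts ++ R)) → Lin (names ([Tt] ++ R))) ∧
      ∀ (b : Fin (2 * n) → Fin (2 * n)) (R : List (Tensor Empty (ℕ ⊕ Fin (2 * n)))),
        Good [] (Ts.map (Tensor.close b) ++ R) →
        VE 0 (net [] (Ts.map (Tensor.close b) ++ R)) (net [] ([Tt].map (Tensor.close b) ++ R)) := by
    intro Ts Tt d k hp hk hc hex
    refine ⟨fun R hL => ?_, fun b R hG => ?_⟩
    · rw [names_append] at hL ⊢
      refine hL.of_double (x := d) (List.Perm.append_right (l₂ := d :: d :: names [Tt]) (names R) (hp.trans ?_))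
      rw [names_cons, hk]
      exact (List.perm_cons d).2 (List.Perm.swap _ _ _)
    · obtain ⟨R', hR⟩ := hex
      have hdk := ne_of_lin (by rwa [names_append] at hR) hp
      obtain ⟨h1, X, hX, h2⟩ := hc b
      rw [List.map_singleton, h1]
      exact VE.netTurn hdk hX (h2.append_right R) hG
  refine sameClosures_of_local hD hE fun β γ Ts hN hex => ?_
  rcases h with ⟨rfl | rfl, rfl⟩ | ⟨rfl | rfl, rfl⟩ <;>
    simp only [List.map_cons, List.map_nil, Layer.pad, Nat.add_zero, Nat.zero_add] at hN ⊢
  · cases hN with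
    | @cons β₁ bot top β₂ _ _ _ T _ _ hl hr hb ht hN =>
      obtain rfl := List.length_eq_zero_iff.1 hb
      obtain ⟨d, rfl⟩ := List.length_eq_one_iff.1 ht
      obtain ⟨k, β₃, rfl, h1, h2⟩ := exists_append_of_length hr
      obtain ⟨k, rfl⟩ := List.length_eq_one_iff.1 h1
      obtain ⟨top', T', rfl, -, ht', hN⟩ := Named.cons_inv hN (β₁ := β₁) (bot := [d, k]) (β₂ := β₃)
        (by simp) hl h2
      obtain rfl := List.length_eq_zero_iff.1 ht'
      obtain ⟨rfl, rfl⟩ := hN.nil_inv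
      refine ⟨[⟨.death e, [k], []⟩], ?_, key (d := d) (k := k) ?_ rfl (fun b => ⟨by simp [Tensor.close, forgetMark, label, Tensor.arc],
        _, .inl rfl, ?_⟩) hex⟩
      · rw [show β₁ ++ [] ++ ([k] ++ β₃) = β₁ ++ [k] ++ β₃ by simp]
        exact .cons hl h2 rfl rfl (.nil _)
      · exact List.perm_iff_count.2 fun y => by simp [names, Tensor.legs, List.count_cons]
      · exact List.Perm.swap _ _ _
  · cases hN with
    | @cons β₁ bot top β₂ _ _ _ T _ _ hl hr hb ht hN =>
      obtain rfl := List.length_eq_zero_iff.1 hb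
      obtain ⟨d, rfl⟩ := List.length_eq_one_iff.1 ht
      obtain ⟨β₁, k, rfl, h1, h2⟩ := exists_append_of_length hl
      obtain ⟨k, rfl⟩ := List.length_eq_one_iff.1 h2
      obtain ⟨top', T', rfl, -, ht', hN⟩ := Named.cons_inv hN (β₁ := β₁) (bot := [k, d]) (β₂ := β₂)
        (by simp) h1 hr
      obtain rfl := List.length_eq_zero_iff.1 ht'
      obtain ⟨rfl, rfl⟩ := hN.nil_inv
      refine ⟨[⟨.death e, [k], []⟩], ?_, key (d := d) (k := k) ?_ rfl (fun b => ⟨by simp [Tensor.close, forgetMark, label, Tensor.arc],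
        _, .inr (.inl rfl), ?_⟩) hex⟩
      · rw [show β₁ ++ [k] ++ [] ++ β₂ = β₁ ++ [k] ++ β₂ by simp]
        exact .cons h1 hr rfl rfl (.nil _)
      · exact List.perm_iff_count.2 fun y => by simp [names, Tensor.legs, List.count_cons]; ring
      · exact List.Perm.swap _ _ _
  · cases hN with
    | @cons β₁ bot top β₂ _ _ _ T _ _ hl hr hb ht hN =>
      obtain rfl := List.length_eq_zero_iff.1 hb
      obtain ⟨d, k, rfl⟩ := List.length_eq_two.1 ht
      obtain ⟨top', T', rfl, -, ht', hN⟩ := Named.cons_inv hN (β₁ := β₁) (bot := [d]) (β₂ := k :: β₂)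
        (by simp) hl (by simp [hr]; omega)
      obtain rfl := List.length_eq_zero_iff.1 ht'
      obtain ⟨rfl, rfl⟩ := hN.nil_inv
      refine ⟨[⟨.birth e, [], [k]⟩], ?_, key (d := d) (k := k) ?_ rfl (fun b => ⟨by simp [Tensor.close, forgetMark, label, Tensor.arc],
        _, .inr (.inr (.inl rfl)), ?_⟩) hex⟩
      · refine .cons hl hr rfl rfl ?_
        rw [show β₁ ++ [k] ++ β₂ = β₁ ++ [] ++ k :: β₂ by simp]
        exact .nil _
      · exact List.perm_iff_count.2 fun y => by simp [names, Tensor.legs, List.count_cons]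
      · exact List.Perm.refl _
  · cases hN with
    | @cons β₁ bot top β₂ _ _ _ T _ _ hl hr hb ht hN =>
      obtain rfl := List.length_eq_zero_iff.1 hb
      obtain ⟨k, d, rfl⟩ := List.length_eq_two.1 ht
      obtain ⟨top', T', rfl, -, ht', hN⟩ := Named.cons_inv hN (β₁ := β₁ ++ [k]) (bot := [d]) (β₂ := β₂)
        (by simp) (by simp [hl]) hr
      obtain rfl := List.length_eq_zero_iff.1 ht'
      obtain ⟨rfl, rfl⟩ := hN.nil_inv
      refine ⟨[⟨.birth e, [], [k]⟩], ?_, key (d := d) (k := k) ?_ rfl (fun b => ⟨by simp [Tensor.close, forgetMark, label, Tensor.arc],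
        _, .inr (.inr (.inr rfl)), ?_⟩) hex⟩
      · refine .cons hl hr rfl rfl ?_
        rw [show β₁ ++ [k] ++ [] ++ β₂ = β₁ ++ [k] ++ β₂ by simp]
        exact .nil _
      · exact List.perm_iff_count.2 fun y => by simp [names, Tensor.legs, List.count_cons]; ring
      · exact List.Perm.refl _

theorem Named.unpad_right {ι α : Type} {x : α} : ∀ {w : Word ι} {β δ : List α} {T : List (Tensor ι α)},
    Named (β ++ [x]) (w.map (Layer.pad 0 1)) T δ → ∃ δ', δ = δ' ++ [x] ∧ Named β w T δ'
  | [], β, δ, T, h => by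
    obtain ⟨rfl, rfl⟩ := h.nil_inv
    exact ⟨β, rfl, .nil β⟩
  | ⟨l, g, r⟩ :: w, β, δ, T, h => by
    rw [List.map_cons] at h
    generalize e : β ++ [x] = β' at h
    cases h with
    | @cons β₁ bot top β₂ _ _ _ T _ _ hl hr hb ht h =>
      obtain ⟨β₂, y, rfl, h1, h2⟩ := exists_append_of_length hr
      obtain ⟨y, rfl⟩ := List.length_eq_one_iff.1 h2
      rw [← List.append_assoc] at e h
      obtain ⟨rfl, e'⟩ := List.append_inj' e rfl
      obtain rfl : x = y := by simpa using e'
      obtain ⟨δ', h3, h4⟩ := Named.unpad_right h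
      exact ⟨δ', h3, .cons (by simpa using hl) h1 hb ht h4⟩

theorem Named.pad_left {ι α : Type} (x : α) {w : Word ι} {β δ : List α} {T : List (Tensor ι α)}
    (h : Named β w T δ) : Named (x :: β) (w.map (Layer.pad 1 0)) T (x :: δ) := by
  induction h with
  | nil => exact .nil _
  | @cons β₁ bot top β₂ _ g w T l r hl hr hb ht _ ih =>
    exact .cons (β₁ := x :: β₁) (by simp [hl]; omega) (by simpa using hr) hb ht ih

/-- Carrying the outer strand `x` to the other side reverses the two names at the lowest minimum and
at the highest maximum and changes nothing else. Arcs have no direction in a network. -/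
theorem sameClosures_sphere {D E : LinkoidDiagram n} (h : SphereMove D.word E.word) : SameClosures D E := by
  obtain ⟨w, hD, hE⟩ := h
  obtain ⟨T, hT, hL⟩ := exists_named_closed D.closed
  have hT0 := hT
  rw [hD] at hT
  obtain ⟨T₁, T₃, δ, rfl, h1, h3⟩ := hT.append_inv
  obtain ⟨T₁, T₂, β, rfl, h1, h2⟩ := h1.append_inv
  obtain ⟨top, T', rfl, -, ht, h1⟩ := Named.cons_inv h1 (β₁ := []) (bot := []) (β₂ := []) rfl rfl rfl
  obtain ⟨rfl, rfl⟩ := h1.nil_inv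
  obtain ⟨a, x, rfl⟩ := List.length_eq_two.1 ht
  obtain ⟨δ', rfl, h2'⟩ := Named.unpad_right (β := [a]) h2
  have hlen : δ'.length = 1 := by
    generalize e : δ' ++ [x] = δ at h3
    cases h3 with
    | cons hl hr hb ht h =>
      have := congrArg List.length e
      simp [hl, hr, hb, dom] at this
      exact this
  obtain ⟨c, rfl⟩ := List.length_eq_one_iff.1 hlen
  obtain ⟨top, T', rfl, -, ht', h3⟩ := Named.cons_inv h3 (β₁ := []) (bot := [c, x]) (β₂ := []) rfl rfl rfl
  obtain rfl := List.length_eq_zero_iff.1 ht'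
  obtain ⟨rfl, -⟩ := h3.nil_inv
  have hT' : Named [] E.word ([⟨.cup, [], [x, a]⟩] ++ T₂ ++ [⟨.cap, [x, c], []⟩]) [] := by
    rw [hE]
    exact ((Named.cons (β₁ := []) (bot := []) (β₂ := []) rfl rfl rfl rfl (.nil _)).append (h2'.pad_left x)).append
      (.cons (β₁ := []) (bot := [x, c]) (β₂ := []) rfl rfl rfl rfl (.nil _))
  refine sameClosures_of_net hT0 hL hT' (hL.perm ?_) fun b hG hG' => ?_
  · refine List.perm_iff_count.2 fun y => ?_
    simp only [names_append, names_cons, Tensor.legs, List.count_append, List.count_cons, List.reverse_cons, List.reverse_nil,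
      List.count_nil]
    ring
  · simp only [List.map_append, List.map_cons, List.map_nil, List.append_assoc] at hG hG' ⊢
    set S := T₂.map (Tensor.close b)
    have cupc : ∀ y z : ℕ, Tensor.close b (⟨.cup, [], [y, z]⟩ : Tensor (Fin (2 * n)) ℕ) =
        Tensor.arc (Sum.inl y) (Sum.inl z) := fun y z => rfl
    have capc : ∀ y z : ℕ, Tensor.close b (⟨.cap, [y, z], []⟩ : Tensor (Fin (2 * n)) ℕ) =
        ⟨cap, [Sum.inl y, Sum.inl z], []⟩ := fun y z => rfl
    simp only [cupc, capc, List.singleton_append] at hG hG' ⊢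
    have pm : ∀ X Y : Tensor Empty (ℕ ⊕ Fin (2 * n)), (X :: (S ++ [Y])).Perm (Y :: X :: S) := fun X Y =>
      (List.perm_append_comm (l₁ := X :: S) (l₂ := [Y]))
    have arcs : ∀ {y z : ℕ} {X : Tensor Empty (ℕ ⊕ Fin (2 * n))} {l : List (ℕ ⊕ Fin (2 * n))}, l = [Sum.inl y, Sum.inl z] →
        Good [] (⟨cap, l, []⟩ :: X :: S) → Good [] (Tensor.arc (Sum.inl y) (Sum.inl z) :: X :: S) := by
      rintro y z X l rfl h
      refine ⟨fun t ht => ?_, h.2.perm ((List.Perm.swap _ _ _).append_right _)⟩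
      rcases List.mem_cons.1 ht with rfl | ht
      · exact Tensor.wf_arc _ _
      · exact h.1 t (List.mem_cons_of_mem _ ht)
    have g1 := hG.perm (pm _ _)
    have g2 := hG'.perm (pm _ _)
    have a1 := arcs rfl g1
    have a2 := arcs rfl g2
    refine (VE.netPerm (pm _ _) hG rfl).trans ((VE.netCapArc g1 rfl).trans ?_)
    refine VE.trans ?_ (((VE.netPerm (pm _ _) hG' rfl).trans (VE.netCapArc g2 rfl)).symm)
    refine (VE.netFlip a1 rfl).trans ?_
    have a3 : Good [] (Tensor.arc (Sum.inl x) (Sum.inl c) :: Tensor.arc (Sum.inl a) (Sum.inl x) :: S) :=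
      a1.of_perm (fun t ht => by
        rcases List.mem_cons.1 ht with rfl | ht
        · exact Tensor.wf_arc _ _
        · exact a1.1 t (List.mem_cons_of_mem _ ht)) ((List.Perm.swap _ _ _).append_right _)
    have a4 := a3.perm (List.Perm.swap _ _ _)
    have a5 := a2.perm (List.Perm.swap _ _ _)
    exact (VE.netPerm (List.Perm.swap _ _ _) a3 rfl).trans ((VE.netFlip a4 rfl).trans
      (VE.netPerm (List.Perm.swap _ _ _) a5 rfl))

theorem sameClosures_of_move {D E : LinkoidDiagram n} (h : InContext IsotopyMove D.word E.word ∨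
    InContext ClassicalMove D.word E.word ∨ SphereMove D.word E.word) : SameClosures D E := by
  rcases h with ⟨a, c, s, t, p, q, h, hD, hE⟩ | ⟨a, c, s, t, p, q, h, hD, hE⟩ | h
  · cases h with
    | exchange g h m => exact sameClosures_exchange hD hE
    | snakeLeft => exact sameClosures_of_labels hD hE rfl rfl (.inl .snakeLeft)
    | snakeRight => exact sameClosures_of_labels hD hE rfl rfl (.inl .snakeRight)
    | overCap => exact sameClosures_of_labels hD hE rfl rfl (.inl .overCap)
    | underCap => exact sameClosures_of_labels hD hE rfl rfl (.inl .underCap)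
    | virtCap => exact sameClosures_of_labels hD hE rfl rfl (.inl .virtCap)
    | overCup => exact sameClosures_of_labels hD hE rfl rfl (.inl .overCup)
    | underCup => exact sameClosures_of_labels hD hE rfl rfl (.inl .underCup)
    | virtCup => exact sameClosures_of_labels hD hE rfl rfl (.inl .virtCup)
    | birthLeft e => exact sameClosures_turn (e := e) hD hE (.inl ⟨.inl rfl, rfl⟩)
    | birthRight e => exact sameClosures_turn (e := e) hD hE (.inl ⟨.inr rfl, rfl⟩)
    | deathLeft e => exact sameClosures_turn (e := e) hD hE (.inr ⟨.inl rfl, rfl⟩)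
    | deathRight e => exact sameClosures_turn (e := e) hD hE (.inr ⟨.inr rfl, rfl⟩)
  · refine sameClosures_of_labels hD hE ?_ ?_ (.inr (.inl ?_)) <;> cases h
    all_goals first | rfl | constructor
  · exact sameClosures_sphere h

theorem sameClosures_of_linkoid_eq {D E : LinkoidDiagram n} (h : D.linkoid = E.linkoid) : SameClosures D E := by
  have h' : Relation.EqvGen _ D E := Quotient.exact h
  clear h
  induction h' with
  | rel _ _ h => exact sameClosures_of_move h
  | refl => exact .refl _
  | symm _ _ _ ih => exact ih.symm
  | trans _ _ _ _ _ ih1 ih2 => exact ih1.trans ih2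

end Invariance

/-- The virtual closure map. -/
theorem existsUnique_virtualClosureMap : ∃! φ : ClosureDatum → VirtualLink, IsVirtualClosureMap φ := by
  have hD : ∀ x : ClosureDatum, ∃ D : LinkoidDiagram x.n, D.linkoid = x.linkoid := fun x => Quotient.exists_rep _
  choose D hD using hD
  have hK := fun x : ClosureDatum => (D x).exists_isVirtualClosure x.closurePerm
  choose K hK using hK
  refine ⟨fun x => (K x).link, fun x E K' hE hK' =>
    sameClosures_of_linkoid_eq ((hD x).trans hE.symm) _ _ _ (hK x) hK', fun φ hφ => ?_⟩
  funext x
  exact hφ x (D x) (K x) (hD x) (hK x)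

/-! ### Equivalent networks -/

section NetEq

variable {α : Type} [DecidableEq α]

/-- The networks are interchangeable as parts of diagrams. -/
def NetEq (S T : List (Tensor Empty α)) : Prop :=
  ∀ β, Good β S → Good β T ∧ VE β.length (net β S) (net β T)

namespace NetEq

variable {S T R : List (Tensor Empty α)}

theorem refl (S : List (Tensor Empty α)) : NetEq S S := fun _ h => ⟨h, .refl (ok_net h)⟩

theorem trans {U : List (Tensor Empty α)} (h : NetEq S T) (h' : NetEq T U) : NetEq S U := fun β hG =>
  ⟨(h' β (h β hG).1).1, (h β hG).2.trans (h' β (h β hG).1).2⟩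

theorem of_perm (h : S.Perm T) : NetEq S T := fun _ hG =>
  ⟨⟨fun t ht => hG.1 t (h.mem_iff.2 ht), hG.2.perm ((names_perm h).append_left _)⟩, VE.netPerm h hG rfl⟩

theorem cons (t : Tensor Empty α) (h : NetEq S T) : NetEq (t :: S) (t :: T) := fun β hG => by
  have ht := hG.1 t (List.mem_cons_self ..)
  obtain ⟨h1, h2⟩ := h _ hG.cons
  refine ⟨⟨fun s hs => ?_, h1.2.perm ?_⟩, VE.netCons ht h2 rfl⟩
  · rcases List.mem_cons.1 hs with rfl | hs
    · exact ht
    · exact h1.1 s hs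
  · rw [names_cons, ← List.append_assoc]
    exact List.perm_append_comm.append_right _

theorem append_left (h : NetEq S T) : ∀ R, NetEq (R ++ S) (R ++ T)
  | [] => h
  | t :: R => (append_left h R).cons t

theorem append_right (h : NetEq S T) (R : List (Tensor Empty α)) : NetEq (S ++ R) (T ++ R) :=
  ((of_perm List.perm_append_comm).trans (h.append_left R)).trans (of_perm List.perm_append_comm)

/-- An arc attached to one leg of a piece is absorbed, and the leg takes the name of the far end of
the arc. This is `netCut` read backwards, behind the bent piece. -/
theorem leg {t t' : Tensor Empty α} {x z : α} {l₁ l₂ : List α} (hw : t'.WF) (hg : t'.gen = t.gen)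
    (h : t.legs = l₁ ++ x :: l₂) (h' : t'.legs = l₁ ++ z :: l₂) :
    NetEq (t :: Tensor.arc x z :: R) (t' :: R) := fun β hG => by
  have h1 := hG.cons
  rw [h, List.append_assoc, List.cons_append] at h1
  refine ⟨⟨fun s hs => ?_, hG.2.of_double (x := x) ?_⟩, ?_⟩
  · rcases List.mem_cons.1 hs with rfl | hs
    · exact hw
    · exact hG.1 s (by simp [hs])
  · refine List.perm_iff_count.2 fun y => ?_
    rw [names_cons, names_cons, names_cons, h, h']
    simp only [Tensor.arc, Tensor.legs, List.count_append, List.count_cons, List.reverse_nil,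
      List.count_nil]
    ring
  · have hl := (hG.1 t (by simp)).length_legs
    have c := (VE.netCut h1 rfl).symm
    simp only [net, hg]
    refine VE.bend (m := (l₁ ++ x :: (l₂ ++ β)).length) ?_ (by omega) ?_
    · rw [h, h', List.append_assoc, List.append_assoc, List.cons_append, List.cons_append]
      exact c
    · rw [h] at hl
      simp only [List.length_append, List.length_cons] at hl ⊢
      omega

theorem flip {a b : α} : NetEq (Tensor.arc a b :: R) (Tensor.arc b a :: R) := fun β hG =>
  ⟨hG.of_perm (fun t ht => by
      rcases List.mem_cons.1 ht with rfl | ht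
      · exact Tensor.wf_arc _ _
      · exact hG.1 t (List.mem_cons_of_mem _ ht)) (((List.Perm.swap _ _ _).append_right _).append_left _),
    VE.netFlip hG rfl⟩

theorem capArc {a b : α} : NetEq (⟨cap, [a, b], []⟩ :: R) (Tensor.arc a b :: R) := fun β hG =>
  ⟨hG.of_perm (fun t ht => by
      rcases List.mem_cons.1 ht with rfl | ht
      · exact Tensor.wf_arc _ _
      · exact hG.1 t (List.mem_cons_of_mem _ ht)) (((List.Perm.swap _ _ _).append_right _).append_left _),
    VE.netCapArc hG rfl⟩

theorem join {x y z : α} : NetEq (Tensor.arc x y :: Tensor.arc x z :: R) (Tensor.arc z y :: R) :=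
  leg (l₁ := []) (l₂ := [y]) (Tensor.wf_arc _ _) rfl rfl rfl

/-- In a network a virtual crossing is nothing but two strands, which connect its opposite legs. -/
theorem virtArcs {p q r s : α} :
    NetEq (⟨virt, [p, q], [r, s]⟩ :: R) (Tensor.arc s p :: Tensor.arc r q :: R) := fun β hG => by
  have h0 : Good β (Tensor.arc s p :: Tensor.arc r q :: R) := ⟨fun t ht => by
      rcases List.mem_cons.1 ht with rfl | ht
      · exact Tensor.wf_arc _ _
      rcases List.mem_cons.1 ht with rfl | ht
      · exact Tensor.wf_arc _ _
      · exact hG.1 t (List.mem_cons_of_mem _ ht), hG.2.perm (List.perm_iff_count.2 fun y => by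
        simp only [names_cons, Tensor.arc, Tensor.legs, List.count_append, List.count_cons, List.reverse_nil,
          List.count_nil, List.reverse_cons]
        ring)⟩
  have h1 : Good ([s] ++ (Tensor.arc r q).bot ++ p :: β) (Tensor.arc r q :: R) := h0.cons
  have h2 : Good ([] ++ s :: r :: q :: p :: β) R := h1.unpiece
  refine ⟨h0, ?_⟩
  change VE β.length ((0, cup) :: (0 + 1, cup) :: (0, virt) :: net (r :: s :: q :: p :: β) R)
    ((0, cup) :: net (s :: p :: β) (Tensor.arc r q :: R))
  refine VE.cons (m := β.length + 2) 0 cup ?_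
  refine VE.trans ?_ (VE.netPiece h1 (l := 1) (by simp [Tensor.arc]) rfl)
  exact VE.cons (m := β.length + 4) 1 cup (VE.netSwap h2 (by simp) rfl)

end NetEq

/-- The network of a word. -/
theorem Named.ve_net {β : List α} {w : Word Empty} {T : List (Tensor Empty α)} (h : Named β w T []) (hG : Good β T) :
    VE β.length (strip w) (net β T) := by
  generalize e : ([] : List α) = δ at h
  induction h with
  | nil => subst e; exact .of_eq rfl (by simp [strip, net, contract_nil])
  | @cons β₁ bot top β₂ δ g w T l r hl hr hb ht h ih =>
    have h1 : Good (β₁ ++ (⟨g, bot, top⟩ : Tensor Empty α).bot ++ β₂) (⟨g, bot, top⟩ :: T) := hG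
    have h2 := VE.netPiece h1 rfl hl.symm
    refine VE.trans (VE.cons' (m := (β₁ ++ top ++ β₂).length) (l, g) ?_ ?_ (ih h1.unpiece e)) h2
    · simp [hl, hr, hb]
    · simp [hl, hr, hb, ht]; omega

/-- Arcs and classical crossings. -/
inductive Tensor.Simple : Tensor Empty α → Prop
  | arc (a b : α) : Simple (Tensor.arc a b)
  | cross {g : Gen Empty} (hg : g.IsClassicalCrossing) (p q r s : α) : Simple ⟨g, [p, q], [r, s]⟩

/-- Minima, maxima and virtual crossings are made of strands only, so that besides arcs just the
classical crossings remain, as in a Gauss diagram. -/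
theorem exists_simple : ∀ {T : List (Tensor Empty α)}, (∀ t ∈ T, t.WF) →
    ∃ B : List (Tensor Empty α), (∀ t ∈ B, t.Simple) ∧ NetEq T B
  | [], _ => ⟨[], by simp, .refl _⟩
  | ⟨g, bot, top⟩ :: T, h => by
    obtain ⟨B, hB, e⟩ := exists_simple fun t ht => h t (List.mem_cons_of_mem _ ht)
    obtain ⟨h1, h2⟩ := h _ (List.mem_cons_self ..)
    have e' := e.cons ⟨g, bot, top⟩
    have cross : g.IsClassicalCrossing → ∃ B : List (Tensor Empty α), (∀ t ∈ B, t.Simple) ∧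
        NetEq (⟨g, bot, top⟩ :: T) B := fun hg => by
      obtain ⟨p, q, rfl⟩ := List.length_eq_two.1 (h1.trans (by rcases hg with rfl | rfl <;> rfl))
      obtain ⟨r, s, rfl⟩ := List.length_eq_two.1 (h2.trans (by rcases hg with rfl | rfl <;> rfl))
      exact ⟨_, List.forall_mem_cons.2 ⟨.cross hg p q r s, hB⟩, e'⟩
    cases g with
    | cup =>
      obtain rfl := List.length_eq_zero_iff.1 h1
      obtain ⟨r, s, rfl⟩ := List.length_eq_two.1 h2
      exact ⟨_, List.forall_mem_cons.2 ⟨.arc r s, hB⟩, e'⟩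
    | cap =>
      obtain rfl := List.length_eq_zero_iff.1 h2
      obtain ⟨r, s, rfl⟩ := List.length_eq_two.1 h1
      exact ⟨_, List.forall_mem_cons.2 ⟨.arc r s, hB⟩, e'.trans .capArc⟩
    | overX => exact cross (.inl rfl)
    | underX => exact cross (.inr rfl)
    | virt =>
      obtain ⟨p, q, rfl⟩ := List.length_eq_two.1 h1
      obtain ⟨r, s, rfl⟩ := List.length_eq_two.1 h2
      exact ⟨_, List.forall_mem_cons.2 ⟨.arc _ _, List.forall_mem_cons.2 ⟨.arc _ _, hB⟩⟩, e'.trans .virtArcs⟩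
    | birth e => exact e.elim
    | death e => exact e.elim
    | mark e => exact e.elim

end NetEq

/-! ### Diagrams that are put together from pieces without strands between them -/

section Strands

variable {ι : Type}

/-- `w` is a diagram of strands from `e` to `e'`, for the pairs `(e, e')` in `L`. -/
structure Strands (w : Word ι) (L : List (ι × ι)) : Prop where
  closed : IsWord 0 w 0
  classical : ∀ x ∈ w, x.gen ≠ Gen.virt ∧ ∀ e, x.gen ≠ Gen.mark e
  labels : (labels w).Perm (L.flatMap fun p => [p.1, p.2])
  joined : ∀ p ∈ L, ∃ y z, EndAt w p.1 y ∧ EndAt w p.2 z ∧ Joined w y z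
  arcs : ∀ z, IsPoint w z → ∃ e y, EndAt w e y ∧ Joined w z y

/-- A point after layers have been added below. -/
def later (n : ℕ) (z : ℕ × ℕ) : ℕ × ℕ := (n + z.1, z.2)

theorem Link.append_right {u : Word ι} (v : Word ι) {y z : ℕ × ℕ} (h : Link u y z) : Link (u ++ v) y z := by
  have key : ∀ {t : ℕ} {x : Layer ι}, u[t]? = some x → (u ++ v)[t]? = some x := fun h => by
    rw [List.getElem?_append_left (List.getElem?_eq_some_iff.1 h).1, h]
  cases h with
  | left h hp => exact .left (key h) hp
  | right h hp => exact .right (key h) hp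
  | cup h hx => exact .cup (key h) hx
  | cap h hx => exact .cap (key h) hx
  | rising h hx => exact .rising (key h) hx
  | falling h hx => exact .falling (key h) hx

theorem getElem?_later (u : Word ι) {v : Word ι} {t : ℕ} {x : Layer ι} (h : v[t]? = some x) :
    (u ++ v)[u.length + t]? = some x := by
  rw [List.getElem?_append_right (Nat.le_add_right ..), Nat.add_sub_cancel_left, h]

theorem Link.append_left (u : Word ι) {v : Word ι} {y z : ℕ × ℕ} (h : Link v y z) :
    Link (u ++ v) (later u.length y) (later u.length z) := by
  cases h with
  | left h hp => exact .left (getElem?_later u h) hp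
  | right h hp => exact .right (getElem?_later u h) hp
  | cup h hx => exact .cup (getElem?_later u h) hx
  | cap h hx => exact .cap (getElem?_later u h) hx
  | rising h hx => exact .rising (getElem?_later u h) hx
  | falling h hx => exact .falling (getElem?_later u h) hx

theorem EndAt.append_right {u : Word ι} (v : Word ι) {e : ι} {z : ℕ × ℕ} (h : EndAt u e z) : EndAt (u ++ v) e z := by
  have key : ∀ {t : ℕ} {x : Layer ι}, u[t]? = some x → (u ++ v)[t]? = some x := fun h => by
    rw [List.getElem?_append_left (List.getElem?_eq_some_iff.1 h).1, h]
  cases h with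
  | birth h hx => exact .birth (key h) hx
  | death h hx => exact .death (key h) hx
  | below h hx => exact .below (key h) hx
  | above h hx => exact .above (key h) hx

theorem EndAt.append_left (u : Word ι) {v : Word ι} {e : ι} {z : ℕ × ℕ} (h : EndAt v e z) :
    EndAt (u ++ v) e (later u.length z) := by
  cases h with
  | birth h hx => exact .birth (getElem?_later u h) hx
  | death h hx => exact .death (getElem?_later u h) hx
  | below h hx => exact .below (getElem?_later u h) hx
  | above h hx => exact .above (getElem?_later u h) hx

theorem Joined.append_right {u : Word ι} (v : Word ι) {y z : ℕ × ℕ} (h : Joined u y z) : Joined (u ++ v) y z :=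
  eqvGen_map (f := id) (fun _ _ h => .rel _ _ (h.append_right v)) h

theorem Joined.append_left (u : Word ι) {v : Word ι} {y z : ℕ × ℕ} (h : Joined v y z) :
    Joined (u ++ v) (later u.length y) (later u.length z) :=
  eqvGen_map (f := later u.length) (fun _ _ h => .rel _ _ (h.append_left u)) h

theorem Strands.nil : Strands ([] : Word ι) [] :=
  ⟨rfl, by simp, by simp [VirtualClosure.labels], by simp, by simp [IsPoint]⟩

theorem Strands.append {u v : Word ι} {L M : List (ι × ι)} (hu : Strands u L) (hv : Strands v M) :
    Strands (u ++ v) (L ++ M) where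
  closed := isWord_append hv.closed hu.closed
  classical x hx := (List.mem_append.1 hx).elim (hu.classical x) (hv.classical x)
  labels := by
    rw [labels_append, List.flatMap_append]
    exact hu.labels.append hv.labels
  joined p hp := by
    rcases List.mem_append.1 hp with hp | hp
    · obtain ⟨y, z, h1, h2, h3⟩ := hu.joined p hp
      exact ⟨y, z, h1.append_right v, h2.append_right v, h3.append_right v⟩
    · obtain ⟨y, z, h1, h2, h3⟩ := hv.joined p hp
      exact ⟨_, _, h1.append_left u, h2.append_left u, h3.append_left u⟩
  arcs z := by
    rintro ⟨x, h, hz⟩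
    rcases Nat.lt_or_ge z.1 u.length with h1 | h1
    · rw [List.getElem?_append_left h1] at h
      obtain ⟨e, y, h2, h3⟩ := hu.arcs z ⟨x, h, hz⟩
      exact ⟨e, y, h2.append_right v, h3.append_right v⟩
    · rw [List.getElem?_append_right h1] at h
      obtain ⟨e, y, h2, h3⟩ := hv.arcs (z.1 - u.length, z.2) ⟨x, h, hz⟩
      have h4 := h3.append_left u
      rw [show later u.length (z.1 - u.length, z.2) = z from
        Prod.ext (Nat.add_sub_cancel' h1) rfl] at h4
      exact ⟨e, _, h2.append_left u, h4⟩

/-- A strand without crossings. -/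
def interval (e e' : ι) : Word ι := [⟨0, .birth e, 0⟩, ⟨0, .death e', 0⟩]

/-- Two strands with one crossing. -/
def crossed (g : Gen ι) (e₁ e₁' e₂ e₂' : ι) : Word ι :=
  [⟨0, .birth e₁, 0⟩, ⟨1, .birth e₂, 0⟩, ⟨0, g, 0⟩, ⟨0, .death e₂', 1⟩, ⟨0, .death e₁', 0⟩]

theorem strands_interval (e e' : ι) : Strands (interval e e') [(e, e')] where
  closed := ⟨rfl, rfl, rfl⟩
  classical := by simp [interval]
  labels := List.Perm.refl _
  joined := by
    rintro p hp
    obtain rfl := List.mem_singleton.1 hp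
    exact ⟨(1, 0), (1, 0), .birth (t := 0) (x := ⟨0, .birth e, 0⟩) rfl rfl,
      .death (t := 1) (x := ⟨0, .death e', 0⟩) rfl rfl, .refl _⟩
  arcs := by
    rintro ⟨t, p⟩ ⟨x, h, hp⟩
    simp only at h hp
    match t, h with
    | 0, h => cases h; simp [Layer.source, dom] at hp
    | 1, h =>
      cases h
      obtain rfl : p = 0 := by simpa [Layer.source, dom] using hp
      exact ⟨e', (1, 0), .death (t := 1) (x := ⟨0, .death e', 0⟩) rfl rfl, .refl _⟩
    | n + 2, h => simp [interval] at h

theorem strands_crossed {g : Gen ι} (hg : g.IsClassicalCrossing) (e₁ e₁' e₂ e₂' : ι) :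
    Strands (crossed g e₁ e₁' e₂ e₂') [(e₁, e₁'), (e₂, e₂')] := by
  have hd : g.dom = 2 := by rcases hg with rfl | rfl <;> rfl
  have hc : g.cod = 2 := by rcases hg with rfl | rfl <;> rfl
  have l1 : Link (crossed g e₁ e₁' e₂ e₂') (1, 0) (2, 0) := .left (t := 1) (x := ⟨1, .birth e₂, 0⟩) rfl Nat.one_pos
  have l2 : Link (crossed g e₁ e₁' e₂ e₂') (2, 0) (3, 1) := .rising (t := 2) (x := ⟨0, g, 0⟩) rfl (.inl hg)
  have l3 : Link (crossed g e₁ e₁' e₂ e₂') (2, 1) (3, 0) := .falling (t := 2) (x := ⟨0, g, 0⟩) rfl (.inl hg)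
  have l4 : Link (crossed g e₁ e₁' e₂ e₂') (3, 1) (4, 0) := .right (t := 3) (p := 0) (x := ⟨0, .death e₂', 1⟩) rfl Nat.one_pos
  have j1 : Joined (crossed g e₁ e₁' e₂ e₂') (3, 1) (4, 0) := .rel _ _ l4
  have j2 : Joined (crossed g e₁ e₁' e₂ e₂') (2, 0) (4, 0) := (Relation.EqvGen.rel _ _ l2).trans _ _ _ j1
  have j3 : Joined (crossed g e₁ e₁' e₂ e₂') (1, 0) (4, 0) := (Relation.EqvGen.rel _ _ l1).trans _ _ _ j2
  have j4 : Joined (crossed g e₁ e₁' e₂ e₂') (2, 1) (3, 0) := .rel _ _ l3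
  have d1 : EndAt (crossed g e₁ e₁' e₂ e₂') e₁' (4, 0) := .death (t := 4) (x := ⟨0, .death e₁', 0⟩) rfl rfl
  have d2 : EndAt (crossed g e₁ e₁' e₂ e₂') e₂' (3, 0) := .death (t := 3) (x := ⟨0, .death e₂', 1⟩) rfl rfl
  refine ⟨⟨rfl, rfl, by simp [Layer.source, Layer.target, hd, cod], ?_⟩, ?_, ?_, ?_, ?_⟩
  · exact ⟨by simp [Layer.source, Layer.target, hc, dom], rfl, rfl⟩
  · rcases hg with rfl | rfl <;> simp [crossed]
  · refine (show (VirtualClosure.labels (crossed g e₁ e₁' e₂ e₂')).Perm [e₁, e₁', e₂, e₂'] from ?_)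
    rw [show VirtualClosure.labels (crossed g e₁ e₁' e₂ e₂') = [e₁, e₂, e₂', e₁'] by
      rcases hg with rfl | rfl <;> rfl]
    exact (List.Perm.cons _ ((List.perm_append_comm (l₁ := [e₂, e₂']) (l₂ := [e₁']))))
  · intro p hp
    simp only [List.mem_cons, List.not_mem_nil, or_false] at hp
    rcases hp with rfl | rfl
    · exact ⟨_, _, .birth (t := 0) (x := ⟨0, .birth e₁, 0⟩) rfl rfl, d1, j3⟩
    · exact ⟨_, _, .birth (t := 1) (x := ⟨1, .birth e₂, 0⟩) rfl rfl, d2, j4⟩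
  · rintro ⟨t, p⟩ ⟨x, h, hp⟩
    simp only at h hp
    match t, h with
    | 0, h => cases h; simp [Layer.source, dom] at hp
    | 1, h =>
      cases h
      obtain rfl : p = 0 := by simpa [Layer.source, dom] using hp
      exact ⟨_, _, d1, j3⟩
    | 2, h =>
      cases h
      have : p < 2 := by simpa [Layer.source, hd] using hp
      match p, this with
      | 0, _ => exact ⟨_, _, d1, j2⟩
      | 1, _ => exact ⟨_, _, d2, j4⟩
    | 3, h =>
      cases h
      have : p < 2 := by simpa [Layer.source, dom] using hp
      match p, this with
      | 0, _ => exact ⟨_, _, d2, .refl _⟩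
      | 1, _ => exact ⟨_, _, d1, j1⟩
    | 4, h =>
      cases h
      obtain rfl : p = 0 := by simpa [Layer.source, dom] using hp
      exact ⟨_, _, d1, .refl _⟩
    | n + 5, h => simp [crossed] at h

/-- The labels at the ends of `n` strands: `2 * i` and `2 * i + 1`. -/
def ends (n : ℕ) : List (Fin (2 * n) × Fin (2 * n)) :=
  (List.finRange n).map fun i =>
    (⟨2 * i.1, by have := i.2; omega⟩, ⟨2 * i.1 + 1, by have := i.2; omega⟩)

/-- The label at the other end of a strand. -/
def opposite {n : ℕ} (i : Fin (2 * n)) : Fin (2 * n) :=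
  if h : i.1 % 2 = 0 then ⟨i.1 + 1, by have := i.2; omega⟩ else ⟨i.1 - 1, by have := i.2; omega⟩

theorem opposite_of_even {n : ℕ} {i : Fin (2 * n)} (h : i.1 % 2 = 0) : (opposite i).1 = i.1 + 1 := by
  rw [opposite, dif_pos h]

theorem opposite_of_odd {n : ℕ} {i : Fin (2 * n)} (h : ¬ i.1 % 2 = 0) : (opposite i).1 = i.1 - 1 := by
  rw [opposite, dif_neg h]

theorem opposite_opposite {n : ℕ} (i : Fin (2 * n)) : opposite (opposite i) = i := by
  apply Fin.ext
  by_cases h : i.1 % 2 = 0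
  · have h' := opposite_of_even h
    rw [opposite_of_odd (by omega)]; omega
  · have h' := opposite_of_odd h
    rw [opposite_of_even (by omega)]; omega

/-- The involution that exchanges `2 * i` and `2 * i + 1`. -/
def adjacent (n : ℕ) : Pairing n :=
  ⟨⟨opposite, opposite, opposite_opposite, opposite_opposite⟩, fun i => ⟨opposite_opposite i, fun h => by
    have h : (opposite i).1 = i.1 := congrArg Fin.val h
    by_cases hi : i.1 % 2 = 0
    · rw [opposite_of_even hi] at h; omega
    · rw [opposite_of_odd hi] at h; omega⟩⟩

theorem ends_perm (n : ℕ) : ((ends n).flatMap fun p => [p.1, p.2]).Perm (List.finRange (2 * n)) := by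
  rw [ends, List.flatMap_map]
  refine (List.perm_ext_iff_of_nodup (List.nodup_flatMap.2 ⟨fun i _ => by simp, ?_⟩) (List.nodup_finRange _)).2 fun i => ?_
  · refine (List.nodup_finRange n).imp fun {i j} h x hi hj => h (Fin.ext ?_)
    simp only [List.mem_cons, List.not_mem_nil, or_false, Fin.ext_iff] at hi hj
    omega
  · simp only [List.mem_flatMap, List.mem_finRange, true_and, iff_true, List.mem_cons, List.not_mem_nil, or_false, Fin.ext_iff]
    have := i.2
    exact ⟨⟨i.1 / 2, by omega⟩, by simp only; omega⟩

variable {n : ℕ}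

/-- The linkoid diagram of a word. -/
def Strands.diagram {w : Word (Fin (2 * n))} (h : Strands w (ends n)) : LinkoidDiagram n where
  word := w
  closed := h.closed
  classical := h.classical
  labelled e := by
    rw [(h.labels.trans (ends_perm n)).count_eq]
    exact List.count_eq_one_of_mem (List.nodup_finRange _) (List.mem_finRange e)
  arcs := h.arcs

theorem EndAt.eq_of_classical {w : Word (Fin (2 * n))} (hw : ∀ x ∈ w, ∀ e, x.gen ≠ Gen.mark e)
    (hl : ∀ e, (labels w).count e = 1) {e : Fin (2 * n)} {y z : ℕ × ℕ} (hy : EndAt w e y) (hz : EndAt w e z) : y = z := by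
  have key : ∀ {y}, EndAt w e y → ∃ (t : ℕ) (x : Layer (Fin (2 * n))), w[t]? = some x ∧
      (x.gen = Gen.birth e ∧ y = (t + 1, x.left) ∨ x.gen = Gen.death e ∧ y = (t, x.left)) := by
    intro y h
    cases h with
    | birth h hx => exact ⟨_, _, h, .inl ⟨hx, rfl⟩⟩
    | death h hx => exact ⟨_, _, h, .inr ⟨hx, rfl⟩⟩
    | below h hx => exact (hw _ (List.mem_of_getElem? h) _ hx).elim
    | above h hx => exact (hw _ (List.mem_of_getElem? h) _ hx).elim
  obtain ⟨t, x, h1, h2⟩ := key hy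
  obtain ⟨t', x', h1', h2'⟩ := key hz
  have e1 : x.gen.label = some e := by rcases h2 with ⟨h, -⟩ | ⟨h, -⟩ <;> rw [h] <;> rfl
  have e2 : x'.gen.label = some e := by rcases h2' with ⟨h, -⟩ | ⟨h, -⟩ <;> rw [h] <;> rfl
  obtain rfl := index_unique (hl e) h1 h1' e1 e2
  obtain rfl := Option.some.inj (h1.symm.trans h1')
  rcases h2 with ⟨h, rfl⟩ | ⟨h, rfl⟩ <;> rcases h2' with ⟨h', rfl⟩ | ⟨h', rfl⟩ <;> first | rfl | (rw [h] at h'; cases h')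

theorem Strands.hasStrandPerm {w : Word (Fin (2 * n))} (h : Strands w (ends n)) :
    h.diagram.linkoid.HasStrandPerm (adjacent n) := by
  refine ⟨h.diagram, rfl, fun e y z hy hz => ?_⟩
  have uniq := fun {e y z} => EndAt.eq_of_classical (fun x hx => (h.diagram.classical x hx).2) h.diagram.labelled (e := e) (y := y) (z := z)
  have he' := e.2
  have hi : e.1 / 2 < n := by omega
  have hmem : ((⟨2 * (e.1 / 2), by omega⟩, ⟨2 * (e.1 / 2) + 1, by omega⟩) : Fin (2 * n) × Fin (2 * n)) ∈ ends n :=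
    List.mem_map.2 ⟨⟨e.1 / 2, hi⟩, List.mem_finRange _, rfl⟩
  obtain ⟨y', z', h1, h2, h3⟩ := h.joined _ hmem
  simp only at h1 h2
  by_cases he : e.1 % 2 = 0
  · have e1 : (⟨2 * (e.1 / 2), by omega⟩ : Fin (2 * n)) = e := Fin.ext (by simp only; omega)
    have e2 : (⟨2 * (e.1 / 2) + 1, by omega⟩ : Fin (2 * n)) = (adjacent n).1 e := Fin.ext (by
      refine Eq.trans ?_ (opposite_of_even he).symm; simp only; omega)
    rw [e1] at h1
    rw [e2] at h2
    rw [uniq hy h1, uniq hz h2]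
    exact h3
  · have e1 : (⟨2 * (e.1 / 2) + 1, by omega⟩ : Fin (2 * n)) = e := Fin.ext (by simp only; omega)
    have e2 : (⟨2 * (e.1 / 2), by omega⟩ : Fin (2 * n)) = (adjacent n).1 e := Fin.ext (by
      refine Eq.trans ?_ (opposite_of_odd he).symm; simp only; omega)
    rw [e1] at h2
    rw [e2] at h1
    rw [uniq hy h2, uniq hz h1]
    exact h3.symm

end Strands

/-! ### Surjectivity -/

section Realize

theorem Named.isWord {ι α : Type} {β δ : List α} {w : Word ι} {T : List (Tensor ι α)} (h : Named β w T δ) :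
    IsWord β.length w δ.length := by
  induction h with
  | nil => rfl
  | cons hl hr hb ht h ih => exact ⟨by simp [Layer.source, hl, hr, hb, Nat.add_assoc],
    by simpa [Layer.target, hl, hr, ht, Nat.add_assoc] using ih⟩

/-- Two consecutive closed diagrams have independent networks. -/
theorem Named.append_inv_closed {ι α : Type} {u v : Word ι} {T : List (Tensor ι α)} (hu : IsWord 0 u 0)
    (h : Named [] (u ++ v) T []) : ∃ T₁ T₂, T = T₁ ++ T₂ ∧ Named [] u T₁ [] ∧ Named [] v T₂ [] := by
  obtain ⟨T₁, T₂, γ, rfl, h1, h2⟩ := h.append_inv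
  obtain rfl := List.length_eq_zero_iff.1 (h1.isWord.right_unique hu)
  exact ⟨T₁, T₂, rfl, h1, h2⟩

variable {ι : Type}

/-- The closures of the diagram `w` are obtained from the network `B`. -/
def Realizes (b : ι → ℕ) (w : Word ι) (B : List (Tensor Empty ℕ)) : Prop :=
  ∀ T, Named [] w T [] → NetEq (T.map (Tensor.close b)) (B.map (Tensor.map (Sum.inr : ℕ → ℕ ⊕ ℕ)))

theorem Realizes.append {b : ι → ℕ} {u v : Word ι} {B C : List (Tensor Empty ℕ)} (hu : IsWord 0 u 0)
    (h : Realizes b u B) (h' : Realizes b v C) : Realizes b (u ++ v) (B ++ C) := by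
  intro T hT
  obtain ⟨T₁, T₂, rfl, h1, h2⟩ := hT.append_inv_closed hu
  rw [List.map_append, List.map_append]
  exact ((h T₁ h1).append_right _).trans ((h' T₂ h2).append_left _)

/-- The two closed ends turn the interval into a chain of two arcs, which are joined. -/
theorem realizes_interval (b : ι → ℕ) (e e' : ι) : Realizes b (interval e e') [Tensor.arc (b e) (b e')] := by
  intro T hT
  obtain ⟨top, T, rfl, -, ht, hT⟩ := Named.cons_inv hT (β₁ := []) (bot := []) (β₂ := []) rfl rfl rfl
  obtain ⟨a, rfl⟩ := List.length_eq_one_iff.1 ht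
  obtain ⟨top, T, rfl, -, ht, hT⟩ := Named.cons_inv hT (β₁ := []) (bot := [a]) (β₂ := []) rfl rfl rfl
  obtain rfl := List.length_eq_zero_iff.1 ht
  obtain ⟨rfl, -⟩ := hT.nil_inv
  change NetEq [Tensor.arc (Sum.inl a) (Sum.inr (b e)), Tensor.arc (Sum.inl a) (Sum.inr (b e'))]
    [Tensor.arc (Sum.inr (b e)) (Sum.inr (b e'))]
  exact NetEq.join.trans .flip

/-- Each of the four closed ends is an arc at one leg of the crossing; `NetEq.leg` absorbs them one
after another. -/
theorem realizes_crossed (b : ι → ℕ) {g : Gen Empty} {g' : Gen ι} (hg : g'.IsClassicalCrossing) (hg' : g'.forgetMark = some g)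
    (e₁ e₁' e₂ e₂' : ι) :
    Realizes b (crossed g' e₁ e₁' e₂ e₂') [⟨g, [b e₁, b e₂], [b e₂', b e₁']⟩] := by
  have hd : g'.dom = 2 := by rcases hg with rfl | rfl <;> rfl
  have hc : g'.cod = 2 := by rcases hg with rfl | rfl <;> rfl
  have hg2 : g.dom = 2 ∧ g.cod = 2 := by rcases hg with rfl | rfl <;> cases hg' <;> exact ⟨rfl, rfl⟩
  intro T hT
  obtain ⟨top, T, rfl, -, ht, hT⟩ := Named.cons_inv hT (β₁ := []) (bot := []) (β₂ := []) rfl rfl rfl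
  obtain ⟨p, rfl⟩ := List.length_eq_one_iff.1 ht
  obtain ⟨top, T, rfl, -, ht, hT⟩ := Named.cons_inv hT (β₁ := [p]) (bot := []) (β₂ := []) rfl rfl rfl
  obtain ⟨q, rfl⟩ := List.length_eq_one_iff.1 ht
  obtain ⟨top, T, rfl, -, ht, hT⟩ := Named.cons_inv hT (β₁ := []) (bot := [p, q]) (β₂ := []) rfl rfl rfl
  obtain ⟨r, s, rfl⟩ := List.length_eq_two.1 (ht.trans hc)
  obtain ⟨top, T, rfl, -, ht, hT⟩ := Named.cons_inv hT (β₁ := []) (bot := [r]) (β₂ := [s]) rfl rfl rfl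
  obtain rfl := List.length_eq_zero_iff.1 ht
  obtain ⟨top, T, rfl, -, ht, hT⟩ := Named.cons_inv hT (β₁ := []) (bot := [s]) (β₂ := []) rfl rfl rfl
  obtain rfl := List.length_eq_zero_iff.1 ht
  obtain ⟨rfl, -⟩ := hT.nil_inv
  have e : Tensor.close b ⟨g', [p, q], [r, s]⟩ = (⟨g, [Sum.inl p, Sum.inl q], [Sum.inl r, Sum.inl s]⟩ : Tensor Empty (ℕ ⊕ ℕ)) := by
    simp [Tensor.close, hg']
  simp only [List.map_cons, List.map_nil, e]
  change NetEq [Tensor.arc (Sum.inl p) (Sum.inr (b e₁)), Tensor.arc (Sum.inl q) (Sum.inr (b e₂)),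
    ⟨g, [Sum.inl p, Sum.inl q], [Sum.inl r, Sum.inl s]⟩, Tensor.arc (Sum.inl r) (Sum.inr (b e₂')),
    Tensor.arc (Sum.inl s) (Sum.inr (b e₁'))] [⟨g, [Sum.inr (b e₁), Sum.inr (b e₂)], [Sum.inr (b e₂'), Sum.inr (b e₁')]⟩]
  have wf : ∀ x y z w : ℕ ⊕ ℕ, (⟨g, [x, y], [z, w]⟩ : Tensor Empty (ℕ ⊕ ℕ)).WF := fun _ _ _ _ => ⟨hg2.1.symm, hg2.2.symm⟩
  refine (NetEq.of_perm (List.perm_append_comm (l₁ := [_, _]))).trans ?_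
  refine (NetEq.leg (l₁ := []) (t := ⟨g, [Sum.inl p, Sum.inl q], [Sum.inl r, Sum.inl s]⟩)
    (wf (Sum.inl p) (Sum.inl q) (Sum.inr (b e₂')) (Sum.inl s)) rfl rfl rfl).trans ?_
  refine (NetEq.leg (l₁ := [Sum.inr (b e₂')]) (t := ⟨g, [Sum.inl p, Sum.inl q], [Sum.inr (b e₂'), Sum.inl s]⟩)
    (wf (Sum.inl p) (Sum.inl q) (Sum.inr (b e₂')) (Sum.inr (b e₁'))) rfl rfl rfl).trans ?_
  refine (NetEq.leg (l₁ := [Sum.inr (b e₂'), Sum.inr (b e₁'), Sum.inl q])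
    (t := ⟨g, [Sum.inl p, Sum.inl q], [Sum.inr (b e₂'), Sum.inr (b e₁')]⟩)
    (wf (Sum.inr (b e₁)) (Sum.inl q) (Sum.inr (b e₂')) (Sum.inr (b e₁'))) rfl rfl rfl).trans ?_
  exact NetEq.leg (l₁ := [Sum.inr (b e₂'), Sum.inr (b e₁')]) (wf _ _ _ _) rfl rfl rfl

/-- The pairs of opposite names at an arc or at a crossing. -/
def Tensor.pairs {α : Type} : Tensor Empty α → List (α × α)
  | ⟨_, [], [a, b]⟩ => [(a, b)]
  | ⟨_, [p, q], [r, s]⟩ => [(p, s), (q, r)]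
  | _ => []

theorem Tensor.Simple.legs_perm {α : Type} {t : Tensor Empty α} (h : t.Simple) :
    t.legs.Perm (t.pairs.flatMap fun p => [p.1, p.2]) := by
  cases h with
  | arc a b => exact .refl _
  | cross hg p q r s =>
    change [r, s, q, p].Perm [p, s, q, r]
    classical
    exact List.perm_iff_count.2 fun y => by simp only [List.count_cons, List.count_nil]; ring

theorem names_perm_pairs {α : Type} : ∀ {B : List (Tensor Empty α)}, (∀ t ∈ B, t.Simple) →
    (names B).Perm ((B.flatMap Tensor.pairs).flatMap fun p => [p.1, p.2])
  | [], _ => .refl _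
  | t :: B, h => by
    rw [names_cons, List.flatMap_cons, List.flatMap_append]
    exact (h t (List.mem_cons_self ..)).legs_perm.append (names_perm_pairs fun t ht => h t (List.mem_cons_of_mem _ ht))

/-- Each arc becomes an interval and each crossing a pair of crossed strands. All these diagrams are
closed words and are simply stacked; connections between them are left to the closure. -/
theorem exists_realizes (b : ι → ℕ) : ∀ {B : List (Tensor Empty ℕ)}, (∀ t ∈ B, t.Simple) → ∀ {L : List (ι × ι)},
    L.map (Prod.map b b) = B.flatMap Tensor.pairs → ∃ w, Strands w L ∧ Realizes b w B
  | [], _, L, hL => by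
    obtain rfl := List.map_eq_nil_iff.1 hL
    refine ⟨[], .nil, fun T hT => ?_⟩
    obtain ⟨rfl, -⟩ := hT.nil_inv
    exact .refl _
  | t :: B, h, L, hL => by
    rw [List.flatMap_cons] at hL
    obtain ⟨L₁, L₂, rfl, h1, h2⟩ := List.map_eq_append_iff.1 hL
    obtain ⟨w, hw, hr⟩ := exists_realizes b (fun t ht => h t (List.mem_cons_of_mem _ ht)) h2
    have key : ∃ u, Strands u L₁ ∧ Realizes b u [t] := by
      cases h t (List.mem_cons_self ..) with
      | arc x y =>
        obtain ⟨⟨e, e'⟩, rfl, h⟩ := List.map_eq_singleton_iff.1 h1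
        cases h
        exact ⟨_, strands_interval e e', realizes_interval b e e'⟩
      | @cross g hg p q r s =>
        obtain ⟨⟨e₁, e₁'⟩, L, rfl, h, h1⟩ := List.map_eq_cons_iff.1 h1
        obtain ⟨⟨e₂, e₂'⟩, rfl, h'⟩ := List.map_eq_singleton_iff.1 h1
        cases h
        cases h'
        rcases hg with rfl | rfl
        · exact ⟨_, strands_crossed (g := overX) (.inl rfl) e₁ e₁' e₂ e₂', realizes_crossed b (.inl rfl) rfl _ _ _ _⟩
        · exact ⟨_, strands_crossed (g := underX) (.inr rfl) e₁ e₁' e₂ e₂', realizes_crossed b (.inr rfl) rfl _ _ _ _⟩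
    obtain ⟨u, hu, hru⟩ := key
    exact ⟨u ++ w, hu.append hw, hru.append hu.closed hr⟩

end Realize

/-- Each name belongs to exactly two labels, and `σ` exchanges them. -/
theorem exists_pairing {n : ℕ} {γ : Type} [DecidableEq γ] (b : Fin (2 * n) → γ)
    (h : Lin ((List.finRange (2 * n)).map b)) : ∃ σ : Pairing n, ArcNames σ b := by
  have h2 : ∀ e, ∃ e', e' ≠ e ∧ ∀ x, b e = b x ↔ x = e ∨ x = e' := by
    intro e
    have hc := (h (b e)).resolve_left (List.count_pos_iff.2 (List.mem_map_of_mem (List.mem_finRange e))).ne'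
    have hcard : (Finset.univ.filter fun x => b x = b e).card = 2 := by
      have hcount : ∀ (m : ℕ) (c : Fin m → γ) (y : γ),
          (Finset.univ.filter fun x => c x = y).card = ((List.finRange m).map c).count y := fun m c y => by
        rw [Finset.card_def, Finset.filter_val, ← Multiset.countP_eq_card_filter, List.count, List.countP_map]
        exact (Multiset.coe_countP ..).trans (List.countP_congr fun x _ => by simp)
      rw [hcount, hc]
    obtain ⟨x, y, hxy, hs⟩ := Finset.card_eq_two.1 hcard
    have hm : ∀ z, b e = b z ↔ z = x ∨ z = y := fun z => by
      have := Finset.ext_iff.1 hs z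
      simpa [eq_comm] using this
    rcases (hm e).1 rfl with rfl | rfl
    · exact ⟨y, hxy.symm, hm⟩
    · exact ⟨x, hxy, fun z => (hm z).trans or_comm⟩
  choose f hne hf using h2
  have hinv : ∀ e, f (f e) = e := fun e => by
    have h1 : b e = b (f e) := (hf e (f e)).2 (.inr rfl)
    rcases (hf (f e) e).1 h1.symm with h | h
    · exact (hne e h.symm).elim
    · exact h.symm
  exact ⟨⟨⟨f, f, hinv, hinv⟩, fun i => ⟨hinv i, hne i⟩⟩, fun e e' => hf e e'⟩

/-- The diagram is cut at every name of its simplified network. An arc contributes one component and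
a crossing two, and equal names prescribe the closure permutation. -/
theorem IsVirtualClosureMap.surjective {φ : ClosureDatum → VirtualLink} (hφ : IsVirtualClosureMap φ) :
    Function.Surjective φ := by
  intro V
  obtain ⟨K, rfl⟩ : ∃ K : VirtualDiagram, K.link = V := Quotient.exists_rep V
  obtain ⟨T, hT, hL⟩ := exists_named_closed K.closed
  have hG : Good [] T := ⟨hT.wf, hL⟩
  obtain ⟨B, hB, hTB⟩ := exists_simple hT.wf
  obtain ⟨hGB, hKB⟩ := hTB [] hG
  have hK := (hT.ve_net hG).trans hKB
  obtain ⟨n, hn⟩ : ∃ n, n = (B.flatMap Tensor.pairs).length := ⟨_, rfl⟩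
  set P := B.flatMap Tensor.pairs with hP
  have hlt : ∀ e : Fin (2 * n), e.1 / 2 < P.length := fun e => by have := e.2; omega
  -- The labels `2 * i` and `2 * i + 1` receive the names at the two ends of the strand with index
  -- `i`, to match `ends` and `adjacent`.
  set b : Fin (2 * n) → ℕ := fun e => if e.1 % 2 = 0 then (P[e.1 / 2]'(hlt e)).1 else (P[e.1 / 2]'(hlt e)).2 with hb
  have hPb : (ends n).map (Prod.map b b) = P := by
    refine List.ext_getElem (by simp [ends, hn]) fun i h1 h2 => ?_
    have e1 : 2 * i / 2 = i := by omega
    have e2 : (2 * i + 1) / 2 = i := by omega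
    have e3 : (2 * i + 1) % 2 = 1 := by omega
    simp [ends, hb, e1, e2, e3]
  obtain ⟨w, hw, hr⟩ := exists_realizes b hB hPb
  have hlin : Lin ((List.finRange (2 * n)).map b) := by
    refine Lin.perm (β := names B) (by simpa using hGB.2) ((names_perm_pairs hB).trans ?_)
    rw [← hP, ← hPb, List.flatMap_map]
    refine List.Perm.trans ?_ ((ends_perm n).map b)
    rw [List.map_flatMap]
    exact .refl _
  obtain ⟨σ, hσ⟩ := exists_pairing b hlin
  refine ⟨⟨n, hw.diagram.linkoid, adjacent n, σ, hw.hasStrandPerm⟩, ?_⟩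
  obtain ⟨K', hK'⟩ := hw.diagram.exists_isVirtualClosure σ
  rw [hφ ⟨n, hw.diagram.linkoid, adjacent n, σ, hw.hasStrandPerm⟩ hw.diagram K' rfl hK']
  obtain ⟨T', hT', hL'⟩ := exists_named_closed hw.diagram.closed
  refine VE.link ((hK'.ve_net hT' hL' hσ).trans (VE.trans ((hr T' hT') [] (hw.diagram.good_close hT' hL' hσ)).2 ?_))
  rw [show net ([] : List (ℕ ⊕ ℕ)) (B.map (Tensor.map Sum.inr)) = net [] B from
    net_map (f := (Sum.inr : ℕ → ℕ ⊕ ℕ)) Sum.inr_injective B []]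
  exact hK.symm

/-! ### Two linkoids with the same closure -/

section Core

variable {ι : Type}

/-- Two crossings, closed up except for two endpoints inside. -/
def innerCore (e e' : ι) : Word ι :=
  [⟨0, .cup, 0⟩, ⟨1, .cup, 1⟩, ⟨0, .overX, 2⟩, ⟨0, .overX, 2⟩, ⟨0, .death e, 3⟩, ⟨1, .birth e', 2⟩, ⟨1, .cap, 1⟩, ⟨0, .cap, 0⟩]

/-- Two crossings, closed up except for two endpoints, one of which is outside. -/
def outerCore (e e' : ι) : Word ι :=
  [⟨0, .cup, 0⟩, ⟨1, .cup, 1⟩, ⟨0, .overX, 2⟩, ⟨0, .overX, 2⟩, ⟨1, .death e, 2⟩, ⟨0, .birth e', 3⟩, ⟨1, .cap, 1⟩, ⟨0, .cap, 0⟩]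

/-- A walk along the only component: the points of the facts `j0` to `j22`, in this order, are all
points of the diagram, from the end `e` to the end `e'`. -/
theorem strands_innerCore (e e' : ι) : Strands (innerCore e e') [(e, e')] := by
  have j : ∀ {z}, Joined (innerCore e e') (4, 0) z → ∀ {z'}, Link (innerCore e e') z z' ∨ Link (innerCore e e') z' z →
      Joined (innerCore e e') (4, 0) z' := fun h _ h' => h.trans _ _ _ (h'.elim (.rel _ _) fun h => .symm _ _ (.rel _ _ h))
  have j0 : Joined (innerCore e e') (4, 0) (4, 0) := .refl _
  have j1 := j j0 (z' := (3, 1)) (.inr (.falling (t := 3) (x := ⟨0, .overX, 2⟩) rfl (.inl (.inl rfl))))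
  have j2 := j j1 (z' := (2, 0)) (.inr (.rising (t := 2) (x := ⟨0, .overX, 2⟩) rfl (.inl (.inl rfl))))
  have j3 := j j2 (z' := (1, 0)) (.inr (.left (t := 1) (x := ⟨1, .cup, 1⟩) (p := 0) rfl (show 0 < 1 by decide)))
  have j4 := j j3 (z' := (1, 1)) (.inl (.cup (t := 0) (x := ⟨0, .cup, 0⟩) rfl rfl))
  have j5 := j j4 (z' := (2, 3)) (.inl (.right (t := 1) (x := ⟨1, .cup, 1⟩) (p := 0) rfl (show 0 < 1 by decide)))
  have j6 := j j5 (z' := (3, 3)) (.inl (.right (t := 2) (x := ⟨0, .overX, 2⟩) (p := 1) rfl (show 1 < 2 by decide)))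
  have j7 := j j6 (z' := (4, 3)) (.inl (.right (t := 3) (x := ⟨0, .overX, 2⟩) (p := 1) rfl (show 1 < 2 by decide)))
  have j8 := j j7 (z' := (5, 2)) (.inl (.right (t := 4) (x := ⟨0, .death e, 3⟩) (p := 2) rfl (show 2 < 3 by decide)))
  have j9 := j j8 (z' := (6, 3)) (.inl (.right (t := 5) (x := ⟨1, .birth e', 2⟩) (p := 1) rfl (show 1 < 2 by decide)))
  have j10 := j j9 (z' := (7, 1)) (.inl (.right (t := 6) (x := ⟨1, .cap, 1⟩) (p := 0) rfl (show 0 < 1 by decide)))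
  have j11 := j j10 (z' := (7, 0)) (.inr (.cap (t := 7) (x := ⟨0, .cap, 0⟩) rfl rfl))
  have j12 := j j11 (z' := (6, 0)) (.inr (.left (t := 6) (x := ⟨1, .cap, 1⟩) (p := 0) rfl (show 0 < 1 by decide)))
  have j13 := j j12 (z' := (5, 0)) (.inr (.left (t := 5) (x := ⟨1, .birth e', 2⟩) (p := 0) rfl (show 0 < 1 by decide)))
  have j14 := j j13 (z' := (4, 1)) (.inr (.right (t := 4) (x := ⟨0, .death e, 3⟩) (p := 0) rfl (show 0 < 3 by decide)))
  have j15 := j j14 (z' := (3, 0)) (.inr (.rising (t := 3) (x := ⟨0, .overX, 2⟩) rfl (.inl (.inl rfl))))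
  have j16 := j j15 (z' := (2, 1)) (.inr (.falling (t := 2) (x := ⟨0, .overX, 2⟩) rfl (.inl (.inl rfl))))
  have j17 := j j16 (z' := (2, 2)) (.inl (.cup (t := 1) (x := ⟨1, .cup, 1⟩) rfl rfl))
  have j18 := j j17 (z' := (3, 2)) (.inl (.right (t := 2) (x := ⟨0, .overX, 2⟩) (p := 0) rfl (show 0 < 2 by decide)))
  have j19 := j j18 (z' := (4, 2)) (.inl (.right (t := 3) (x := ⟨0, .overX, 2⟩) (p := 0) rfl (show 0 < 2 by decide)))
  have j20 := j j19 (z' := (5, 1)) (.inl (.right (t := 4) (x := ⟨0, .death e, 3⟩) (p := 1) rfl (show 1 < 3 by decide)))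
  have j21 := j j20 (z' := (6, 2)) (.inl (.right (t := 5) (x := ⟨1, .birth e', 2⟩) (p := 0) rfl (show 0 < 2 by decide)))
  have j22 := j j21 (z' := (6, 1)) (.inr (.cap (t := 6) (x := ⟨1, .cap, 1⟩) rfl rfl))
  have d : EndAt (innerCore e e') e (4, 0) := (.death (t := 4) (x := ⟨0, .death e, 3⟩) rfl rfl)
  have b : EndAt (innerCore e e') e' (6, 1) := (.birth (t := 5) (x := ⟨1, .birth e', 2⟩) rfl rfl)
  refine ⟨⟨rfl, rfl, rfl, rfl, rfl, rfl, rfl, rfl, rfl⟩, by simp [innerCore], .refl _, ?_, ?_⟩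
  · rintro p hp
    obtain rfl := List.mem_singleton.1 hp
    exact ⟨_, _, d, b, j22⟩
  · rintro ⟨t, p⟩ ⟨x, h, hp⟩
    refine ⟨e, (4, 0), d, .symm _ _ ?_⟩
    simp only at h hp
    match t, h with
    | 0, h => cases h; exact (Nat.not_lt_zero _ hp).elim
    | 1, h =>
      cases h
      have hp : p < 2 := hp
      match p, hp with
      | 0, _ => exact j3
      | 1, _ => exact j4
    | 2, h =>
      cases h
      have hp : p < 4 := hp
      match p, hp with
      | 0, _ => exact j2
      | 1, _ => exact j16
      | 2, _ => exact j17
      | 3, _ => exact j5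
    | 3, h =>
      cases h
      have hp : p < 4 := hp
      match p, hp with
      | 0, _ => exact j15
      | 1, _ => exact j1
      | 2, _ => exact j18
      | 3, _ => exact j6
    | 4, h =>
      cases h
      have hp : p < 4 := hp
      match p, hp with
      | 0, _ => exact j0
      | 1, _ => exact j14
      | 2, _ => exact j19
      | 3, _ => exact j7
    | 5, h =>
      cases h
      have hp : p < 3 := hp
      match p, hp with
      | 0, _ => exact j13
      | 1, _ => exact j20
      | 2, _ => exact j8
    | 6, h =>
      cases h
      have hp : p < 4 := hp
      match p, hp with
      | 0, _ => exact j12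
      | 1, _ => exact j22
      | 2, _ => exact j21
      | 3, _ => exact j9
    | 7, h =>
      cases h
      have hp : p < 2 := hp
      match p, hp with
      | 0, _ => exact j11
      | 1, _ => exact j10
    | n + 8, h => simp [innerCore] at h

theorem strands_outerCore (e e' : ι) : Strands (outerCore e e') [(e, e')] := by
  have j : ∀ {z}, Joined (outerCore e e') (4, 1) z → ∀ {z'}, Link (outerCore e e') z z' ∨ Link (outerCore e e') z' z →
      Joined (outerCore e e') (4, 1) z' := fun h _ h' => h.trans _ _ _ (h'.elim (.rel _ _) fun h => .symm _ _ (.rel _ _ h))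
  have j0 : Joined (outerCore e e') (4, 1) (4, 1) := .refl _
  have j1 := j j0 (z' := (3, 0)) (.inr (.rising (t := 3) (x := ⟨0, .overX, 2⟩) rfl (.inl (.inl rfl))))
  have j2 := j j1 (z' := (2, 1)) (.inr (.falling (t := 2) (x := ⟨0, .overX, 2⟩) rfl (.inl (.inl rfl))))
  have j3 := j j2 (z' := (2, 2)) (.inl (.cup (t := 1) (x := ⟨1, .cup, 1⟩) rfl rfl))
  have j4 := j j3 (z' := (3, 2)) (.inl (.right (t := 2) (x := ⟨0, .overX, 2⟩) (p := 0) rfl (show 0 < 2 by decide)))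
  have j5 := j j4 (z' := (4, 2)) (.inl (.right (t := 3) (x := ⟨0, .overX, 2⟩) (p := 0) rfl (show 0 < 2 by decide)))
  have j6 := j j5 (z' := (5, 1)) (.inl (.right (t := 4) (x := ⟨1, .death e, 2⟩) (p := 0) rfl (show 0 < 2 by decide)))
  have j7 := j j6 (z' := (6, 2)) (.inl (.right (t := 5) (x := ⟨0, .birth e', 3⟩) (p := 1) rfl (show 1 < 3 by decide)))
  have j8 := j j7 (z' := (6, 1)) (.inr (.cap (t := 6) (x := ⟨1, .cap, 1⟩) rfl rfl))
  have j9 := j j8 (z' := (5, 0)) (.inr (.right (t := 5) (x := ⟨0, .birth e', 3⟩) (p := 0) rfl (show 0 < 3 by decide)))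
  have j10 := j j9 (z' := (4, 0)) (.inr (.left (t := 4) (x := ⟨1, .death e, 2⟩) (p := 0) rfl (show 0 < 1 by decide)))
  have j11 := j j10 (z' := (3, 1)) (.inr (.falling (t := 3) (x := ⟨0, .overX, 2⟩) rfl (.inl (.inl rfl))))
  have j12 := j j11 (z' := (2, 0)) (.inr (.rising (t := 2) (x := ⟨0, .overX, 2⟩) rfl (.inl (.inl rfl))))
  have j13 := j j12 (z' := (1, 0)) (.inr (.left (t := 1) (x := ⟨1, .cup, 1⟩) (p := 0) rfl (show 0 < 1 by decide)))
  have j14 := j j13 (z' := (1, 1)) (.inl (.cup (t := 0) (x := ⟨0, .cup, 0⟩) rfl rfl))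
  have j15 := j j14 (z' := (2, 3)) (.inl (.right (t := 1) (x := ⟨1, .cup, 1⟩) (p := 0) rfl (show 0 < 1 by decide)))
  have j16 := j j15 (z' := (3, 3)) (.inl (.right (t := 2) (x := ⟨0, .overX, 2⟩) (p := 1) rfl (show 1 < 2 by decide)))
  have j17 := j j16 (z' := (4, 3)) (.inl (.right (t := 3) (x := ⟨0, .overX, 2⟩) (p := 1) rfl (show 1 < 2 by decide)))
  have j18 := j j17 (z' := (5, 2)) (.inl (.right (t := 4) (x := ⟨1, .death e, 2⟩) (p := 1) rfl (show 1 < 2 by decide)))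
  have j19 := j j18 (z' := (6, 3)) (.inl (.right (t := 5) (x := ⟨0, .birth e', 3⟩) (p := 2) rfl (show 2 < 3 by decide)))
  have j20 := j j19 (z' := (7, 1)) (.inl (.right (t := 6) (x := ⟨1, .cap, 1⟩) (p := 0) rfl (show 0 < 1 by decide)))
  have j21 := j j20 (z' := (7, 0)) (.inr (.cap (t := 7) (x := ⟨0, .cap, 0⟩) rfl rfl))
  have j22 := j j21 (z' := (6, 0)) (.inr (.left (t := 6) (x := ⟨1, .cap, 1⟩) (p := 0) rfl (show 0 < 1 by decide)))
  have d : EndAt (outerCore e e') e (4, 1) := (.death (t := 4) (x := ⟨1, .death e, 2⟩) rfl rfl)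
  have b : EndAt (outerCore e e') e' (6, 0) := (.birth (t := 5) (x := ⟨0, .birth e', 3⟩) rfl rfl)
  refine ⟨⟨rfl, rfl, rfl, rfl, rfl, rfl, rfl, rfl, rfl⟩, by simp [outerCore], .refl _, ?_, ?_⟩
  · rintro p hp
    obtain rfl := List.mem_singleton.1 hp
    exact ⟨_, _, d, b, j22⟩
  · rintro ⟨t, p⟩ ⟨x, h, hp⟩
    refine ⟨e, (4, 1), d, .symm _ _ ?_⟩
    simp only at h hp
    match t, h with
    | 0, h => cases h; exact (Nat.not_lt_zero _ hp).elim
    | 1, h =>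
      cases h
      have hp : p < 2 := hp
      match p, hp with
      | 0, _ => exact j13
      | 1, _ => exact j14
    | 2, h =>
      cases h
      have hp : p < 4 := hp
      match p, hp with
      | 0, _ => exact j12
      | 1, _ => exact j2
      | 2, _ => exact j3
      | 3, _ => exact j15
    | 3, h =>
      cases h
      have hp : p < 4 := hp
      match p, hp with
      | 0, _ => exact j1
      | 1, _ => exact j11
      | 2, _ => exact j4
      | 3, _ => exact j16
    | 4, h =>
      cases h
      have hp : p < 4 := hp
      match p, hp with
      | 0, _ => exact j10
      | 1, _ => exact j0
      | 2, _ => exact j5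
      | 3, _ => exact j17
    | 5, h =>
      cases h
      have hp : p < 3 := hp
      match p, hp with
      | 0, _ => exact j9
      | 1, _ => exact j6
      | 2, _ => exact j18
    | 6, h =>
      cases h
      have hp : p < 4 := hp
      match p, hp with
      | 0, _ => exact j22
      | 1, _ => exact j8
      | 2, _ => exact j7
      | 3, _ => exact j19
    | 7, h =>
      cases h
      have hp : p < 2 := hp
      match p, hp with
      | 0, _ => exact j21
      | 1, _ => exact j20
    | n + 8, h => simp [outerCore] at h

/-- A core followed by strands without crossings. -/
def withIntervals (c : Word ι) (L : List (ι × ι)) : Word ι := c ++ L.flatMap fun p => interval p.1 p.2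

theorem Strands.withIntervals {c : Word ι} {M : List (ι × ι)} (h : Strands c M) (L : List (ι × ι)) :
    Strands (withIntervals c L) (M ++ L) := by
  refine h.append ?_
  induction L with
  | nil => exact .nil
  | cons p L ih => exact (strands_interval p.1 p.2).append ih

theorem realizes_intervals (b : ι → ℕ) : ∀ L : List (ι × ι), Realizes b (L.flatMap fun p => interval p.1 p.2)
    (L.map fun p => Tensor.arc (b p.1) (b p.2))
  | [] => fun T hT => by
    obtain ⟨rfl, -⟩ := hT.nil_inv
    exact .refl _
  | p :: L => (realizes_interval b p.1 p.2).append (strands_interval p.1 p.2).closed (realizes_intervals b L)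

/-! ### Networks of circles and of the virtual trefoil -/

section Nets

variable {α : Type} [DecidableEq α]

theorem VE.netCircles {R : List (Tensor Empty α)} : ∀ L : List α, Good [] (L.map (fun x => Tensor.arc x x) ++ R) →
    VE 0 (net [] (L.map (fun x => Tensor.arc x x) ++ R))
      ((List.replicate L.length [((0, cup) : Op Empty), (0, cap)]).flatten ++ net [] R)
  | [], h => refl (ok_net h)
  | x :: L, h => by
    have h1 : Good ([] ++ x :: x :: []) (L.map (fun x => Tensor.arc x x) ++ R) := h.cons
    have h2 : Good [] (L.map (fun x => Tensor.arc x x) ++ R) := h1.uncap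
    have ih := netCircles L h2
    rw [List.length_cons, List.replicate_succ, List.flatten_cons, List.append_assoc]
    refine cons (m := 2) 0 cup (trans (netCap h1 rfl rfl).symm ?_)
    exact cons (m := 0) 0 cap ih

/-- Above the crossings the strands are `g, h, d, b`, and the last two arcs join the first with the
third and the second with the fourth. This is a virtual crossing of `g` and `h` below two nested
maxima. -/
theorem VE.netCore {a b c d e f g h : α} {R : List (Tensor Empty α)}
    (hG : Good [] (Tensor.arc a b :: Tensor.arc c d :: ⟨overX, [a, c], [e, f]⟩ :: ⟨overX, [e, f], [g, h]⟩ ::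
      Tensor.arc g d :: Tensor.arc h b :: R)) :
    Good [] R ∧ VE 0 (net [] (Tensor.arc a b :: Tensor.arc c d :: ⟨overX, [a, c], [e, f]⟩ :: ⟨overX, [e, f], [g, h]⟩ ::
      Tensor.arc g d :: Tensor.arc h b :: R))
      ([(0, cup), (1, cup), (0, overX), (0, overX), (0, virt), (1, cap), (0, cap)] ++ net [] R) := by
  have g1 : Good ([a] ++ (Tensor.arc c d).bot ++ [b]) (Tensor.arc c d :: ⟨overX, [a, c], [e, f]⟩ ::
    ⟨overX, [e, f], [g, h]⟩ :: Tensor.arc g d :: Tensor.arc h b :: R) := hG.cons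
  have g2 : Good ([] ++ (⟨overX, [a, c], [e, f]⟩ : Tensor Empty α).bot ++ [d, b]) (⟨overX, [a, c], [e, f]⟩ ::
    ⟨overX, [e, f], [g, h]⟩ :: Tensor.arc g d :: Tensor.arc h b :: R) := g1.unpiece
  have g3 : Good ([] ++ (⟨overX, [e, f], [g, h]⟩ : Tensor Empty α).bot ++ [d, b]) (
    ⟨overX, [e, f], [g, h]⟩ :: Tensor.arc g d :: Tensor.arc h b :: R) := g2.unpiece
  have g4 : Good ([] ++ g :: [h, d, b]) (Tensor.arc g d :: Tensor.arc h b :: R) := g3.unpiece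
  have g5 : Good ([d] ++ h :: [d, b]) (Tensor.arc h b :: R) := g4.uncut
  have g6 : Good ([] ++ d :: b :: [d, b]) R := g5.uncut
  have g7 : Good ([b] ++ d :: d :: [b]) R := g6.reorder (List.Perm.swap _ _ _)
  have g8 : Good ([] ++ b :: b :: []) R := g7.uncap
  have g9 : Good [] R := g8.uncap
  have o := ok_net g9
  have s1 : VE 4 (net [d, b, d, b] R) ((0, virt) :: (1, cap) :: (0, cap) :: net [] R) :=
    trans (netSwap g6 rfl rfl).symm (cons (m := 4) 0 virt (trans (netCap g7 rfl rfl).symm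
      (cons (m := 2) 1 cap (netCap g8 rfl rfl).symm)))
  have s2 : VE 4 (net [g, h, d, b] (Tensor.arc g d :: Tensor.arc h b :: R)) ((0, virt) :: (1, cap) :: (0, cap) :: net [] R) :=
    trans (netCut g4 rfl).symm (trans (netCut g5 rfl).symm s1)
  refine ⟨g9, cons (m := 2) 0 cup (trans (netPiece g1 rfl rfl).symm (cons (m := 4) 1 cup ?_))⟩
  exact trans (netPiece g2 rfl rfl).symm (cons (m := 4) 0 overX (trans (netPiece g3 rfl rfl).symm (cons (m := 4) 0 overX s2)))

/-- The strand `g` ends, and the new strand `x` leads to `d`. Both endpoints are connected with the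
closure arc `y`, so after closing `g` is connected with `d`. -/
theorem NetEq.bridge (g d h b x y : α) : NetEq [Tensor.arc g y, Tensor.arc x y, ⟨cap, [x, d], []⟩, ⟨cap, [h, b], []⟩]
    [Tensor.arc g d, Tensor.arc h b] := by
  refine (NetEq.of_perm (T := [⟨cap, [x, d], []⟩, Tensor.arc x y, Tensor.arc g y, ⟨cap, [h, b], []⟩]) ?_).trans ?_
  · exact (List.perm_append_comm (l₁ := [_]) (l₂ := [_, _])).append_right [_] |>.trans
      ((List.Perm.swap _ _ _).trans (.refl _))
  refine NetEq.capArc.trans (NetEq.join.trans ?_)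
  refine (NetEq.of_perm (List.Perm.swap _ _ _)).trans (NetEq.flip.trans (NetEq.join.trans (NetEq.flip.trans ?_)))
  exact NetEq.cons _ NetEq.capArc

end Nets

theorem strip_trefoilWord (k : ℕ) : strip (trefoilWord k) =
    [(0, cup), (1, cup), (0, overX), (0, overX), (0, virt), (1, cap), (0, cap)] ++
      (List.replicate k [((0, cup) : Op Empty), (0, cap)]).flatten := by
  rw [trefoilWord, strip, List.map_append, List.map_flatten, List.map_replicate]
  rfl

/-- The networks of the closures of the two linkoids. -/
def CoreNet (b : ι → ℕ) (c : Word ι) : Prop := ∀ T, Named [] c T [] → ∃ x y z w e f g h : ℕ ⊕ ℕ,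
  NetEq (T.map (Tensor.close b)) [Tensor.arc x y, Tensor.arc z w, ⟨overX, [x, z], [e, f]⟩, ⟨overX, [e, f], [g, h]⟩,
      Tensor.arc g w, Tensor.arc h y]

theorem coreNet_innerCore {b : ι → ℕ} {e e' : ι} (he : b e = b e') : CoreNet b (innerCore e e') := by
  intro T hT
  obtain ⟨top, T, rfl, -, ht, hT⟩ := Named.cons_inv hT (β₁ := []) (bot := []) (β₂ := []) rfl rfl rfl
  obtain ⟨x, y, rfl⟩ := List.length_eq_two.1 ht
  obtain ⟨top, T, rfl, -, ht, hT⟩ := Named.cons_inv hT (β₁ := [x]) (bot := []) (β₂ := [y]) rfl rfl rfl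
  obtain ⟨z, w, rfl⟩ := List.length_eq_two.1 ht
  obtain ⟨top, T, rfl, -, ht, hT⟩ := Named.cons_inv hT (β₁ := []) (bot := [x, z]) (β₂ := [w, y]) rfl rfl rfl
  obtain ⟨p, q, rfl⟩ := List.length_eq_two.1 ht
  obtain ⟨top, T, rfl, -, ht, hT⟩ := Named.cons_inv hT (β₁ := []) (bot := [p, q]) (β₂ := [w, y]) rfl rfl rfl
  obtain ⟨g, h, rfl⟩ := List.length_eq_two.1 ht
  obtain ⟨top, T, rfl, -, ht, hT⟩ := Named.cons_inv hT (β₁ := []) (bot := [g]) (β₂ := [h, w, y]) rfl rfl rfl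
  obtain rfl := List.length_eq_zero_iff.1 ht
  obtain ⟨top, T, rfl, -, ht, hT⟩ := Named.cons_inv hT (β₁ := [h]) (bot := []) (β₂ := [w, y]) rfl rfl rfl
  obtain ⟨k, rfl⟩ := List.length_eq_one_iff.1 ht
  obtain ⟨top, T, rfl, -, ht, hT⟩ := Named.cons_inv hT (β₁ := [h]) (bot := [k, w]) (β₂ := [y]) rfl rfl rfl
  obtain rfl := List.length_eq_zero_iff.1 ht
  obtain ⟨top, T, rfl, -, ht, hT⟩ := Named.cons_inv hT (β₁ := []) (bot := [h, y]) (β₂ := []) rfl rfl rfl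
  obtain rfl := List.length_eq_zero_iff.1 ht
  obtain ⟨rfl, -⟩ := hT.nil_inv
  have br := NetEq.bridge (Sum.inl g : ℕ ⊕ ℕ) (Sum.inl w) (Sum.inl h) (Sum.inl y) (Sum.inl k) (Sum.inr (b e'))
  have := br.append_left [Tensor.arc (Sum.inl x) (Sum.inl y), Tensor.arc (Sum.inl z) (Sum.inl w),
    ⟨overX, [Sum.inl x, Sum.inl z], [Sum.inl p, Sum.inl q]⟩, ⟨overX, [Sum.inl p, Sum.inl q], [Sum.inl g, Sum.inl h]⟩]
  refine ⟨Sum.inl x, Sum.inl y, Sum.inl z, Sum.inl w, Sum.inl p, Sum.inl q, Sum.inl g, Sum.inl h, ?_⟩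
  simp only [List.map_cons, List.map_nil, Tensor.close, forgetMark, label, Option.toList, List.nil_append, List.append_nil,
    List.cons_append, he]
  exact this

theorem coreNet_outerCore {b : ι → ℕ} {e e' : ι} (he : b e = b e') : CoreNet b (outerCore e e') := by
  intro T hT
  obtain ⟨top, T, rfl, -, ht, hT⟩ := Named.cons_inv hT (β₁ := []) (bot := []) (β₂ := []) rfl rfl rfl
  obtain ⟨x, y, rfl⟩ := List.length_eq_two.1 ht
  obtain ⟨top, T, rfl, -, ht, hT⟩ := Named.cons_inv hT (β₁ := [x]) (bot := []) (β₂ := [y]) rfl rfl rfl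
  obtain ⟨z, w, rfl⟩ := List.length_eq_two.1 ht
  obtain ⟨top, T, rfl, -, ht, hT⟩ := Named.cons_inv hT (β₁ := []) (bot := [x, z]) (β₂ := [w, y]) rfl rfl rfl
  obtain ⟨p, q, rfl⟩ := List.length_eq_two.1 ht
  obtain ⟨top, T, rfl, -, ht, hT⟩ := Named.cons_inv hT (β₁ := []) (bot := [p, q]) (β₂ := [w, y]) rfl rfl rfl
  obtain ⟨g, h, rfl⟩ := List.length_eq_two.1 ht
  obtain ⟨top, T, rfl, -, ht, hT⟩ := Named.cons_inv hT (β₁ := [g]) (bot := [h]) (β₂ := [w, y]) rfl rfl rfl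
  obtain rfl := List.length_eq_zero_iff.1 ht
  obtain ⟨top, T, rfl, -, ht, hT⟩ := Named.cons_inv hT (β₁ := []) (bot := []) (β₂ := [g, w, y]) rfl rfl rfl
  obtain ⟨k, rfl⟩ := List.length_eq_one_iff.1 ht
  obtain ⟨top, T, rfl, -, ht, hT⟩ := Named.cons_inv hT (β₁ := [k]) (bot := [g, w]) (β₂ := [y]) rfl rfl rfl
  obtain rfl := List.length_eq_zero_iff.1 ht
  obtain ⟨top, T, rfl, -, ht, hT⟩ := Named.cons_inv hT (β₁ := []) (bot := [k, y]) (β₂ := []) rfl rfl rfl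
  obtain rfl := List.length_eq_zero_iff.1 ht
  obtain ⟨rfl, -⟩ := hT.nil_inv
  -- Here it is `h` that ends, and the new strand meets `y`. The two maxima have exchanged their
  -- roles, which is corrected by permutations of the network.
  have br := NetEq.bridge (Sum.inl h : ℕ ⊕ ℕ) (Sum.inl y) (Sum.inl g) (Sum.inl w) (Sum.inl k) (Sum.inr (b e'))
  have br' := ((NetEq.of_perm ((List.Perm.swap _ _ _).append_left [_, _])).trans br).trans
    (NetEq.of_perm (List.Perm.swap _ _ _))
  have := br'.append_left [Tensor.arc (Sum.inl x) (Sum.inl y), Tensor.arc (Sum.inl z) (Sum.inl w),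
    ⟨overX, [Sum.inl x, Sum.inl z], [Sum.inl p, Sum.inl q]⟩, ⟨overX, [Sum.inl p, Sum.inl q], [Sum.inl g, Sum.inl h]⟩]
  refine ⟨Sum.inl x, Sum.inl y, Sum.inl z, Sum.inl w, Sum.inl p, Sum.inl q, Sum.inl g, Sum.inl h, ?_⟩
  simp only [List.map_cons, List.map_nil, Tensor.close, forgetMark, label, Option.toList, List.nil_append, List.append_nil,
    List.cons_append, he]
  exact this

theorem arcNames_adjacent (n : ℕ) : ArcNames (adjacent n) fun e : Fin (2 * n) => e.1 / 2 := by
  intro e e'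
  have key : (adjacent n).1 e = opposite e := rfl
  rw [key, Fin.ext_iff, Fin.ext_iff]
  change e.1 / 2 = e'.1 / 2 ↔ _
  by_cases h : e.1 % 2 = 0
  · rw [opposite_of_even h]; omega
  · rw [opposite_of_odd h]; omega

/-- The closure permutation is the strand permutation, so each component is closed by itself:
intervals become circles and the core becomes the network of the virtual trefoil. The names `e.1 /
2` agree exactly at the two ends of a component. -/
theorem closure_eq_virtualTrefoil {k : ℕ} {p : Fin (2 * (k + 1)) × Fin (2 * (k + 1))}
    {L : List (Fin (2 * (k + 1)) × Fin (2 * (k + 1)))} (hL : ends (k + 1) = p :: L) {c : Word (Fin (2 * (k + 1)))}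
    (hc : Strands c [p]) (hnet : CoreNet (fun e => e.1 / 2) c) {D : LinkoidDiagram (k + 1)}
    (hD : D.word = withIntervals c L) {K : VirtualDiagram} (hK : IsVirtualClosure D (adjacent (k + 1)) K) :
    K.link = (virtualTrefoil k).link := by
  obtain ⟨T, hT, hLin⟩ := exists_named_closed D.closed
  have hb := arcNames_adjacent (k + 1)
  have hG := D.good_close hT hLin hb
  have h0 := hK.ve_net hT hLin hb
  rw [hD] at hT
  obtain ⟨T₁, T₂, rfl, h1, h2⟩ := hT.append_inv_closed hc.closed
  obtain ⟨x, y, z, w, e, f, g, h, hcore⟩ := hnet T₁ h1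
  have hL2 : (L.map fun p => (Tensor.arc (p.1.1 / 2) (p.2.1 / 2) : Tensor Empty ℕ)).map (Tensor.map Sum.inr) =
      (L.map fun p => (Sum.inr (p.1.1 / 2) : ℕ ⊕ ℕ)).map (fun x => Tensor.arc x x) ++ [] := by
    rw [List.map_map, List.map_map, List.append_nil]
    refine List.map_congr_left fun q hq => ?_
    have hq : q ∈ ends (k + 1) := hL ▸ List.mem_cons_of_mem _ hq
    obtain ⟨i, -, rfl⟩ := List.mem_map.1 hq
    simp only [Function.comp, Tensor.map, Tensor.arc, List.map_cons, List.map_nil]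
    rw [show (2 * i.1 + 1) / 2 = 2 * i.1 / 2 by omega]
  have hlen : L.length = k := by
    have := congrArg List.length hL
    simpa [ends] using this.symm
  have hcirc := realizes_intervals (fun e : Fin (2 * (k + 1)) => e.1 / 2) L T₂ h2
  rw [hL2] at hcirc
  have hnet2 := (hcore.append_right _).trans (hcirc.append_left _)
  rw [List.map_append] at h0 hG
  obtain ⟨hG2, h3⟩ := hnet2 [] hG
  obtain ⟨hG3, h4⟩ := VE.netCore hG2
  have h5 := VE.netCircles _ hG3
  have h6 := strip_trefoilWord k
  rw [List.length_map, hlen, show net ([] : List (ℕ ⊕ ℕ)) [] = [] from contract_nil,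
    List.append_nil (List.flatten _)] at h5
  refine VE.link (h0.trans (h3.trans (h4.trans ?_)))
  change VE 0 _ (strip (trefoilWord k))
  rw [h6]
  exact .cons (m := 2) 0 cup (.cons (m := 4) 1 cup (.cons (m := 4) 0 overX (.cons (m := 4) 0 overX
    (.cons (m := 4) 0 virt (.cons (m := 2) 1 cap (.cons (m := 0) 0 cap h5))))))

end Core

/-! ### Three-colourings of linkoid diagrams -/

section Colour

variable {ι : Type}

/-- Sum over the colourings of a piece with the colours `bot` at its bottom.  At a crossing the colours
of the two parts of the lower strand add up to twice the colour of the upper strand. -/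
def Gen.colour : Gen ι → List (Fin 3) → (List (Fin 3) → ℕ) → ℕ
  | cup, _, k => k [0, 0] + k [1, 1] + k [2, 2]
  | cap, [a, b], k => if a = b then k [] else 0
  | overX, [a, b], k => k [a + a - b, a]
  | underX, [a, b], k => k [b, b + b - a]
  | virt, [a, b], k => k [b, a]
  | birth _, _, k => k [0] + k [1] + k [2]
  | death _, [_], k => k []
  | mark _, [a], k => k [a]
  | _, _, _ => 0

/-- Sum over the colourings of a word with the colours `β` at its bottom. -/
def colour : Word ι → (List (Fin 3) → ℕ) → List (Fin 3) → ℕ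
  | [], k, β => k β
  | ⟨l, g, _⟩ :: w, k, β => g.colour ((β.drop l).take g.dom) fun top =>
      colour w k (β.take l ++ top ++ β.drop (l + g.dom))

/-- The sum runs over a multiset of colours at the top that does not depend on `k`. Hence sums over
different pieces can be interchanged. -/
theorem Gen.exists_colour {g : Gen ι} {bot : List (Fin 3)} (h : bot.length = g.dom) :
    ∃ m : Multiset (List (Fin 3)), (∀ x ∈ m, x.length = g.cod) ∧ ∀ k, g.colour bot k = (m.map k).sum := by
  have two : ∀ {b : List (Fin 3)}, b.length = 2 → ∃ x y, b = [x, y] := List.length_eq_two.1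
  cases g with
  | cup => exact ⟨{[0, 0], [1, 1], [2, 2]}, by simp [cod], fun k => by simp [Gen.colour, add_assoc]⟩
  | birth e => exact ⟨{[0], [1], [2]}, by simp [cod], fun k => by simp [Gen.colour, add_assoc]⟩
  | cap =>
    obtain ⟨x, y, rfl⟩ := two h
    by_cases hxy : x = y
    · exact ⟨{[]}, by simp [cod], fun k => by simp [Gen.colour, hxy]⟩
    · exact ⟨0, by simp, fun k => by simp [Gen.colour, hxy]⟩
  | overX =>
    obtain ⟨x, y, rfl⟩ := two h
    exact ⟨{[x + x - y, x]}, by simp [cod], fun k => by simp [Gen.colour]⟩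
  | underX =>
    obtain ⟨x, y, rfl⟩ := two h
    exact ⟨{[y, y + y - x]}, by simp [cod], fun k => by simp [Gen.colour]⟩
  | virt =>
    obtain ⟨x, y, rfl⟩ := two h
    exact ⟨{[y, x]}, by simp [cod], fun k => by simp [Gen.colour]⟩
  | death e =>
    obtain ⟨x, rfl⟩ := List.length_eq_one_iff.1 h
    exact ⟨{[]}, by simp [cod], fun k => by simp [Gen.colour]⟩
  | mark e =>
    obtain ⟨x, rfl⟩ := List.length_eq_one_iff.1 h
    exact ⟨{[x]}, by simp [cod], fun k => by simp [Gen.colour]⟩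

theorem Gen.colour_congr {g : Gen ι} {bot : List (Fin 3)} (h : bot.length = g.dom) {k k' : List (Fin 3) → ℕ}
    (hk : ∀ top, top.length = g.cod → k top = k' top) : g.colour bot k = g.colour bot k' := by
  obtain ⟨m, h1, h2⟩ := Gen.exists_colour h
  rw [h2, h2, Multiset.map_congr rfl fun x hx => hk x (h1 x hx)]

theorem colour_append (u v : Word ι) (k : List (Fin 3) → ℕ) : ∀ β, colour (u ++ v) k β = colour u (colour v k) β := by
  induction u with
  | nil => exact fun _ => rfl
  | cons x u ih => intro β; simp only [List.cons_append, colour, ih]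

theorem colour_cons {l r : ℕ} {g : Gen ι} {w : Word ι} {k : List (Fin 3) → ℕ} {β₁ bot β₂ : List (Fin 3)}
    (hl : β₁.length = l) (hb : bot.length = g.dom) :
    colour (⟨l, g, r⟩ :: w) k (β₁ ++ bot ++ β₂) = g.colour bot fun top => colour w k (β₁ ++ top ++ β₂) := by
  subst hl
  rw [colour, ← hb]
  simp only [List.append_assoc, List.take_left, List.drop_left]
  congr 1
  funext top
  rw [← List.append_assoc β₁ bot, ← List.length_append, List.drop_left]

theorem exists_split {β : List (Fin 3)} {l d r : ℕ} (h : β.length = l + d + r) :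
    ∃ β₁ bot β₂, β = β₁ ++ bot ++ β₂ ∧ β₁.length = l ∧ bot.length = d ∧ β₂.length = r := by
  obtain ⟨γ, β₂, rfl, h1, h2⟩ := exists_append_of_length h
  obtain ⟨β₁, bot, rfl, h3, h4⟩ := exists_append_of_length h1
  exact ⟨_, _, _, rfl, h3, h4, h2⟩

theorem colour_congr {k k' : List (Fin 3) → ℕ} {n : ℕ} (hk : ∀ γ, γ.length = n → k γ = k' γ) :
    ∀ {w : Word ι} {β : List (Fin 3)}, IsWord β.length w n → colour w k β = colour w k' β
  | [], β, h => hk β h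
  | ⟨l, g, r⟩ :: w, β, h => by
    obtain ⟨β₁, bot, β₂, rfl, h1, h2, h3⟩ := exists_split h.1
    rw [colour_cons h1 h2, colour_cons h1 h2]
    refine Gen.colour_congr h2 fun top ht => colour_congr hk ?_
    have h' := h.2
    rw [show (⟨l, g, r⟩ : Layer ι).target = (β₁ ++ top ++ β₂).length by simp [Layer.target, h1, ht, h3, Nat.add_assoc]] at h'
    exact h'

theorem colour_pad {k : List (Fin 3) → ℕ} {n p q : ℕ} {γ δ : List (Fin 3)} (hγ : γ.length = p) :
    ∀ {w : Word ι} {β : List (Fin 3)}, IsWord β.length w n →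
    colour (w.map (Layer.pad p q)) k (γ ++ β ++ δ) = colour w (fun β => k (γ ++ β ++ δ)) β
  | [], β, h => rfl
  | ⟨l, g, r⟩ :: w, β, h => by
    obtain ⟨β₁, bot, β₂, rfl, h1, h2, h3⟩ := exists_split h.1
    rw [List.map_cons, Layer.pad, show γ ++ (β₁ ++ bot ++ β₂) ++ δ = (γ ++ β₁) ++ bot ++ (β₂ ++ δ) by simp,
      colour_cons (by simp [hγ, h1]) h2, colour_cons h1 h2]
    refine Gen.colour_congr h2 fun top ht => ?_
    have h' := h.2
    rw [show (⟨l, g, r⟩ : Layer ι).target = (β₁ ++ top ++ β₂).length by simp [Layer.target, h1, ht, h3, Nat.add_assoc]] at h'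
    rw [← colour_pad hγ h']
    congr 1
    simp

theorem IsWord.unpad {p q m : ℕ} : ∀ {w : Word ι} {a : ℕ}, IsWord (p + a + q) (w.map (Layer.pad p q)) m →
    ∃ b, m = p + b + q ∧ IsWord a w b
  | [], a, h => ⟨a, h.symm, rfl⟩
  | ⟨l, g, r⟩ :: w, a, h => by
    obtain ⟨h1, h2⟩ := h
    simp only [Layer.pad, Layer.source, Layer.target] at h1 h2
    rw [show p + l + g.cod + (r + q) = p + (l + g.cod + r) + q by omega] at h2
    obtain ⟨b, h3, h4⟩ := IsWord.unpad h2
    exact ⟨b, h3, by simp only [Layer.source]; omega, h4⟩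

/-- The local pictures have the same colourings. -/
def SameColour (s t : Word ι) : Prop :=
  s ≠ [] ∧ ∃ a b, IsWord a s b ∧ IsWord a t b ∧ ∀ k β, β.length = a → colour s k β = colour t k β

theorem SameColour.inContext {u v : Word ι} (h : InContext SameColour u v) (hu : IsWord 0 u 0) (k : List (Fin 3) → ℕ) :
    colour u k [] = colour v k [] := by
  obtain ⟨c, d, s, t, p, q, ⟨h0, a, b, hs, ht, h⟩, rfl, rfl⟩ := h
  rw [List.append_assoc, isWord_append_iff] at hu
  obtain ⟨n, h1, h2⟩ := hu
  obtain ⟨m, h2, -⟩ := isWord_append_iff.1 h2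
  -- This uses `s ≠ []`: an empty word would not reveal how many strands pass through it.
  have hn : n = p + a + q := by
    cases s with
    | nil => exact (h0 rfl).elim
    | cons x s => exact h2.1.trans (hs.pad p q).1.symm
  rw [List.append_assoc, List.append_assoc, colour_append, colour_append]
  refine colour_congr (n := n) (fun γ hγ => ?_) h1
  obtain ⟨β₁, β₂, β₃, rfl, h3, h4, -⟩ := exists_split (hγ.trans hn)
  rw [colour_append, colour_append, colour_pad h3 (by rw [h4]; exact hs), colour_pad h3 (by rw [h4]; exact ht)]
  exact h _ _ h4

/-- The pieces act on disjoint sets of strands, so this is an interchange of two finite sums. -/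
theorem sameColour_exchange (g h : Gen ι) (m : ℕ) :
    SameColour [⟨0, g, m + h.dom⟩, ⟨g.cod + m, h, 0⟩] [⟨g.dom + m, h, 0⟩, ⟨0, g, m + h.cod⟩] := by
  refine ⟨by simp, g.dom + m + h.dom, g.cod + m + h.cod, ⟨?_, ?_, ?_⟩, ⟨?_, ?_, ?_⟩, fun k β hβ => ?_⟩
  any_goals simp [Layer.source, Layer.target, Nat.add_assoc, IsWord]
  obtain ⟨β₁, β₂, β₃, rfl, h1, h2, h3⟩ := exists_split hβ
  obtain ⟨m1, a1, b1⟩ := Gen.exists_colour h1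
  obtain ⟨m2, a2, b2⟩ := Gen.exists_colour h3
  have e1 := colour_cons (l := 0) (r := m + h.dom) (g := g) (w := [⟨g.cod + m, h, 0⟩]) (k := k) (β₁ := []) (β₂ := β₂ ++ β₃) rfl h1
  have e2 := colour_cons (l := g.dom + m) (r := 0) (g := h) (w := [⟨0, g, m + h.cod⟩]) (k := k) (β₁ := β₁ ++ β₂) (β₂ := [])
    (by simp [h1, h2]) h3
  simp only [List.nil_append, List.append_nil, ← List.append_assoc] at e1 e2
  rw [e1, e2, b1, b2]
  have e3 : ∀ x ∈ m1, colour [⟨g.cod + m, h, 0⟩] k (x ++ β₂ ++ β₃) = (m2.map fun y => k (x ++ β₂ ++ y)).sum := fun x hx => by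
    have := colour_cons (l := g.cod + m) (r := 0) (g := h) (w := []) (k := k) (β₁ := x ++ β₂) (β₂ := [])
      (by simp [a1 x hx, h2]) h3
    simp only [List.append_nil] at this
    rw [this, b2]
    rfl
  have e4 : ∀ y ∈ m2, colour [⟨0, g, m + h.cod⟩] k (β₁ ++ β₂ ++ y) = (m1.map fun x => k (x ++ β₂ ++ y)).sum := fun y _ => by
    have := colour_cons (l := 0) (r := m + h.cod) (g := g) (w := []) (k := k) (β₁ := []) (β₂ := β₂ ++ y) rfl h1
    simp only [List.nil_append, ← List.append_assoc] at this
    rw [this, b1]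
    rfl
  rw [Multiset.map_congr rfl e3, Multiset.map_congr rfl e4, Multiset.sum_map_sum_map]

theorem eq_zero_or_one_or_two : ∀ a : Fin 3, a = 0 ∨ a = 1 ∨ a = 2 := by decide

theorem SameColour.of_zero {s t : Word ι} (h0 : s ≠ []) {b : ℕ} (hs : IsWord 0 s b) (ht : IsWord 0 t b)
    (h : ∀ k, colour s k [] = colour t k []) : SameColour s t :=
  ⟨h0, 0, b, hs, ht, fun k β hβ => by obtain rfl := List.length_eq_zero_iff.1 hβ; exact h k⟩

theorem SameColour.of_one {s t : Word ι} (h0 : s ≠ []) {b : ℕ} (hs : IsWord 1 s b) (ht : IsWord 1 t b)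
    (h : ∀ k x, colour s k [x] = colour t k [x]) : SameColour s t :=
  ⟨h0, 1, b, hs, ht, fun k β hβ => by obtain ⟨x, rfl⟩ := List.length_eq_one_iff.1 hβ; exact h k x⟩

theorem SameColour.of_two {s t : Word ι} (h0 : s ≠ []) {b : ℕ} (hs : IsWord 2 s b) (ht : IsWord 2 t b)
    (h : ∀ k x y, colour s k [x, y] = colour t k [x, y]) : SameColour s t :=
  ⟨h0, 2, b, hs, ht, fun k β hβ => by obtain ⟨x, y, rfl⟩ := List.length_eq_two.1 hβ; exact h k x y⟩

theorem SameColour.of_three {s t : Word ι} (h0 : s ≠ []) {b : ℕ} (hs : IsWord 3 s b) (ht : IsWord 3 t b)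
    (h : ∀ k x y z, colour s k [x, y, z] = colour t k [x, y, z]) : SameColour s t :=
  ⟨h0, 3, b, hs, ht, fun k β hβ => by obtain ⟨x, y, z, rfl⟩ := List.length_eq_three.1 hβ; exact h k x y z⟩

/-- Apart from the exchange of heights, the pictures have at most three strands below, and all
colours of these are tried. -/
theorem sameColour_isotopy {s t : Word ι} (h : IsotopyMove s t) : SameColour s t := by
  cases h with
  | exchange g h m => exact sameColour_exchange g h m
  | snakeLeft | snakeRight | deathLeft | deathRight | birthLeft | birthRight =>
    first
    | refine .of_zero (by simp) ⟨rfl, rfl, rfl⟩ ⟨rfl, rfl⟩ fun k => rfl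
    | refine .of_one (by simp) ⟨rfl, rfl, rfl⟩ (by exact rfl) fun k x => ?_
    | refine .of_one (by simp) ⟨rfl, rfl, rfl⟩ (by exact ⟨rfl, rfl⟩) fun k x => ?_
    all_goals rcases eq_zero_or_one_or_two x with rfl | rfl | rfl <;> simp [colour, Gen.colour, dom]
  | overCap | underCap | virtCap =>
    refine .of_three (by simp) ⟨rfl, rfl, rfl⟩ ⟨rfl, rfl, rfl⟩ fun k x y z => ?_
    rcases eq_zero_or_one_or_two x with rfl | rfl | rfl <;> rcases eq_zero_or_one_or_two y with rfl | rfl | rfl <;>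
      rcases eq_zero_or_one_or_two z with rfl | rfl | rfl <;> rfl
  | overCup | underCup | virtCup =>
    refine .of_one (by simp) ⟨rfl, rfl, rfl⟩ ⟨rfl, rfl, rfl⟩ fun k x => ?_
    rcases eq_zero_or_one_or_two x with rfl | rfl | rfl <;>
      first | rfl | exact Nat.add_right_comm _ _ _ | exact congrArg (· + _) (Nat.add_comm _ _) |
        exact (Nat.add_comm _ _).trans ((congrArg (_ + ·) (Nat.add_comm _ _)).trans (Nat.add_assoc _ _ _).symm)

/-- The operation `2a - b` is idempotent, an involution in `b`, and distributes over itself; this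
gives the three moves. The check is again by trying all colours. -/
theorem sameColour_classical {s t : Word ι} (h : ClassicalMove s t) : SameColour s t := by
  cases h with
  | r1OverCap | r1UnderCap | r2OverUnder | r2UnderOver =>
    first
    | refine .of_two (by simp) ⟨rfl, rfl, rfl⟩ (by exact rfl) fun k x y => ?_
    | refine .of_two (by simp) ⟨rfl, rfl, rfl⟩ (by exact ⟨rfl, rfl⟩) fun k x y => ?_
    all_goals rcases eq_zero_or_one_or_two x with rfl | rfl | rfl <;>
      rcases eq_zero_or_one_or_two y with rfl | rfl | rfl <;> rfl
  | r1OverCup | r1UnderCup => exact .of_zero (by simp) ⟨rfl, rfl, rfl⟩ ⟨rfl, rfl⟩ fun k => rfl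
  | r3Over | r3Under =>
    refine .of_three (by simp) ⟨rfl, rfl, rfl, rfl⟩ ⟨rfl, rfl, rfl, rfl⟩ fun k x y z => ?_
    rcases eq_zero_or_one_or_two x with rfl | rfl | rfl <;> rcases eq_zero_or_one_or_two y with rfl | rfl | rfl <;>
      rcases eq_zero_or_one_or_two z with rfl | rfl | rfl <;> rfl

/-- Labels do not enter the sum, so the number of colourings is an invariant of unlabelled linkoids.
-/
theorem colour_relabel (f : ι → ι) (k : List (Fin 3) → ℕ) : ∀ (w : Word ι) (β : List (Fin 3)),
    colour (w.map (Layer.relabel f)) k β = colour w k β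
  | [], _ => rfl
  | ⟨l, g, r⟩ :: w, β => by
    have hd : (g.relabel f).dom = g.dom := by cases g <;> rfl
    have hc : (g.relabel f).colour = g.colour := by
      funext bot k'
      cases g <;> first | rfl | (rcases bot with _ | ⟨a, _ | ⟨b, bot⟩⟩ <;> rfl)
    rw [List.map_cons, Layer.relabel, colour, colour, hd, hc]
    simp only [colour_relabel f k w]

variable {n : ℕ}

/-- The number of colourings of a diagram. -/
def LinkoidDiagram.colourings (D : LinkoidDiagram n) : ℕ := colour D.word (fun _ => 1) []

theorem colourings_of_move {D E : LinkoidDiagram n} (h : InContext IsotopyMove D.word E.word ∨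
    InContext ClassicalMove D.word E.word ∨ SphereMove D.word E.word) : D.colourings = E.colourings := by
  rcases h with ⟨a, b, s, t, p, q, h, hD, hE⟩ | ⟨a, b, s, t, p, q, h, hD, hE⟩ | ⟨T, hD, hE⟩
  · exact SameColour.inContext ⟨a, b, s, t, p, q, sameColour_isotopy h, hD, hE⟩ D.closed _
  · exact SameColour.inContext ⟨a, b, s, t, p, q, sameColour_classical h, hD, hE⟩ D.closed _
  · have hw := D.closed
    rw [hD, List.append_assoc] at hw
    have hw : IsWord 2 (T.map (Layer.pad 0 1) ++ [⟨0, .cap, 0⟩]) 0 := hw.2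
    obtain ⟨m, h1, h2, -⟩ := isWord_append_iff.1 hw
    obtain ⟨b, rfl, hT⟩ := IsWord.unpad (p := 0) (a := 1) (q := 1) h1
    obtain rfl : b = 1 := by simp only [Layer.source, dom] at h2; omega
    -- The outer strand keeps one colour `c` from the minimum to the maximum, and the condition at
    -- the maximum is symmetric in its two strands.
    have key : ∀ c : Fin 3,
        colour (T.map (Layer.pad 0 1)) (colour [(⟨0, .cap, 0⟩ : Layer (Fin (2 * n)))] fun _ => 1) [c, c] =
          colour (T.map (Layer.pad 1 0)) (colour [(⟨0, .cap, 0⟩ : Layer (Fin (2 * n)))] fun _ => 1) [c, c] := fun c => by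
      have e1 := fun k => colour_pad (k := k) (γ := []) (β := [c]) (δ := [c]) (p := 0) (q := 1) rfl hT
      have e2 := fun k => colour_pad (k := k) (γ := [c]) (β := [c]) (δ := []) (p := 1) (q := 0) rfl hT
      refine (e1 _).trans (Eq.trans (colour_congr (n := 1) (fun γ hγ => ?_) hT) (e2 _).symm)
      obtain ⟨x, rfl⟩ := List.length_eq_one_iff.1 hγ
      simp [colour, Gen.colour, dom, eq_comm]
    rw [LinkoidDiagram.colourings, LinkoidDiagram.colourings, hD, hE, List.append_assoc, List.append_assoc]
    have hcup : ∀ S : Word (Fin (2 * n)), colour ([⟨0, .cup, 0⟩] ++ S) (fun _ => 1) [] =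
        colour S (fun _ => 1) [0, 0] + colour S (fun _ => 1) [1, 1] + colour S (fun _ => 1) [2, 2] := fun _ => rfl
    rw [hcup, hcup]
    simp only [colour_append, key]

theorem colourings_of_linkoid_eq {D E : LinkoidDiagram n} (h : D.linkoid = E.linkoid) : D.colourings = E.colourings := by
  have h' : Relation.EqvGen _ D E := Quotient.exact h
  clear h
  induction h' with
  | rel _ _ h => exact colourings_of_move h
  | refl => rfl
  | symm _ _ _ ih => exact ih.symm
  | trans _ _ _ _ _ ih1 ih2 => exact ih1.trans ih2

theorem colourings_of_equivUnlabelled {D E : LinkoidDiagram n} (h : D.linkoid.EquivUnlabelled E.linkoid) :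
    D.colourings = E.colourings := by
  obtain ⟨D', E', π, hD, hE, h⟩ := h
  rw [← colourings_of_linkoid_eq hD, ← colourings_of_linkoid_eq hE, LinkoidDiagram.colourings, LinkoidDiagram.colourings, h,
    colour_relabel]

theorem colour_const (c : ℕ) : ∀ (w : Word ι) (β : List (Fin 3)), colour w (fun _ => c) β = c * colour w (fun _ => 1) β
  | [], _ => (mul_one c).symm
  | ⟨l, g, r⟩ :: w, β => by
    have hg : ∀ bot k, g.colour bot (fun x => c * k x) = c * g.colour bot k := fun bot k => by
      unfold Gen.colour
      split <;> simp [mul_add]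
    simp only [colour]
    rw [← hg]
    simp only [colour_const c w]

/-- No strand connects the two diagrams, so the upper one contributes a constant factor. -/
theorem colour_append_closed {u v : Word ι} (hu : IsWord 0 u 0) :
    colour (u ++ v) (fun _ => 1) [] = colour u (fun _ => 1) [] * colour v (fun _ => 1) [] := by
  rw [colour_append, mul_comm, ← colour_const]
  refine colour_congr (n := 0) (fun γ hγ => ?_) hu
  rw [List.length_eq_zero_iff.1 hγ]

theorem colour_intervals : ∀ L : List (ι × ι), colour (L.flatMap fun p => interval p.1 p.2) (fun _ => 1) [] = 3 ^ L.length
  | [] => rfl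
  | p :: L => by
    rw [List.flatMap_cons, colour_append_closed (strands_interval p.1 p.2).closed, colour_intervals L, List.length_cons,
      pow_succ']
    rfl

/-- With colours `a` and `b` at the two minima, the left strands above the crossings have the
colours `3a - 2b = b` and `2a - b`, modulo 3. The first of them ends. The outer maximum requires `2a
- b = a`, hence `a = b`, and the new strand takes the colour `b`. -/
theorem colour_innerCore (e e' : ι) : colour (innerCore e e') (fun _ => 1) [] = 3 := rfl

/-- Here the strand of colour `2a - b` ends. The other one has the colour `b` required by the inner
maximum, and the new strand takes the colour `a`, so that `a` and `b` are free. -/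
theorem colour_outerCore (e e' : ι) : colour (outerCore e e') (fun _ => 1) [] = 9 := rfl

end Colour

theorem Linkoid.EquivUnlabelled.refl {n : ℕ} (L : Linkoid n) : L.EquivUnlabelled L := by
  obtain ⟨D, rfl⟩ := Quotient.exists_rep L
  refine ⟨D, D, Equiv.refl _, rfl, rfl, ?_⟩
  have : Layer.relabel (Equiv.refl (Fin (2 * n))) = id := by
    funext ⟨l, g, r⟩
    cases g <;> rfl
  rw [this, List.map_id]

/-- The cores, each with `k` intervals added. The numbers of colourings are `3 * 3 ^ k` and `9 * 3 ^
k`, while both closures are virtual trefoils with `k` circles. -/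
theorem exists_pair {φ : ClosureDatum → VirtualLink} (hφ : IsVirtualClosureMap φ) (k : ℕ) :
    ∃ (L M : Linkoid (k + 1)) (τ : Pairing (k + 1)) (hL : L.HasStrandPerm τ) (hM : M.HasStrandPerm τ),
      ¬ L.EquivUnlabelled M ∧ φ ⟨k + 1, L, τ, τ, hL⟩ = (virtualTrefoil k).link ∧
        φ ⟨k + 1, M, τ, τ, hM⟩ = (virtualTrefoil k).link := by
  have hlen : (ends (k + 1)).length = k + 1 := by simp [ends]
  obtain ⟨⟨e, e'⟩, L, hE⟩ := List.exists_cons_of_length_pos (l := ends (k + 1)) (by omega)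
  have hp : e.1 / 2 = e'.1 / 2 := by
    have hmem : (e, e') ∈ ends (k + 1) := hE ▸ List.mem_cons_self ..
    obtain ⟨i, -, hi⟩ := List.mem_map.1 hmem
    cases hi
    simp only
    omega
  have h1 : Strands (withIntervals (innerCore e e') L) (ends (k + 1)) :=
    hE ▸ (strands_innerCore e e').withIntervals L
  have h2 : Strands (withIntervals (outerCore e e') L) (ends (k + 1)) :=
    hE ▸ (strands_outerCore e e').withIntervals L
  refine ⟨_, _, adjacent (k + 1), h1.hasStrandPerm, h2.hasStrandPerm, fun h => ?_, ?_, ?_⟩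
  · have h := colourings_of_equivUnlabelled h
    change colour (innerCore e e' ++ _) _ _ = colour (outerCore e e' ++ _) _ _ at h
    rw [colour_append_closed (strands_innerCore e e').closed, colour_append_closed (strands_outerCore e e').closed,
      colour_intervals, colour_innerCore, colour_outerCore] at h
    have := pow_pos (show 0 < 3 by norm_num) L.length
    omega
  · obtain ⟨K, hK⟩ := h1.diagram.exists_isVirtualClosure (adjacent (k + 1))
    exact (hφ ⟨k + 1, _, adjacent (k + 1), adjacent (k + 1), h1.hasStrandPerm⟩ _ K rfl hK).trans (closure_eq_virtualTrefoil hE (strands_innerCore e e') (coreNet_innerCore hp) rfl hK)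
  · obtain ⟨K, hK⟩ := h2.diagram.exists_isVirtualClosure (adjacent (k + 1))
    exact (hφ ⟨k + 1, _, adjacent (k + 1), adjacent (k + 1), h2.hasStrandPerm⟩ _ K rfl hK).trans (closure_eq_virtualTrefoil hE (strands_outerCore e e') (coreNet_outerCore hp) rfl hK)

end VirtualClosure

/-- Every diagram of a linkoid has virtual closures, and these define one and only one map on triples
(the virtual closure map).  It is surjective and not injective; in fact, for every `n ≥ 1` there
are two linkoids with `n` components and the same strand permutation `τ`, not equivalent even when
the labels of the endpoints are ignored, whose virtual closures with respect to `τ` are both the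
split union of the virtual trefoil and `n - 1` trivial circles. -/
theorem theorem3p1 :
    (∀ (n : ℕ) (D : VirtualClosure.LinkoidDiagram n) (σ : VirtualClosure.Pairing n),
      ∃ K : VirtualClosure.VirtualDiagram, VirtualClosure.IsVirtualClosure D σ K) ∧
    (∃! φ : VirtualClosure.ClosureDatum → VirtualClosure.VirtualLink,
      VirtualClosure.IsVirtualClosureMap φ) ∧
    ∀ φ : VirtualClosure.ClosureDatum → VirtualClosure.VirtualLink,
      VirtualClosure.IsVirtualClosureMap φ →
        Function.Surjective φ ∧
        ¬ Function.Injective φ ∧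
        ∀ k : ℕ, ∃ (L M : VirtualClosure.Linkoid (k + 1)) (τ : VirtualClosure.Pairing (k + 1))
          (hL : L.HasStrandPerm τ) (hM : M.HasStrandPerm τ),
          ¬ L.EquivUnlabelled M ∧
          φ ⟨k + 1, L, τ, τ, hL⟩ = (VirtualClosure.virtualTrefoil k).link ∧
          φ ⟨k + 1, M, τ, τ, hM⟩ = (VirtualClosure.virtualTrefoil k).link := by
  refine ⟨fun n D σ => D.exists_isVirtualClosure σ, VirtualClosure.existsUnique_virtualClosureMap, fun φ hφ => ?_⟩
  have h := VirtualClosure.exists_pair hφ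
  refine ⟨hφ.surjective, fun hinj => ?_, h⟩
  -- Linkoids with a single component already contradict injectivity: equal data would have equal
  -- linkoids.
  obtain ⟨L, M, τ, hL, hM, hne, h1, h2⟩ := h 0
  have e := hinj (h1.trans h2.symm)
  injection e with _ e
  subst e
  exact hne (VirtualClosure.Linkoid.EquivUnlabelled.refl L)
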